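/- Let $\mathbf k$ be an algebraically closed field of characteristic zero and let $(\mathcal A,\otimes,\mathbf 1,c)$ be a premodular category over $\mathbf k$, i.e. a braided spherical fusion category, with left duals $X^*$ (maps $\mathrm{ev}:X^*X\to\mathbf 1$, $\mathrm{coev}:\mathbf 1\to XX^*$) and pivotal structure $\delta:X\cong X^{**}$, which also gives $\widetilde{\mathrm{ev}}:XX^*\to\mathbf 1$ and $\widetilde{\mathrm{coev}}:\mathbf 1\to X^*X$. Write $XY$ for $X\otimes Y$ and suppress associativity and unit isomorphisms. Let $X_i$ ($i\in\mathrm{Irr}$) represent the simple objects, $d_i=\dim X_i$, $\mathcal D=\sum_i d_i^2$, and fix square roots $\sqrt{d_i}$, $\sqrt{\mathcal D}$. Whenever $\varphi_\alpha,\varphi^\alpha$ occur, they are bases of $\mathrm{Hom}(V,X_j)$ and $\mathrm{Hom}(X_j,V)$ that are dual for the trace pairing, $\mathrm{tr}(\varphi_\alpha\varphi^\beta)=\delta_{\alpha\beta}$. Half-braidings are written $\gamma_B: BX\to XB$, and $\mathcal Z(\mathcal A)$ is the Drinfeld center. When a strand $P$ crosses a strand $Q$ from the left ($PQ\to QP$),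 "$P$ over" means $c_{Q,P}^{-1}$ and "$P$ under" means $c_{P,Q}$. For $\psi: X_j\to BX_i$ let $\psi^\circlearrowright: X_i^*\to X_j^*B$ be obtained from it with $\widetilde{\mathrm{coev}}_{X_j}$ and $\widetilde{\mathrm{ev}}_{X_i}$, and let $$N^{ij}_{B,V}=\sum_\alpha(\mathrm{id}_{X_jV}\otimes(\varphi^\alpha)^{\circlearrowright})(\varphi_\alpha\otimes\mathrm{id}_{VX_i^*}):\ BX_iVX_i^*\to X_jVX_j^*B,\qquad \varphi_\alpha\in\mathrm{Hom}(BX_i,X_j).$$ The functor $I:\mathcal A\to\mathcal Z(\mathcal A)$ is $I(V)=(\bigoplus_i X_iVX_i^*,\Gamma)$, $\Gamma_B=\sum_{i,j}\sqrt{d_i}\sqrt{d_j}\,N^{ij}_{B,V}$, and $I(f)=\bigoplus_i\mathrm{id}_{X_i}\otimes f\otimes\mathrm{id}_{X_i^*}$. The reduced tensor product of $(X,\gamma)$ and $(Y,\mu)$ is as follows. Let $T_i: XY\to X_iXYX_i^*$ be: create $X_iX_i^*$ between $X$ and $Y$, move $X_i$ to the left under $X$ (by $c_{X_i,X}^{-1}$),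 and move $X_i^*$ to the right of $Y$ by $\mu_{X_i^*}$. Let $L_i: X_iXYX_i^*\to XY$ be: apply $\gamma_{X_i}$, move $X_i^*$ to the left over $Y$ (by $c_{Y,X_i^*}$), and apply $\widetilde{\mathrm{ev}}_{X_i}$. Then $Q_{\gamma,\mu}=\frac1{\mathcal D}\sum_i d_i\,L_iT_i$ is a projection of $XY$, and $$(X,\gamma)\,\overline\otimes\,(Y,\mu)=\Big(\mathrm{im}\,Q_{\gamma,\mu},\ \tfrac1{\mathcal D}\sum_{i,j}d_id_j\,(L_j\otimes\mathrm{id}_B)\,N^{ij}_{B,XY}\,(\mathrm{id}_B\otimes T_i)\Big),$$ the half-braiding being restricted to the image; on morphisms $f\,\overline\otimes\,g$ is the restriction of $f\otimes g$, and the associativity constraint is the restriction of that of $\mathcal A$. The unit object is $I(\mathbf 1)$. The unit constraint $I(\mathbf 1)\,\overline\otimes\,X\to X$ is the restriction of $\sum_i\frac{\sqrt{d_i}}{\sqrt{\mathcal D}}$ times the map $X_iX_i^*X\to X$ that moves $X_i^*$ to the right over $X$, applies $\gamma_{X_i}$ and then $\widetilde{\mathrm{ev}}_{X_i}$. The unit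 constraint $X\,\overline\otimes\,I(\mathbf 1)\to X$ is the restriction of $\sum_i\frac{\sqrt{d_i}}{\sqrt{\mathcal D}}$ times the map $XX_iX_i^*\to X$ that moves $X_i$ to the left under $X$, applies $\gamma_{X_i}$ and then $\widetilde{\mathrm{ev}}_{X_i}$. The dual of $(X,\gamma)$ is $(X^*,\gamma^\vee)$, where $\gamma^\vee_B$ is $c_{B,X^*}$, followed by the map $X^*B\to BX^*$ obtained from $\gamma_B$ with $\mathrm{coev}_X$ and $\mathrm{ev}_X$, followed by $c_{X^*,B}^{-1}:BX^*\to X^*B$. The evaluation $X^*X\to I(\mathbf 1)$ is $\sum_i\frac{\sqrt{d_i}}{\sqrt{\mathcal D}}$ times: create $X_iX_i^*$ between $X^*$ and $X$, move $X_i$ to the left under $X^*$, apply $\gamma_{X_i^*}$, then $\mathrm{ev}_X$. The coevaluation $I(\mathbf 1)\to XX^*$ is $\sum_i\frac{\sqrt{d_i}}{\sqrt{\mathcal D}}$ times: create $XX^*$ between $X_i$ and $X_i^*$, apply $\gamma_{X_i}$, move $X_i^*$ to the left over $X^*$, then apply $\widetilde{\mathrm{ev}}_{X_i}$. The pivotal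 structure is that of $\mathcal A$. **Proposition.** The formulas above define a functor $I:\mathcal A\to\mathcal Z(\mathcal A)$ and a pivotal monoidal category $(\mathcal Z(\mathcal A),\overline\otimes)$. The functor $I$ is $\mathbf k$-linear and is both a left and a right adjoint of the forgetful functor $\mathcal Z(\mathcal A)\to\mathcal A$. For $V,W\in\mathcal A$ let $J_{V,W}:I(V)\,\overline\otimes\,I(W)\to I(VW)$ be the restriction of $$\sum_{i,k,j}\sqrt{d_i}\sqrt{d_j}\sqrt{d_k}\sum_\alpha\big(\varphi_\alpha\otimes\mathrm{id}_{VW}\otimes(\varphi^\alpha)^*\big)\circ\sigma:\ (X_iVX_i^*)(X_kWX_k^*)\to X_j\,VW\,X_j^*,$$ where $\varphi_\alpha\in\mathrm{Hom}(X_iX_k,X_j)$, $(\varphi^\alpha)^*:X_k^*X_i^*\cong(X_iX_k)^*\to X_j^*$, and $\sigma:X_iVX_i^*X_kWX_k^*\to X_iX_k\,VW\,X_k^*X_i^*$ moves $X_k$ to the left under $X_i^*$ and $V$, and $X_i^*$ to the right over $W$ and $X_k^*$. Then $J$ is a tensor structure on $I$ (with a suitable isomorphism of unit objects), and $$(I,J):(\mathcal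 A,\otimes)\to(\mathcal Z(\mathcal A),\overline\otimes)$$ is a pivotal tensor functor. -/

import Mathlib

open CategoryTheory MonoidalCategory Limits

universe w v u v₁ u₁

attribute [local instance] Abelian.hasFiniteBiproducts

/-! ## Pivotal categories and pivotal functors

In Mathlib's convention `Xᘁ` comes with `η_ X Xᘁ : 𝟙_ ⟶ X ⊗ Xᘁ` and `ε_ X Xᘁ : Xᘁ ⊗ X ⟶ 𝟙_`;
it is the object written `X^*` in the literature on fusion categories. -/

/-- A pivotal structure on a monoidal category with duals: a monoidal natural isomorphism
`δ : X ≅ Xᘁᘁ`. -/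
class PivotalCategory (C : Type u) [Category.{v} C] [MonoidalCategory C]
    [RightRigidCategory C] where
  /-- The component at `X` of the pivotal structure. -/
  pivot : ∀ X : C, X ≅ (Xᘁ)ᘁ
  pivot_naturality : ∀ {X Y : C} (f : X ⟶ Y),
    f ≫ (pivot Y).hom = (pivot X).hom ≫ ((fᘁ)ᘁ)
  pivot_tensor : ∀ X Y : C,
    (pivot (X ⊗ Y)).hom ≫ ((rightDualTensorIso X Y).inv)ᘁ ≫ (rightDualTensorIso Yᘁ Xᘁ).hom =
      (pivot X).hom ⊗ₘ (pivot Y).hom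

namespace PivotalCategory

section

variable {C : Type u} [Category.{v} C] [MonoidalCategory C] [RightRigidCategory C]
  [PivotalCategory C]

/-- The evaluation `X ⊗ X^* ⟶ 𝟙` coming from the pivotal structure. -/
def evR (X : C) : X ⊗ Xᘁ ⟶ 𝟙_ C := (pivot X).hom ▷ Xᘁ ≫ ε_ Xᘁ (Xᘁ)ᘁ

/-- The coevaluation `𝟙 ⟶ X^* ⊗ X` coming from the pivotal structure. -/
def coevL (X : C) : 𝟙_ C ⟶ Xᘁ ⊗ X := η_ Xᘁ (Xᘁ)ᘁ ≫ Xᘁ ◁ (pivot X).inv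

/-- The pivotal trace closing the strand on the right. -/
def rtrace {X : C} (f : X ⟶ X) : 𝟙_ C ⟶ 𝟙_ C := η_ X Xᘁ ≫ f ▷ Xᘁ ≫ evR X

/-- The pivotal trace closing the strand on the left. -/
def ltrace {X : C} (f : X ⟶ X) : 𝟙_ C ⟶ 𝟙_ C := coevL X ≫ Xᘁ ◁ f ≫ ε_ X Xᘁ

end

section

variable {C : Type u} [Category.{v} C] [MonoidalCategory C] [RightRigidCategory C]
  {D : Type u₁} [Category.{v₁} D] [MonoidalCategory D] [RightRigidCategory D]

open Functor.LaxMonoidal Functor.OplaxMonoidal in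
/-- The canonical comparison morphism `F(X^*) ⟶ F(X)^*` of a monoidal functor `F`. -/
def dualComparison (F : C ⥤ D) [F.Monoidal] (X : C) : F.obj Xᘁ ⟶ (F.obj X)ᘁ :=
  (ρ_ _).inv ≫ F.obj Xᘁ ◁ η_ (F.obj X) (F.obj X)ᘁ ≫ (α_ _ _ _).inv ≫
    (μ F Xᘁ X ≫ F.map (ε_ X Xᘁ) ≫ Functor.OplaxMonoidal.η F) ▷ (F.obj X)ᘁ ≫ (λ_ _).hom

/-- A monoidal functor between pivotal categories is pivotal if it carries the pivotal structure
of the source to that of the target, through the canonical morphisms `F(X^*) ⟶ F(X)^*`. -/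
def IsPivotalFunctor [PivotalCategory C] [PivotalCategory D] (F : C ⥤ D) [F.Monoidal] : Prop :=
  ∀ X : C, F.map (pivot X).hom ≫ dualComparison F Xᘁ =
    (pivot (F.obj X)).hom ≫ (dualComparison F X)ᘁ

end

end PivotalCategory

open PivotalCategory

/-! ## Premodular categories -/

/-- A premodular category over `k`: a braided spherical fusion category. -/
class PremodularCategory (k : Type w) [Field k] (A : Type u) [Category.{v} A] [Abelian A]
    [Linear k A] [MonoidalCategory A] [MonoidalPreadditive A] [MonoidalLinear k A]
    [BraidedCategory A] [RigidCategory A] [PivotalCategory A] : Prop where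
  finiteDimensional_hom : ∀ X Y : A, FiniteDimensional k (X ⟶ Y)
  simple_unit : Simple (𝟙_ A)
  semisimple : ∀ X : A, ∃ (n : ℕ) (T : Fin n → A), (∀ m, Simple (T m)) ∧ Nonempty (X ≅ ⨁ T)
  finite_simples : ∃ (n : ℕ) (T : Fin n → A), ∀ X : A, Simple X → ∃ m, Nonempty (X ≅ T m)
  spherical : ∀ {X : A} (f : X ⟶ X), rtrace f = ltrace f

attribute [instance] PremodularCategory.finiteDimensional_hom

namespace ReducedTensor

noncomputable section

section Nonvanishing

variable {A : Type u} [Category.{v} A] [Abelian A]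

lemma exists_retraction
    (hs : ∀ V : A, ∃ (n : ℕ) (T : Fin n → A), (∀ m, Simple (T m)) ∧ Nonempty (V ≅ ⨁ T))
    {S V : A} [Simple S] (ψ : S ⟶ V) (h : ψ ≠ 0) :
    ∃ φ : V ⟶ S, ψ ≫ φ = 𝟙 S := by
  obtain ⟨n, T, hT, ⟨e⟩⟩ := hs V
  by_contra! hc
  apply h
  rw [← cancel_mono e.hom, zero_comp]
  apply biproduct.hom_ext
  intro m
  have := hT m
  by_contra hm
  rw [zero_comp] at hm
  have := isIso_of_hom_simple hm
  apply hc (e.hom ≫ biproduct.π T m ≫ inv ((ψ ≫ e.hom) ≫ biproduct.π T m))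
  rw [← Category.assoc, ← Category.assoc]
  exact IsIso.hom_inv_id ((ψ ≫ e.hom) ≫ biproduct.π T m)

lemma exists_section
    (hs : ∀ V : A, ∃ (n : ℕ) (T : Fin n → A), (∀ m, Simple (T m)) ∧ Nonempty (V ≅ ⨁ T))
    {S V : A} [Simple S] (φ : V ⟶ S) (h : φ ≠ 0) :
    ∃ ψ : S ⟶ V, ψ ≫ φ = 𝟙 S := by
  obtain ⟨n, T, hT, ⟨e⟩⟩ := hs V
  by_contra! hc
  apply h
  rw [← cancel_epi e.inv, comp_zero]
  apply biproduct.hom_ext'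
  intro m
  have := hT m
  by_contra hm
  rw [comp_zero] at hm
  have := isIso_of_hom_simple hm
  apply hc (inv (biproduct.ι T m ≫ e.inv ≫ φ) ≫ biproduct.ι T m ≫ e.inv)
  simp

variable [MonoidalCategory A] [MonoidalPreadditive A] [RightRigidCategory A]

lemma evaluation_ne_zero {X : A} (hX : 𝟙 X ≠ 0) : ε_ X Xᘁ ≠ 0 := by
  intro h
  apply hX
  have := ExactPairing.evaluation_coevaluation X Xᘁ
  rw [h, MonoidalPreadditive.whiskerLeft_zero, comp_zero, comp_zero] at this
  have h2 : (λ_ X).inv ≫ ((λ_ X).hom ≫ (ρ_ X).inv) ≫ (ρ_ X).hom = 𝟙 X := by simp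
  rw [← h2, ← this]; simp

lemma coevaluation_ne_zero {X : A} (hX : 𝟙 X ≠ 0) : η_ X Xᘁ ≠ 0 := by
  intro h
  apply hX
  have := ExactPairing.evaluation_coevaluation X Xᘁ
  rw [h, MonoidalPreadditive.zero_whiskerRight, zero_comp] at this
  have h2 : (λ_ X).inv ≫ ((λ_ X).hom ≫ (ρ_ X).inv) ≫ (ρ_ X).hom = 𝟙 X := by simp
  rw [← h2, ← this]; simp

lemma evR_ne_zero [PivotalCategory A] {X : A} (hX : 𝟙 X ≠ 0) : evR X ≠ 0 := by
  have h1 : 𝟙 Xᘁ ≠ 0 := by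
    intro h0
    apply evaluation_ne_zero hX
    have : ε_ X Xᘁ = (𝟙 Xᘁ) ▷ X ≫ ε_ X Xᘁ := by simp
    rw [this, h0]; simp
  intro h
  apply evaluation_ne_zero h1
  have : ε_ Xᘁ (Xᘁ)ᘁ = (pivot X).inv ▷ Xᘁ ≫ evR X := by
    simp [evR]
  rw [this, h, comp_zero]

end Nonvanishing

section Basics

variable (k : Type w) [Field k] [IsAlgClosed k]
  {A : Type u} [Category.{v} A] [Abelian A] [Linear k A] [MonoidalCategory A]
  [MonoidalPreadditive A] [MonoidalLinear k A] [BraidedCategory A] [RigidCategory A]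
  [PivotalCategory A] [PremodularCategory k A]

/-! ### Scalars, dimensions and dual bases -/

/-- The scalar `c` with `f = c • 𝟙`, for an endomorphism `f` of the simple unit object. -/
def unitScalar : (𝟙_ A ⟶ 𝟙_ A) ≃ₗ[k] k :=
  have : Simple (𝟙_ A) := PremodularCategory.simple_unit k
  (LinearEquiv.ofBijective (LinearMap.toSpanSingleton k (𝟙_ A ⟶ 𝟙_ A) (𝟙 (𝟙_ A)))
    ⟨smul_left_injective k (id_nonzero (𝟙_ A)), endomorphism_simple_eq_smul_id k⟩).symm

/-- The categorical dimension of an object, as an element of `k`. -/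
def dim (X : A) : k := unitScalar k (rtrace (𝟙 X))

/-- The pairing `Hom(V, S) × Hom(S, V) → k`, obtained by closing up `S ⟶ V ⟶ S` to a loop. -/
def tracePairing (V S : A) : (V ⟶ S) →ₗ[k] (S ⟶ V) →ₗ[k] k :=
  LinearMap.mk₂ k (fun φ ψ => unitScalar k (rtrace (ψ ≫ φ)))
    (by intros; simp [rtrace]) (by intros; simp [rtrace])
    (by intros; simp [rtrace]) (by intros; simp [rtrace])

lemma dim_ne_zero (X : A) [Simple X] : dim k X ≠ 0 := by
  have : Simple (𝟙_ A) := PremodularCategory.simple_unit k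
  have hX := id_nonzero X
  obtain ⟨r, hr⟩ := exists_retraction (PremodularCategory.semisimple k) (η_ X Xᘁ) (coevaluation_ne_zero hX)
  let E := tensorRightHomEquiv X Xᘁ ((Xᘁ)ᘁ) (𝟙_ A)
  let F : (X ⊗ Xᘁ ⟶ 𝟙_ A) → (X ⟶ X) := fun h => E h ≫ (λ_ _).hom ≫ (pivot X).inv
  have hFinj : Function.Injective F := by
    intro a b hab
    apply E.injective
    simpa [F] using hab
  have hsmul : ∀ (c : k) h, F (c • h) = c • F h := by
    intro c h; simp [F, E, tensorRightHomEquiv]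
  have h0 : F (evR X) ≠ 0 := by
    intro h
    apply evR_ne_zero hX
    apply hFinj
    rw [h]
    have := hsmul 0 0
    simpa using this.symm
  obtain ⟨a, ha⟩ := endomorphism_simple_eq_smul_id k (F (evR X))
  obtain ⟨b, hb⟩ := endomorphism_simple_eq_smul_id k (F r)
  have ha0 : a ≠ 0 := by
    rintro rfl
    exact h0 (by rw [← ha, zero_smul])
  have hrc : r = (b / a) • evR X := by
    apply hFinj
    rw [hsmul, ← ha, ← hb, smul_smul, div_mul_cancel₀ _ ha0]
  intro hd
  have htr : rtrace (𝟙 X) = 0 := (unitScalar k).injective (by rw [map_zero]; exact hd)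
  have : η_ X Xᘁ ≫ evR X = 0 := by simpa [rtrace] using htr
  apply id_nonzero (𝟙_ A)
  rw [← hr, hrc, Linear.comp_smul, this, smul_zero]

instance isPerfPair_tracePairing (V S : A) [Simple S] : (tracePairing k V S).IsPerfPair := by
  apply LinearMap.IsPerfPair.of_injective
  · rw [injective_iff_map_eq_zero]
    intro φ hφ
    by_contra h
    obtain ⟨ψ, hψ⟩ := exists_section (PremodularCategory.semisimple k) φ h
    apply dim_ne_zero k S
    have := LinearMap.congr_fun hφ ψ
    simpa [tracePairing, hψ, dim] using this
  · rw [injective_iff_map_eq_zero]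
    intro ψ hψ
    by_contra h
    obtain ⟨φ, hφ⟩ := exists_retraction (PremodularCategory.semisimple k) ψ h
    apply dim_ne_zero k S
    have := LinearMap.congr_fun hψ φ
    simpa [tracePairing, hφ, dim] using this

/-- The number of summation labels `α`: the dimension of `Hom(V, S)`. -/
abbrev mult (V S : A) : ℕ := Module.finrank k (V ⟶ S)

/-- A basis `φ_α` of `Hom(V, S)`. -/
def node (V S : A) (a : Fin (mult k V S)) : V ⟶ S := Module.finBasis k (V ⟶ S) a

/-- The basis `φ^α` of `Hom(S, V)` that is dual to the basis `φ_α` of `Hom(V, S)`, for the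
trace pairing. -/
def dualNode (V S : A) [Simple S] (a : Fin (mult k V S)) : S ⟶ V :=
  (tracePairing k V S).flip.toPerfPair.symm ((Module.finBasis k (V ⟶ S)).coord a)

lemma tracePairing_node_dualNode (V S : A) [Simple S] (a b : Fin (mult k V S)) :
    unitScalar k (rtrace (dualNode k V S b ≫ node k V S a)) = if a = b then 1 else 0 := by
  have := LinearMap.apply_toPerfPair_flip (tracePairing k V S)
    ((Module.finBasis k (V ⟶ S)).coord b) (node k V S a)
  simpa [tracePairing, node, dualNode, Finsupp.single_apply] using this

/-! ### The choices made once and for all -/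

/-- Representatives `X_i` of the isomorphism classes of simple objects, indexed by `ι`, square
roots of their dimensions `d_i`, and a square root of the global dimension `∑ d_i ^ 2`. -/
structure SimpleData (A : Type u) [Category.{v} A] [Abelian A] [Linear k A] [MonoidalCategory A]
    [MonoidalPreadditive A] [MonoidalLinear k A] [BraidedCategory A] [RigidCategory A]
    [PivotalCategory A] [PremodularCategory k A] (ι : Type u₁) [Fintype ι] where
  obj : ι → A
  simple : ∀ i, Simple (obj i)
  eq_of_iso : ∀ i j, Nonempty (obj i ≅ obj j) → i = j
  exists_iso : ∀ X : A, Simple X → ∃ i, Nonempty (X ≅ obj i)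
  sqrtDim : ι → k
  sqrtDim_sq : ∀ i, sqrtDim i ^ 2 = dim k (obj i)
  sqrtGlobalDim : k
  sqrtGlobalDim_sq : sqrtGlobalDim ^ 2 = ∑ i, dim k (obj i) ^ 2

attribute [instance] SimpleData.simple

end Basics

/-! ### The Drinfeld center as a category

The objects and morphisms are those of Mathlib's `Center A`, with the half-braidings inverted to
the form `B ⊗ X ⟶ X ⊗ B`. The type `Center A` itself is not used, because it carries the standard
tensor product as an instance, while here it is the reduced tensor product that is considered. -/

section CenterCategory

/-- An object of the Drinfeld center of `A`: an object of `A` with a half-braiding. -/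
structure ZCenter (A : Type u) [Category.{v} A] [MonoidalCategory A] where
  obj : A
  halfBraiding : HalfBraiding obj

variable {A : Type u} [Category.{v} A] [MonoidalCategory A]

namespace ZCenter

/-- The half-braiding `γ_B : B ⊗ X ⟶ X ⊗ B` of an object `(X, γ)`. -/
def γ (X : ZCenter A) (B : A) : B ⊗ X.obj ⟶ X.obj ⊗ B := (X.halfBraiding.β B).inv

/-- A morphism in the Drinfeld center: a morphism compatible with the half-braidings. -/
@[ext]
structure Hom (X Y : ZCenter A) where
  hom : X.obj ⟶ Y.obj
  comm : ∀ B : A, B ◁ hom ≫ Y.γ B = X.γ B ≫ hom ▷ B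

instance : Category (ZCenter A) where
  Hom := Hom
  id X := ⟨𝟙 X.obj, by simp⟩
  comp f g := ⟨f.hom ≫ g.hom, fun B => by
    rw [whiskerLeft_comp, Category.assoc, g.comm, ← Category.assoc, f.comm, comp_whiskerRight,
      Category.assoc]⟩

@[ext]
lemma hom_ext {X Y : ZCenter A} {f g : X ⟶ Y} (h : f.hom = g.hom) : f = g := Hom.ext h

@[simp]
lemma id_hom (X : ZCenter A) : Hom.hom (𝟙 X) = 𝟙 X.obj := rfl

@[simp]
lemma comp_hom {X Y Z : ZCenter A} (f : X ⟶ Y) (g : Y ⟶ Z) : (f ≫ g).hom = f.hom ≫ g.hom := rfl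

end ZCenter

/-- The forgetful functor from the Drinfeld center. -/
@[simps]
def forget (A : Type u) [Category.{v} A] [MonoidalCategory A] : ZCenter A ⥤ A where
  obj X := X.obj
  map f := f.hom

end CenterCategory

section CenterLinear

namespace ZCenter

variable {A : Type u} [Category.{v} A] [Preadditive A] [MonoidalCategory A]
  [MonoidalPreadditive A]

instance (X Y : ZCenter A) : Zero (X ⟶ Y) := ⟨⟨0, by simp⟩⟩

instance (X Y : ZCenter A) : Add (X ⟶ Y) :=
  ⟨fun f g => ⟨f.hom + g.hom, fun B => by
    simp [MonoidalPreadditive.whiskerLeft_add, MonoidalPreadditive.add_whiskerRight,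
      f.comm, g.comm]⟩⟩

instance (X Y : ZCenter A) : Neg (X ⟶ Y) :=
  ⟨fun f => ⟨-f.hom, fun B => by
    have h1 : B ◁ (-f.hom) = -(B ◁ f.hom) := (tensorLeft B).map_neg
    have h2 : (-f.hom) ▷ B = -(f.hom ▷ B) := (tensorRight B).map_neg
    rw [h1, h2, Preadditive.neg_comp, Preadditive.comp_neg, f.comm]⟩⟩

instance (X Y : ZCenter A) : AddCommGroup (X ⟶ Y) where
  add_assoc f g h := hom_ext (add_assoc _ _ _)
  zero_add f := hom_ext (zero_add _)
  add_zero f := hom_ext (add_zero _)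
  add_comm f g := hom_ext (add_comm _ _)
  neg_add_cancel f := hom_ext (neg_add_cancel _)
  nsmul := nsmulRec
  zsmul := zsmulRec

instance : Preadditive (ZCenter A) where
  add_comp _ _ _ f f' g := hom_ext (Preadditive.add_comp _ _ _ f.hom f'.hom g.hom)
  comp_add _ _ _ f g g' := hom_ext (Preadditive.comp_add _ _ _ f.hom g.hom g'.hom)

variable {k : Type w} [Field k] [Linear k A] [MonoidalLinear k A]

instance (X Y : ZCenter A) : Module k (X ⟶ Y) where
  smul c f := ⟨c • f.hom, fun B => by simp [f.comm]⟩
  one_smul f := hom_ext (one_smul k f.hom)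
  mul_smul a b f := hom_ext (mul_smul a b f.hom)
  smul_zero a := hom_ext (smul_zero a)
  smul_add a f g := hom_ext (smul_add a f.hom g.hom)
  add_smul a b f := hom_ext (add_smul a b f.hom)
  zero_smul f := hom_ext (zero_smul k f.hom)

instance : Linear k (ZCenter A) where
  smul_comp _ _ _ r f g := hom_ext (Linear.smul_comp _ _ _ r f.hom g.hom)
  comp_smul _ _ _ f r g := hom_ext (Linear.comp_smul _ _ _ f.hom r g.hom)

end ZCenter

end CenterLinear

/-! ### The induction functor -/

section Construction

variable {k : Type w} [Field k] [IsAlgClosed k]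
  {A : Type u} [Category.{v} A] [Abelian A] [Linear k A] [MonoidalCategory A]
  [MonoidalPreadditive A] [MonoidalLinear k A] [BraidedCategory A] [RigidCategory A]
  [PivotalCategory A] [PremodularCategory k A] {ι : Type u₁} [Fintype ι]
  (S : SimpleData k A ι)

/-- The morphism `Q^* ⟶ P^* ⊗ B` obtained from `ψ : P ⟶ B ⊗ Q` by turning around the strands
`P` and `Q`. -/
def turn {P Q B : A} (ψ : P ⟶ B ⊗ Q) : Qᘁ ⟶ Pᘁ ⊗ B :=
  𝟙 _ ⊗≫ coevL P ▷ Qᘁ ⊗≫ Pᘁ ◁ ψ ▷ Qᘁ ⊗≫ (Pᘁ ⊗ B) ◁ evR Q ⊗≫ 𝟙 _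

/-- The strand `B` enters `V`, flanked by `X_i` and `X_i^*`, at a node on the left and leaves it
at a node on the right; the two nodes are labelled by dual bases, over which we sum. -/
def pass (B V : A) (i j : ι) :
    B ⊗ S.obj i ⊗ V ⊗ (S.obj i)ᘁ ⟶ (S.obj j ⊗ V ⊗ (S.obj j)ᘁ) ⊗ B :=
  ∑ a : Fin (mult k (B ⊗ S.obj i) (S.obj j)),
    (𝟙 _ ⊗≫ node k (B ⊗ S.obj i) (S.obj j) a ▷ (V ⊗ (S.obj i)ᘁ) ⊗≫
      (S.obj j ⊗ V) ◁ turn (dualNode k (B ⊗ S.obj i) (S.obj j) a) ⊗≫ 𝟙 _)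

/-- The object `⨁ X_i ⊗ V ⊗ X_i^*`. -/
abbrev indObj (V : A) : A := ⨁ fun i => S.obj i ⊗ V ⊗ (S.obj i)ᘁ

/-- The inclusion of a summand of `⨁ X_i ⊗ V ⊗ X_i^*`. -/
abbrev indι (V : A) (i : ι) : S.obj i ⊗ V ⊗ (S.obj i)ᘁ ⟶ indObj S V :=
  biproduct.ι (fun i => S.obj i ⊗ V ⊗ (S.obj i)ᘁ) i

/-- The projection to a summand of `⨁ X_i ⊗ V ⊗ X_i^*`. -/
abbrev indπ (V : A) (i : ι) : indObj S V ⟶ S.obj i ⊗ V ⊗ (S.obj i)ᘁ :=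
  biproduct.π (fun i => S.obj i ⊗ V ⊗ (S.obj i)ᘁ) i

/-- The map `⨁ X_i ⊗ f ⊗ X_i^*`. -/
def indMap {V W : A} (f : V ⟶ W) : indObj S V ⟶ indObj S W :=
  biproduct.map fun i => S.obj i ◁ f ▷ (S.obj i)ᘁ

/-- The morphisms `Γ_B : B ⊗ (⨁ X_i ⊗ V ⊗ X_i^*) ⟶ (⨁ X_j ⊗ V ⊗ X_j^*) ⊗ B`. -/
def indγ (V B : A) : B ⊗ indObj S V ⟶ indObj S V ⊗ B :=
  ∑ i, ∑ j, (S.sqrtDim i * S.sqrtDim j) •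
    (B ◁ indπ S V i ≫ pass S B V i j ≫ indι S V j ▷ B)

/-- The induction functor `I`, that is, the fact that `Γ` is a half-braiding on
`⨁ X_i ⊗ V ⊗ X_i^*` for which the maps `⨁ X_i ⊗ f ⊗ X_i^*` are morphisms in the center. -/
structure Induction where
  halfBraiding : ∀ V : A, HalfBraiding (indObj S V)
  halfBraiding_inv : ∀ V B : A, ((halfBraiding V).β B).inv = indγ S V B
  comm : ∀ {V W : A} (f : V ⟶ W) (B : A),
    B ◁ indMap S f ≫ indγ S W B = indγ S V B ≫ indMap S f ▷ B

variable {S} in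
/-- The induction functor `I : A ⥤ Z(A)`. -/
def Induction.functor (I : Induction S) : A ⥤ ZCenter A where
  obj V := ⟨indObj S V, I.halfBraiding V⟩
  map {V W} f := ⟨indMap S f, fun B => by
    simpa only [ZCenter.γ, I.halfBraiding_inv] using I.comm f B⟩
  map_id V := by
    apply ZCenter.hom_ext
    apply biproduct.hom_ext
    intro j
    simp [indMap, indObj]
  map_comp f g := by
    apply ZCenter.hom_ext
    apply biproduct.hom_ext
    intro j
    simp [indMap]

/-! ### The reduced tensor product -/

/-- The upper half of a loop coloured by `X_i` around two strands: the loop opens between the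
strands, passes under `X` to the left, and crosses `Y` to the right through the half-braiding. -/
def loopTop (X Y : ZCenter A) (i : ι) :
    X.obj ⊗ Y.obj ⟶ S.obj i ⊗ (X.obj ⊗ Y.obj) ⊗ (S.obj i)ᘁ :=
  𝟙 _ ⊗≫ X.obj ◁ η_ (S.obj i) (S.obj i)ᘁ ▷ Y.obj ⊗≫
    (β_ (S.obj i) X.obj).inv ▷ ((S.obj i)ᘁ ⊗ Y.obj) ⊗≫
    (S.obj i ⊗ X.obj) ◁ Y.γ (S.obj i)ᘁ ⊗≫ 𝟙 _

/-- The lower half of a loop coloured by `X_i` around two strands: the loop crosses `X` from the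
left through the half-braiding, passes over `Y` from the right, and closes between the strands. -/
def loopBot (X Y : ZCenter A) (i : ι) :
    S.obj i ⊗ (X.obj ⊗ Y.obj) ⊗ (S.obj i)ᘁ ⟶ X.obj ⊗ Y.obj :=
  𝟙 _ ⊗≫ X.γ (S.obj i) ▷ (Y.obj ⊗ (S.obj i)ᘁ) ⊗≫
    (X.obj ⊗ S.obj i) ◁ (β_ Y.obj (S.obj i)ᘁ).hom ⊗≫
    X.obj ◁ evR (S.obj i) ▷ Y.obj ⊗≫ 𝟙 _

/-- The projection `Q_{γ,μ}` of `X ⊗ Y`, whose image is the reduced tensor product. -/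
def redProj (X Y : ZCenter A) : X.obj ⊗ Y.obj ⟶ X.obj ⊗ Y.obj :=
  (S.sqrtGlobalDim ^ 2)⁻¹ • ∑ i, dim k (S.obj i) • (loopTop S X Y i ≫ loopBot S X Y i)

/-- The natural transformation `γ ⊗̄ μ : B ⊗ (X ⊗ Y) ⟶ (X ⊗ Y) ⊗ B`. -/
def redγ (X Y : ZCenter A) (B : A) : B ⊗ X.obj ⊗ Y.obj ⟶ (X.obj ⊗ Y.obj) ⊗ B :=
  (S.sqrtGlobalDim ^ 2)⁻¹ • ∑ i, ∑ j, (dim k (S.obj i) * dim k (S.obj j)) •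
    (B ◁ loopTop S X Y i ≫ pass S B (X.obj ⊗ Y.obj) i j ≫ loopBot S X Y j ▷ B)

/-- The left unit constraint, before restriction: `I(𝟙) ⊗ X ⟶ X`. -/
def redLeftUnitor (X : ZCenter A) : indObj S (𝟙_ A) ⊗ X.obj ⟶ X.obj :=
  ∑ i, (S.sqrtDim i / S.sqrtGlobalDim) •
    (indπ S (𝟙_ A) i ▷ X.obj ⊗≫ S.obj i ◁ (β_ X.obj (S.obj i)ᘁ).inv ⊗≫
      X.γ (S.obj i) ▷ (S.obj i)ᘁ ⊗≫ X.obj ◁ evR (S.obj i) ⊗≫ 𝟙 _)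

/-- The right unit constraint, before restriction: `X ⊗ I(𝟙) ⟶ X`. -/
def redRightUnitor (X : ZCenter A) : X.obj ⊗ indObj S (𝟙_ A) ⟶ X.obj :=
  ∑ i, (S.sqrtDim i / S.sqrtGlobalDim) •
    (X.obj ◁ indπ S (𝟙_ A) i ⊗≫ (β_ (S.obj i) X.obj).inv ▷ (S.obj i)ᘁ ⊗≫
      X.γ (S.obj i) ▷ (S.obj i)ᘁ ⊗≫ X.obj ◁ evR (S.obj i) ⊗≫ 𝟙 _)

/-- The half-braiding `γ^∨` on `X^*`. -/
def redDualγ (X : ZCenter A) (B : A) : B ⊗ X.objᘁ ⟶ X.objᘁ ⊗ B :=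
  (β_ B (X.objᘁ : A)).hom ⊗≫ (X.objᘁ ⊗ B) ◁ η_ X.obj X.objᘁ ⊗≫
    X.objᘁ ◁ X.γ B ▷ X.objᘁ ⊗≫ ε_ X.obj X.objᘁ ▷ (B ⊗ X.objᘁ) ⊗≫ (β_ (X.objᘁ : A) B).inv

/-- The evaluation of the reduced tensor product, before restriction: `X^* ⊗ X ⟶ I(𝟙)`. -/
def redEv (X : ZCenter A) : X.objᘁ ⊗ X.obj ⟶ indObj S (𝟙_ A) :=
  ∑ i, (S.sqrtDim i / S.sqrtGlobalDim) •
    (𝟙 _ ⊗≫ (X.objᘁ : A) ◁ η_ (S.obj i) (S.obj i)ᘁ ▷ X.obj ⊗≫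
      (β_ (S.obj i) (X.objᘁ : A)).inv ▷ ((S.obj i)ᘁ ⊗ X.obj) ⊗≫
      (S.obj i ⊗ X.objᘁ) ◁ X.γ (S.obj i)ᘁ ⊗≫
      S.obj i ◁ ε_ X.obj X.objᘁ ▷ (S.obj i)ᘁ ⊗≫ indι S (𝟙_ A) i)

/-- The coevaluation of the reduced tensor product, before restriction: `I(𝟙) ⟶ X ⊗ X^*`. -/
def redCoev (X : ZCenter A) : indObj S (𝟙_ A) ⟶ X.obj ⊗ X.objᘁ :=
  ∑ i, (S.sqrtDim i / S.sqrtGlobalDim) •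
    (indπ S (𝟙_ A) i ⊗≫ S.obj i ◁ η_ X.obj X.objᘁ ▷ (S.obj i)ᘁ ⊗≫
      X.γ (S.obj i) ▷ (X.objᘁ ⊗ (S.obj i)ᘁ) ⊗≫
      (X.obj ⊗ S.obj i) ◁ (β_ (X.objᘁ : A) (S.obj i)ᘁ).hom ⊗≫
      X.obj ◁ evR (S.obj i) ▷ X.objᘁ ⊗≫ 𝟙 _)

variable {S} in
/-- The pivotal monoidal category `(Z(A), ⊗̄)` given by the reduced tensor product. The objects
`X ⊗̄ Y` are images of the projections `Q`, with inclusion `incl` and projection `proj`, and all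
the structure is prescribed by explicit formulas. -/
structure ReducedStructure (I : Induction S) where
  [monoidal : MonoidalCategory (ZCenter A)]
  incl : ∀ X Y : ZCenter A, (X ⊗ Y).obj ⟶ X.obj ⊗ Y.obj
  proj : ∀ X Y : ZCenter A, X.obj ⊗ Y.obj ⟶ (X ⊗ Y).obj
  incl_proj : ∀ X Y, incl X Y ≫ proj X Y = 𝟙 _
  proj_incl : ∀ X Y, proj X Y ≫ incl X Y = redProj S X Y
  tensorObj_γ : ∀ (X Y : ZCenter A) (B : A),
    (X ⊗ Y).γ B = B ◁ incl X Y ≫ redγ S X Y B ≫ proj X Y ▷ B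
  tensorHom_hom : ∀ {X X' Y Y' : ZCenter A} (f : X ⟶ X') (g : Y ⟶ Y'),
    (f ⊗ₘ g).hom = incl X Y ≫ (f.hom ⊗ₘ g.hom) ≫ proj X' Y'
  associator_hom : ∀ X Y Z : ZCenter A,
    (α_ X Y Z).hom.hom = incl (X ⊗ Y) Z ≫ incl X Y ▷ Z.obj ≫ (α_ X.obj Y.obj Z.obj).hom ≫
      X.obj ◁ proj Y Z ≫ proj X (Y ⊗ Z)
  /-- The unit object is `I(𝟙)`. -/
  unitIso : 𝟙_ (ZCenter A) ≅ I.functor.obj (𝟙_ A)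
  leftUnitor_hom : ∀ X : ZCenter A,
    (λ_ X).hom.hom = incl (𝟙_ (ZCenter A)) X ≫ unitIso.hom.hom ▷ X.obj ≫ redLeftUnitor S X
  rightUnitor_hom : ∀ X : ZCenter A,
    (ρ_ X).hom.hom = incl X (𝟙_ (ZCenter A)) ≫ X.obj ◁ unitIso.hom.hom ≫ redRightUnitor S X
  [rigid : RightRigidCategory (ZCenter A)]
  /-- The object underlying the dual of `(X, γ)` is `X^*`. -/
  dualIso : ∀ X : ZCenter A, (Xᘁ).obj ≅ X.objᘁ
  dual_γ : ∀ (X : ZCenter A) (B : A),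
    (Xᘁ).γ B = B ◁ (dualIso X).hom ≫ redDualγ X B ≫ (dualIso X).inv ▷ B
  evaluation_hom : ∀ X : ZCenter A,
    (ε_ X Xᘁ).hom = incl Xᘁ X ≫ (dualIso X).hom ▷ X.obj ≫ redEv S X ≫ unitIso.inv.hom
  coevaluation_hom : ∀ X : ZCenter A,
    (η_ X Xᘁ).hom = unitIso.hom.hom ≫ redCoev S X ≫ X.obj ◁ (dualIso X).inv ≫ proj X Xᘁ
  [pivotal : PivotalCategory (ZCenter A)]
  /-- The pivotal structure is that of `A`. -/
  pivot_hom : ∀ X : ZCenter A,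
    (pivot X).hom.hom ≫ (dualIso Xᘁ).hom = (pivot X.obj).hom ≫ ((dualIso X).hom)ᘁ

/-! ### The tensor structure on the induction functor -/

/-- The component of `J` from `(X_i ⊗ V ⊗ X_i^*) ⊗ (X_l ⊗ W ⊗ X_l^*)` to
`X_j ⊗ (V ⊗ W) ⊗ X_j^*`, without its coefficient: `X_l` passes to the left under `X_i^*` and `V`,
the strand `X_i^*` passes to the right over `W` and `X_l^*`, and the strands `X_i, X_l` and
`X_l^*, X_i^*` meet in two nodes labelled by dual bases, over which we sum. -/
def tensorComponent (V W : A) (i l j : ι) :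
    (S.obj i ⊗ V ⊗ (S.obj i)ᘁ) ⊗ (S.obj l ⊗ W ⊗ (S.obj l)ᘁ) ⟶
      S.obj j ⊗ (V ⊗ W) ⊗ (S.obj j)ᘁ :=
  ∑ a : Fin (mult k (S.obj i ⊗ S.obj l) (S.obj j)),
    (𝟙 _ ⊗≫ (S.obj i ⊗ V) ◁ (β_ (S.obj l) (S.obj i)ᘁ).inv ▷ (W ⊗ (S.obj l)ᘁ) ⊗≫
      S.obj i ◁ (β_ (S.obj l) V).inv ▷ ((S.obj i)ᘁ ⊗ W ⊗ (S.obj l)ᘁ) ⊗≫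
      (S.obj i ⊗ S.obj l ⊗ V) ◁ (β_ W (S.obj i)ᘁ).inv ▷ (S.obj l)ᘁ ⊗≫
      (S.obj i ⊗ S.obj l ⊗ V ⊗ W) ◁ (β_ (S.obj l)ᘁ (S.obj i)ᘁ).inv ⊗≫
      node k (S.obj i ⊗ S.obj l) (S.obj j) a ▷ (V ⊗ W ⊗ (S.obj l)ᘁ ⊗ (S.obj i)ᘁ) ⊗≫
      (S.obj j ⊗ V ⊗ W) ◁ ((rightDualTensorIso (S.obj i) (S.obj l)).inv ≫
        (dualNode k (S.obj i ⊗ S.obj l) (S.obj j) a)ᘁ) ⊗≫ 𝟙 _)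

/-- The morphism `J_{V,W} : I(V) ⊗ I(W) ⟶ I(V ⊗ W)`, before restriction to `I(V) ⊗̄ I(W)`. -/
def tensorMap (V W : A) : indObj S V ⊗ indObj S W ⟶ indObj S (V ⊗ W) :=
  ∑ i, ∑ l, ∑ j, (S.sqrtDim i * S.sqrtDim j * S.sqrtDim l) •
    ((indπ S V i ⊗ₘ indπ S W l) ≫ tensorComponent S V W i l j ≫ indι S (V ⊗ W) j)

end Construction

end

end ReducedTensor

set_option linter.unusedSectionVars false

/-! ### Duality calculus in a pivotal category -/

namespace PivotalCategory

variable {C : Type u} [Category.{v} C] [MonoidalCategory C] [RightRigidCategory C]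

/-! The object `I(V)` is a coend of `B ⊗ V ⊗ B^*` over all `B`, and the proof works with arbitrary
colours instead of simple ones. A pairing `f : B ⊗ B' ⟶ 𝟙` gives an insertion `ins S V f : B ⊗ V ⊗
B' ⟶ I(V)`, a sum over dual bases that is extranatural in the pairing (`ins_left`, `ins_right`). The
summand inclusions are rescaled insertions (`indι_eq`), and extranatural families descend to `I(V)`
(`map_ins_desc`). In these terms `Γ_B` nests the given pairing inside one for `B`
(`whiskerLeft_ins_indγ`), so the axioms of a half-braiding become identities between nested
pairings.

A half-braiding on `W` yields central maps `act : I(W) ⟶ W` and `coact : W ⟶ I(W)`. With `ins₁` and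
`counit` they form the units and counits of the two adjunctions. Moreover `coact ≫ act` is the
global dimension `𝒟` (`coact_act`), and `𝒟 ≠ 0` because the vector of dimensions is an eigenvector,
with eigenvalue `𝒟`, of a positive definite integer matrix (`globalDim_ne_zero`). Hence `avg f = 𝒟⁻¹
• (coact ≫ I(f) ≫ act)` projects onto the central morphisms, and it commutes with composition by
central morphisms on either side.

On `X ⊗ Y` there are two half-braidings: `tensUnder` passes under `X` and crosses `Y` by its
half-braiding, while `tensOver` crosses `X` by its half-braiding and passes over `Y`. The projection
`Q` is the average of the identity from the first to the second (`redProj_eq`). Yang–Baxter moves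
show that `Q` is central for every choice of the two at source and target. So `Q` is idempotent, the
two half-braidings agree on its image, and morphisms that do not distinguish them absorb `Q`
(`rproj_comp`, `rproj_comp_of_hb_comp`). Associativity holds because both triple idempotents equal
the product of two adjacent copies of `Q` (`rprL_rinclL_associator`). The unit constraints come from
the isomorphisms `I(V) ⊗ W ≅ I(V ⊗ W) ≅ V ⊗ I(W)`, which allow identities to be checked on the copy
of `V` in `I(V)`.

The half-braiding `γ^∨` is such that evaluation and coevaluation of `A` do not distinguish the two
half-braidings. The zigzags in the center then reduce to those of `A`, the two factors `𝒟^{-1/2}`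
cancelling one `𝒟`. Pairings in the center are compared with pairings in `A` through `flat`, which
shows that duals of morphisms and the pivotal structure are inherited from `A`.

Finally, the forgetful functor is lax monoidal, with the projections `X ⊗ Y ⟶ X ⊗̄ Y` as structure
maps, so its left adjoint `I` is oplax monoidal. The prescribed `J`, rewritten as `indTensor` by
`tensorMap_eq`, is inverse to the oplax structure maps, so `I` is strong monoidal. Its pivotality is
tested on the copy of `V` in `I(V)`. -/

lemma rightDualTensorIso_inv_evaluation (X Y : C) :
    (rightDualTensorIso X Y).inv ▷ (X ⊗ Y) ≫ ε_ (X ⊗ Y) (X ⊗ Y)ᘁ =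
      𝟙 _ ⊗≫ (Yᘁ : C) ◁ ε_ X Xᘁ ▷ Y ⊗≫ ε_ Y Yᘁ := by
  -- The inverse of `rightDualTensorIso` is the mate of the identity of `X ⊗ Y` with respect to two
  -- duals, the chosen one and the product of the duals.
  have := @rightAdjointMate_comp_evaluation C _ _ (X ⊗ Y) (X ⊗ Y) ⟨(X ⊗ Y)ᘁ⟩
    (hasRightDualTensor) (𝟙 _)
  rw [MonoidalCategory.whiskerLeft_id, Category.id_comp] at this
  refine Eq.trans this ?_
  change 𝟙 _ ⊗≫ (Yᘁ : C) ◁ (ε_ X Xᘁ ▷ Y) ⊗≫ ε_ Y Yᘁ = _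
  rfl

variable [PivotalCategory C]

/-- The zigzag of `Xᘁ` with its own dual, in which the pivot inside `evR` cancels its inverse inside
`coevL`. With `evR_coevL` it makes `Xᘁ` a dual of `X` on the other side as well. -/
lemma coevL_evR (X : C) : X ◁ coevL X ⊗≫ evR X ▷ X = ⊗𝟙.hom := by
  calc
    _ = 𝟙 _ ⊗≫ X ◁ η_ Xᘁ (Xᘁ)ᘁ ⊗≫ ((X ⊗ Xᘁ) ◁ (pivot X).inv ≫
          ((pivot X).hom ▷ Xᘁ) ▷ X) ⊗≫ ε_ Xᘁ (Xᘁ)ᘁ ▷ X := by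
        simp only [coevL, evR]; monoidal
    _ = 𝟙 _ ⊗≫ (X ◁ η_ Xᘁ (Xᘁ)ᘁ ≫ (pivot X).hom ▷ ((Xᘁ : C) ⊗ (Xᘁ)ᘁ)) ⊗≫ 
          (((Xᘁ)ᘁ ⊗ Xᘁ : C) ◁ (pivot X).inv ≫ ε_ (Xᘁ : C) (Xᘁ)ᘁ ▷ X) := by
        rw [whisker_exchange]; monoidal
    _ = 𝟙 _ ⊗≫ (pivot X).hom ⊗≫ (((Xᘁ)ᘁ : C) ◁ η_ (Xᘁ : C) (Xᘁ)ᘁ ⊗≫ ε_ (Xᘁ : C) (Xᘁ)ᘁ ▷ ((Xᘁ)ᘁ : C)) ⊗≫ 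
          (pivot X).inv ⊗≫ 𝟙 _ := by
        rw [whisker_exchange, whisker_exchange]; monoidal
    _ = 𝟙 _ ⊗≫ ((pivot X).hom ≫ (pivot X).inv) ⊗≫ 𝟙 _ := by
        rw [ExactPairing.coevaluation_evaluation'']; monoidal
    _ = _ := by rw [Iso.hom_inv_id]; monoidal

lemma evR_coevL (X : C) : coevL X ▷ Xᘁ ⊗≫ Xᘁ ◁ evR X = ⊗𝟙.hom := by
  calc
    _ = 𝟙 _ ⊗≫ η_ Xᘁ (Xᘁ)ᘁ ▷ Xᘁ ⊗≫ Xᘁ ◁ ((pivot X).inv ≫ (pivot X).hom) ▷ Xᘁ ⊗≫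
          Xᘁ ◁ ε_ Xᘁ (Xᘁ)ᘁ := by
        simp only [coevL, evR]; monoidal
    _ = 𝟙 _ ⊗≫ (η_ Xᘁ (Xᘁ)ᘁ ▷ Xᘁ ⊗≫ Xᘁ ◁ ε_ Xᘁ (Xᘁ)ᘁ) ⊗≫ 𝟙 _ := by
        rw [Iso.inv_hom_id]; monoidal
    _ = _ := by rw [ExactPairing.evaluation_coevaluation'']; monoidal

lemma evR_naturality {X Y : C} (f : X ⟶ Y) : f ▷ Yᘁ ≫ evR Y = X ◁ fᘁ ≫ evR X := by
  rw [evR, evR, ← Category.assoc, ← comp_whiskerRight, pivot_naturality, comp_whiskerRight,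
    Category.assoc, rightAdjointMate_comp_evaluation, whisker_exchange_assoc]

lemma coevL_naturality {X Y : C} (f : X ⟶ Y) : coevL X ≫ Xᘁ ◁ f = coevL Y ≫ fᘁ ▷ Y := by
  have h : (pivot X).inv ≫ f = ((fᘁ)ᘁ) ≫ (pivot Y).inv := by
    rw [Iso.inv_comp_eq, ← Category.assoc, ← pivot_naturality]; simp
  rw [coevL, coevL, Category.assoc, ← MonoidalCategory.whiskerLeft_comp, h,
    MonoidalCategory.whiskerLeft_comp, coevaluation_comp_rightAdjointMate_assoc, Category.assoc,
    whisker_exchange]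

lemma pivot_comp_rightDualTensorIso (X Y : C) :
    (pivot (X ⊗ Y)).hom ≫ ((rightDualTensorIso X Y).inv)ᘁ =
      ((pivot X).hom ⊗ₘ (pivot Y).hom) ≫ (rightDualTensorIso Yᘁ Xᘁ).inv := by
  rw [Iso.eq_comp_inv, Category.assoc, pivot_tensor]

/-- This is the form in which the monoidality of the pivot is used: it splits the pivot of `X ⊗ Y`
into two, one for each of the nested evaluations. -/
lemma evR_tensor (X Y : C) :
    (X ⊗ Y) ◁ (rightDualTensorIso X Y).inv ≫ evR (X ⊗ Y) =
      𝟙 _ ⊗≫ X ◁ evR Y ▷ Xᘁ ⊗≫ evR X := by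
  calc
    _ = (pivot (X ⊗ Y)).hom ▷ _ ≫ (_ ◁ (rightDualTensorIso X Y).inv ≫ ε_ _ _) := by
      rw [evR, whisker_exchange_assoc]
    _ = ((pivot (X ⊗ Y)).hom ≫ ((rightDualTensorIso X Y).inv)ᘁ) ▷ _ ≫ ε_ _ _ := by
      rw [← rightAdjointMate_comp_evaluation, comp_whiskerRight_assoc]
    _ = _ := by
      rw [pivot_comp_rightDualTensorIso, comp_whiskerRight_assoc, rightDualTensorIso_inv_evaluation, tensorHom_def']
      calc
        _ = 𝟙 _ ⊗≫ X ◁ (pivot Y).hom ▷ (Yᘁ ⊗ Xᘁ) ⊗≫ ((pivot X).hom ▷ ((Yᘁ)ᘁ ⊗ Yᘁ ⊗ Xᘁ : C) ≫ 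
          ((Xᘁ)ᘁ : C) ◁ (𝟙 _ ⊗≫ ε_ (Yᘁ : C) (Yᘁ)ᘁ ▷ (Xᘁ : C))) ⊗≫ ε_ (Xᘁ : C) (Xᘁ)ᘁ := by monoidal
        _ = _ := by
          rw [← whisker_exchange]; simp only [evR]; monoidal

end PivotalCategory

namespace ReducedTensor

noncomputable section

/-! ### Simplicity of duals, dual bases and semisimplicity -/

section Duals

variable {k : Type w} [Field k] [IsAlgClosed k]
  {A : Type u} [Category.{v} A] [Abelian A] [Linear k A] [MonoidalCategory A]
  [MonoidalPreadditive A] [MonoidalLinear k A] [BraidedCategory A] [RigidCategory A]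
  [PivotalCategory A]

variable (k) in
lemma unitScalar_smul [PremodularCategory k A] (t : 𝟙_ A ⟶ 𝟙_ A) : unitScalar k t • 𝟙 (𝟙_ A) = t :=
  (unitScalar k).symm_apply_apply t

variable (k) in
lemma unitScalar_id [PremodularCategory k A] : unitScalar k (𝟙 (𝟙_ A)) = 1 := by
  have := (unitScalar (A := A) k).apply_symm_apply 1
  rwa [show (unitScalar (A := A) k).symm 1 = 𝟙 _ from one_smul k (𝟙 (𝟙_ A))] at this

variable (k) in
-- Both `End(Xᘁ)` and `End(X)` are identified with `Hom(Xᘁ ⊗ X, 𝟙)`, so endomorphisms of `Xᘁ` are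
-- scalars. By semisimplicity a simple object splits off `Xᘁ`; the corresponding idempotent is a
-- nonzero scalar, hence the identity.
lemma simple_dual [PremodularCategory k A] (X : A) [Simple X] : Simple (Xᘁ : A) := by
  have hX : 𝟙 (Xᘁ : A) ≠ 0 := by
    intro h0
    apply evaluation_ne_zero (id_nonzero X)
    have : ε_ X Xᘁ = (𝟙 (Xᘁ : A)) ▷ X ≫ ε_ X Xᘁ := by simp
    rw [this, h0]; simp
  have hend : ∀ t : (Xᘁ : A) ⟶ Xᘁ, ∃ c : k, t = c • 𝟙 _ := by
    intro t
    let E := tensorRightHomEquiv (Xᘁ : A) X Xᘁ (𝟙_ A)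
    let F := tensorLeftHomEquiv X X Xᘁ (𝟙_ A)
    obtain ⟨c, hc⟩ := endomorphism_simple_eq_smul_id k
      (F (E.symm (t ≫ (λ_ _).inv)) ≫ (ρ_ _).hom)
    obtain ⟨b, hb⟩ := endomorphism_simple_eq_smul_id k
      (F (E.symm (𝟙 _ ≫ (λ_ _).inv)) ≫ (ρ_ _).hom)
    have hb0 : b ≠ 0 := by
      rintro rfl
      rw [zero_smul] at hb
      have h1 : F (E.symm (𝟙 _ ≫ (λ_ _).inv)) = F (E.symm 0) := by
        rw [← cancel_mono (ρ_ _).hom, ← hb]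
        simp [E, F, tensorRightHomEquiv, tensorLeftHomEquiv]
      have h2 := E.symm.injective (F.injective h1)
      apply hX
      rw [← cancel_mono (λ_ _).inv, h2, zero_comp]
    -- The scalar `b` is the image of the identity of `Xᘁ` under the identification with `End(X)`;
    -- dividing by it normalises the identification.
    refine ⟨c / b, ?_⟩
    have h1 : F (E.symm (t ≫ (λ_ _).inv)) = F (E.symm (((c / b) • 𝟙 _) ≫ (λ_ _).inv)) := by
      rw [← cancel_mono (ρ_ _).hom, ← hc]
      have : F (E.symm (((c / b) • 𝟙 _) ≫ (λ_ _).inv)) ≫ (ρ_ _).hom =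
          (c / b) • (F (E.symm (𝟙 _ ≫ (λ_ _).inv)) ≫ (ρ_ _).hom) := by
        simp [E, F, tensorRightHomEquiv, tensorLeftHomEquiv]
      rw [this, ← hb, smul_smul, div_mul_cancel₀ _ hb0]
    rw [← cancel_mono (λ_ _).inv]
    exact E.symm.injective (F.injective h1)
  obtain ⟨n, T, hT, ⟨e⟩⟩ := PremodularCategory.semisimple (A := A) k (Xᘁ)
  obtain ⟨m, hm⟩ : ∃ m, e.hom ≫ biproduct.π T m ≠ 0 := by
    by_contra! h
    apply hX
    rw [← cancel_mono e.hom]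
    apply biproduct.hom_ext
    intro j
    rw [Category.assoc, h, comp_zero, zero_comp, zero_comp]
  have := hT m
  obtain ⟨ψ, hψ⟩ := exists_section (PremodularCategory.semisimple k) _ hm
  obtain ⟨c, hc⟩ := hend ((e.hom ≫ biproduct.π T m) ≫ ψ)
  have hc1 : ((e.hom ≫ biproduct.π T m) ≫ ψ) = 𝟙 _ := by
    have h2 := congrArg (ψ ≫ ·) hc
    simp only [← Category.assoc, Linear.comp_smul, Category.comp_id] at h2
    rw [Category.assoc ψ, hψ, Category.id_comp] at h2
    have h3 : c = 1 := by
      have h4 : c • 𝟙 (T m) = 𝟙 (T m) := by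
        have := congrArg (· ≫ (e.hom ≫ biproduct.π T m)) h2
        simp only [Linear.smul_comp, hψ] at this
        exact this.symm
      have h5 : (c - 1) • 𝟙 (T m) = 0 := by rw [sub_smul, h4, one_smul, sub_self]
      rcases smul_eq_zero.1 h5 with h | h
      · exact sub_eq_zero.1 h
      · exact absurd h (id_nonzero _)
    rw [hc, h3, one_smul]
  exact Simple.of_iso ⟨_, ψ, hc1, hψ⟩

lemma nonempty_iso_of_dual_iso {X Y : A} (e : (Xᘁ : A) ≅ Yᘁ) : Nonempty (X ≅ Y) :=
  ⟨pivot X ≪≫ ⟨(e.inv)ᘁ, (e.hom)ᘁ, by rw [← comp_rightAdjointMate]; simp,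
    by rw [← comp_rightAdjointMate]; simp⟩ ≪≫ (pivot Y).symm⟩

end Duals

section Semisimple

variable {k : Type w} [Field k] [IsAlgClosed k]
  {A : Type u} [Category.{v} A] [Abelian A] [Linear k A] [MonoidalCategory A]
  [MonoidalPreadditive A] [MonoidalLinear k A] [BraidedCategory A] [RigidCategory A]
  [PivotalCategory A] [PremodularCategory k A]

lemma sum_node {V S : A} [Simple S] (h : V ⟶ S) :
    ∑ b, unitScalar k (rtrace (dualNode k V S b ≫ h)) • node k V S b = h := by
  conv_rhs => rw [← (Module.finBasis k (V ⟶ S)).sum_repr h]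
  refine Finset.sum_congr rfl fun b _ => ?_
  congr 1
  exact LinearMap.apply_toPerfPair_flip (tracePairing k V S)
    ((Module.finBasis k (V ⟶ S)).coord b) h

lemma hom_ext_node {V S : A} [Simple S] (ψ ψ' : S ⟶ V)
    (h : ∀ a, unitScalar k (rtrace (ψ ≫ node k V S a)) =
      unitScalar k (rtrace (ψ' ≫ node k V S a))) : ψ = ψ' := by
  apply (tracePairing k V S).flip.toPerfPair.injective
  apply (Module.finBasis k (V ⟶ S)).ext
  exact h

lemma rtrace_sum_smul {n : ℕ} {X : A} (x : Fin n → k) (f : Fin n → (X ⟶ X)) :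
    unitScalar k (rtrace (∑ a, x a • f a)) = ∑ a, x a * unitScalar k (rtrace (f a)) := by
  have h1 : rtrace (∑ a, x a • f a) = ∑ a, x a • rtrace (f a) := by
    simp only [rtrace, sum_whiskerRight, MonoidalLinear.smul_whiskerRight,
      Preadditive.sum_comp, Preadditive.comp_sum, Linear.smul_comp, Linear.comp_smul]
  rw [h1, map_sum]
  simp

/-- Moving a morphism through a pair of dual bases. -/
lemma exists_node_coeff {V W : A} (S : A) [Simple S] (f : V ⟶ W) :
    ∃ c : Fin (mult k W S) → Fin (mult k V S) → k,
      (∀ a, f ≫ node k W S a = ∑ b, c a b • node k V S b) ∧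
      (∀ b, dualNode k V S b ≫ f = ∑ a, c a b • dualNode k W S a) := by
  refine ⟨fun a b => unitScalar k (rtrace (dualNode k V S b ≫ f ≫ node k W S a)), ?_, ?_⟩
  · intro a
    exact (sum_node (k := k) (f ≫ node k W S a)).symm
  · intro b
    refine hom_ext_node (k := k) (dualNode k V S b ≫ f) _ fun a => ?_
    simp only [Preadditive.sum_comp, Linear.smul_comp, Category.assoc, rtrace_sum_smul]
    rw [Finset.sum_eq_single a]
    · rw [tracePairing_node_dualNode, if_pos rfl, mul_one]
    · intro a' _ h
      rw [tracePairing_node_dualNode, if_neg h.symm, mul_zero]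
    · simp

/-- A resolution of the identity by dual bases of morphisms to and from the simple objects. -/
lemma sum_resolution_eq_id {ι : Type u₁} [Fintype ι] {V : A} (Y : ι → A) (hY : ∀ i, Simple (Y i))
    (hYiso : ∀ i j, Nonempty (Y i ≅ Y j) → i = j)
    (hYex : ∀ X : A, Simple X → ∃ i, Nonempty (X ≅ Y i)) {n : ι → ℕ}
    (f : ∀ i, Fin (n i) → (V ⟶ Y i)) (g : ∀ i, Fin (n i) → (Y i ⟶ V)) (c : ι → k)
    (hf : ∀ i (h : V ⟶ Y i), ∃ x : Fin (n i) → k, h = ∑ a, x a • f i a)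
    (hfg : ∀ i a b, c i • (g i a ≫ f i b) = if a = b then 𝟙 (Y i) else 0) :
    ∑ i, c i • ∑ a, f i a ≫ g i a = 𝟙 V := by
  classical
  -- Maps to the simples detect equality of morphisms out of `V`. After expanding `h` in the given
  -- family, Schur's lemma leaves only the terms with target `Y j`, and duality leaves only one of
  -- those.
  have key : ∀ i (h : V ⟶ Y i), (∑ i, c i • ∑ a, f i a ≫ g i a) ≫ h = h := by
    intro j h
    obtain ⟨x, rfl⟩ := hf j h
    simp only [Preadditive.sum_comp, Preadditive.comp_sum, Linear.comp_smul, Linear.smul_comp,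
      Category.assoc]
    refine Finset.sum_congr rfl fun b _ => ?_
    congr 1
    rw [Finset.sum_eq_single j]
    · rw [Finset.smul_sum, Finset.sum_eq_single b]
      · rw [← Linear.comp_smul, hfg, if_pos rfl, Category.comp_id]
      · intro a _ hab
        rw [← Linear.comp_smul, hfg, if_neg hab, comp_zero]
      · simp
    · intro i _ hij
      have hz : ∀ a, g i a ≫ f j b = 0 := by
        intro a
        by_contra h0
        have := hY i
        have := hY j
        have := isIso_of_hom_simple h0
        exact hij (hYiso i j ⟨asIso (g i a ≫ f j b)⟩)
      simp [hz]
    · simp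
  obtain ⟨m, T, hT, ⟨e⟩⟩ := PremodularCategory.semisimple (A := A) k V
  rw [← cancel_mono e.hom]
  apply biproduct.hom_ext
  intro l
  obtain ⟨i, ⟨e'⟩⟩ := hYex (T l) (hT l)
  rw [← cancel_mono e'.hom]
  simpa only [Category.assoc, Category.id_comp] using key i (e.hom ≫ biproduct.π T l ≫ e'.hom)

end Semisimple

end

end ReducedTensor

namespace ReducedTensor

noncomputable section

/-! ### Resolutions of the identity and rotated nodes -/

section Resolution

variable {k : Type w} [Field k] [IsAlgClosed k]
  {A : Type u} [Category.{v} A] [Abelian A] [Linear k A] [MonoidalCategory A]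
  [MonoidalPreadditive A] [MonoidalLinear k A] [BraidedCategory A] [RigidCategory A]
  [PivotalCategory A] [PremodularCategory k A] {ι : Type u₁} [Fintype ι]
  (S : SimpleData k A ι)

lemma rtrace_smul_id {X : A} (c : k) : rtrace (c • 𝟙 X) = (c * dim k X) • 𝟙 (𝟙_ A) := by
  have h1 : rtrace (c • 𝟙 X) = c • rtrace (𝟙 X) := by simp [rtrace]
  rw [h1, mul_smul, dim, unitScalar_smul]

/-- By Schur's lemma the composite is a scalar, and its trace is that scalar times the dimension.
Normalising dual bases by the trace is what puts the weight `d_i` into every resolution of the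
identity. -/
lemma dualNode_comp_node (V X : A) [Simple X] (a b : Fin (mult k V X)) :
    dim k X • (dualNode k V X a ≫ node k V X b) = if a = b then 𝟙 X else 0 := by
  obtain ⟨c, hc⟩ := endomorphism_simple_eq_smul_id k (dualNode k V X a ≫ node k V X b)
  have h := tracePairing_node_dualNode k V X b a
  rw [← hc, rtrace_smul_id, map_smul, unitScalar_id, smul_eq_mul, mul_one] at h
  rw [← hc, smul_smul, mul_comm, h]
  simp [eq_comm]

lemma sum_node_comp_dualNode (V : A) :
    ∑ i, dim k (S.obj i) • ∑ a, node k V (S.obj i) a ≫ dualNode k V (S.obj i) a = 𝟙 V := by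
  refine sum_resolution_eq_id S.obj S.simple S.eq_of_iso S.exists_iso _ _ _ ?_ ?_
  · intro i h
    exact ⟨_, (sum_node h).symm⟩
  · intro i a b
    exact dualNode_comp_node V (S.obj i) a b

/-- The morphism `P^* ⊗ B ⟶ Q^*` obtained from `φ : B ⊗ Q ⟶ P`. -/
def turnNode {P Q B : A} (φ : B ⊗ Q ⟶ P) : Pᘁ ⊗ B ⟶ Qᘁ :=
  𝟙 _ ⊗≫ (Pᘁ ⊗ B : A) ◁ η_ Q Qᘁ ⊗≫ (Pᘁ : A) ◁ φ ▷ (Qᘁ : A) ⊗≫ ε_ P Pᘁ ▷ (Qᘁ : A) ⊗≫ 𝟙 _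

/-- A rotated node slides around the cup back to its original position. Together with
`turnNode_evaluation` this turns traces on `Qᘁ` into traces on `P`. -/
lemma coevL_turn {P Q B : A} (ψ : P ⟶ B ⊗ Q) :
    coevL Q ≫ turn ψ ▷ Q = coevL P ≫ (Pᘁ : A) ◁ ψ ≫ (α_ _ _ _).inv := by
  calc
    _ = 𝟙 _ ⊗≫ (𝟙_ A ◁ coevL Q ≫ (coevL P ⊗≫ (Pᘁ : A) ◁ ψ) ▷ (Qᘁ ⊗ Q : A)) ⊗≫ 
          ((Pᘁ ⊗ B : A) ◁ evR Q) ▷ Q ⊗≫ 𝟙 _ := by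
        rw [turn]; monoidal
    _ = 𝟙 _ ⊗≫ ((coevL P ⊗≫ (Pᘁ : A) ◁ ψ) ▷ 𝟙_ A ≫ (Pᘁ ⊗ B ⊗ Q : A) ◁ coevL Q) ⊗≫ 
          ((Pᘁ ⊗ B : A) ◁ evR Q) ▷ Q ⊗≫ 𝟙 _ := by
        rw [← whisker_exchange]
    _ = 𝟙 _ ⊗≫ (coevL P ⊗≫ (Pᘁ : A) ◁ ψ) ⊗≫ (Pᘁ ⊗ B : A) ◁ (Q ◁ coevL Q ⊗≫ evR Q ▷ Q) ⊗≫ 𝟙 _ := by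
        monoidal
    _ = _ := by rw [coevL_evR]; monoidal

lemma turnNode_evaluation {P Q B : A} (φ : B ⊗ Q ⟶ P) :
    turnNode φ ▷ Q ≫ ε_ Q Qᘁ = (α_ _ _ _).hom ≫ (Pᘁ : A) ◁ φ ≫ ε_ P Pᘁ := by
  calc
    _ = 𝟙 _ ⊗≫ (Pᘁ ⊗ B : A) ◁ η_ Q Qᘁ ▷ Q ⊗≫ (((Pᘁ : A) ◁ φ ⊗≫ ε_ P Pᘁ) ▷ (Qᘁ ⊗ Q : A) ≫
          (𝟙_ A) ◁ ε_ Q Qᘁ) ⊗≫ 𝟙 _ := by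
        rw [turnNode]; monoidal
    _ = 𝟙 _ ⊗≫ (Pᘁ ⊗ B : A) ◁ (η_ Q Qᘁ ▷ Q ⊗≫ Q ◁ ε_ Q Qᘁ) ⊗≫ ((Pᘁ : A) ◁ φ ⊗≫ ε_ P Pᘁ) ⊗≫ 
          𝟙 _ := by
        rw [← whisker_exchange]; monoidal
    _ = _ := by rw [ExactPairing.evaluation_coevaluation'']; monoidal

lemma coevaluation_turnNode {P Q B : A} (φ : B ⊗ Q ⟶ P) :
    (λ_ B).inv ≫ η_ P Pᘁ ▷ B ≫ (α_ _ _ _).hom ≫ P ◁ turnNode φ =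
      𝟙 _ ⊗≫ B ◁ η_ Q Qᘁ ⊗≫ φ ▷ (Qᘁ : A) := by
  calc
    _ = 𝟙 _ ⊗≫ (η_ P Pᘁ ▷ (B ⊗ 𝟙_ A) ≫ (P ⊗ (Pᘁ : A)) ◁ (B ◁ η_ Q Qᘁ ⊗≫ φ ▷ (Qᘁ : A))) ⊗≫
          P ◁ ε_ P Pᘁ ▷ (Qᘁ : A) ⊗≫ 𝟙 _ := by
        rw [turnNode]; monoidal
    _ = 𝟙 _ ⊗≫ (B ◁ η_ Q Qᘁ ⊗≫ φ ▷ (Qᘁ : A)) ⊗≫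
          (η_ P Pᘁ ▷ P ⊗≫ P ◁ ε_ P Pᘁ) ▷ (Qᘁ : A) ⊗≫ 𝟙 _ := by
        rw [← whisker_exchange]; monoidal
    _ = _ := by rw [ExactPairing.evaluation_coevaluation'']; monoidal

lemma exists_turnNode_eq {P Q B : A} (h : Pᘁ ⊗ B ⟶ (Qᘁ : A)) :
    ∃ φ : B ⊗ Q ⟶ P, turnNode φ = h := by
  refine ⟨𝟙 _ ⊗≫ η_ P Pᘁ ▷ (B ⊗ Q) ⊗≫ P ◁ h ▷ Q ⊗≫ P ◁ ε_ Q Qᘁ ⊗≫ 𝟙 _, ?_⟩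
  calc
    _ = 𝟙 _ ⊗≫ (Pᘁ ⊗ B : A) ◁ η_ Q Qᘁ ⊗≫ (Pᘁ : A) ◁ η_ P Pᘁ ▷ (B ⊗ Q ⊗ Qᘁ : A) ⊗≫
          (Pᘁ : A) ◁ P ◁ (h ▷ (Q ⊗ Qᘁ : A) ⊗≫ ε_ Q Qᘁ ▷ (Qᘁ : A)) ⊗≫
          ε_ P Pᘁ ▷ (Qᘁ : A) ⊗≫ 𝟙 _ := by
        rw [turnNode]; monoidal
    _ = 𝟙 _ ⊗≫ (Pᘁ ⊗ B : A) ◁ η_ Q Qᘁ ⊗≫ (Pᘁ : A) ◁ η_ P Pᘁ ▷ (B ⊗ Q ⊗ Qᘁ : A) ⊗≫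
          (((Pᘁ : A) ⊗ P) ◁ (h ▷ (Q ⊗ Qᘁ : A) ⊗≫ ε_ Q Qᘁ ▷ (Qᘁ : A)) ≫
          ε_ P Pᘁ ▷ _) ⊗≫ 𝟙 _ := by monoidal
    _ = 𝟙 _ ⊗≫ (Pᘁ ⊗ B : A) ◁ η_ Q Qᘁ ⊗≫
          ((Pᘁ : A) ◁ η_ P Pᘁ ⊗≫ ε_ P Pᘁ ▷ (Pᘁ : A)) ▷ (B ⊗ Q ⊗ Qᘁ : A) ⊗≫
          (h ▷ (Q ⊗ Qᘁ : A) ⊗≫ ε_ Q Qᘁ ▷ (Qᘁ : A)) ⊗≫ 𝟙 _ := by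
        rw [whisker_exchange]; monoidal
    _ = 𝟙 _ ⊗≫ ((Pᘁ ⊗ B : A) ◁ η_ Q Qᘁ ≫ h ▷ (Q ⊗ Qᘁ : A)) ⊗≫ ε_ Q Qᘁ ▷ (Qᘁ : A) ⊗≫ 𝟙 _ := by
        rw [ExactPairing.coevaluation_evaluation'']; monoidal
    _ = 𝟙 _ ⊗≫ h ⊗≫ ((Qᘁ : A) ◁ η_ Q Qᘁ ⊗≫ ε_ Q Qᘁ ▷ (Qᘁ : A)) ⊗≫ 𝟙 _ := by
        rw [whisker_exchange]; monoidal
    _ = _ := by rw [ExactPairing.coevaluation_evaluation'']; monoidal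

/-- The composite is a scalar since `Qᘁ` is simple. Closing the strand turns it into the left trace
of `ψ ≫ φ`, and sphericality replaces this by the right trace that defines dual bases. So rotation
preserves duality up to the change of weight from `d_P` to `d_Q`. -/
lemma turn_turnNode {P Q B : A} [Simple P] [Simple Q] (φ : B ⊗ Q ⟶ P) (ψ : P ⟶ B ⊗ Q) :
    dim k Q • (turn ψ ≫ turnNode φ) = unitScalar k (rtrace (ψ ≫ φ)) • 𝟙 (Qᘁ : A) := by
  have := simple_dual k Q
  obtain ⟨c, hc⟩ := endomorphism_simple_eq_smul_id k (turn ψ ≫ turnNode φ)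
  have h1 : coevL Q ≫ (turn ψ ≫ turnNode φ) ▷ Q ≫ ε_ Q Qᘁ = rtrace (ψ ≫ φ) := by
    rw [PremodularCategory.spherical k, comp_whiskerRight, Category.assoc, turnNode_evaluation,
      ← Category.assoc, coevL_turn, ltrace]
    simp
  have h2 : coevL Q ≫ (c • 𝟙 (Qᘁ : A)) ▷ Q ≫ ε_ Q Qᘁ = (c * dim k Q) • 𝟙 (𝟙_ A) := by
    have h3 : coevL Q ≫ (c • 𝟙 (Qᘁ : A)) ▷ Q ≫ ε_ Q Qᘁ = c • ltrace (𝟙 Q) := by simp [ltrace]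
    rw [h3, ← PremodularCategory.spherical k, mul_smul, dim, unitScalar_smul]
  rw [hc, h1] at h2
  rw [← hc, h2, smul_smul, map_smul, unitScalar_id, smul_eq_mul, mul_one, mul_comm]

/-- The duals of the `X_i` again represent all simple objects, every morphism to them is a rotated
node, and rotated dual bases remain dual by `turn_turnNode`. Hence they resolve the identity in the
same way. -/
lemma sum_turnNode_comp_turn (B : A) (j : ι) :
    ∑ i, dim k (S.obj i) • ∑ a, turnNode (node k (B ⊗ S.obj i) (S.obj j) a) ≫
      turn (dualNode k (B ⊗ S.obj i) (S.obj j) a) = 𝟙 ((S.obj j)ᘁ ⊗ B : A) := by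
  refine sum_resolution_eq_id (fun i => ((S.obj i)ᘁ : A)) (fun i => simple_dual k (S.obj i))
    (fun i j ⟨e⟩ => S.eq_of_iso i j (nonempty_iso_of_dual_iso e)) ?_ _ _ _ ?_ ?_
  · intro X hX
    obtain ⟨i, ⟨e⟩⟩ := S.exists_iso _ (simple_dual k X)
    exact ⟨i, ⟨pivot X ≪≫ ⟨(e.inv)ᘁ, (e.hom)ᘁ, by rw [← comp_rightAdjointMate]; simp,
      by rw [← comp_rightAdjointMate]; simp⟩⟩⟩
  · intro i h
    obtain ⟨φ, rfl⟩ := exists_turnNode_eq h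
    refine ⟨fun b => unitScalar k (rtrace (dualNode k _ _ b ≫ φ)), ?_⟩
    conv_lhs => rw [← sum_node (k := k) φ]
    simp [turnNode, monoidalComp, Preadditive.sum_comp, Preadditive.comp_sum, sum_whiskerRight,
      whiskerLeft_sum]
  · intro i a b
    rw [turn_turnNode, tracePairing_node_dualNode]
    simp [eq_comm, ite_smul]

/-- Sliding a strand `B` over a sum over all simple colours. -/
lemma sum_coevaluation_slide (B : A) (j : ι) :
    ∑ i, dim k (S.obj i) • ∑ a, (𝟙 _ ⊗≫ B ◁ η_ (S.obj i) (S.obj i)ᘁ ⊗≫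
      node k (B ⊗ S.obj i) (S.obj j) a ▷ ((S.obj i)ᘁ : A) ⊗≫
      S.obj j ◁ turn (dualNode k (B ⊗ S.obj i) (S.obj j) a)) =
    𝟙 B ⊗≫ η_ (S.obj j) (S.obj j)ᘁ ▷ B ⊗≫ 𝟙 _ := by
  -- Bending the strand `X_j^*` of the rotated resolution with the coevaluation of `X_j` undoes the
  -- rotation of the upper node.
  have h := congrArg (fun t => (λ_ B).inv ≫ η_ (S.obj j) (S.obj j)ᘁ ▷ B ≫ (α_ _ _ _).hom ≫
    S.obj j ◁ t) (sum_turnNode_comp_turn S B j)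
  simp only [whiskerLeft_sum, MonoidalLinear.whiskerLeft_smul, Preadditive.comp_sum,
    Linear.comp_smul, MonoidalCategory.whiskerLeft_comp] at h
  have h2 : ∀ (i : ι) (a : _), (λ_ B).inv ≫ η_ (S.obj j) (S.obj j)ᘁ ▷ B ≫ (α_ _ _ _).hom ≫
      S.obj j ◁ turnNode (node k (B ⊗ S.obj i) (S.obj j) a) ≫
      S.obj j ◁ turn (dualNode k (B ⊗ S.obj i) (S.obj j) a) =
      𝟙 _ ⊗≫ B ◁ η_ (S.obj i) (S.obj i)ᘁ ⊗≫
      node k (B ⊗ S.obj i) (S.obj j) a ▷ ((S.obj i)ᘁ : A) ⊗≫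
      S.obj j ◁ turn (dualNode k (B ⊗ S.obj i) (S.obj j) a) := by
    intro i a
    have := coevaluation_turnNode (node k (B ⊗ S.obj i) (S.obj j) a)
    simp only [← Category.assoc] at this ⊢
    rw [this]
    simp [monoidalComp]
  simp only [h2] at h
  rw [h]
  monoidal

end Resolution

end

end ReducedTensor

namespace ReducedTensor

noncomputable section

/-! ### Insertions of coloured strands into `I(V)` -/

section Insertion

variable {k : Type w} [Field k] [IsAlgClosed k]
  {A : Type u} [Category.{v} A] [Abelian A] [Linear k A] [MonoidalCategory A]
  [MonoidalPreadditive A] [MonoidalLinear k A] [BraidedCategory A] [RigidCategory A]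
  [PivotalCategory A] [PremodularCategory k A] {ι : Type u₁} [Fintype ι]
  (S : SimpleData k A ι)

/-- The transpose `B' ⟶ P^*` of `ψ : P ⟶ B` with respect to a pairing `B ⊗ B' ⟶ 𝟙`. -/
def transpose {P B B' : A} (f : B ⊗ B' ⟶ 𝟙_ A) (ψ : P ⟶ B) : B' ⟶ Pᘁ :=
  𝟙 _ ⊗≫ coevL P ▷ B' ⊗≫ (Pᘁ : A) ◁ ψ ▷ B' ⊗≫ (Pᘁ : A) ◁ f ⊗≫ 𝟙 _

lemma transpose_comp_right {P B C C' : A} (f : C ⊗ C' ⟶ 𝟙_ A) (ψ : P ⟶ B) (g : B ⟶ C) :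
    transpose f (ψ ≫ g) = transpose (g ▷ C' ≫ f) ψ := by
  rw [transpose, transpose]; monoidal

lemma transpose_comp_left {P B B' C' : A} (f : B ⊗ C' ⟶ 𝟙_ A) (ψ : P ⟶ B) (h : B' ⟶ C') :
    transpose (B ◁ h ≫ f) ψ = h ≫ transpose f ψ := by
  calc
    _ = 𝟙 _ ⊗≫ (coevL P ⊗≫ (Pᘁ : A) ◁ ψ) ▷ B' ⊗≫ (Pᘁ ⊗ B : A) ◁ h ⊗≫ (Pᘁ : A) ◁ f ⊗≫ 𝟙 _ := by
      rw [transpose]; monoidal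
    _ = 𝟙 _ ⊗≫ ((coevL P ⊗≫ (Pᘁ : A) ◁ ψ) ▷ B' ≫ (Pᘁ ⊗ B : A) ◁ h) ⊗≫ 
        (Pᘁ : A) ◁ f ⊗≫ 𝟙 _ := by monoidal
    _ = _ := by rw [← whisker_exchange, transpose]; monoidal

lemma transpose_evR_id (P : A) : transpose (evR P) (𝟙 P) = 𝟙 _ := by
  calc
    _ = 𝟙 _ ⊗≫ (coevL P ▷ (Pᘁ : A) ⊗≫ (Pᘁ : A) ◁ evR P) ⊗≫ 𝟙 _ := by rw [transpose]; monoidal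
    _ = _ := by rw [evR_coevL]; monoidal

lemma whiskerLeft_transpose_evR {P B B' : A} (f : B ⊗ B' ⟶ 𝟙_ A) (ψ : P ⟶ B) :
    P ◁ transpose f ψ ≫ evR P = ψ ▷ B' ≫ f := by
  calc
    _ = 𝟙 _ ⊗≫ P ◁ coevL P ▷ B' ⊗≫ ((P ⊗ (Pᘁ : A)) ◁ (ψ ▷ B' ≫ f) ≫ evR P ▷ 𝟙_ A) ⊗≫ 𝟙 _ := by
      rw [transpose]; monoidal
    _ = 𝟙 _ ⊗≫ (P ◁ coevL P ⊗≫ evR P ▷ P) ▷ B' ⊗≫ (ψ ▷ B' ≫ f) ⊗≫ 𝟙 _ := by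
      rw [whisker_exchange]; monoidal
    _ = _ := by rw [coevL_evR]; monoidal

lemma transpose_smul_right {P B B' : A} (f : B ⊗ B' ⟶ 𝟙_ A) (ψ : P ⟶ B) (c : k) :
    transpose f (c • ψ) = c • transpose f ψ := by
  simp [transpose, monoidalComp]

lemma transpose_smul_left {P B B' : A} (f : B ⊗ B' ⟶ 𝟙_ A) (ψ : P ⟶ B) (c : k) :
    transpose (c • f) ψ = c • transpose f ψ := by
  simp [transpose, monoidalComp]

lemma transpose_sum_right {P B B' : A} (f : B ⊗ B' ⟶ 𝟙_ A) {J : Type*} (s : Finset J)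
    (ψ : J → (P ⟶ B)) : transpose f (∑ a ∈ s, ψ a) = ∑ a ∈ s, transpose f (ψ a) := by
  simp [transpose, monoidalComp, sum_whiskerRight, whiskerLeft_sum, Preadditive.sum_comp,
    Preadditive.comp_sum]

lemma transpose_sum_left {P B B' : A} {J : Type*} (s : Finset J) (f : J → (B ⊗ B' ⟶ 𝟙_ A))
    (ψ : P ⟶ B) : transpose (∑ a ∈ s, f a) ψ = ∑ a ∈ s, transpose (f a) ψ := by
  simp [transpose, monoidalComp, whiskerLeft_sum, Preadditive.sum_comp,
    Preadditive.comp_sum]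

/-- The morphism `B ⊗ V ⊗ B' ⟶ ⨁ X_i ⊗ V ⊗ X_i^*` given by a pairing `B ⊗ B' ⟶ 𝟙`. -/
def ins (V : A) {B B' : A} (f : B ⊗ B' ⟶ 𝟙_ A) : B ⊗ V ⊗ B' ⟶ indObj S V :=
  ∑ j, S.sqrtDim j • ∑ a, (node k B (S.obj j) a ▷ (V ⊗ B') ≫
    S.obj j ◁ V ◁ transpose f (dualNode k B (S.obj j) a) ≫ indι S V j)

/-- A sum over dual bases allows `g` to be moved from the basis to the dual basis
(`exists_node_coeff`), and from there into the pairing. Together with `ins_right` this is the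
extranaturality of insertions. -/
lemma ins_left (V : A) {B C C' : A} (f : C ⊗ C' ⟶ 𝟙_ A) (g : B ⟶ C) :
    g ▷ (V ⊗ C') ≫ ins S V f = ins S V (g ▷ C' ≫ f) := by
  simp only [ins, Preadditive.comp_sum, Linear.comp_smul]
  refine Finset.sum_congr rfl fun j _ => ?_
  congr 1
  obtain ⟨c, h1, h2⟩ := exists_node_coeff (k := k) (S.obj j) g
  simp only [← comp_whiskerRight_assoc, h1, ← transpose_comp_right, h2]
  simp only [sum_whiskerRight, MonoidalLinear.smul_whiskerRight, Preadditive.sum_comp,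
    Linear.smul_comp, transpose_sum_right, transpose_smul_right, whiskerLeft_sum,
    MonoidalLinear.whiskerLeft_smul, Preadditive.comp_sum, Linear.comp_smul]
  rw [Finset.sum_comm]

lemma ins_right (V : A) {B B' C' : A} (f : B ⊗ C' ⟶ 𝟙_ A) (h : B' ⟶ C') :
    B ◁ V ◁ h ≫ ins S V f = ins S V (B ◁ h ≫ f) := by
  simp only [ins, Preadditive.comp_sum, Linear.comp_smul]
  refine Finset.sum_congr rfl fun j _ => ?_
  congr 1
  refine Finset.sum_congr rfl fun a _ => ?_
  rw [transpose_comp_left, MonoidalCategory.whiskerLeft_comp, MonoidalCategory.whiskerLeft_comp,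
    ← Category.assoc, whisker_exchange]
  simp only [Category.assoc]

lemma ins_map {V W : A} (g : V ⟶ W) {B B' : A} (f : B ⊗ B' ⟶ 𝟙_ A) :
    B ◁ g ▷ B' ≫ ins S W f = ins S V f ≫ indMap S g := by
  simp only [ins, Preadditive.comp_sum, Linear.comp_smul, Preadditive.sum_comp, Linear.smul_comp]
  refine Finset.sum_congr rfl fun j _ => ?_
  congr 1
  refine Finset.sum_congr rfl fun a _ => ?_
  rw [whisker_exchange_assoc, ← MonoidalCategory.whiskerLeft_comp_assoc, ← whisker_exchange]
  simp [indMap]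

lemma ins_smul (V : A) {B B' : A} (f : B ⊗ B' ⟶ 𝟙_ A) (c : k) :
    ins S V (c • f) = c • ins S V f := by
  simp only [ins, transpose_smul_left, MonoidalLinear.whiskerLeft_smul, Linear.smul_comp,
    Linear.comp_smul, Finset.smul_sum]
  simp only [smul_smul, mul_comm]

lemma ins_sum (V : A) {B B' : A} {J : Type*} (s : Finset J) (f : J → (B ⊗ B' ⟶ 𝟙_ A)) :
    ins S V (∑ a ∈ s, f a) = ∑ a ∈ s, ins S V (f a) := by
  simp only [ins, transpose_sum_left, whiskerLeft_sum, Preadditive.sum_comp,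
    Preadditive.comp_sum, Finset.smul_sum]
  rw [Finset.sum_comm]
  exact Finset.sum_congr rfl fun j _ => Finset.sum_comm

lemma node_eq_zero {i j : ι} (h : i ≠ j) (f : S.obj i ⟶ S.obj j) : f = 0 := by
  by_contra h0
  have := isIso_of_hom_simple h0
  exact h (S.eq_of_iso i j ⟨asIso f⟩)

lemma sqrtDim_mul_self (i : ι) : S.sqrtDim i * S.sqrtDim i = dim k (S.obj i) := by
  rw [← S.sqrtDim_sq, sq]

/-- By Schur's lemma only the summand `i` contributes. There the dual bases of `End(X_i)` compose to
`d_i⁻¹`, which is cancelled by the two factors `√d_i`, one from `ins` and one in front. -/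
lemma indι_eq (V : A) (i : ι) : indι S V i = S.sqrtDim i • ins S V (evR (S.obj i)) := by
  have h1 : ins S V (evR (S.obj i)) = S.sqrtDim i • ∑ a,
      (node k (S.obj i) (S.obj i) a ▷ (V ⊗ (S.obj i)ᘁ) ≫
      S.obj i ◁ V ◁ transpose (evR _) (dualNode k (S.obj i) (S.obj i) a) ≫ indι S V i) := by
    rw [ins, Finset.sum_eq_single i]
    · intro j _ hj
      simp [node_eq_zero S hj.symm]
    · simp
  have h2 : dim k (S.obj i) • ∑ a, node k (S.obj i) (S.obj i) a ≫
      dualNode k (S.obj i) (S.obj i) a = 𝟙 _ := by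
    rw [← sum_node_comp_dualNode S (S.obj i), Finset.sum_eq_single i]
    · intro j _ hj
      simp [node_eq_zero S hj.symm]
    · simp
  -- A node in `End(X_i)` is a scalar, so it may be moved across `V` to the other strand.
  have h3 : ∀ a, node k (S.obj i) (S.obj i) a ▷ (V ⊗ (S.obj i)ᘁ) ≫
      S.obj i ◁ V ◁ transpose (evR _) (dualNode k (S.obj i) (S.obj i) a) ≫ indι S V i =
      S.obj i ◁ V ◁ transpose (evR _) (node k (S.obj i) (S.obj i) a ≫
        dualNode k (S.obj i) (S.obj i) a) ≫ indι S V i := by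
    intro a
    obtain ⟨c, hc⟩ := endomorphism_simple_eq_smul_id k (node k (S.obj i) (S.obj i) a)
    rw [← hc]
    simp [transpose_smul_right]
  rw [h1, smul_smul, sqrtDim_mul_self]
  simp only [h3]
  rw [← Preadditive.sum_comp, ← whiskerLeft_sum, ← whiskerLeft_sum, ← transpose_sum_right,
    ← Linear.smul_comp, ← MonoidalLinear.whiskerLeft_smul, ← MonoidalLinear.whiskerLeft_smul,
    ← transpose_smul_right, h2, transpose_evR_id]
  simp

lemma sum_indπ_indι (V : A) : ∑ i, indπ S V i ≫ indι S V i = 𝟙 _ := by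
  classical
  apply biproduct.hom_ext'
  intro i
  rw [Preadditive.comp_sum, Finset.sum_eq_single i]
  · rw [biproduct.ι_π_self_assoc, Category.comp_id]
  · intro j _ hj
    rw [biproduct.ι_π_ne_assoc _ hj.symm, zero_comp]
  · simp

lemma hom_ext_ins {V Z : A} {f g : indObj S V ⟶ Z}
    (h : ∀ i, ins S V (evR (S.obj i)) ≫ f = ins S V (evR (S.obj i)) ≫ g) : f = g := by
  apply biproduct.hom_ext'
  intro i
  change indι S V i ≫ f = indι S V i ≫ g
  rw [indι_eq, Linear.smul_comp, Linear.smul_comp, h]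

lemma hom_ext_ins_left {V P Z : A} {f g : P ⊗ indObj S V ⟶ Z}
    (h : ∀ i, P ◁ ins S V (evR (S.obj i)) ≫ f = P ◁ ins S V (evR (S.obj i)) ≫ g) : f = g := by
  have h1 : ∀ i, P ◁ indι S V i ≫ f = P ◁ indι S V i ≫ g := fun i => by
    rw [indι_eq, MonoidalLinear.whiskerLeft_smul, Linear.smul_comp, Linear.smul_comp, h]
  rw [← Category.id_comp f, ← Category.id_comp g, ← MonoidalCategory.whiskerLeft_id,
    ← sum_indπ_indι]
  simp only [whiskerLeft_sum, Preadditive.sum_comp, MonoidalCategory.whiskerLeft_comp,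
    Category.assoc, h1]

lemma hom_ext_ins_right {V R Z : A} {f g : indObj S V ⊗ R ⟶ Z}
    (h : ∀ i, ins S V (evR (S.obj i)) ▷ R ≫ f = ins S V (evR (S.obj i)) ▷ R ≫ g) : f = g := by
  have h1 : ∀ i, indι S V i ▷ R ≫ f = indι S V i ▷ R ≫ g := fun i => by
    rw [indι_eq, MonoidalLinear.smul_whiskerRight, Linear.smul_comp, Linear.smul_comp, h]
  rw [← Category.id_comp f, ← Category.id_comp g, ← MonoidalCategory.id_whiskerRight,
    ← sum_indπ_indι]
  simp only [sum_whiskerRight, Preadditive.sum_comp, comp_whiskerRight,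
    Category.assoc, h1]

/-- Nested pairings. -/
def nest {B B' C C' : A} (f : C ⊗ C' ⟶ 𝟙_ A) (e : B ⊗ B' ⟶ 𝟙_ A) :
    (B ⊗ C) ⊗ (C' ⊗ B') ⟶ 𝟙_ A :=
  𝟙 _ ⊗≫ B ◁ f ▷ B' ⊗≫ e

/-- The composite `B ⊗ C ⊗ V ⊗ C' ⟶ I(V) ⊗ B` given by pairings `f` of `C`, `C'` and
`e` of `B`, `B'`. -/
def wrap (V : A) {B B' C C' : A} (e : B ⊗ B' ⟶ 𝟙_ A) (cv : 𝟙_ A ⟶ B' ⊗ B)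
    (f : C ⊗ C' ⟶ 𝟙_ A) : B ⊗ C ⊗ V ⊗ C' ⟶ indObj S V ⊗ B :=
  𝟙 _ ⊗≫ (B ⊗ C ⊗ V ⊗ C') ◁ cv ⊗≫ ins S V (nest f e) ▷ B

variable {S}

lemma wrap_left (V : A) {B B' C D D' : A} (e : B ⊗ B' ⟶ 𝟙_ A) (cv : 𝟙_ A ⟶ B' ⊗ B)
    (f : D ⊗ D' ⟶ 𝟙_ A) (g : C ⟶ D) :
    B ◁ g ▷ (V ⊗ D') ≫ wrap S V e cv f = wrap S V e cv (g ▷ D' ≫ f) := by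
  have h : nest (g ▷ D' ≫ f) e = (B ◁ g) ▷ (D' ⊗ B') ≫ nest f e := by
    rw [nest, nest]; monoidal
  rw [wrap, wrap, h, ← ins_left]
  calc
    _ = 𝟙 _ ⊗≫ ((B ◁ g ▷ (V ⊗ D')) ▷ 𝟙_ A ≫ (B ⊗ D ⊗ V ⊗ D') ◁ cv) ⊗≫ 
      ins S V (nest f e) ▷ B := by monoidal
    _ = _ := by rw [← whisker_exchange]; monoidal

lemma wrap_right (V : A) {B B' C C' D' : A} (e : B ⊗ B' ⟶ 𝟙_ A) (cv : 𝟙_ A ⟶ B' ⊗ B)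
    (f : C ⊗ D' ⟶ 𝟙_ A) (g : C' ⟶ D') :
    B ◁ C ◁ V ◁ g ≫ wrap S V e cv f = wrap S V e cv (C ◁ g ≫ f) := by
  have h : nest (C ◁ g ≫ f) e = (B ⊗ C) ◁ (g ▷ B') ≫ nest f e := by
    rw [nest, nest]; monoidal
  rw [wrap, wrap, h, ← ins_right]
  calc
    _ = 𝟙 _ ⊗≫ ((B ◁ C ◁ V ◁ g) ▷ 𝟙_ A ≫ (B ⊗ C ⊗ V ⊗ D') ◁ cv) ⊗≫ 
      ins S V (nest f e) ▷ B := by monoidal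
    _ = _ := by rw [← whisker_exchange]; monoidal

lemma wrap_smul (V : A) {B B' C C' : A} (e : B ⊗ B' ⟶ 𝟙_ A) (cv : 𝟙_ A ⟶ B' ⊗ B)
    (f : C ⊗ C' ⟶ 𝟙_ A) (c : k) : wrap S V e cv (c • f) = c • wrap S V e cv f := by
  have h : nest (c • f) e = c • nest f e := by simp [nest, monoidalComp]
  rw [wrap, wrap, h, ins_smul]
  simp [monoidalComp]

lemma wrap_sum (V : A) {B B' C C' : A} (e : B ⊗ B' ⟶ 𝟙_ A) (cv : 𝟙_ A ⟶ B' ⊗ B)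
    {J : Type*} (s : Finset J) (f : J → (C ⊗ C' ⟶ 𝟙_ A)) :
    wrap S V e cv (∑ a ∈ s, f a) = ∑ a ∈ s, wrap S V e cv (f a) := by
  have h : nest (∑ a ∈ s, f a) e = ∑ a ∈ s, nest (f a) e := by
    simp [nest, monoidalComp, sum_whiskerRight, whiskerLeft_sum, Preadditive.sum_comp,
      Preadditive.comp_sum]
  simp only [wrap, h, ins_sum]
  simp [monoidalComp, sum_whiskerRight, Preadditive.comp_sum]

/-- The strand `B` of a rotated node may be bent down and up again with any `e` and `cv` that
satisfy one zigzag. This freedom makes it possible later to use nested pairings for `B ⊗ C` and the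
trivial pairing for the unit. -/
lemma turn_eq_transpose {P Q B B' : A} (ψ : P ⟶ B ⊗ Q) (e : B ⊗ B' ⟶ 𝟙_ A)
    (cv : 𝟙_ A ⟶ B' ⊗ B) (hcv : B ◁ cv ⊗≫ e ▷ B = ⊗𝟙.hom) :
    turn ψ = 𝟙 _ ⊗≫ (Qᘁ : A) ◁ cv ⊗≫ transpose (nest (evR Q) e) ψ ▷ B := by
  symm
  calc
    _ = 𝟙 _ ⊗≫ (𝟙_ A ◁ ((Qᘁ : A) ◁ cv) ≫
        (coevL P ⊗≫ (Pᘁ : A) ◁ ψ) ▷ (Qᘁ ⊗ B' ⊗ B : A)) ⊗≫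
        (Pᘁ ⊗ B : A) ◁ evR Q ▷ (B' ⊗ B) ⊗≫ (Pᘁ : A) ◁ e ▷ B ⊗≫ 𝟙 _ := by
      rw [transpose, nest]; monoidal
    _ = 𝟙 _ ⊗≫ (coevL P ⊗≫ (Pᘁ : A) ◁ ψ) ▷ (Qᘁ : A) ⊗≫
        (Pᘁ ⊗ B : A) ◁ ((Q ⊗ Qᘁ : A) ◁ cv ≫ evR Q ▷ (B' ⊗ B)) ⊗≫
        (Pᘁ : A) ◁ e ▷ B ⊗≫ 𝟙 _ := by
      rw [whisker_exchange]; monoidal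
    _ = 𝟙 _ ⊗≫ (coevL P ⊗≫ (Pᘁ : A) ◁ ψ) ▷ (Qᘁ : A) ⊗≫ (Pᘁ ⊗ B : A) ◁ evR Q ⊗≫
        (Pᘁ : A) ◁ (B ◁ cv ⊗≫ e ▷ B) ⊗≫ 𝟙 _ := by
      rw [whisker_exchange]; monoidal
    _ = _ := by rw [hcv, turn]; monoidal

/-- The sum over nodes in `Γ` out of the summand `i` is, term by term, the sum over nodes that
defines the insertion of the nested pairing of `B ⊗ X_i`. -/
lemma whiskerLeft_indι_indγ (V : A) (i : ι) {B B' : A} (e : B ⊗ B' ⟶ 𝟙_ A)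
    (cv : 𝟙_ A ⟶ B' ⊗ B) (hcv : B ◁ cv ⊗≫ e ▷ B = ⊗𝟙.hom) :
    B ◁ indι S V i ≫ indγ S V B = S.sqrtDim i • wrap S V e cv (evR (S.obj i)) := by
  classical
  have h1 : B ◁ indι S V i ≫ indγ S V B =
      ∑ j, (S.sqrtDim i * S.sqrtDim j) • (pass S B V i j ≫ indι S V j ▷ B) := by
    simp only [indγ, Preadditive.comp_sum, Linear.comp_smul]
    rw [Finset.sum_eq_single i]
    · refine Finset.sum_congr rfl fun j _ => ?_
      rw [← MonoidalCategory.whiskerLeft_comp_assoc, biproduct.ι_π_self]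
      simp
    · intro i' _ hi
      refine Finset.sum_eq_zero fun j _ => ?_
      rw [← MonoidalCategory.whiskerLeft_comp_assoc, biproduct.ι_π_ne _ hi.symm]
      simp
    · simp
  rw [h1, wrap, ins]
  simp only [monoidalComp, sum_whiskerRight, Preadditive.comp_sum, Finset.smul_sum,
    MonoidalLinear.smul_whiskerRight, Linear.comp_smul, pass, Preadditive.sum_comp, smul_smul]
  refine Finset.sum_congr rfl fun j _ => Finset.sum_congr rfl fun a _ => ?_
  congr 1
  rw [turn_eq_transpose _ e cv hcv]
  generalize transpose (nest (evR (S.obj i)) e) _ = t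
  generalize indι S V j = u
  calc
    _ = 𝟙 _ ⊗≫ (node k (B ⊗ S.obj i) (S.obj j) a ▷ (V ⊗ (S.obj i)ᘁ) ▷ 𝟙_ A ≫
        (S.obj j ⊗ (V ⊗ (S.obj i)ᘁ) : A) ◁ cv) ⊗≫
        S.obj j ◁ V ◁ t ▷ B ⊗≫ u ▷ B := by monoidal
    _ = _ := by rw [← whisker_exchange]; monoidal

/-- The working description of `Γ`, free of simple objects: the new strand is nested around the old
ones. Resolving the identity of `C` into simples reduces it to the summand inclusions, and
extranaturality of `wrap` in the inner pairing reassembles the terms. -/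
lemma whiskerLeft_ins_indγ (V : A) {B B' C C' : A} (f : C ⊗ C' ⟶ 𝟙_ A) (e : B ⊗ B' ⟶ 𝟙_ A)
    (cv : 𝟙_ A ⟶ B' ⊗ B) (hcv : B ◁ cv ⊗≫ e ▷ B = ⊗𝟙.hom) :
    B ◁ ins S V f ≫ indγ S V B = wrap S V e cv f := by
  have h := congrArg (fun t => wrap S V e cv (t ▷ C' ≫ f)) (sum_node_comp_dualNode S C)
  simp only [sum_whiskerRight, Preadditive.sum_comp, MonoidalLinear.smul_whiskerRight,
    Linear.smul_comp, wrap_sum, wrap_smul, MonoidalCategory.id_whiskerRight,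
    Category.id_comp] at h
  rw [← h]
  simp only [ins, whiskerLeft_sum, Preadditive.sum_comp, MonoidalLinear.whiskerLeft_smul,
    Linear.smul_comp, MonoidalCategory.whiskerLeft_comp, Category.assoc,
    whiskerLeft_indι_indγ V _ e cv hcv, Linear.comp_smul, wrap_right, wrap_left]
  refine Finset.sum_congr rfl fun j _ => ?_
  rw [← sqrtDim_mul_self, ← smul_smul]
  simp only [Finset.smul_sum]
  refine Finset.sum_congr rfl fun a _ => ?_
  rw [whiskerLeft_transpose_evR, comp_whiskerRight_assoc]

end Insertion

end

end ReducedTensor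

namespace ReducedTensor

noncomputable section

/-! ### Half-braidings and morphisms compatible with them -/

section HalfBraidings

variable {A : Type u} [Category.{v} A] [MonoidalCategory A]

/-- The half-braiding in the form `B ⊗ X ⟶ X ⊗ B`. -/
def hb {X : A} (h : HalfBraiding X) (B : A) : B ⊗ X ⟶ X ⊗ B := (h.β B).inv

instance {X : A} (h : HalfBraiding X) (B : A) : IsIso (hb h B) := by rw [hb]; infer_instance

/-- The properties of a half-braiding, invertibility excepted. -/
structure IsLaxBraiding {X : A} (g : ∀ B : A, B ⊗ X ⟶ X ⊗ B) : Prop where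
  naturality : ∀ {B C : A} (f : B ⟶ C), f ▷ X ≫ g C = g B ≫ X ◁ f
  tensor : ∀ B C : A, g (B ⊗ C) = 𝟙 _ ⊗≫ B ◁ g C ⊗≫ g B ▷ C ⊗≫ 𝟙 _
  unit : g (𝟙_ A) = (λ_ X).hom ≫ (ρ_ X).inv

lemma hb_isLaxBraiding {X : A} (h : HalfBraiding X) : IsLaxBraiding (hb h) := by
  have nat : ∀ {B C : A} (f : B ⟶ C), f ▷ X ≫ hb h C = hb h B ≫ X ◁ f := by
    intro B C f
    rw [hb, hb, Iso.comp_inv_eq, Category.assoc, h.naturality, Iso.inv_hom_id_assoc]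
  have ten : ∀ B C : A, hb h (B ⊗ C) = 𝟙 _ ⊗≫ B ◁ hb h C ⊗≫ hb h B ▷ C ⊗≫ 𝟙 _ := by
    intro B C
    have : h.β (B ⊗ C) = (α_ _ _ _).symm ≪≫ whiskerRightIso (h.β B) C ≪≫ α_ _ _ _ ≪≫
        whiskerLeftIso B (h.β C) ≪≫ (α_ _ _ _).symm := Iso.ext (by simp [h.monoidal])
    rw [hb, this]
    simp [hb, monoidalComp]
  refine ⟨nat, ten, ?_⟩
  -- Multiplicativity for `𝟙 ⊗ 𝟙` and naturality for its unitor make the crossing with `𝟙`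
  -- idempotent up to unitors; being invertible, it is then trivial.
  have h1 : hb h (𝟙_ A) ≫ (ρ_ X).hom ≫ (λ_ X).inv ≫ hb h (𝟙_ A) = hb h (𝟙_ A) := by
    calc
      _ = 𝟙 _ ⊗≫ (hb h (𝟙_ A ⊗ 𝟙_ A) ≫ X ◁ (λ_ (𝟙_ A)).hom) ⊗≫ 𝟙 _ := by rw [ten]; monoidal
      _ = _ := by rw [← nat]; monoidal
  have h2 : (ρ_ X).hom ≫ (λ_ X).inv ≫ hb h (𝟙_ A) = 𝟙 _ := by
    rw [← cancel_epi (hb h (𝟙_ A)), h1, Category.comp_id]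
  rw [← cancel_epi (λ_ X).inv, ← cancel_epi (ρ_ X).hom, h2]
  simp

lemma IsLaxBraiding.pairing {X : A} {g : ∀ B : A, B ⊗ X ⟶ X ⊗ B} (hg : IsLaxBraiding g)
    {B C : A} (e : B ⊗ C ⟶ 𝟙_ A) :
    𝟙 (B ⊗ C ⊗ X) ⊗≫ B ◁ g C ⊗≫ g B ▷ C ⊗≫ X ◁ e =
      𝟙 (B ⊗ C ⊗ X) ⊗≫ e ▷ X ⊗≫ 𝟙 (X ⊗ 𝟙_ A) := by
  calc
    _ = 𝟙 _ ⊗≫ (g (B ⊗ C) ≫ X ◁ e) ⊗≫ 𝟙 _ := by rw [hg.tensor]; monoidal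
    _ = _ := by rw [← hg.naturality, hg.unit]; monoidal

lemma IsLaxBraiding.copairing {X : A} {g : ∀ B : A, B ⊗ X ⟶ X ⊗ B} (hg : IsLaxBraiding g)
    {B C : A} (e : 𝟙_ A ⟶ B ⊗ C) :
    e ▷ X ⊗≫ B ◁ g C ⊗≫ g B ▷ C = 𝟙 (𝟙_ A ⊗ X) ⊗≫ X ◁ e ⊗≫ 𝟙 ((X ⊗ B) ⊗ C) := by
  calc
    _ = 𝟙 _ ⊗≫ (e ▷ X ≫ g (B ⊗ C)) ⊗≫ 𝟙 _ := by rw [hg.tensor]; monoidal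
    _ = _ := by rw [hg.naturality, hg.unit]; monoidal

/-- The inverse of a lax braiding with an object that has a dual. -/
def laxInv {X : A} (g : ∀ B : A, B ⊗ X ⟶ X ⊗ B) (B : A) [HasRightDual B] : X ⊗ B ⟶ B ⊗ X :=
  𝟙 _ ⊗≫ η_ B Bᘁ ▷ (X ⊗ B) ⊗≫ B ◁ g Bᘁ ▷ B ⊗≫ (B ⊗ X) ◁ ε_ B Bᘁ ⊗≫ 𝟙 _

/-- Crossing `X` first with `B` and then with its dual strand is crossing it with a cap, which
slides off by naturality; a zigzag remains. So invertibility of a half-braiding is automatic in the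
presence of duals. -/
lemma IsLaxBraiding.comp_laxInv {X : A} {g : ∀ B : A, B ⊗ X ⟶ X ⊗ B} (hg : IsLaxBraiding g)
    (B : A) [HasRightDual B] : g B ≫ laxInv g B = 𝟙 _ := by
  calc
    _ = 𝟙 _ ⊗≫ (𝟙_ A ◁ g B ≫ η_ B Bᘁ ▷ (X ⊗ B)) ⊗≫ B ◁ g Bᘁ ▷ B ⊗≫ (B ⊗ X) ◁ ε_ B Bᘁ ⊗≫ 𝟙 _ := by
      rw [laxInv]; monoidal
    _ = 𝟙 _ ⊗≫ η_ B Bᘁ ▷ (B ⊗ X) ⊗≫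
        B ◁ (𝟙 (Bᘁ ⊗ B ⊗ X) ⊗≫ (Bᘁ : A) ◁ g B ⊗≫ g Bᘁ ▷ B ⊗≫ X ◁ ε_ B Bᘁ) ⊗≫ 𝟙 _ := by
      rw [whisker_exchange]; monoidal
    _ = 𝟙 _ ⊗≫ (η_ B Bᘁ ▷ B ⊗≫ B ◁ ε_ B Bᘁ) ▷ X ⊗≫ 𝟙 _ := by
      rw [hg.pairing]; monoidal
    _ = _ := by rw [ExactPairing.evaluation_coevaluation'']; monoidal

lemma IsLaxBraiding.laxInv_comp {X : A} {g : ∀ B : A, B ⊗ X ⟶ X ⊗ B} (hg : IsLaxBraiding g)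
    (B : A) [HasRightDual B] : laxInv g B ≫ g B = 𝟙 _ := by
  calc
    _ = 𝟙 _ ⊗≫ η_ B Bᘁ ▷ (X ⊗ B) ⊗≫ B ◁ g Bᘁ ▷ B ⊗≫ ((B ⊗ X) ◁ ε_ B Bᘁ ≫ g B ▷ 𝟙_ A) ⊗≫ 𝟙 _ := by
      rw [laxInv]; monoidal
    _ = 𝟙 _ ⊗≫ (η_ B Bᘁ ▷ X ⊗≫ B ◁ g Bᘁ ⊗≫ g B ▷ (Bᘁ : A)) ▷ B ⊗≫ (X ⊗ B) ◁ ε_ B Bᘁ ⊗≫ 𝟙 _ := by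
      rw [whisker_exchange]; monoidal
    _ = 𝟙 _ ⊗≫ X ◁ (η_ B Bᘁ ▷ B ⊗≫ B ◁ ε_ B Bᘁ) ⊗≫ 𝟙 _ := by
      rw [hg.copairing]; monoidal
    _ = _ := by rw [ExactPairing.evaluation_coevaluation'']; monoidal

/-- In a category with duals, a lax braiding is a half-braiding. -/
def IsLaxBraiding.halfBraiding [RightRigidCategory A] {X : A} {g : ∀ B : A, B ⊗ X ⟶ X ⊗ B}
    (hg : IsLaxBraiding g) : HalfBraiding X where
  β B := ⟨laxInv g B, g B, hg.laxInv_comp B, hg.comp_laxInv B⟩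
  monoidal B C := by
    let e : ∀ B, X ⊗ B ≅ B ⊗ X := fun B =>
      ⟨laxInv g B, g B, hg.laxInv_comp B, hg.comp_laxInv B⟩
    have h : e (B ⊗ C) = (α_ _ _ _).symm ≪≫ whiskerRightIso (e B) C ≪≫ α_ _ _ _ ≪≫
        whiskerLeftIso B (e C) ≪≫ (α_ _ _ _).symm :=
      Iso.ext_inv (by simp [e, hg.tensor, monoidalComp])
    simpa [e] using congrArg Iso.hom h
  naturality {B C} f := by
    dsimp only
    have h1 := congrArg (fun t => laxInv g B ≫ t ≫ laxInv g C) (hg.naturality f)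
    simp only [Category.assoc, hg.comp_laxInv, Category.comp_id, reassoc_of% hg.laxInv_comp] at h1
    exact h1.symm

lemma halfBraiding_ext {X : A} {h h' : HalfBraiding X} (H : ∀ B, hb h B = hb h' B) : h = h' := by
  have : h.β = h'.β := funext fun B => Iso.ext_inv (H B)
  cases h; cases h'; simp only at this; subst this; rfl

/-- The half-braiding on a tensor product. -/
def tens {X Y : A} (h : HalfBraiding X) (h' : HalfBraiding Y) : HalfBraiding (X ⊗ Y) :=
  (Center.tensorObj ⟨X, h⟩ ⟨Y, h'⟩).2

lemma hb_tens {X Y : A} (h : HalfBraiding X) (h' : HalfBraiding Y) (B : A) :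
    hb (tens h h') B = 𝟙 _ ⊗≫ hb h B ▷ Y ⊗≫ X ◁ hb h' B ⊗≫ 𝟙 _ := by
  simp [hb, tens, Center.tensorObj, monoidalComp]

/-- The half-braiding of the unit object. -/
def unitHb : HalfBraiding (𝟙_ A) := Center.tensorUnit.2

lemma hb_unitHb (B : A) : hb (unitHb (A := A)) B = (ρ_ B).hom ≫ (λ_ B).inv := by
  simp [hb, unitHb, Center.tensorUnit]

/-- Compatibility of a morphism with half-braidings on its source and target. -/
def Cen {X Y : A} (h : HalfBraiding X) (h' : HalfBraiding Y) (f : X ⟶ Y) : Prop :=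
  ∀ B : A, B ◁ f ≫ hb h' B = hb h B ≫ f ▷ B

namespace Cen

lemma id {X : A} (h : HalfBraiding X) : Cen h h (𝟙 X) := fun B => by simp

lemma comp {X Y Z : A} {h : HalfBraiding X} {h' : HalfBraiding Y} {h'' : HalfBraiding Z}
    {f : X ⟶ Y} {g : Y ⟶ Z} (hf : Cen h h' f) (hg : Cen h' h'' g) : Cen h h'' (f ≫ g) := by
  intro B
  rw [MonoidalCategory.whiskerLeft_comp, Category.assoc, hg, reassoc_of% (hf B),
    comp_whiskerRight]

lemma of_iso {X Y : A} {h : HalfBraiding X} {h' : HalfBraiding Y} {f : X ⟶ Y} {g : Y ⟶ X}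
    (hf : Cen h h' f) (hfg : f ≫ g = 𝟙 X) (hgf : g ≫ f = 𝟙 Y) : Cen h' h g := by
  intro B
  have := congrArg (fun t => B ◁ g ≫ t ≫ g ▷ B) (hf B)
  simp only [Category.assoc, ← comp_whiskerRight, hfg, MonoidalCategory.id_whiskerRight,
    Category.comp_id, ← MonoidalCategory.whiskerLeft_comp_assoc, hgf,
    MonoidalCategory.whiskerLeft_id, Category.id_comp] at this
  exact this.symm

lemma whiskerLeft {X Y Z : A} (h : HalfBraiding X) {h' : HalfBraiding Y} {h'' : HalfBraiding Z}
    {f : Y ⟶ Z} (hf : Cen h' h'' f) : Cen (tens h h') (tens h h'') (X ◁ f) := by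
  intro B
  rw [hb_tens, hb_tens]
  calc
    _ = 𝟙 _ ⊗≫ ((B ⊗ X) ◁ f ≫ hb h B ▷ Z) ⊗≫ X ◁ hb h'' B ⊗≫ 𝟙 _ := by monoidal
    _ = 𝟙 _ ⊗≫ hb h B ▷ Y ⊗≫ X ◁ (B ◁ f ≫ hb h'' B) ⊗≫ 𝟙 _ := by rw [whisker_exchange]; monoidal
    _ = _ := by rw [hf B]; monoidal

lemma whiskerRight {X Y Z : A} {h : HalfBraiding X} {h' : HalfBraiding Y} 
    {f : X ⟶ Y} (hf : Cen h h' f) (h'' : HalfBraiding Z) :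
    Cen (tens h h'') (tens h' h'') (f ▷ Z) := by
  intro B
  rw [hb_tens, hb_tens]
  calc
    _ = 𝟙 _ ⊗≫ (B ◁ f ≫ hb h' B) ▷ Z ⊗≫ Y ◁ hb h'' B ⊗≫ 𝟙 _ := by monoidal
    _ = 𝟙 _ ⊗≫ hb h B ▷ Z ⊗≫ (f ▷ (B ⊗ Z) ≫ Y ◁ hb h'' B) ⊗≫ 𝟙 _ := by rw [hf B]; monoidal
    _ = _ := by rw [← whisker_exchange]; monoidal

lemma associator {X Y Z : A} (h : HalfBraiding X) (h' : HalfBraiding Y) (h'' : HalfBraiding Z) :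
    Cen (tens (tens h h') h'') (tens h (tens h' h'')) (α_ X Y Z).hom := by
  intro B
  simp only [hb_tens]
  monoidal

lemma associator_inv {X Y Z : A} (h : HalfBraiding X) (h' : HalfBraiding Y)
    (h'' : HalfBraiding Z) :
    Cen (tens h (tens h' h'')) (tens (tens h h') h'') (α_ X Y Z).inv :=
  (associator h h' h'').of_iso (Iso.hom_inv_id _) (Iso.inv_hom_id _)

lemma leftUnitor {X : A} (h : HalfBraiding X) : Cen (tens unitHb h) h (λ_ X).hom := by
  intro B
  simp only [hb_tens, hb_unitHb]
  monoidal

lemma rightUnitor {X : A} (h : HalfBraiding X) : Cen (tens h unitHb) h (ρ_ X).hom := by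
  intro B
  simp only [hb_tens, hb_unitHb]
  monoidal

lemma leftUnitor_inv {X : A} (h : HalfBraiding X) : Cen h (tens unitHb h) (λ_ X).inv :=
  (leftUnitor h).of_iso (Iso.hom_inv_id _) (Iso.inv_hom_id _)

lemma rightUnitor_inv {X : A} (h : HalfBraiding X) : Cen h (tens h unitHb) (ρ_ X).inv :=
  (rightUnitor h).of_iso (Iso.hom_inv_id _) (Iso.inv_hom_id _)

end Cen

variable [BraidedCategory A]

/-- The half-braiding of `V` in which the strand that crosses `V` passes over it. -/
def overHb (V : A) : HalfBraiding V := (Center.ofBraidedObj V).2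

lemma hb_over (V B : A) : hb (overHb V) B = (β_ V B).inv := rfl

/-- The half-braiding of `V` in which the strand that crosses `V` passes under it. -/
def underHb (V : A) : HalfBraiding V where
  β B := (β_ B V).symm
  monoidal B C := by
    simp
  naturality f := by
    simp

lemma hb_under (V B : A) : hb (underHb V) B = (β_ B V).hom := rfl

lemma tens_over_over (V W : A) : tens (overHb V) (overHb W) = overHb (V ⊗ W) := by
  apply halfBraiding_ext
  intro B
  rw [hb_tens, hb_over, hb_over, hb_over]
  simp [monoidalComp]

lemma tens_under_under (V W : A) : tens (underHb V) (underHb W) = underHb (V ⊗ W) := by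
  apply halfBraiding_ext
  intro B
  rw [hb_tens, hb_under, hb_under, hb_under]
  simp [monoidalComp]

lemma over_unit : overHb (𝟙_ A) = unitHb := by
  apply halfBraiding_ext
  intro B
  rw [hb_over, hb_unitHb]
  simp

lemma under_unit : underHb (𝟙_ A) = unitHb := by
  apply halfBraiding_ext
  intro B
  rw [hb_under, hb_unitHb]
  simp

namespace Cen

lemma ofOver {V W : A} (f : V ⟶ W) : Cen (overHb V) (overHb W) f := by
  intro B
  rw [hb_over, hb_over, Iso.comp_inv_eq, Category.assoc, BraidedCategory.braiding_naturality_left]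
  simp

lemma ofUnder {V W : A} (f : V ⟶ W) : Cen (underHb V) (underHb W) f := by
  intro B
  rw [hb_under, hb_under, BraidedCategory.braiding_naturality_right]

/-- A Yang–Baxter move: it is the naturality of the half-braiding of `X` with respect to the
crossing of `C` with `B`. -/
lemma hb_over {X : A} (h : HalfBraiding X) (B : A) :
    Cen (tens (overHb B) h) (tens h (overHb B)) (hb h B) := by
  intro C
  rw [hb_tens, hb_tens]
  calc
    _ = 𝟙 _ ⊗≫ (𝟙 ((C ⊗ B) ⊗ X) ⊗≫ C ◁ hb h B ⊗≫ hb h C ▷ B ⊗≫ 𝟙 (X ⊗ C ⊗ B)) ⊗≫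
        X ◁ hb (overHb B) C ⊗≫ 𝟙 _ := by monoidal
    _ = 𝟙 _ ⊗≫ (hb (overHb B) C ▷ X ≫ hb h (B ⊗ C)) ⊗≫ 𝟙 _ := by
      rw [← (hb_isLaxBraiding h).tensor, (hb_isLaxBraiding h).naturality]; monoidal
    _ = _ := by rw [(hb_isLaxBraiding h).tensor]; monoidal

lemma hb_under {X : A} (h : HalfBraiding X) (B : A) :
    Cen (tens (underHb B) h) (tens h (underHb B)) (hb h B) := by
  intro C
  rw [hb_tens, hb_tens]
  calc
    _ = 𝟙 _ ⊗≫ (𝟙 ((C ⊗ B) ⊗ X) ⊗≫ C ◁ hb h B ⊗≫ hb h C ▷ B ⊗≫ 𝟙 (X ⊗ C ⊗ B)) ⊗≫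
        X ◁ hb (underHb B) C ⊗≫ 𝟙 _ := by monoidal
    _ = 𝟙 _ ⊗≫ (hb (underHb B) C ▷ X ≫ hb h (B ⊗ C)) ⊗≫ 𝟙 _ := by
      rw [← (hb_isLaxBraiding h).tensor, (hb_isLaxBraiding h).naturality]; monoidal
    _ = _ := by rw [(hb_isLaxBraiding h).tensor]; monoidal

/-- A second Yang–Baxter move, where it is the crossing of `B` that is natural, with respect to the
half-braiding `hb h C`. -/
lemma over_hb {X : A} (h : HalfBraiding X) (B : A) :
    Cen (tens h (overHb B)) (tens (overHb B) h)
      (hb (overHb B) X) := by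
  intro C
  rw [hb_tens, hb_tens]
  calc
    _ = 𝟙 _ ⊗≫ (hb (overHb B) (C ⊗ X) ≫ B ◁ hb h C) ⊗≫ 𝟙 _ := by
      rw [(hb_isLaxBraiding _).tensor]; monoidal
    _ = _ := by
      rw [← (hb_isLaxBraiding _).naturality, (hb_isLaxBraiding _).tensor]; monoidal

lemma under_hb {X : A} (h : HalfBraiding X) (B : A) :
    Cen (tens h (underHb B)) (tens (underHb B) h)
      (hb (underHb B) X) := by
  intro C
  rw [hb_tens, hb_tens]
  calc
    _ = 𝟙 _ ⊗≫ (hb (underHb B) (C ⊗ X) ≫ B ◁ hb h C) ⊗≫ 𝟙 _ := by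
      rw [(hb_isLaxBraiding _).tensor]; monoidal
    _ = _ := by
      rw [← (hb_isLaxBraiding _).naturality, (hb_isLaxBraiding _).tensor]; monoidal

end Cen

end HalfBraidings

end

end ReducedTensor

namespace ReducedTensor

noncomputable section

/-! ### The half-braiding of `I(V)` -/

section InducedHalfBraiding

variable {k : Type w} [Field k] [IsAlgClosed k]
  {A : Type u} [Category.{v} A] [Abelian A] [Linear k A] [MonoidalCategory A]
  [MonoidalPreadditive A] [MonoidalLinear k A] [BraidedCategory A] [RigidCategory A]
  [PivotalCategory A] [PremodularCategory k A] {ι : Type u₁} [Fintype ι]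
  (S : SimpleData k A ι)

lemma hb_nat {X : A} (h : HalfBraiding X) {B C : A} (f : B ⟶ C) :
    f ▷ X ≫ hb h C = hb h B ≫ X ◁ f := (hb_isLaxBraiding h).naturality f

lemma hb_tensor {X : A} (h : HalfBraiding X) (B C : A) :
    hb h (B ⊗ C) = 𝟙 _ ⊗≫ B ◁ hb h C ⊗≫ hb h B ▷ C ⊗≫ 𝟙 _ := (hb_isLaxBraiding h).tensor B C

lemma hb_one {X : A} (h : HalfBraiding X) :
    hb h (𝟙_ A) = (λ_ X).hom ≫ (ρ_ X).inv := (hb_isLaxBraiding h).unit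

lemma coevL_evR_pairing (B : A) : B ◁ coevL B ⊗≫ evR B ▷ B = ⊗𝟙.hom := coevL_evR B

lemma nest_zigzag {B B' C C' : A} (f : C ⊗ C' ⟶ 𝟙_ A) (cf : 𝟙_ A ⟶ C' ⊗ C)
    (hcf : C ◁ cf ⊗≫ f ▷ C = ⊗𝟙.hom) (e : B ⊗ B' ⟶ 𝟙_ A)
    (cv : 𝟙_ A ⟶ B' ⊗ B) (hcv : B ◁ cv ⊗≫ e ▷ B = ⊗𝟙.hom) :
    (B ⊗ C) ◁ (cf ⊗≫ C' ◁ cv ▷ C ⊗≫ 𝟙 ((C' ⊗ B') ⊗ (B ⊗ C))) ⊗≫ nest f e ▷ (B ⊗ C) =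
      ⊗𝟙.hom := by
  calc
    _ = 𝟙 _ ⊗≫ B ◁ (C ◁ cf ⊗≫ ((C ⊗ C') ◁ cv ≫ f ▷ (B' ⊗ B)) ▷ C) ⊗≫ e ▷ (B ⊗ C) := by
      rw [nest]; monoidal
    _ = 𝟙 _ ⊗≫ B ◁ (C ◁ cf ⊗≫ f ▷ C) ⊗≫ (B ◁ cv ⊗≫ e ▷ B) ▷ C ⊗≫ 𝟙 _ := by
      rw [whisker_exchange]; monoidal
    _ = _ := by rw [hcf, hcv]; monoidal

lemma nest_whisker_left {B C C' D D' : A} (q : D ⊗ D' ⟶ 𝟙_ A) (f : B ⟶ C)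
    (e : C ⊗ C' ⟶ 𝟙_ A) :
    nest q (f ▷ C' ≫ e) = (f ▷ D) ▷ (D' ⊗ C') ≫ nest q e := by
  symm
  calc
    _ = 𝟙 _ ⊗≫ (f ▷ (D ⊗ D') ≫ C ◁ q) ▷ C' ⊗≫ e := by rw [nest]; monoidal
    _ = _ := by rw [← whisker_exchange, nest]; monoidal

lemma nest_whisker_right {B C C' D D' : A} (q : D ⊗ D' ⟶ 𝟙_ A) (f : C ⟶ C')
    (e : B ⊗ C' ⟶ 𝟙_ A) :
    nest q (B ◁ f ≫ e) = (B ⊗ D) ◁ D' ◁ f ≫ nest q e := by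
  symm
  calc
    _ = 𝟙 _ ⊗≫ B ◁ ((D ⊗ D') ◁ f ≫ q ▷ C') ⊗≫ e := by rw [nest]; monoidal
    _ = _ := by rw [whisker_exchange, nest]; monoidal

/-- On insertions `Γ` is nesting of pairings. Naturality is extranaturality of insertions,
multiplicativity is associativity of nesting, and the unit axiom is nesting inside a trivial
pairing. -/
lemma indγ_isLaxBraiding (V : A) : IsLaxBraiding (indγ S V) where
  naturality {B C} f := by
    apply hom_ext_ins_left S
    intro i
    rw [whisker_exchange_assoc, whiskerLeft_ins_indγ V _ _ _ (coevL_evR_pairing C),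
      ← Category.assoc, whiskerLeft_ins_indγ V _ _ _ (coevL_evR_pairing B)]
    generalize evR (S.obj i) = q
    have h1 : ins S V (nest q (f ▷ (Cᘁ : A) ≫ evR C)) =
        (f ▷ S.obj i) ▷ (V ⊗ (S.obj i)ᘁ ⊗ Cᘁ : A) ≫ ins S V (nest q (evR C)) := by
      rw [ins_left, nest_whisker_left]
    have h2 : ins S V (nest q (B ◁ fᘁ ≫ evR B)) =
        (B ⊗ S.obj i) ◁ V ◁ (S.obj i)ᘁ ◁ fᘁ ≫ ins S V (nest q (evR B)) := by
      rw [ins_right, nest_whisker_right]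
    -- The pairing of `B` with `Cᘁ` given by `f` can be written with `f` on one strand or with its
    -- dual on the other. Comparing the two moves `f` through the nested insertion.
    rw [evR_naturality, h2] at h1
    symm
    calc
      _ = 𝟙 _ ⊗≫ (B ⊗ S.obj i ⊗ V ⊗ (S.obj i)ᘁ : A) ◁ coevL B ⊗≫
          (ins S V (nest q (evR B)) ▷ B ≫ indObj S V ◁ f) := by rw [wrap]; monoidal
      _ = 𝟙 _ ⊗≫ (B ⊗ S.obj i ⊗ V ⊗ (S.obj i)ᘁ : A) ◁ (coevL B ≫ (Bᘁ : A) ◁ f) ⊗≫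
          ins S V (nest q (evR B)) ▷ C := by rw [← whisker_exchange]; monoidal
      _ = 𝟙 _ ⊗≫ (B ⊗ S.obj i ⊗ V ⊗ (S.obj i)ᘁ : A) ◁ coevL C ⊗≫
          ((B ⊗ S.obj i) ◁ V ◁ (S.obj i)ᘁ ◁ fᘁ ≫ ins S V (nest q (evR B))) ▷ C := by
        rw [coevL_naturality]; monoidal
      _ = 𝟙 _ ⊗≫ (B ◁ (S.obj i ⊗ V ⊗ (S.obj i)ᘁ : A) ◁ coevL C ≫
          f ▷ ((S.obj i ⊗ V ⊗ (S.obj i)ᘁ) ⊗ Cᘁ ⊗ C : A)) ⊗≫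
          ins S V (nest q (evR C)) ▷ C := by
        rw [h1]; monoidal
      _ = _ := by rw [whisker_exchange, wrap]; monoidal
  tensor B C := by
    apply hom_ext_ins_left S
    intro i
    generalize evR (S.obj i) = q
    generalize (S.obj i)ᘁ = X' at q ⊢
    have hB := coevL_evR_pairing B
    have hC := coevL_evR_pairing C
    generalize evR B = eB at hB
    generalize coevL B = cB at hB
    generalize (Bᘁ : A) = B' at eB cB hB
    generalize evR C = eC at hC
    generalize coevL C = cC at hC
    generalize (Cᘁ : A) = C' at eC cC hC
    -- The pairing used for `B ⊗ C` is the nested one with `C' ⊗ B'`, not the evaluation of the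
    -- chosen dual, so that both sides become iterated nestings.
    rw [whiskerLeft_ins_indγ V q (nest eC eB) (cC ⊗≫ C' ◁ cB ▷ C ⊗≫ 𝟙 ((C' ⊗ B') ⊗ (B ⊗ C)))
      (by simpa [monoidalComp] using nest_zigzag eC cC hC eB cB hB)]
    have h1 : ins S V (nest q (nest eC eB)) = (α_ B C (S.obj i)).hom ▷ (V ⊗ X' ⊗ C' ⊗ B') ≫
        (B ⊗ C ⊗ S.obj i) ◁ V ◁ (α_ X' C' B').inv ≫ ins S V (nest (nest q eC) eB) := by
      rw [ins_right, ins_left]; congr 1; simp only [nest]; monoidal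
    symm
    calc
      _ = 𝟙 _ ⊗≫ B ◁ (C ◁ ins S V q ≫ indγ S V C) ⊗≫ indγ S V B ▷ C ⊗≫ 𝟙 _ := by monoidal
      _ = 𝟙 _ ⊗≫ (B ⊗ C ⊗ S.obj i ⊗ V ⊗ X') ◁ cC ⊗≫
          (B ◁ ins S V (nest q eC) ≫ indγ S V B) ▷ C ⊗≫ 𝟙 _ := by
        rw [whiskerLeft_ins_indγ V q eC cC hC, wrap]; monoidal
      _ = _ := by
        rw [whiskerLeft_ins_indγ V _ eB cB hB, wrap, wrap, h1]; monoidal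
  unit := by
    apply hom_ext_ins_left S
    intro i
    generalize evR (S.obj i) = q
    generalize (S.obj i)ᘁ = X' at q ⊢
    rw [whiskerLeft_ins_indγ V q (λ_ (𝟙_ A)).hom (λ_ (𝟙_ A)).inv (by monoidal)]
    have h1 : ins S V (nest q (λ_ (𝟙_ A)).hom) = (λ_ (S.obj i)).hom ▷ (V ⊗ X' ⊗ 𝟙_ A) ≫
        (S.obj i) ◁ V ◁ (ρ_ X').hom ≫ ins S V q := by
      rw [ins_right, ins_left]; congr 1; simp only [nest]; monoidal
    rw [wrap, h1]; monoidal

/-- The half-braiding of `I(V)`. -/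
def indHb (V : A) : HalfBraiding (indObj S V) := (indγ_isLaxBraiding S V).halfBraiding

lemma hb_indHb (V B : A) : hb (indHb S V) B = indγ S V B := rfl

lemma indMap_comm {V W : A} (f : V ⟶ W) (B : A) :
    B ◁ indMap S f ≫ indγ S W B = indγ S V B ≫ indMap S f ▷ B := by
  apply hom_ext_ins_left S
  intro i
  rw [← MonoidalCategory.whiskerLeft_comp_assoc, ← ins_map, MonoidalCategory.whiskerLeft_comp,
    Category.assoc, whiskerLeft_ins_indγ W _ _ _ (coevL_evR_pairing B), ← Category.assoc,
    whiskerLeft_ins_indγ V _ _ _ (coevL_evR_pairing B)]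
  generalize evR (S.obj i) = q
  calc
    _ = 𝟙 _ ⊗≫ ((B ◁ S.obj i ◁ f ▷ (S.obj i)ᘁ) ▷ 𝟙_ A ≫
        (B ⊗ S.obj i ⊗ W ⊗ (S.obj i)ᘁ : A) ◁ coevL B) ⊗≫ ins S W (nest q (evR B)) ▷ B := by
      rw [wrap]; monoidal
    _ = 𝟙 _ ⊗≫ (B ⊗ S.obj i ⊗ V ⊗ (S.obj i)ᘁ : A) ◁ coevL B ⊗≫
        ((B ⊗ S.obj i) ◁ f ▷ ((S.obj i)ᘁ ⊗ Bᘁ : A) ≫ ins S W (nest q (evR B))) ▷ B := by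
      rw [← whisker_exchange]; monoidal
    _ = _ := by rw [ins_map, wrap]; monoidal

lemma cen_indMap {V W : A} (f : V ⟶ W) : Cen (indHb S V) (indHb S W) (indMap S f) :=
  fun B => indMap_comm S f B

/-- The fact that `Γ` is a half-braiding. -/
def induction : Induction S where
  halfBraiding := indHb S
  halfBraiding_inv _ _ := rfl
  comm := indMap_comm S

lemma indMap_id (V : A) : indMap S (𝟙 V) = 𝟙 _ := by
  apply biproduct.hom_ext
  intro j
  simp [indMap, indObj]

lemma indMap_comp {V W Z : A} (f : V ⟶ W) (g : W ⟶ Z) :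
    indMap S (f ≫ g) = indMap S f ≫ indMap S g := by
  apply biproduct.hom_ext
  intro j
  simp [indMap]

lemma indMap_add {V W : A} (f g : V ⟶ W) : indMap S (f + g) = indMap S f + indMap S g := by
  apply biproduct.hom_ext
  intro j
  simp [indMap, MonoidalPreadditive.whiskerLeft_add, MonoidalPreadditive.add_whiskerRight]

lemma indMap_smul {V W : A} (c : k) (f : V ⟶ W) : indMap S (c • f) = c • indMap S f := by
  apply biproduct.hom_ext
  intro j
  simp [indMap]

end InducedHalfBraiding

end

end ReducedTensor

namespace ReducedTensor

noncomputable section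

/-! ### Traces, dimensions and the nonvanishing of the global dimension -/

section Traces

variable {C : Type u} [Category.{v} C] [MonoidalCategory C] [RightRigidCategory C]

lemma coevaluation_rightDualTensorIso_hom (X Y : C) :
    η_ (X ⊗ Y) (X ⊗ Y)ᘁ ≫ (X ⊗ Y) ◁ (rightDualTensorIso X Y).hom =
      𝟙 _ ⊗≫ η_ X Xᘁ ⊗≫ X ◁ η_ Y Yᘁ ▷ (Xᘁ : C) ⊗≫ 𝟙 _ := by
  have := @coevaluation_comp_rightAdjointMate C _ _ (X ⊗ Y) (X ⊗ Y) hasRightDualTensor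
    (RightRigidCategory.rightDual (X ⊗ Y)) (𝟙 _)
  rw [MonoidalCategory.id_whiskerRight, Category.comp_id] at this
  refine Eq.trans this ?_
  change η_ X Xᘁ ⊗≫ (X ◁ η_ Y Yᘁ) ▷ (Xᘁ : C) ⊗≫ 𝟙 _ = _
  monoidal

variable [PivotalCategory C]

lemma rtrace_comm {X Y : C} (f : X ⟶ Y) (g : Y ⟶ X) : rtrace (f ≫ g) = rtrace (g ≫ f) := by
  rw [rtrace, comp_whiskerRight, Category.assoc, ← coevaluation_comp_rightAdjointMate_assoc f,
    rtrace, whisker_exchange_assoc, ← evR_naturality, comp_whiskerRight_assoc]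

/-- The partial trace of an endomorphism of `X ⊗ Y`, closing the strand `Y` on the right. -/
def partialTrace {X Y : C} (f : X ⊗ Y ⟶ X ⊗ Y) : X ⟶ X :=
  𝟙 _ ⊗≫ X ◁ η_ Y Yᘁ ⊗≫ f ▷ (Yᘁ : C) ⊗≫ X ◁ evR Y ⊗≫ 𝟙 _

lemma rtrace_tensor {X Y : C} (f : X ⊗ Y ⟶ X ⊗ Y) : rtrace f = rtrace (partialTrace f) := by
  have h : rtrace f = (η_ (X ⊗ Y) (X ⊗ Y)ᘁ ≫ (X ⊗ Y) ◁ (rightDualTensorIso X Y).hom) ≫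
      f ▷ (Yᘁ ⊗ Xᘁ : C) ≫ (X ⊗ Y) ◁ (rightDualTensorIso X Y).inv ≫ evR (X ⊗ Y) := by
    rw [rtrace, Category.assoc, whisker_exchange_assoc, ← MonoidalCategory.whiskerLeft_comp_assoc]
    simp
  rw [h, coevaluation_rightDualTensorIso_hom, evR_tensor, rtrace, partialTrace]
  monoidal

end Traces

section Dimensions
variable {k : Type w} [Field k] [IsAlgClosed k]
  {A : Type u} [Category.{v} A] [Abelian A] [Linear k A] [MonoidalCategory A]
  [MonoidalPreadditive A] [MonoidalLinear k A] [BraidedCategory A] [RigidCategory A]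
  [PivotalCategory A] [PremodularCategory k A] {ι : Type u₁} [Fintype ι]
  (S : SimpleData k A ι)
variable (k) in
lemma dim_of_iso {X Y : A} (e : X ≅ Y) : dim k X = dim k Y := by
  rw [dim, dim, ← e.hom_inv_id, rtrace_comm, e.inv_hom_id]

lemma rtrace_smul {X : A} (c : k) (f : X ⟶ X) : rtrace (c • f) = c • rtrace f := by
  simp [rtrace]

lemma rtrace_sum {X : A} {J : Type*} (s : Finset J) (f : J → (X ⟶ X)) :
    rtrace (∑ a ∈ s, f a) = ∑ a ∈ s, rtrace (f a) := by
  simp [rtrace, sum_whiskerRight, Preadditive.sum_comp, Preadditive.comp_sum]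

variable (k) in
lemma dim_tensor (X Y : A) : dim k (X ⊗ Y) = dim k X * dim k Y := by
  have h : partialTrace (𝟙 (X ⊗ Y)) = dim k Y • 𝟙 X := by
    calc
      _ = 𝟙 _ ⊗≫ X ◁ rtrace (𝟙 Y) ⊗≫ 𝟙 _ := by rw [partialTrace, rtrace]; monoidal
      _ = dim k Y • (𝟙 _ ⊗≫ X ◁ 𝟙 (𝟙_ A) ⊗≫ 𝟙 X) := by
        rw [← unitScalar_smul (k := k) (rtrace (𝟙 Y)), dim]; simp [monoidalComp]
      _ = _ := by congr 1; monoidal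
  rw [dim, rtrace_tensor, h, rtrace_smul, map_smul, smul_eq_mul, mul_comm]
  rfl

variable (k A) in
-- The dimension of the unit object equals its own square, and it is not zero.
lemma dim_unit : dim k (𝟙_ A) = 1 := by
  have : Simple (𝟙_ A) := PremodularCategory.simple_unit k
  have h := dim_tensor k (𝟙_ A) (𝟙_ A)
  rw [dim_of_iso k (λ_ (𝟙_ A))] at h
  exact (mul_eq_left₀ (dim_ne_zero k (𝟙_ A))).1 h.symm

lemma coevaluation_evR_of_dim_eq_one {U : A} (h : dim k U = 1) :
    η_ U Uᘁ ≫ evR U = 𝟙 _ := by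
  have : rtrace (𝟙 U) = 𝟙 _ := by
    rw [← unitScalar_smul (k := k) (rtrace _)]
    change dim k U • _ = _
    rw [h, one_smul]
  simpa [rtrace] using this

end Dimensions

section DualTrace

variable {A : Type u} [Category.{v} A] [MonoidalCategory A] [RightRigidCategory A]
  [PivotalCategory A]

/-- This expresses that the pivot of `Xᘁ` is inverse to the dual of the pivot of `X`. It follows
from the naturality of `evR` along the evaluation `Xᘁ ⊗ X ⟶ 𝟙`, combined with `evR_tensor`. The copy
`U` of the unit, whose loop has value `1`, is inserted to provide the dual strand of the target. -/
lemma evR_dual_of_iso_unit {U : A} (a : 𝟙_ A ≅ U) (h1 : η_ U Uᘁ ≫ evR U = 𝟙 _) (X : A) :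
    (Xᘁ : A) ◁ (pivot X).hom ≫ evR (Xᘁ : A) = ε_ X Xᘁ := by
  have h2 := evR_naturality (ε_ X Xᘁ ≫ a.hom)
  have h3 : (Xᘁ ⊗ X : A) ◁ (rightDualTensorIso (Xᘁ : A) X).hom ≫
      (𝟙 _ ⊗≫ (Xᘁ : A) ◁ evR X ▷ ((Xᘁ)ᘁ : A) ⊗≫ evR (Xᘁ : A)) = evR (Xᘁ ⊗ X : A) := by
    rw [← evR_tensor, ← MonoidalCategory.whiskerLeft_comp_assoc]; simp
  have h4 : η_ U Uᘁ ≫ a.inv ▷ (Uᘁ : A) ≫ 𝟙_ A ◁ ((ε_ X Xᘁ ≫ a.hom)ᘁ ≫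
      (rightDualTensorIso (Xᘁ : A) X).hom) = η_ (Xᘁ : A) ((Xᘁ)ᘁ) ⊗≫ 𝟙 _ := by
    calc
      _ = (η_ U Uᘁ ≫ U ◁ (ε_ X Xᘁ ≫ a.hom)ᘁ) ≫ U ◁ (rightDualTensorIso (Xᘁ : A) X).hom ≫
          a.inv ▷ _ := by
        rw [← whisker_exchange, MonoidalCategory.whiskerLeft_comp, Category.assoc,
          Category.assoc]
      _ = η_ (Xᘁ ⊗ X : A) (Xᘁ ⊗ X : A)ᘁ ≫ ((ε_ X Xᘁ) ▷ ((Xᘁ ⊗ X)ᘁ : A) ≫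
          𝟙_ A ◁ (rightDualTensorIso (Xᘁ : A) X).hom) := by
        rw [coevaluation_comp_rightAdjointMate, whisker_exchange, Category.assoc,
          ← comp_whiskerRight_assoc, Category.assoc, a.hom_inv_id, Category.comp_id]
      _ = η_ (Xᘁ : A) ((Xᘁ)ᘁ) ⊗≫ ((Xᘁ : A) ◁ η_ X Xᘁ ⊗≫ ε_ X Xᘁ ▷ (Xᘁ : A)) ▷ ((Xᘁ)ᘁ : A) ⊗≫
          𝟙 _ := by
        rw [← whisker_exchange, ← Category.assoc, coevaluation_rightDualTensorIso_hom]; monoidal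
      _ = _ := by rw [ExactPairing.coevaluation_evaluation'']; monoidal
  symm
  calc
    _ = 𝟙 _ ⊗≫ (ε_ X Xᘁ ▷ 𝟙_ A ≫ 𝟙_ A ◁ (η_ U Uᘁ ≫ (a.inv ≫ a.hom) ▷ (Uᘁ : A) ≫ evR U)) ⊗≫
        𝟙 _ := by
      rw [a.inv_hom_id, MonoidalCategory.id_whiskerRight, Category.id_comp, h1]; monoidal
    _ = 𝟙 _ ⊗≫ (Xᘁ ⊗ X : A) ◁ (η_ U Uᘁ ≫ a.inv ▷ (Uᘁ : A)) ⊗≫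
        ((ε_ X Xᘁ ≫ a.hom) ▷ (Uᘁ : A) ≫ evR U) := by
      rw [← whisker_exchange]
      calc
        _ = 𝟙 _ ⊗≫ (Xᘁ ⊗ X : A) ◁ (η_ U Uᘁ ≫ a.inv ▷ (Uᘁ : A)) ⊗≫
          ((Xᘁ ⊗ X : A) ◁ (a.hom ▷ (Uᘁ : A) ≫ evR U) ≫ ε_ X Xᘁ ▷ 𝟙_ A) ⊗≫ 𝟙 _ := by
            monoidal
        _ = _ := by rw [whisker_exchange]; monoidal
    _ = 𝟙 _ ⊗≫ (Xᘁ ⊗ X : A) ◁ (η_ U Uᘁ ≫ a.inv ▷ (Uᘁ : A) ≫ 𝟙_ A ◁ ((ε_ X Xᘁ ≫ a.hom)ᘁ ≫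
        (rightDualTensorIso (Xᘁ : A) X).hom)) ⊗≫ (Xᘁ : A) ◁ evR X ▷ ((Xᘁ)ᘁ : A) ⊗≫
        evR (Xᘁ : A) := by
      rw [h2, ← h3]; monoidal
    _ = 𝟙 _ ⊗≫ (Xᘁ : A) ◁ (X ◁ η_ (Xᘁ : A) ((Xᘁ)ᘁ) ⊗≫ ((pivot X).hom ▷ (Xᘁ : A) ≫
        ε_ (Xᘁ : A) ((Xᘁ)ᘁ)) ▷ ((Xᘁ)ᘁ : A) ⊗≫ 𝟙 ((Xᘁ)ᘁ : A)) ⊗≫ evR (Xᘁ : A) := by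
      rw [h4, ← evR]; monoidal
    _ = 𝟙 _ ⊗≫ (Xᘁ : A) ◁ ((X ◁ η_ (Xᘁ : A) ((Xᘁ)ᘁ) ≫ (pivot X).hom ▷ (Xᘁ ⊗ (Xᘁ)ᘁ : A)) ⊗≫
        ε_ (Xᘁ : A) ((Xᘁ)ᘁ) ▷ ((Xᘁ)ᘁ : A) ⊗≫ 𝟙 ((Xᘁ)ᘁ : A)) ⊗≫ evR (Xᘁ : A) := by
      monoidal
    _ = 𝟙 _ ⊗≫ (Xᘁ : A) ◁ ((pivot X).hom ⊗≫ (((Xᘁ)ᘁ : A) ◁ η_ (Xᘁ : A) ((Xᘁ)ᘁ) ⊗≫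
        ε_ (Xᘁ : A) ((Xᘁ)ᘁ) ▷ ((Xᘁ)ᘁ : A)) ⊗≫ 𝟙 ((Xᘁ)ᘁ : A)) ⊗≫ evR (Xᘁ : A) := by
      rw [whisker_exchange]; monoidal
    _ = _ := by rw [ExactPairing.coevaluation_evaluation'']; monoidal

lemma rtrace_id_dual_of_iso_unit {U : A} (a : 𝟙_ A ≅ U) (h1 : η_ U Uᘁ ≫ evR U = 𝟙 _) (X : A) :
    rtrace (𝟙 (Xᘁ : A)) = ltrace (𝟙 X) := by
  rw [ltrace, ← evR_dual_of_iso_unit a h1 X, rtrace, coevL]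
  simp [← MonoidalCategory.whiskerLeft_comp_assoc]

end DualTrace

section GlobalDimension

variable {k : Type w} [Field k] [IsAlgClosed k]
  {A : Type u} [Category.{v} A] [Abelian A] [Linear k A] [MonoidalCategory A]
  [MonoidalPreadditive A] [MonoidalLinear k A] [BraidedCategory A] [RigidCategory A]
  [PivotalCategory A] [PremodularCategory k A] {ι : Type u₁} [Fintype ι]
  (S : SimpleData k A ι)

variable (k) in
lemma dim_dual (X : A) : dim k (Xᘁ : A) = dim k X := by
  rw [dim, rtrace_id_dual_of_iso_unit (Iso.refl _) (coevaluation_evR_of_dim_eq_one (dim_unit k A)),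
    ← PremodularCategory.spherical k]
  rfl

lemma sum_mult_mul_dim (V : A) :
    ∑ j, (mult k V (S.obj j) : k) * dim k (S.obj j) = dim k V := by
  conv_rhs => rw [dim, ← sum_node_comp_dualNode S V]
  simp only [rtrace_sum, rtrace_smul, map_sum, map_smul]
  refine Finset.sum_congr rfl fun j _ => ?_
  have : ∀ a, unitScalar k (rtrace (node k V (S.obj j) a ≫ dualNode k V (S.obj j) a)) = 1 := by
    intro a
    rw [rtrace_comm, tracePairing_node_dualNode, if_pos rfl]
  simp [this, mul_comm]

/-- The trace of the rotated resolution of the identity of `X_j^* ⊗ B`. With `sum_mult_mul_dim` it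
says that the vector of dimensions is an eigenvector of each fusion matrix and of its transpose,
with the same eigenvalue. -/
lemma sum_mult_tensor_mul_dim (B : A) (j : ι) :
    ∑ i, (mult k (B ⊗ S.obj i) (S.obj j) : k) * dim k (S.obj i) = dim k B * dim k (S.obj j) := by
  rw [mul_comm, ← dim_dual k (S.obj j), ← dim_tensor]
  conv_rhs => rw [dim, ← sum_turnNode_comp_turn S B j]
  simp only [rtrace_sum, rtrace_smul, map_sum, map_smul]
  refine Finset.sum_congr rfl fun i _ => ?_
  have : ∀ a, dim k (S.obj i) • unitScalar k (rtrace (turnNode (node k (B ⊗ S.obj i) (S.obj j) a) ≫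
      turn (dualNode k (B ⊗ S.obj i) (S.obj j) a))) = dim k (S.obj i) := by
    intro a
    rw [rtrace_comm, ← map_smul, ← rtrace_smul, turn_turnNode, tracePairing_node_dualNode,
      if_pos rfl, one_smul]
    exact dim_dual k _
  rw [Finset.smul_sum]
  simp only [this, Finset.sum_const, Finset.card_univ, Fintype.card_fin, nsmul_eq_mul]

lemma mult_unit_tensor [DecidableEq ι] {u : A} (e : 𝟙_ A ≅ u) (i j : ι) :
    mult k (u ⊗ S.obj i) (S.obj j) = if i = j then 1 else 0 := by
  let f : u ⊗ S.obj i ≅ S.obj i := whiskerRightIso e.symm _ ≪≫ λ_ _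
  have h : mult k (u ⊗ S.obj i) (S.obj j) = mult k (S.obj i) (S.obj j) :=
    LinearEquiv.finrank_eq
      { toFun := fun g => f.inv ≫ g
        invFun := fun g => f.hom ≫ g
        map_add' := by simp
        map_smul' := by simp
        left_inv := fun g => by simp
        right_inv := fun g => by simp }
  rw [h]
  split_ifs with hij
  · subst hij
    exact finrank_hom_simple_simple_eq_one_iff k _ _ |>.2 ⟨Iso.refl _⟩
  · exact finrank_hom_simple_simple_eq_zero_iff k _ _ |>.2 ⟨fun e => hij (S.eq_of_iso i j ⟨e⟩)⟩

/-- The global dimension of a premodular category in characteristic zero is not zero. -/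
lemma globalDim_ne_zero [CharZero k] : ∑ i, dim k (S.obj i) ^ 2 ≠ 0 := by
  classical
  have hu : Simple (𝟙_ A) := PremodularCategory.simple_unit k
  obtain ⟨o, ⟨e⟩⟩ := S.exists_iso (𝟙_ A) hu
  let N : ι → Matrix ι ι ℤ := fun b =>
    Matrix.of fun i j => (mult k (S.obj b ⊗ S.obj i) (S.obj j) : ℤ)
  let d : ι → k := fun i => dim k (S.obj i)
  -- `M` has eigenvalue `∑ d_b ^ 2` on the vector of dimensions, since each `N b` and its transpose
  -- act there as `d_b`.
  let M : Matrix ι ι ℤ := ∑ b, (N b).transpose * N b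
  have hN : ∀ b, ((N b).map (Int.castRingHom k)).mulVec d = d b • d := by
    intro b
    funext i
    have := sum_mult_mul_dim S (S.obj b ⊗ S.obj i)
    rw [dim_tensor] at this
    simpa [Matrix.mulVec, dotProduct, N, d] using this
  have hNt : ∀ b, ((N b).transpose.map (Int.castRingHom k)).mulVec d = d b • d := by
    intro b
    funext j
    have := sum_mult_tensor_mul_dim S (S.obj b) j
    simpa [Matrix.mulVec, dotProduct, N, d] using this
  have hM : (M.map (Int.castRingHom k)).mulVec d = (∑ i, d i ^ 2) • d := by
    have : M.map (Int.castRingHom k) =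
        ∑ b, (N b).transpose.map (Int.castRingHom k) * (N b).map (Int.castRingHom k) := by
      have := map_sum (Int.castRingHom k).mapMatrix (fun b => (N b).transpose * N b) Finset.univ
      simpa only [map_mul, RingHom.mapMatrix_apply] using this
    rw [this, Matrix.sum_mulVec, Finset.sum_smul]
    refine Finset.sum_congr rfl fun b _ => ?_
    rw [← Matrix.mulVec_mulVec, hN, Matrix.mulVec_smul, hNt, smul_smul, sq]
  -- A kernel vector `x` satisfies `∑ ‖N_b x‖² = 0` over the integers, and the fusion matrix of the
  -- unit object is the identity, so `x = 0`.
  have hdet : M.det ≠ 0 := by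
    intro h0
    obtain ⟨x, hx, hMx⟩ := Matrix.exists_mulVec_eq_zero_iff.2 h0
    apply hx
    have h1 : ∑ b, (N b).mulVec x ⬝ᵥ (N b).mulVec x = 0 := by
      have : x ⬝ᵥ M.mulVec x = 0 := by rw [hMx]; simp
      rw [Matrix.sum_mulVec, dotProduct_sum] at this
      rw [← this]
      refine Finset.sum_congr rfl fun b _ => ?_
      rw [← Matrix.mulVec_mulVec, Matrix.dotProduct_mulVec x, Matrix.vecMul_transpose]
    have h2 := (Finset.sum_eq_zero_iff_of_nonneg
      (fun b _ => Finset.sum_nonneg fun i _ => mul_self_nonneg ((N b).mulVec x i))).1 h1 o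
      (Finset.mem_univ o)
    have h3 : N o = 1 := by
      ext i j
      simp [N, mult_unit_tensor S e, Matrix.one_apply]
    rw [h3, Matrix.one_mulVec] at h2
    exact dotProduct_self_eq_zero.1 h2
  intro h0
  -- The nonzero integer `det M` stays nonzero in `k` by characteristic zero.
  have hdet' : (M.map (Int.castRingHom k)).det ≠ 0 := by
    have := (Int.castRingHom k).map_det M
    rw [RingHom.mapMatrix_apply] at this
    rw [← this]
    simpa using hdet
  have hd : d = 0 := Matrix.eq_zero_of_mulVec_eq_zero hdet' (by rw [hM]; simp [d, h0])
  exact dim_ne_zero k (S.obj o) (congrFun hd o)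

end GlobalDimension

end

end ReducedTensor

namespace ReducedTensor

noncomputable section

/-! ### Descent from insertions, action, coaction and averaging -/

section Descent

variable {k : Type w} [Field k] [IsAlgClosed k]
  {A : Type u} [Category.{v} A] [Abelian A] [Linear k A] [MonoidalCategory A]
  [MonoidalPreadditive A] [MonoidalLinear k A] [BraidedCategory A] [RigidCategory A]
  [PivotalCategory A] [PremodularCategory k A] {ι : Type u₁} [Fintype ι]
  (S : SimpleData k A ι)

/-- A family of morphisms `F(B ⊗ V ⊗ B') ⟶ Z`, indexed by the pairings `B ⊗ B' ⟶ 𝟙`, that is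
natural and linear in the pairing. -/
structure IsExtranatural (k : Type w) [Field k] [Linear k A] (F : A ⥤ A) (V : A) {Z : A}
    (Φ : ∀ {B B' : A}, (B ⊗ B' ⟶ 𝟙_ A) → (F.obj (B ⊗ V ⊗ B') ⟶ Z)) : Prop where
  left : ∀ {B C C' : A} (f : C ⊗ C' ⟶ 𝟙_ A) (g : B ⟶ C),
    F.map (g ▷ (V ⊗ C')) ≫ Φ f = Φ (g ▷ C' ≫ f)
  right : ∀ {B B' C' : A} (f : B ⊗ C' ⟶ 𝟙_ A) (h : B' ⟶ C'),
    F.map (B ◁ V ◁ h) ≫ Φ f = Φ (B ◁ h ≫ f)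
  add : ∀ {B B' : A} (f g : B ⊗ B' ⟶ 𝟙_ A), Φ (f + g) = Φ f + Φ g
  smul : ∀ {B B' : A} (c : k) (f : B ⊗ B' ⟶ 𝟙_ A), Φ (c • f) = c • Φ f

lemma IsExtranatural.map_sum {F : A ⥤ A} {V Z : A}
    {Φ : ∀ {B B' : A}, (B ⊗ B' ⟶ 𝟙_ A) → (F.obj (B ⊗ V ⊗ B') ⟶ Z)}
    (hΦ : IsExtranatural k F V Φ) {B B' : A} {J : Type*} (s : Finset J)
    (f : J → (B ⊗ B' ⟶ 𝟙_ A)) : Φ (∑ a ∈ s, f a) = ∑ a ∈ s, Φ (f a) :=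
  _root_.map_sum (⟨⟨Φ, hΦ.add⟩, hΦ.smul⟩ : (B ⊗ B' ⟶ 𝟙_ A) →ₗ[k] (F.obj (B ⊗ V ⊗ B') ⟶ Z)) f s

/-- The morphism `F(I(V)) ⟶ Z` induced by an extranatural family. -/
def desc (F : A ⥤ A) (V : A) {Z : A}
    (Φ : ∀ {B B' : A}, (B ⊗ B' ⟶ 𝟙_ A) → (F.obj (B ⊗ V ⊗ B') ⟶ Z)) : F.obj (indObj S V) ⟶ Z :=
  ∑ i, S.sqrtDim i • (F.map (indπ S V i) ≫ Φ (evR (S.obj i)))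

lemma map_indι_desc (F : A ⥤ A) [F.Additive] [F.Linear k] (V : A) {Z : A}
    (Φ : ∀ {B B' : A}, (B ⊗ B' ⟶ 𝟙_ A) → (F.obj (B ⊗ V ⊗ B') ⟶ Z)) (i : ι) :
    F.map (indι S V i) ≫ desc S F V Φ = S.sqrtDim i • Φ (evR (S.obj i)) := by
  classical
  rw [desc, Preadditive.comp_sum, Finset.sum_eq_single i]
  · rw [Linear.comp_smul, ← F.map_comp_assoc, biproduct.ι_π_self, F.map_id, Category.id_comp]
  · intro j _ hj
    rw [Linear.comp_smul, ← F.map_comp_assoc, biproduct.ι_π_ne _ hj.symm, F.map_zero, zero_comp,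
      smul_zero]
  · simp

/-- The existence half of the coend property of `I(V)`. Resolving the identity of `B` into simples
expresses the family through its values on the `X_i`. The functor `F` is there so that the property
can be used after tensoring with a fixed object. -/
lemma map_ins_desc (F : A ⥤ A) [F.Additive] [F.Linear k] (V : A) {Z : A}
    {Φ : ∀ {B B' : A}, (B ⊗ B' ⟶ 𝟙_ A) → (F.obj (B ⊗ V ⊗ B') ⟶ Z)}
    (hΦ : IsExtranatural k F V Φ) {B B' : A} (f : B ⊗ B' ⟶ 𝟙_ A) :
    F.map (ins S V f) ≫ desc S F V Φ = Φ f := by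
  have h := congrArg (fun t => Φ (t ▷ B' ≫ f)) (sum_node_comp_dualNode S B)
  simp only [sum_whiskerRight, Preadditive.sum_comp, MonoidalLinear.smul_whiskerRight,
    Linear.smul_comp, hΦ.map_sum, hΦ.smul, MonoidalCategory.id_whiskerRight,
    Category.id_comp] at h
  rw [← h, ins]
  simp only [F.map_sum, Preadditive.sum_comp, Functor.map_smul, Linear.smul_comp, F.map_comp,
    Category.assoc, map_indι_desc, Linear.comp_smul, hΦ.right, hΦ.left]
  refine Finset.sum_congr rfl fun j _ => ?_
  rw [← sqrtDim_mul_self, ← smul_smul]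
  congr 1
  rw [Finset.smul_sum]
  refine Finset.sum_congr rfl fun a _ => ?_
  rw [whiskerLeft_transpose_evR, comp_whiskerRight_assoc]

end Descent

section Action

variable {k : Type w} [Field k] [IsAlgClosed k]
  {A : Type u} [Category.{v} A] [Abelian A] [Linear k A] [MonoidalCategory A]
  [MonoidalPreadditive A] [MonoidalLinear k A] [BraidedCategory A] [RigidCategory A]
  [PivotalCategory A] [PremodularCategory k A] {ι : Type u₁} [Fintype ι]
  (S : SimpleData k A ι)

/-- The half-braiding of `W` with `B`, followed by a pairing of `B` with `B'`. -/
def actOn {W : A} (h : HalfBraiding W) {B B' : A} (f : B ⊗ B' ⟶ 𝟙_ A) : B ⊗ W ⊗ B' ⟶ W :=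
  𝟙 _ ⊗≫ hb h B ▷ B' ⊗≫ W ◁ f ⊗≫ 𝟙 _

lemma actOn_isExtranatural {W : A} (h : HalfBraiding W) :
    IsExtranatural k (𝟭 A) W (actOn h) where
  left {B C C'} f g := by
    change g ▷ (W ⊗ C') ≫ actOn h f = _
    calc
      _ = 𝟙 _ ⊗≫ (g ▷ W ≫ hb h C) ▷ C' ⊗≫ W ◁ f ⊗≫ 𝟙 _ := by
        rw [actOn]; monoidal
      _ = _ := by rw [hb_nat, actOn]; monoidal
  right {B B' C'} f g := by
    change B ◁ W ◁ g ≫ actOn h f = _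
    calc
      _ = 𝟙 _ ⊗≫ ((B ⊗ W) ◁ g ≫ hb h B ▷ C') ⊗≫ W ◁ f ⊗≫ 𝟙 _ := by
        rw [actOn]; monoidal
      _ = _ := by rw [whisker_exchange, actOn]; monoidal
  add f g := by simp [actOn, monoidalComp, MonoidalPreadditive.whiskerLeft_add]
  smul c f := by simp [actOn, monoidalComp]

/-- The action `I(W) ⟶ W` of the induction on an object of the center. -/
def act {W : A} (h : HalfBraiding W) : indObj S W ⟶ W := desc S (𝟭 A) W (actOn h)

lemma ins_act {W : A} (h : HalfBraiding W) {B B' : A} (f : B ⊗ B' ⟶ 𝟙_ A) :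
    ins S W f ≫ act S h = actOn h f :=
  map_ins_desc S (𝟭 A) W (actOn_isExtranatural h) f

lemma indι_act {W : A} (h : HalfBraiding W) (i : ι) :
    indι S W i ≫ act S h = S.sqrtDim i • actOn h (evR (S.obj i)) :=
  map_indι_desc S (𝟭 A) W (actOn h) i

/-- Acting by a nested pairing is acting by the inner one and then crossing with `B`, whose strand
is straightened by the zigzag. Since `Γ` nests pairings, this is the centrality of `act`. -/
lemma actOn_nest {W : A} (h : HalfBraiding W) {B B' C C' : A} (f : C ⊗ C' ⟶ 𝟙_ A)
    (e : B ⊗ B' ⟶ 𝟙_ A) (cv : 𝟙_ A ⟶ B' ⊗ B) (hcv : B ◁ cv ⊗≫ e ▷ B = ⊗𝟙.hom) :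
    𝟙 _ ⊗≫ (B ⊗ C ⊗ W ⊗ C') ◁ cv ⊗≫ actOn h (nest f e) ▷ B = B ◁ actOn h f ≫ hb h B := by
  calc
    _ = 𝟙 _ ⊗≫ ((((B ⊗ C) ⊗ W) ⊗ C') ◁ cv ≫ hb h (B ⊗ C) ▷ C' ▷ (B' ⊗ B)) ⊗≫
        W ◁ nest f e ▷ B ⊗≫ 𝟙 _ := by rw [actOn]; monoidal
    _ = 𝟙 _ ⊗≫ hb h (B ⊗ C) ▷ C' ⊗≫ W ◁ B ◁ ((C ⊗ C') ◁ cv ≫ f ▷ (B' ⊗ B)) ⊗≫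
        W ◁ e ▷ B ⊗≫ 𝟙 _ := by rw [whisker_exchange, nest]; monoidal
    _ = 𝟙 _ ⊗≫ hb h (B ⊗ C) ▷ C' ⊗≫ W ◁ B ◁ f ⊗≫ W ◁ (B ◁ cv ⊗≫ e ▷ B) ⊗≫ 𝟙 _ := by
      rw [whisker_exchange]; monoidal
    _ = 𝟙 _ ⊗≫ B ◁ hb h C ▷ C' ⊗≫ (hb h B ▷ (C ⊗ C') ≫ (W ⊗ B) ◁ f) ⊗≫ 𝟙 _ := by
      rw [hcv, hb_tensor]; monoidal
    _ = _ := by rw [← whisker_exchange, actOn]; monoidal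

lemma cen_act {W : A} (h : HalfBraiding W) : Cen (indHb S W) h (act S h) := by
  intro B
  apply hom_ext_ins_left S
  intro i
  rw [← MonoidalCategory.whiskerLeft_comp_assoc, ins_act, hb_indHb, ← Category.assoc,
    whiskerLeft_ins_indγ W _ _ _ (coevL_evR_pairing B),
    ← actOn_nest h _ _ _ (coevL_evR_pairing B), ← ins_act S, wrap]
  monoidal

lemma indMap_act {W W' : A} {h : HalfBraiding W} {h' : HalfBraiding W'} {f : W ⟶ W'}
    (hf : Cen h h' f) : indMap S f ≫ act S h' = act S h ≫ f := by
  apply hom_ext_ins S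
  intro i
  rw [← Category.assoc, ← ins_map, Category.assoc, ins_act, ← Category.assoc, ins_act]
  generalize evR (S.obj i) = q
  generalize (S.obj i)ᘁ = X' at q ⊢
  calc
    _ = 𝟙 _ ⊗≫ (S.obj i ◁ f ≫ hb h' (S.obj i)) ▷ X' ⊗≫ W' ◁ q ⊗≫ 𝟙 _ := by
      rw [actOn]; monoidal
    _ = 𝟙 _ ⊗≫ hb h (S.obj i) ▷ X' ⊗≫ (f ▷ (S.obj i ⊗ X') ≫ W' ◁ q) ⊗≫ 𝟙 _ := by
      rw [hf]; monoidal
    _ = _ := by rw [← whisker_exchange, actOn]; monoidal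

/-- A copairing of `B` with `B'`, followed by the half-braiding of `W` with `B'`. -/
def coactOn {W : A} (h : HalfBraiding W) {B B' : A} (c : 𝟙_ A ⟶ B ⊗ B') : W ⟶ B ⊗ W ⊗ B' :=
  𝟙 _ ⊗≫ c ▷ W ⊗≫ B ◁ hb h B'

lemma coactOn_hb {W : A} (h : HalfBraiding W) {B B' : A} (c : 𝟙_ A ⟶ B ⊗ B') :
    coactOn h c ⊗≫ hb h B ▷ B' = 𝟙 _ ⊗≫ W ◁ c ⊗≫ 𝟙 _ := by
  have := (hb_isLaxBraiding h).copairing c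
  calc
    _ = 𝟙 _ ⊗≫ (c ▷ W ⊗≫ B ◁ hb h B' ⊗≫ hb h B ▷ B') := by rw [coactOn]; monoidal
    _ = _ := by rw [this]; monoidal

/-- The coaction `W ⟶ I(W)` of the induction on an object of the center. -/
def coact {W : A} (h : HalfBraiding W) : W ⟶ indObj S W :=
  ∑ i, S.sqrtDim i • (coactOn h (η_ (S.obj i) (S.obj i)ᘁ) ≫ indι S W i)

lemma coact_eq {W : A} (h : HalfBraiding W) : coact S h = ∑ i, dim k (S.obj i) •
    (coactOn h (η_ (S.obj i) (S.obj i)ᘁ) ≫ ins S W (evR (S.obj i))) := by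
  rw [coact]
  refine Finset.sum_congr rfl fun i _ => ?_
  rw [indι_eq, Linear.comp_smul, smul_smul, sqrtDim_mul_self]

lemma coact_indπ {W : A} (h : HalfBraiding W) (i : ι) :
    coact S h ≫ indπ S W i = S.sqrtDim i • coactOn h (η_ (S.obj i) (S.obj i)ᘁ) := by
  classical
  rw [coact, Preadditive.sum_comp, Finset.sum_eq_single i]
  · simp
  · intro j _ hj
    rw [Linear.smul_comp, Category.assoc, biproduct.ι_π_ne _ hj, comp_zero, smul_zero]
  · simp

/-- Naturality of the half-braiding moves the lower node above the crossing with `W`. The two nodes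
are then adjacent, and `B` slides over the weighted sum of colours by `sum_coevaluation_slide`. -/
lemma sum_coactOn_pass {W : A} (h : HalfBraiding W) (B : A) (j : ι) :
    ∑ i, dim k (S.obj i) • (B ◁ coactOn h (η_ (S.obj i) (S.obj i)ᘁ) ≫ pass S B W i j) =
      hb h B ≫ coactOn h (η_ (S.obj j) (S.obj j)ᘁ) ▷ B := by
  have key : ∀ i a, B ◁ coactOn h (η_ (S.obj i) (S.obj i)ᘁ) ≫
      (𝟙 _ ⊗≫ node k (B ⊗ S.obj i) (S.obj j) a ▷ (W ⊗ (S.obj i)ᘁ) ⊗≫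
        (S.obj j ⊗ W) ◁ turn (dualNode k (B ⊗ S.obj i) (S.obj j) a) ⊗≫
        𝟙 ((S.obj j ⊗ W ⊗ (S.obj j)ᘁ) ⊗ B)) =
      𝟙 _ ⊗≫ (𝟙 B ⊗≫ B ◁ η_ (S.obj i) (S.obj i)ᘁ ⊗≫
      node k (B ⊗ S.obj i) (S.obj j) a ▷ ((S.obj i)ᘁ : A) ⊗≫
      S.obj j ◁ turn (dualNode k (B ⊗ S.obj i) (S.obj j) a)) ▷ W ⊗≫
      S.obj j ◁ hb h ((S.obj j)ᘁ ⊗ B) ⊗≫ 𝟙 _ := by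
    intro i a
    generalize node k (B ⊗ S.obj i) (S.obj j) a = φ
    generalize dualNode k (B ⊗ S.obj i) (S.obj j) a = ψ
    calc
      _ = 𝟙 _ ⊗≫ B ◁ η_ (S.obj i) (S.obj i)ᘁ ▷ W ⊗≫ ((B ⊗ S.obj i) ◁ hb h ((S.obj i)ᘁ) ≫
          φ ▷ (W ⊗ (S.obj i)ᘁ)) ⊗≫ (S.obj j ⊗ W) ◁ turn ψ ⊗≫ 𝟙 _ := by
        rw [coactOn]; monoidal
      _ = 𝟙 _ ⊗≫ B ◁ η_ (S.obj i) (S.obj i)ᘁ ▷ W ⊗≫ φ ▷ ((S.obj i)ᘁ ⊗ W : A) ⊗≫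
          S.obj j ◁ (hb h ((S.obj i)ᘁ) ≫ W ◁ turn ψ) ⊗≫ 𝟙 _ := by
        rw [whisker_exchange]; monoidal
      _ = _ := by rw [← hb_nat]; monoidal
  have h1 := congrArg (fun t => 𝟙 (B ⊗ W) ⊗≫ t ▷ W ⊗≫ S.obj j ◁ hb h ((S.obj j)ᘁ ⊗ B) ⊗≫
    𝟙 ((S.obj j ⊗ W ⊗ (S.obj j)ᘁ) ⊗ B)) (sum_coevaluation_slide S B j)
  have h2 : 𝟙 (B ⊗ W) ⊗≫ (𝟙 B ⊗≫ η_ (S.obj j) (S.obj j)ᘁ ▷ B ⊗≫ 𝟙 (S.obj j ⊗ (S.obj j)ᘁ ⊗ B)) ▷ W ⊗≫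
      S.obj j ◁ hb h ((S.obj j)ᘁ ⊗ B) ⊗≫ 𝟙 ((S.obj j ⊗ W ⊗ (S.obj j)ᘁ) ⊗ B) =
      hb h B ≫ coactOn h (η_ (S.obj j) (S.obj j)ᘁ) ▷ B := by
    calc
      _ = 𝟙 _ ⊗≫ (η_ (S.obj j) (S.obj j)ᘁ ▷ (B ⊗ W) ≫ (S.obj j ⊗ (S.obj j)ᘁ : A) ◁ hb h B) ⊗≫
          S.obj j ◁ hb h ((S.obj j)ᘁ) ▷ B ⊗≫ 𝟙 _ := by rw [hb_tensor]; monoidal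
      _ = _ := by rw [← whisker_exchange, coactOn]; monoidal
  rw [← h2, ← h1]
  simp only [pass, Preadditive.comp_sum, key]
  simp only [monoidalComp, sum_whiskerRight, Preadditive.sum_comp, Preadditive.comp_sum,
    MonoidalLinear.smul_whiskerRight, Linear.smul_comp, Linear.comp_smul]

lemma cen_coact {W : A} (h : HalfBraiding W) : Cen h (indHb S W) (coact S h) := by
  intro B
  have h1 : B ◁ coact S h ≫ hb (indHb S W) B = ∑ j, S.sqrtDim j •
      ((∑ i, dim k (S.obj i) • (B ◁ coactOn h (η_ (S.obj i) (S.obj i)ᘁ) ≫ pass S B W i j)) ≫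
        indι S W j ▷ B) := by
    rw [hb_indHb, indγ]
    simp only [Preadditive.comp_sum, Linear.comp_smul, ← MonoidalCategory.whiskerLeft_comp_assoc,
      coact_indπ, MonoidalLinear.whiskerLeft_smul, Linear.smul_comp, smul_smul,
      Preadditive.sum_comp, Finset.smul_sum, Category.assoc]
    rw [Finset.sum_comm]
    refine Finset.sum_congr rfl fun j _ => Finset.sum_congr rfl fun i _ => ?_
    congr 1
    rw [← sqrtDim_mul_self]; ring
  rw [h1]
  simp only [sum_coactOn_pass]
  rw [coact]
  simp only [sum_whiskerRight, Preadditive.comp_sum, MonoidalLinear.smul_whiskerRight,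
    Linear.comp_smul, comp_whiskerRight, Category.assoc]

lemma coact_indMap {W W' : A} {h : HalfBraiding W} {h' : HalfBraiding W'} {f : W ⟶ W'}
    (hf : Cen h h' f) : coact S h ≫ indMap S f = f ≫ coact S h' := by
  rw [coact_eq, coact_eq]
  simp only [Preadditive.comp_sum, Preadditive.sum_comp, Linear.comp_smul, Linear.smul_comp]
  refine Finset.sum_congr rfl fun i _ => ?_
  congr 1
  rw [Category.assoc, ← ins_map, ← Category.assoc, ← Category.assoc]
  congr 1
  symm
  calc
    _ = 𝟙 _ ⊗≫ (𝟙_ A ◁ f ≫ η_ (S.obj i) (S.obj i)ᘁ ▷ W') ⊗≫ S.obj i ◁ hb h' (S.obj i)ᘁ := by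
      rw [coactOn]; monoidal
    _ = 𝟙 _ ⊗≫ η_ (S.obj i) (S.obj i)ᘁ ▷ W ⊗≫
        S.obj i ◁ ((S.obj i)ᘁ ◁ f ≫ hb h' (S.obj i)ᘁ) := by rw [whisker_exchange]; monoidal
    _ = _ := by rw [hf, coactOn]; monoidal

/-- The cup of colour `X_i` slides off `W` and becomes a free loop of value `d_i`; the second factor
`d_i` is the weight of that colour. -/
lemma coact_act {W : A} (h : HalfBraiding W) :
    coact S h ≫ act S h = (∑ i, dim k (S.obj i) ^ 2) • 𝟙 W := by
  rw [coact_eq, Preadditive.sum_comp, Finset.sum_smul]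
  refine Finset.sum_congr rfl fun i _ => ?_
  rw [Linear.smul_comp, Category.assoc, ins_act, sq, ← smul_smul]
  congr 1
  calc
    _ = (coactOn h (η_ (S.obj i) (S.obj i)ᘁ) ⊗≫ hb h (S.obj i) ▷ (S.obj i)ᘁ) ⊗≫
        W ◁ evR (S.obj i) ⊗≫ 𝟙 _ := by rw [actOn]; monoidal
    _ = 𝟙 _ ⊗≫ W ◁ rtrace (𝟙 (S.obj i)) ⊗≫ 𝟙 _ := by
      rw [coactOn_hb, rtrace]; monoidal
    _ = dim k (S.obj i) • (𝟙 _ ⊗≫ W ◁ 𝟙 (𝟙_ A) ⊗≫ 𝟙 W) := by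
      rw [← unitScalar_smul (k := k) (rtrace (𝟙 (S.obj i))), dim]; simp [monoidalComp]
    _ = _ := by congr 1; monoidal

end Action

section Averaging

variable {k : Type w} [Field k] [IsAlgClosed k]
  {A : Type u} [Category.{v} A] [Abelian A] [Linear k A] [MonoidalCategory A]
  [MonoidalPreadditive A] [MonoidalLinear k A] [BraidedCategory A] [RigidCategory A]
  [PivotalCategory A] [PremodularCategory k A] {ι : Type u₁} [Fintype ι]
  (S : SimpleData k A ι)

/-- The average of a morphism over the simple objects, which is a morphism in the center. -/
def avg {W W' : A} (h : HalfBraiding W) (h' : HalfBraiding W') (f : W ⟶ W') : W ⟶ W' :=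
  (S.sqrtGlobalDim ^ 2)⁻¹ • (coact S h ≫ indMap S f ≫ act S h')

lemma Cen.smul {W W' : A} {h : HalfBraiding W} {h' : HalfBraiding W'} {f : W ⟶ W'}
    (hf : Cen h h' f) (c : k) : Cen h h' (c • f) := by
  intro B
  simp only [MonoidalLinear.whiskerLeft_smul, MonoidalLinear.smul_whiskerRight, Linear.smul_comp,
    Linear.comp_smul, hf B]

lemma cen_avg {W W' : A} (h : HalfBraiding W) (h' : HalfBraiding W') (f : W ⟶ W') :
    Cen h h' (avg S h h' f) :=
  ((cen_coact S h).comp ((cen_indMap S f).comp (cen_act S h'))).smul _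

/-- Coaction and action are natural along central morphisms, so averaging is linear over central
morphisms on both sides (with `avg_comp`). Most later identities use only this and `avg_of_cen`. -/
lemma comp_avg {W W' W'' : A} {h : HalfBraiding W} {h' : HalfBraiding W'} {h'' : HalfBraiding W''}
    {g : W ⟶ W'} (hg : Cen h h' g) (f : W' ⟶ W'') :
    g ≫ avg S h' h'' f = avg S h h'' (g ≫ f) := by
  rw [avg, avg, Linear.comp_smul, indMap_comp, ← Category.assoc, ← coact_indMap S hg]
  simp only [Category.assoc]

lemma avg_comp {W W' W'' : A} {h : HalfBraiding W} {h' : HalfBraiding W'} {h'' : HalfBraiding W''}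
    (f : W ⟶ W') {g : W' ⟶ W''} (hg : Cen h' h'' g) :
    avg S h h' f ≫ g = avg S h h'' (f ≫ g) := by
  rw [avg, avg, Linear.smul_comp, indMap_comp]
  simp only [Category.assoc]
  rw [indMap_act S hg]

lemma sqrtGlobalDim_ne_zero [CharZero k] : S.sqrtGlobalDim ≠ 0 := by
  intro h
  apply globalDim_ne_zero S
  rw [← S.sqrtGlobalDim_sq, h]; simp

/-- A central `f` slides out between coaction and action, leaving the global dimension, which is
invertible. With `cen_avg` this makes averaging a projection onto the central morphisms. -/
lemma avg_of_cen [CharZero k] {W W' : A} {h : HalfBraiding W} {h' : HalfBraiding W'} {f : W ⟶ W'}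
    (hf : Cen h h' f) : avg S h h' f = f := by
  rw [avg, indMap_act S hf, ← Category.assoc, coact_act, Linear.smul_comp, Category.id_comp,
    smul_smul, S.sqrtGlobalDim_sq, inv_mul_cancel₀ (globalDim_ne_zero S), one_smul]

end Averaging

end

end ReducedTensor

namespace ReducedTensor

noncomputable section

/-! ### The two adjunctions between `I` and the forgetful functor -/

section Unit

variable {k : Type w} [Field k] [IsAlgClosed k]
  {A : Type u} [Category.{v} A] [Abelian A] [Linear k A] [MonoidalCategory A]
  [MonoidalPreadditive A] [MonoidalLinear k A] [BraidedCategory A] [RigidCategory A]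
  [PivotalCategory A] [PremodularCategory k A] {ι : Type u₁} [Fintype ι]
  (S : SimpleData k A ι)

/-- The inclusion `V ⟶ I(V)` of the summand of the unit object. -/
def ins₁ (V : A) : V ⟶ indObj S V := 𝟙 _ ⊗≫ ins S V (λ_ (𝟙_ A)).hom

lemma ins₁_indMap {V W : A} (f : V ⟶ W) : ins₁ S V ≫ indMap S f = f ≫ ins₁ S W := by
  calc
    _ = 𝟙 _ ⊗≫ (ins S V (λ_ (𝟙_ A)).hom ≫ indMap S f) := by rw [ins₁]; monoidal
    _ = _ := by rw [← ins_map, ins₁]; monoidal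

lemma ins₁_act {W : A} (h : HalfBraiding W) : ins₁ S W ≫ act S h = 𝟙 W := by
  calc
    _ = 𝟙 _ ⊗≫ (ins S W (λ_ (𝟙_ A)).hom ≫ act S h) := by rw [ins₁]; monoidal
    _ = _ := by rw [ins_act, actOn, hb_one]; monoidal

/-- The copy of `V` is the insertion of the trivial pairing, so after nesting only the pairing of
`B` remains. Thus `Γ` generates all of `I(V)` from this copy. -/
lemma whiskerLeft_ins₁_indγ (V : A) {B B' : A} (e : B ⊗ B' ⟶ 𝟙_ A)
    (cv : 𝟙_ A ⟶ B' ⊗ B) (hcv : B ◁ cv ⊗≫ e ▷ B = ⊗𝟙.hom) :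
    B ◁ ins₁ S V ≫ indγ S V B = 𝟙 _ ⊗≫ (B ⊗ V) ◁ cv ⊗≫ ins S V e ▷ B := by
  have h : ins S V (nest (λ_ (𝟙_ A)).hom e) =
      (ρ_ B).hom ▷ (V ⊗ 𝟙_ A ⊗ B') ≫ B ◁ V ◁ (λ_ B').hom ≫ ins S V e := by
    rw [ins_right, ins_left]; congr 1; rw [nest]; monoidal
  calc
    _ = 𝟙 _ ⊗≫ (B ◁ ins S V (λ_ (𝟙_ A)).hom ≫ indγ S V B) := by rw [ins₁]; monoidal
    _ = _ := by rw [whiskerLeft_ins_indγ V _ e cv hcv, wrap, h]; monoidal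

lemma indMap_ins₁_act (V : A) : indMap S (ins₁ S V) ≫ act S (indHb S V) = 𝟙 _ := by
  apply hom_ext_ins S
  intro i
  rw [← Category.assoc, ← ins_map, Category.assoc, ins_act, Category.comp_id]
  have hz := evR_coevL (S.obj i)
  have hc := coevL_evR_pairing (S.obj i)
  generalize evR (S.obj i) = q at hz hc ⊢
  generalize coevL (S.obj i) = c at hz hc ⊢
  generalize (S.obj i)ᘁ = X' at q c hz hc ⊢
  calc
    _ = 𝟙 _ ⊗≫ (S.obj i ◁ ins₁ S V ≫ indγ S V (S.obj i)) ▷ X' ⊗≫ indObj S V ◁ q ⊗≫ 𝟙 _ := by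
      rw [actOn, hb_indHb]; monoidal
    _ = 𝟙 _ ⊗≫ (S.obj i ⊗ V) ◁ c ▷ X' ⊗≫ (ins S V q ▷ (S.obj i ⊗ X') ≫ indObj S V ◁ q) ⊗≫
        𝟙 _ := by
      rw [whiskerLeft_ins₁_indγ S V q c hc]; monoidal
    _ = 𝟙 _ ⊗≫ (S.obj i ⊗ V) ◁ (c ▷ X' ⊗≫ X' ◁ q) ⊗≫ ins S V q ⊗≫ 𝟙 _ := by
      rw [← whisker_exchange]; monoidal
    _ = _ := by rw [hz]; monoidal

/-- The uniqueness half of the adjunction: the triangle identity `indMap_ins₁_act` recovers a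
central morphism from its restriction to `V`. -/
lemma hom_ext_ins₁ {V Z : A} {h : HalfBraiding Z} {f g : indObj S V ⟶ Z}
    (hf : Cen (indHb S V) h f) (hg : Cen (indHb S V) h g) (H : ins₁ S V ≫ f = ins₁ S V ≫ g) :
    f = g := by
  have key : ∀ {f : indObj S V ⟶ Z}, Cen (indHb S V) h f →
      f = indMap S (ins₁ S V ≫ f) ≫ act S h := by
    intro f hf
    rw [indMap_comp, Category.assoc, indMap_act S hf, ← Category.assoc, indMap_ins₁_act,
      Category.id_comp]
  rw [key hf, key hg, H]

end Unit

section Counit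

variable {k : Type w} [Field k] [IsAlgClosed k]
  {A : Type u} [Category.{v} A] [Abelian A] [Linear k A] [MonoidalCategory A]
  [MonoidalPreadditive A] [MonoidalLinear k A] [BraidedCategory A] [RigidCategory A]
  [PivotalCategory A] [PremodularCategory k A] {ι : Type u₁} [Fintype ι]
  (S : SimpleData k A ι)

/-- The morphism `B ⊗ V ⊗ B' ⟶ V` obtained by projecting `B` to the unit object. -/
def counitOn (k : Type w) [Field k] [IsAlgClosed k] [Linear k A] [MonoidalLinear k A]
    [PremodularCategory k A] (V : A) {B B' : A} (f : B ⊗ B' ⟶ 𝟙_ A) : B ⊗ V ⊗ B' ⟶ V :=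
  have : Simple (𝟙_ A) := PremodularCategory.simple_unit k
  ∑ a, (node k B (𝟙_ A) a ▷ (V ⊗ B') ⊗≫ V ◁ (dualNode k B (𝟙_ A) a ▷ B' ≫ f) ⊗≫ 𝟙 V)

lemma counitOn_isExtranatural (V : A) :
    IsExtranatural k (𝟭 A) V (counitOn k V) where
  left {B C C'} f g := by
    have : Simple (𝟙_ A) := PremodularCategory.simple_unit k
    change g ▷ (V ⊗ C') ≫ counitOn k V f = _
    obtain ⟨c, h1, h2⟩ := exists_node_coeff (k := k) (𝟙_ A) g
    simp only [counitOn, Preadditive.comp_sum]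
    have h3 : ∀ a, g ▷ (V ⊗ C') ≫ (node k C (𝟙_ A) a ▷ (V ⊗ C') ⊗≫
        V ◁ (dualNode k C (𝟙_ A) a ▷ C' ≫ f) ⊗≫ 𝟙 V) =
        (g ≫ node k C (𝟙_ A) a) ▷ (V ⊗ C') ⊗≫
        V ◁ (dualNode k C (𝟙_ A) a ▷ C' ≫ f) ⊗≫ 𝟙 V := by
      intro a; monoidal
    have h4 : ∀ b, node k B (𝟙_ A) b ▷ (V ⊗ C') ⊗≫
        V ◁ (dualNode k B (𝟙_ A) b ▷ C' ≫ g ▷ C' ≫ f) ⊗≫ 𝟙 V =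
        node k B (𝟙_ A) b ▷ (V ⊗ C') ⊗≫
        V ◁ ((dualNode k B (𝟙_ A) b ≫ g) ▷ C' ≫ f) ⊗≫ 𝟙 V := by
      intro b; monoidal
    simp only [h3, h4, h1, h2]
    simp only [monoidalComp, sum_whiskerRight, whiskerLeft_sum, Preadditive.sum_comp,
      Preadditive.comp_sum, MonoidalLinear.smul_whiskerRight, MonoidalLinear.whiskerLeft_smul,
      Linear.smul_comp, Linear.comp_smul]
    rw [Finset.sum_comm]
  right {B B' C'} f g := by
    have : Simple (𝟙_ A) := PremodularCategory.simple_unit k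
    change B ◁ V ◁ g ≫ counitOn k V f = _
    simp only [counitOn, Preadditive.comp_sum]
    refine Finset.sum_congr rfl fun a _ => ?_
    generalize node k B (𝟙_ A) a = φ
    generalize dualNode k B (𝟙_ A) a = ψ
    calc
      _ = 𝟙 _ ⊗≫ (B ◁ (V ◁ g) ≫ φ ▷ (V ⊗ C')) ⊗≫ V ◁ (ψ ▷ C' ≫ f) ⊗≫ 𝟙 V := by monoidal
      _ = 𝟙 _ ⊗≫ φ ▷ (V ⊗ B') ⊗≫ V ◁ ((𝟙_ A ◁ g ≫ ψ ▷ C') ≫ f) ⊗≫ 𝟙 V := by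
        rw [whisker_exchange]; monoidal
      _ = _ := by rw [whisker_exchange]; monoidal
  add f g := by
    simp [counitOn, monoidalComp, MonoidalPreadditive.whiskerLeft_add, Finset.sum_add_distrib]
  smul c f := by simp [counitOn, monoidalComp, Finset.smul_sum]

/-- The projection `I(V) ⟶ V` to the summand of the unit object. -/
def counit (V : A) : indObj S V ⟶ V := desc S (𝟭 A) V (counitOn k V)

lemma ins_counit (V : A) {B B' : A} (f : B ⊗ B' ⟶ 𝟙_ A) :
    ins S V f ≫ counit S V = counitOn k V f :=
  map_ins_desc S (𝟭 A) V (counitOn_isExtranatural V) f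

lemma counitOn_naturality {V W : A} (g : V ⟶ W) {B B' : A} (f : B ⊗ B' ⟶ 𝟙_ A) :
    B ◁ g ▷ B' ≫ counitOn k W f = counitOn k V f ≫ g := by
  have : Simple (𝟙_ A) := PremodularCategory.simple_unit k
  simp only [counitOn, Preadditive.comp_sum, Preadditive.sum_comp]
  refine Finset.sum_congr rfl fun a _ => ?_
  generalize node k B (𝟙_ A) a = φ
  generalize dualNode k B (𝟙_ A) a = ψ
  calc
    _ = 𝟙 _ ⊗≫ (B ◁ (g ▷ B') ≫ φ ▷ (W ⊗ B')) ⊗≫ W ◁ (ψ ▷ B' ≫ f) ⊗≫ 𝟙 _ := by monoidal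
    _ = 𝟙 _ ⊗≫ φ ▷ (V ⊗ B') ⊗≫ (g ▷ (𝟙_ A ⊗ B') ≫ W ◁ (ψ ▷ B' ≫ f)) ⊗≫ 𝟙 _ := by
      rw [whisker_exchange]; monoidal
    _ = _ := by rw [← whisker_exchange]; monoidal

lemma indMap_counit {V W : A} (g : V ⟶ W) : indMap S g ≫ counit S W = counit S V ≫ g := by
  apply hom_ext_ins S
  intro i
  rw [← Category.assoc, ← ins_map, Category.assoc, ins_counit, counitOn_naturality,
    ← Category.assoc, ins_counit]

variable (k) in
lemma dim_smul_sum_node_self (X : A) [Simple X] :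
    dim k X • ∑ a, node k X X a ≫ dualNode k X X a = 𝟙 X := by
  have h : Module.finrank k (X ⟶ X) = 1 := finrank_endomorphism_simple_eq_one k X
  have h1 : ∀ a, node k X X a ≫ dualNode k X X a = dualNode k X X a ≫ node k X X a := by
    intro a
    obtain ⟨c, hc⟩ := endomorphism_simple_eq_smul_id k (node k X X a)
    rw [← hc]; simp
  simp only [h1, Finset.smul_sum, dualNode_comp_node, if_pos]
  simp [h]

lemma ins₁_counit (V : A) : ins₁ S V ≫ counit S V = 𝟙 V := by
  have hs : Simple (𝟙_ A) := PremodularCategory.simple_unit k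
  have h := dim_smul_sum_node_self k (𝟙_ A)
  rw [dim_unit, one_smul] at h
  calc
    _ = 𝟙 _ ⊗≫ (ins S V (λ_ (𝟙_ A)).hom ≫ counit S V) := by rw [ins₁]; monoidal
    _ = 𝟙 _ ⊗≫ V ◁ (∑ a, node k (𝟙_ A) (𝟙_ A) a ≫ dualNode k (𝟙_ A) (𝟙_ A) a) ⊗≫ 𝟙 V := by
      rw [ins_counit, counitOn]
      simp only [monoidalComp, whiskerLeft_sum, Preadditive.sum_comp, Preadditive.comp_sum]
      refine Finset.sum_congr rfl fun a _ => ?_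
      generalize node k (𝟙_ A) (𝟙_ A) a = φ
      generalize dualNode k (𝟙_ A) (𝟙_ A) a = ψ
      obtain ⟨c, rfl⟩ := endomorphism_simple_eq_smul_id k φ
      simp only [MonoidalLinear.smul_whiskerRight, MonoidalLinear.whiskerLeft_smul,
        Linear.smul_comp, Linear.comp_smul]
      congr 1
      monoidal
    _ = _ := by rw [h]; monoidal

/-- Only the colour isomorphic to `𝟙` has a nonzero morphism to `𝟙`. For that colour the strand can
be contracted to nothing, with dimension and multiplicity both equal to `1`. -/
lemma coact_counit {W : A} (h : HalfBraiding W) : coact S h ≫ counit S W = 𝟙 W := by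
  have hs : Simple (𝟙_ A) := PremodularCategory.simple_unit k
  rw [coact_eq, Preadditive.sum_comp]
  have key : ∀ i, (dim k (S.obj i) • (coactOn h (η_ (S.obj i) (S.obj i)ᘁ) ≫
      ins S W (evR (S.obj i)))) ≫ counit S W =
      (dim k (S.obj i) * mult k (S.obj i) (𝟙_ A)) • 𝟙 W := by
    intro i
    have h1 : ∀ a, coactOn h (η_ (S.obj i) (S.obj i)ᘁ) ≫
        (node k (S.obj i) (𝟙_ A) a ▷ (W ⊗ (S.obj i)ᘁ) ⊗≫
        W ◁ (dualNode k (S.obj i) (𝟙_ A) a ▷ (S.obj i)ᘁ ≫ evR (S.obj i)) ⊗≫ 𝟙 W) = 𝟙 W := by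
      intro a
      -- By cyclicity this loop is the trace pairing of a basis vector with its own dual vector.
      have h2 : rtrace (node k (S.obj i) (𝟙_ A) a ≫ dualNode k (S.obj i) (𝟙_ A) a) = 𝟙 _ := by
        rw [rtrace_comm, ← unitScalar_smul (k := k) (rtrace _), tracePairing_node_dualNode,
          if_pos rfl, one_smul]
      generalize node k (S.obj i) (𝟙_ A) a = φ at h2 ⊢
      generalize dualNode k (S.obj i) (𝟙_ A) a = ψ at h2 ⊢
      calc
        _ = 𝟙 _ ⊗≫ η_ (S.obj i) (S.obj i)ᘁ ▷ W ⊗≫ (S.obj i ◁ hb h (S.obj i)ᘁ ≫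
            φ ▷ (W ⊗ (S.obj i)ᘁ)) ⊗≫ W ◁ (ψ ▷ (S.obj i)ᘁ ≫ evR (S.obj i)) ⊗≫ 𝟙 W := by
          rw [coactOn]; monoidal
        _ = 𝟙 _ ⊗≫ η_ (S.obj i) (S.obj i)ᘁ ▷ W ⊗≫ φ ▷ ((S.obj i)ᘁ ⊗ W : A) ⊗≫
            (hb h (S.obj i)ᘁ ≫ W ◁ ((λ_ _).inv ≫ ψ ▷ (S.obj i)ᘁ ≫ evR (S.obj i))) ⊗≫ 𝟙 W := by
          rw [whisker_exchange]; monoidal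
        _ = 𝟙 _ ⊗≫ (η_ (S.obj i) (S.obj i)ᘁ ≫ (φ ≫ ψ) ▷ (S.obj i)ᘁ ≫ evR (S.obj i)) ▷ W ⊗≫
            𝟙 _ := by
          rw [← hb_nat, hb_one]; monoidal
        _ = _ := by
          rw [← rtrace, h2]; monoidal
    rw [Linear.smul_comp, Category.assoc, ins_counit, counitOn, Preadditive.comp_sum]
    simp only [h1]
    simp [mul_smul, Nat.cast_smul_eq_nsmul]
  simp only [key]
  rw [← Finset.sum_smul]
  obtain ⟨o, ⟨e⟩⟩ := S.exists_iso (𝟙_ A) hs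
  rw [Finset.sum_eq_single o]
  · rw [show mult k (S.obj o) (𝟙_ A) = 1 from
      (finrank_hom_simple_simple_eq_one_iff k _ _).2 ⟨e.symm⟩, ← dim_of_iso k e, dim_unit]
    simp
  · intro j _ hj
    rw [show mult k (S.obj j) (𝟙_ A) = 0 from
      (finrank_hom_simple_simple_eq_zero_iff k _ _).2
        ⟨fun e' => hj (S.eq_of_iso _ _ ⟨e' ≪≫ e⟩)⟩]
    simp
  · simp

lemma ins₁_indγ_counit (V B : A) [Simple (𝟙_ A)] : B ◁ ins₁ S V ≫ indγ S V B ≫ counit S V ▷ B =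
    ∑ a, (node k B (𝟙_ A) a ▷ V ⊗≫ V ◁ dualNode k B (𝟙_ A) a) := by
  rw [← Category.assoc, whiskerLeft_ins₁_indγ S V _ _ (coevL_evR_pairing B)]
  have hc := coevL_evR_pairing B
  generalize evR B = e at hc ⊢
  generalize coevL B = c at hc ⊢
  generalize (Bᘁ : A) = B' at e c hc ⊢
  calc
    _ = 𝟙 _ ⊗≫ (B ⊗ V) ◁ c ⊗≫ (ins S V e ≫ counit S V) ▷ B := by monoidal
    _ = ∑ a, (𝟙 _ ⊗≫ (B ⊗ V) ◁ c ⊗≫ (node k B (𝟙_ A) a ▷ (V ⊗ B') ⊗≫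
          V ◁ (dualNode k B (𝟙_ A) a ▷ B' ≫ e) ⊗≫ 𝟙 V) ▷ B) := by
      rw [ins_counit, counitOn]
      simp only [monoidalComp, sum_whiskerRight, Preadditive.comp_sum]
    _ = _ := by
      refine Finset.sum_congr rfl fun a _ => ?_
      generalize node k B (𝟙_ A) a = φ
      generalize dualNode k B (𝟙_ A) a = ψ
      calc
        _ = 𝟙 _ ⊗≫ (B ◁ (V ◁ c) ≫ φ ▷ (V ⊗ B' ⊗ B)) ⊗≫ V ◁ (ψ ▷ B' ≫ e) ▷ B ⊗≫ 𝟙 _ := by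
          monoidal
        _ = 𝟙 _ ⊗≫ φ ▷ V ⊗≫ V ◁ (𝟙_ A ◁ c ≫ ψ ▷ (B' ⊗ B)) ⊗≫ V ◁ e ▷ B ⊗≫ 𝟙 _ := by
          rw [whisker_exchange]; monoidal
        _ = 𝟙 _ ⊗≫ φ ▷ V ⊗≫ V ◁ ψ ⊗≫ V ◁ (B ◁ c ⊗≫ e ▷ B) ⊗≫ 𝟙 _ := by
          rw [whisker_exchange]; monoidal
        _ = _ := by rw [hc]; monoidal

lemma exists_ins_eq_smul_ins₁ (V : A) (f : 𝟙_ A ⊗ 𝟙_ A ⟶ 𝟙_ A) :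
    ∃ c : k, 𝟙 V ⊗≫ ins S V f = c • ins₁ S V := by
  have hs : Simple (𝟙_ A) := PremodularCategory.simple_unit k
  obtain ⟨c, hc⟩ := endomorphism_simple_eq_smul_id k ((λ_ (𝟙_ A)).inv ≫ f)
  refine ⟨c, ?_⟩
  rw [Iso.eq_inv_comp, Linear.comp_smul, Category.comp_id] at hc
  rw [← hc, ins_smul, ins₁]
  simp [monoidalComp]

/-- Restricted to `V`, each term factors through insertions of pairings on `𝟙 ⊗ 𝟙`, so the central
composite is a scalar. The scalar is not computed from the sum: composing with `counit` and applying
`coact_counit` identifies it. -/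
lemma coact_indMap_counit (V : A) : coact S (indHb S V) ≫ indMap S (counit S V) = 𝟙 _ := by
  have hs : Simple (𝟙_ A) := PremodularCategory.simple_unit k
  obtain ⟨c, hc⟩ : ∃ c : k, ins₁ S V ≫ coact S (indHb S V) ≫ indMap S (counit S V) =
      c • ins₁ S V := by
    have key : ∀ i a, ∃ c : k, 𝟙 _ ⊗≫ η_ (S.obj i) (S.obj i)ᘁ ▷ V ⊗≫
        S.obj i ◁ (node k ((S.obj i)ᘁ : A) (𝟙_ A) a ▷ V ⊗≫
          V ◁ dualNode k ((S.obj i)ᘁ : A) (𝟙_ A) a) ≫ ins S V (evR (S.obj i)) =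
        c • ins₁ S V := by
      intro i a
      generalize node k ((S.obj i)ᘁ : A) (𝟙_ A) a = φ
      generalize dualNode k ((S.obj i)ᘁ : A) (𝟙_ A) a = ψ
      obtain ⟨c, hc⟩ := exists_ins_eq_smul_ins₁ S V
        ((η_ (S.obj i) (S.obj i)ᘁ ≫ S.obj i ◁ φ ≫ (ρ_ _).hom) ▷ 𝟙_ A ≫
          S.obj i ◁ ψ ≫ evR (S.obj i))
      refine ⟨c, ?_⟩
      rw [← hc, ← ins_left, ← ins_right]
      monoidal
    choose c hc using key
    refine ⟨∑ i, dim k (S.obj i) * ∑ a, c i a, ?_⟩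
    rw [coact_eq, Preadditive.sum_comp, Preadditive.comp_sum, Finset.sum_smul]
    refine Finset.sum_congr rfl fun i _ => ?_
    rw [Linear.smul_comp, Linear.comp_smul, mul_smul, Finset.sum_smul]
    congr 1
    simp only [← hc]
    rw [Category.assoc, ← ins_map]
    calc
      _ = 𝟙 _ ⊗≫ (𝟙_ A ◁ ins₁ S V ≫ η_ (S.obj i) (S.obj i)ᘁ ▷ indObj S V) ⊗≫
          S.obj i ◁ (indγ S V (S.obj i)ᘁ ≫ counit S V ▷ (S.obj i)ᘁ) ⊗≫
          ins S V (evR (S.obj i)) := by rw [coactOn, hb_indHb]; monoidal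
      _ = 𝟙 _ ⊗≫ η_ (S.obj i) (S.obj i)ᘁ ▷ V ⊗≫
          S.obj i ◁ ((S.obj i)ᘁ ◁ ins₁ S V ≫ indγ S V (S.obj i)ᘁ ≫ counit S V ▷ (S.obj i)ᘁ) ≫
          ins S V (evR (S.obj i)) := by rw [whisker_exchange]; monoidal
      _ = _ := by
        rw [ins₁_indγ_counit]
        simp only [monoidalComp, whiskerLeft_sum, Preadditive.sum_comp, Preadditive.comp_sum]
  have h1 : coact S (indHb S V) ≫ indMap S (counit S V) = c • 𝟙 _ := by
    refine hom_ext_ins₁ S ((cen_coact S _).comp (cen_indMap S _)) ((Cen.id _).smul c) ?_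
    rw [hc]; simp
  have h2 := congrArg (fun t => t ≫ counit S V) h1
  simp only [Category.assoc] at h2
  rw [indMap_counit, ← Category.assoc, coact_counit, Category.id_comp] at h2
  have h3 := congrArg (fun t => ins₁ S V ≫ t) h2
  simp only [ins₁_counit, Linear.smul_comp, Linear.comp_smul, Category.id_comp] at h3
  -- Only `ins₁ = c • ins₁` is obtained and not `c = 1`, since `V` may be zero.
  have h4 := congrArg (fun t => t ≫ ins₁ S V) h3
  simp only [Linear.smul_comp, Category.id_comp] at h4
  refine hom_ext_ins₁ S ((cen_coact S _).comp (cen_indMap S _)) (Cen.id _) ?_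
  rw [hc, ← h4, Category.comp_id]

end Counit

end

end ReducedTensor

namespace ReducedTensor

noncomputable section

/-! ### Retracts, loops around two strands and the projection `Q` -/

section Retract

variable {A : Type u} [Category.{v} A] [MonoidalCategory A]

/-- Centrality of the idempotent is needed only for multiplicativity, where the idempotent between
the two crossings is moved through one of them and absorbed. -/
lemma cen_retract_isLaxBraiding {X R : A} {h : HalfBraiding X} {i : R ⟶ X} {p : X ⟶ R}
    (hip : i ≫ p = 𝟙 R) (hpi : Cen h h (p ≫ i)) :
    IsLaxBraiding (fun B => B ◁ i ≫ hb h B ≫ p ▷ B) where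
  naturality {B C} f := by
    rw [← whisker_exchange_assoc, reassoc_of% ((hb_isLaxBraiding h).naturality f)]
    simp only [Category.assoc, whisker_exchange]
  tensor B C := by
    have h1 : B ◁ (p ≫ i) ≫ hb h B = hb h B ≫ (p ≫ i) ▷ B := hpi B
    calc
      _ = 𝟙 _ ⊗≫ B ◁ (C ◁ i ≫ hb h C) ⊗≫ (hb h B ≫ (p ≫ i ≫ p) ▷ B) ▷ C ⊗≫ 𝟙 _ := by
        rw [(hb_isLaxBraiding h).tensor, hip, Category.comp_id]; monoidal
      _ = 𝟙 _ ⊗≫ B ◁ (C ◁ i ≫ hb h C) ⊗≫ (hb h B ≫ (p ≫ i) ▷ B ≫ p ▷ B) ▷ C ⊗≫ 𝟙 _ := by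
        rw [← Category.assoc p i p, comp_whiskerRight (p ≫ i) p]
      _ = _ := by rw [← reassoc_of% h1]; monoidal
  unit := by
    rw [(hb_isLaxBraiding h).unit]
    calc
      _ = 𝟙 _ ⊗≫ (i ≫ p) ⊗≫ 𝟙 _ := by monoidal
      _ = _ := by rw [hip]; monoidal

/-- The half-braiding of a retract that is cut out by an idempotent in the center. -/
def retractHb [RightRigidCategory A] {X R : A} {h : HalfBraiding X} {i : R ⟶ X} {p : X ⟶ R}
    (hip : i ≫ p = 𝟙 R) (hpi : Cen h h (p ≫ i)) : HalfBraiding R :=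
  (cen_retract_isLaxBraiding hip hpi).halfBraiding

variable [RightRigidCategory A] {X R : A} {h : HalfBraiding X} {i : R ⟶ X} {p : X ⟶ R}
  (hip : i ≫ p = 𝟙 R) (hpi : Cen h h (p ≫ i))

lemma hb_retractHb (B : A) : hb (retractHb hip hpi) B = B ◁ i ≫ hb h B ≫ p ▷ B := rfl

lemma cen_retract_incl : Cen (retractHb hip hpi) h i := by
  intro B
  have := hpi B
  rw [hb_retractHb, Category.assoc, Category.assoc, ← comp_whiskerRight, ← this,
    ← MonoidalCategory.whiskerLeft_comp_assoc, reassoc_of% hip]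

lemma cen_retract_proj : Cen h (retractHb hip hpi) p := by
  intro B
  have := hpi B
  rw [hb_retractHb, ← MonoidalCategory.whiskerLeft_comp_assoc, reassoc_of% this,
    ← comp_whiskerRight, Category.assoc, hip, Category.comp_id]

end Retract

section Braided

variable {k : Type w} [Field k] [IsAlgClosed k]
  {A : Type u} [Category.{v} A] [Abelian A] [Linear k A] [MonoidalCategory A]
  [MonoidalPreadditive A] [MonoidalLinear k A] [BraidedCategory A] [RigidCategory A]
  [PivotalCategory A] [PremodularCategory k A] {ι : Type u₁} [Fintype ι]
  (S : SimpleData k A ι)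

/-- The half-braiding of `X ⊗ Y` in which a strand crosses `X` by the half-braiding and passes
over `Y`. -/
def tensOver {X : A} (h : HalfBraiding X) (Y : A) : HalfBraiding (X ⊗ Y) := tens h (overHb Y)

/-- The half-braiding of `X ⊗ Y` in which a strand passes under `X` and crosses `Y` by the
half-braiding. -/
def tensUnder (X : A) {Y : A} (h : HalfBraiding Y) : HalfBraiding (X ⊗ Y) := tens (underHb X) h

lemma hb_tensOver {X : A} (h : HalfBraiding X) (Y B : A) : hb (tensOver h Y) B =
    𝟙 _ ⊗≫ hb h B ▷ Y ⊗≫ X ◁ (β_ Y B).inv ⊗≫ 𝟙 _ := by rw [tensOver, hb_tens, hb_over]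

lemma hb_tensUnder (X : A) {Y : A} (h : HalfBraiding Y) (B : A) : hb (tensUnder X h) B =
    𝟙 _ ⊗≫ (β_ B X).hom ▷ Y ⊗≫ X ◁ hb h B ⊗≫ 𝟙 _ := by rw [tensUnder, hb_tens, hb_under]

lemma actOn_eq {W : A} (h : HalfBraiding W) {B B' : A} (e : B ⊗ B' ⟶ 𝟙_ A) :
    B ◁ hb h B' ⊗≫ actOn h e = 𝟙 _ ⊗≫ e ▷ W ⊗≫ 𝟙 _ := by
  have := (hb_isLaxBraiding h).pairing e
  calc
    _ = (𝟙 _ ⊗≫ B ◁ hb h B' ⊗≫ hb h B ▷ B' ⊗≫ W ◁ e) ⊗≫ 𝟙 _ := by rw [actOn]; monoidal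
    _ = _ := by rw [this]; monoidal

/-- A cap passing over `Y` slides off it, so the crossing of `B` can be exchanged for the inverse
crossing of `B'`. This brings actions into the shape of `loopBot`; `coactOn_underHb` does the same
for `loopTop`. -/
lemma actOn_overHb (Y : A) {B B' : A} (e : B ⊗ B' ⟶ 𝟙_ A) :
    actOn (overHb Y) e = B ◁ (β_ Y B').hom ⊗≫ e ▷ Y ⊗≫ 𝟙 _ := by
  have := actOn_eq (overHb Y) e
  calc
    _ = B ◁ (β_ Y B').hom ⊗≫ (B ◁ hb (overHb Y) B' ⊗≫ actOn (overHb Y) e) := by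
      have h : (β_ Y B').hom ≫ hb (overHb Y) B' = 𝟙 _ := Iso.hom_inv_id _
      calc
        _ = B ◁ ((β_ Y B').hom ≫ hb (overHb Y) B') ⊗≫ actOn (overHb Y) e := by rw [h]; monoidal
        _ = _ := by monoidal
    _ = _ := by rw [this]; monoidal

lemma coactOn_underHb (X : A) {B B' : A} (c : 𝟙_ A ⟶ B ⊗ B') :
    coactOn (underHb X) c = 𝟙 _ ⊗≫ X ◁ c ⊗≫ (β_ B X).inv ▷ B' ⊗≫ 𝟙 _ := by
  have := coactOn_hb (underHb X) c
  calc
    _ = (coactOn (underHb X) c ⊗≫ hb (underHb X) B ▷ B') ⊗≫ (β_ B X).inv ▷ B' ⊗≫ 𝟙 _ := by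
      have h : hb (underHb X) B ≫ (β_ B X).inv = 𝟙 _ := Iso.hom_inv_id _
      symm
      calc
        _ = coactOn (underHb X) c ⊗≫ (hb (underHb X) B ≫ (β_ B X).inv) ▷ B' ⊗≫ 𝟙 _ := by
          monoidal
        _ = _ := by rw [h]; monoidal
    _ = _ := by rw [this]; monoidal

lemma actOn_tens {X Y : A} (h : HalfBraiding X) (h' : HalfBraiding Y) {B B' : A}
    (e : B ⊗ B' ⟶ 𝟙_ A) :
    actOn (tens h h') e = 𝟙 _ ⊗≫ hb h B ▷ (Y ⊗ B') ⊗≫ X ◁ actOn h' e := by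
  rw [actOn, actOn, hb_tens]; monoidal

lemma coactOn_tens {X Y : A} (h : HalfBraiding X) (h' : HalfBraiding Y) {B B' : A}
    (c : 𝟙_ A ⟶ B ⊗ B') :
    coactOn (tens h h') c = 𝟙 _ ⊗≫ coactOn h c ▷ Y ⊗≫ (B ⊗ X) ◁ hb h' B' ⊗≫ 𝟙 _ := by
  rw [coactOn, coactOn, hb_tens]; monoidal

lemma actOn_tensOver {X : A} (h : HalfBraiding X) (Y : A) {B B' : A} (e : B ⊗ B' ⟶ 𝟙_ A) :
    actOn (tensOver h Y) e = 𝟙 _ ⊗≫ (B ⊗ X) ◁ (β_ Y B').hom ⊗≫ actOn h e ▷ Y := by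
  calc
    _ = 𝟙 _ ⊗≫ (hb h B ▷ (Y ⊗ B') ≫ (X ⊗ B) ◁ (β_ Y B').hom) ⊗≫ X ◁ e ▷ Y ⊗≫ 𝟙 _ := by
      rw [tensOver, actOn_tens, actOn_overHb]; monoidal
    _ = _ := by rw [← whisker_exchange, actOn]; monoidal

lemma coactOn_tensOver {X : A} (h : HalfBraiding X) (Y : A) {B B' : A} (c : 𝟙_ A ⟶ B ⊗ B') :
    coactOn (tensOver h Y) c = coactOn h c ▷ Y ⊗≫ (B ⊗ X) ◁ (β_ Y B').inv ⊗≫ 𝟙 _ := by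
  rw [tensOver, coactOn_tens, hb_over]; monoidal

lemma actOn_tensUnder (X : A) {Y : A} (h : HalfBraiding Y) {B B' : A} (e : B ⊗ B' ⟶ 𝟙_ A) :
    actOn (tensUnder X h) e = 𝟙 _ ⊗≫ (β_ B X).hom ▷ (Y ⊗ B') ⊗≫ X ◁ actOn h e := by
  rw [tensUnder, actOn_tens, hb_under]

lemma coactOn_tensUnder (X : A) {Y : A} (h : HalfBraiding Y) {B B' : A} (c : 𝟙_ A ⟶ B ⊗ B') :
    coactOn (tensUnder X h) c = X ◁ coactOn h c ⊗≫ (β_ B X).inv ▷ (Y ⊗ B') ⊗≫ 𝟙 _ := by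
  calc
    _ = 𝟙 _ ⊗≫ X ◁ c ▷ Y ⊗≫ ((β_ B X).inv ▷ (B' ⊗ Y) ≫ (B ⊗ X) ◁ hb h B') ⊗≫ 𝟙 _ := by
      rw [tensUnder, coactOn_tens, coactOn_underHb]; monoidal
    _ = _ := by rw [← whisker_exchange, coactOn]; monoidal

end Braided

section AverageWhisker

variable {k : Type w} [Field k] [IsAlgClosed k]
  {A : Type u} [Category.{v} A] [Abelian A] [Linear k A] [MonoidalCategory A]
  [MonoidalPreadditive A] [MonoidalLinear k A] [BraidedCategory A] [RigidCategory A]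
  [PivotalCategory A] [PremodularCategory k A] {ι : Type u₁} [Fintype ι]
  (S : SimpleData k A ι)

lemma avg_eq {W W' : A} (h : HalfBraiding W) (h' : HalfBraiding W') (f : W ⟶ W') :
    avg S h h' f = (S.sqrtGlobalDim ^ 2)⁻¹ • ∑ i, dim k (S.obj i) •
      (coactOn h (η_ (S.obj i) (S.obj i)ᘁ) ≫ S.obj i ◁ f ▷ (S.obj i)ᘁ ≫
        actOn h' (evR (S.obj i))) := by
  rw [avg, coact_eq, Preadditive.sum_comp]
  congr 1
  refine Finset.sum_congr rfl fun i _ => ?_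
  rw [Linear.smul_comp, Category.assoc, ← Category.assoc (ins _ _ _), ← ins_map, Category.assoc,
    ins_act]

/-- The averaging loop passes over `Z` in both its halves, so the crossings of its right strand with
`Z` cancel and the loop shrinks to one around `W`. -/
lemma avg_whiskerRight {W W' : A} (h : HalfBraiding W) (h' : HalfBraiding W') (f : W ⟶ W')
    (Z : A) : avg S (tensOver h Z) (tensOver h' Z) (f ▷ Z) = avg S h h' f ▷ Z := by
  rw [avg_eq, avg_eq, MonoidalLinear.smul_whiskerRight, sum_whiskerRight]
  congr 1
  refine Finset.sum_congr rfl fun i _ => ?_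
  rw [MonoidalLinear.smul_whiskerRight]
  congr 1
  rw [coactOn_tensOver, actOn_tensOver]
  calc
    _ = coactOn h (η_ (S.obj i) (S.obj i)ᘁ) ▷ Z ⊗≫ ((S.obj i ⊗ W) ◁ (β_ Z (S.obj i)ᘁ).inv ≫
          (S.obj i ◁ f) ▷ (Z ⊗ (S.obj i)ᘁ)) ⊗≫ (S.obj i ⊗ W') ◁ (β_ Z (S.obj i)ᘁ).hom ⊗≫
          actOn h' (evR (S.obj i)) ▷ Z := by monoidal
    _ = coactOn h (η_ (S.obj i) (S.obj i)ᘁ) ▷ Z ⊗≫ (S.obj i ◁ f) ▷ ((S.obj i)ᘁ ⊗ Z) ⊗≫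
          (S.obj i ⊗ W') ◁ ((β_ Z (S.obj i)ᘁ).inv ≫ (β_ Z (S.obj i)ᘁ).hom) ⊗≫
          actOn h' (evR (S.obj i)) ▷ Z := by rw [whisker_exchange]; monoidal
    _ = _ := by rw [Iso.inv_hom_id]; monoidal

lemma avg_whiskerLeft {W W' : A} (h : HalfBraiding W) (h' : HalfBraiding W') (f : W ⟶ W')
    (X : A) : avg S (tensUnder X h) (tensUnder X h') (X ◁ f) = X ◁ avg S h h' f := by
  rw [avg_eq, avg_eq, MonoidalLinear.whiskerLeft_smul, whiskerLeft_sum]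
  congr 1
  refine Finset.sum_congr rfl fun i _ => ?_
  rw [MonoidalLinear.whiskerLeft_smul]
  congr 1
  rw [coactOn_tensUnder, actOn_tensUnder]
  calc
    _ = X ◁ coactOn h (η_ (S.obj i) (S.obj i)ᘁ) ⊗≫ ((β_ (S.obj i) X).inv ▷ (W ⊗ (S.obj i)ᘁ) ≫
          (S.obj i ⊗ X) ◁ (f ▷ (S.obj i)ᘁ)) ⊗≫ (β_ (S.obj i) X).hom ▷ (W' ⊗ (S.obj i)ᘁ) ⊗≫
          X ◁ actOn h' (evR (S.obj i)) := by monoidal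
    _ = X ◁ coactOn h (η_ (S.obj i) (S.obj i)ᘁ) ⊗≫ (X ⊗ S.obj i) ◁ (f ▷ (S.obj i)ᘁ) ⊗≫
          ((β_ (S.obj i) X).inv ≫ (β_ (S.obj i) X).hom) ▷ (W' ⊗ (S.obj i)ᘁ) ⊗≫
          X ◁ actOn h' (evR (S.obj i)) := by rw [← whisker_exchange]; monoidal
    _ = _ := by rw [Iso.inv_hom_id]; monoidal

end AverageWhisker

section Projection

variable {k : Type w} [Field k] [IsAlgClosed k]
  {A : Type u} [Category.{v} A] [Abelian A] [Linear k A] [MonoidalCategory A]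
  [MonoidalPreadditive A] [MonoidalLinear k A] [BraidedCategory A] [RigidCategory A]
  [PivotalCategory A] [PremodularCategory k A] {ι : Type u₁} [Fintype ι]
  (S : SimpleData k A ι)

lemma loopTop_eq (X Y : ZCenter A) (i : ι) : loopTop S X Y i =
    coactOn (tensUnder X.obj Y.halfBraiding) (η_ (S.obj i) (S.obj i)ᘁ) := by
  rw [loopTop, tensUnder, coactOn_tens, coactOn_underHb]
  change 𝟙 _ ⊗≫ _ ⊗≫ _ ⊗≫ _ ◁ hb Y.halfBraiding _ ⊗≫ _ = _
  monoidal

lemma loopBot_eq (X Y : ZCenter A) (i : ι) : loopBot S X Y i =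
    actOn (tensOver X.halfBraiding Y.obj) (evR (S.obj i)) := by
  rw [loopBot, tensOver, actOn_tens, actOn_overHb]
  change 𝟙 _ ⊗≫ hb X.halfBraiding _ ▷ _ ⊗≫ _ = _
  monoidal

/-- The upper half of the loop is the coaction for one half-braiding of `X ⊗ Y`, and the lower half
is the action for the other. -/
lemma redProj_eq (X Y : ZCenter A) : redProj S X Y =
    avg S (tensUnder X.obj Y.halfBraiding) (tensOver X.halfBraiding Y.obj) (𝟙 _) := by
  rw [avg_eq, redProj]
  simp only [loopTop_eq, loopBot_eq]
  simp

/-- The prescribed formula is `Γ` sandwiched between coaction and action. Centrality of the action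
turns `Γ` into an ordinary half-braiding, preceded by the projection. -/
lemma redγ_eq (X Y : ZCenter A) (B : A) : redγ S X Y B =
    B ◁ redProj S X Y ≫ hb (tensOver X.halfBraiding Y.obj) B := by
  have h : redγ S X Y B = (S.sqrtGlobalDim ^ 2)⁻¹ •
      (B ◁ coact S (tensUnder X.obj Y.halfBraiding) ≫ indγ S (X.obj ⊗ Y.obj) B ≫
        act S (tensOver X.halfBraiding Y.obj) ▷ B) := by
    rw [redγ, indγ]
    congr 1
    simp only [Preadditive.comp_sum, Linear.comp_smul, Linear.smul_comp, Preadditive.sum_comp,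
      ← MonoidalCategory.whiskerLeft_comp_assoc, coact_indπ, Category.assoc, ← comp_whiskerRight,
      indι_act, MonoidalLinear.whiskerLeft_smul, MonoidalLinear.smul_whiskerRight, smul_smul,
      loopTop_eq, loopBot_eq]
    refine Finset.sum_congr rfl fun i _ => Finset.sum_congr rfl fun j _ => ?_
    congr 1
    rw [← sqrtDim_mul_self, ← sqrtDim_mul_self]; ring
  have h1 := cen_act S (tensOver X.halfBraiding Y.obj) B
  rw [hb_indHb] at h1
  rw [h, ← h1, redProj_eq, avg, indMap_id, Category.id_comp, MonoidalLinear.whiskerLeft_smul,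
    Linear.smul_comp, MonoidalCategory.whiskerLeft_comp, Category.assoc]

/-- The projection of `X ⊗ Y` whose image is the reduced tensor product. -/
def rproj {X Y : A} (h : HalfBraiding X) (h' : HalfBraiding Y) : X ⊗ Y ⟶ X ⊗ Y :=
  avg S (tensUnder X h') (tensOver h Y) (𝟙 _)

variable {X Y : A} (h : HalfBraiding X) (h' : HalfBraiding Y)

lemma cen_rproj_under_over : Cen (tensUnder X h') (tensOver h Y) (rproj S h h') := cen_avg S _ _ _

lemma Cen.sum {J : Type*} (s : Finset J) {W W' : A} {h : HalfBraiding W} {h' : HalfBraiding W'}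
    {f : J → (W ⟶ W')} (hf : ∀ a ∈ s, Cen h h' (f a)) : Cen h h' (∑ a ∈ s, f a) := by
  intro B
  rw [whiskerLeft_sum, sum_whiskerRight, Preadditive.comp_sum, Preadditive.sum_comp]
  exact Finset.sum_congr rfl fun a ha => hf a ha B

end Projection

end

end ReducedTensor

namespace ReducedTensor

noncomputable section

/-! ### Centrality of `Q`, the reduced tensor product and triple products -/

section ProjectionCentral

variable {k : Type w} [Field k] [IsAlgClosed k]
  {A : Type u} [Category.{v} A] [Abelian A] [Linear k A] [MonoidalCategory A]
  [MonoidalPreadditive A] [MonoidalLinear k A] [BraidedCategory A] [RigidCategory A]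
  [PivotalCategory A] [PremodularCategory k A] {ι : Type u₁} [Fintype ι]
  (S : SimpleData k A ι)

variable {X Y : A} (h : HalfBraiding X) (h' : HalfBraiding Y)

lemma Cen.of_eq {X Y : A} {h : HalfBraiding X} {h' : HalfBraiding Y} {f g : X ⟶ Y} (he : f = g)
    (hg : Cen h h' g) : Cen h h' f := he ▸ hg

lemma Cen.ofOver_tens {V P Q R : A} (f : V ⟶ P ⊗ Q ⊗ R) :
    Cen (overHb V) (tens (overHb P) (tens (overHb Q) (overHb R))) f := by
  rw [tens_over_over, tens_over_over]; exact Cen.ofOver f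

lemma Cen.tens_ofOver {V P Q R : A} (f : P ⊗ Q ⊗ R ⟶ V) :
    Cen (tens (overHb P) (tens (overHb Q) (overHb R))) (overHb V) f := by
  rw [tens_over_over, tens_over_over]; exact Cen.ofOver f

lemma Cen.ofUnder_tens {V P Q R : A} (f : V ⟶ P ⊗ Q ⊗ R) :
    Cen (underHb V) (tens (underHb P) (tens (underHb Q) (underHb R))) f := by
  rw [tens_under_under, tens_under_under]; exact Cen.ofUnder f

lemma Cen.tens_ofUnder {V P Q R : A} (f : P ⊗ Q ⊗ R ⟶ V) :
    Cen (tens (underHb P) (tens (underHb Q) (underHb R))) (underHb V) f := by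
  rw [tens_under_under, tens_under_under]; exact Cen.ofUnder f

/-- The part of the loop that involves the half-braiding of `Y` lies entirely below the moving
strand, and the crossing of `B` with `X` is central by Yang–Baxter. Note that the coaction is the
one for `tensUnder`, while compatibility is with `tensOver`. -/
lemma cen_coactOn_over {B B' : A} (c : 𝟙_ A ⟶ B ⊗ B') :
    Cen (tensOver h Y) (tens (overHb B) (tens (tensOver h Y) (overHb B')))
      (coactOn (tensUnder X h') c) := by
  have := (Cen.whiskerLeft h (Cen.ofOver_tens (coactOn h' c))).comp
    ((Cen.associator_inv h (overHb B) (tens (overHb Y) (overHb B'))).comp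
    (((Cen.over_hb h B).whiskerRight (tens (overHb Y) (overHb B'))).comp
    ((Cen.associator (overHb B) h (tens (overHb Y) (overHb B'))).comp
    (Cen.whiskerLeft (overHb B) (Cen.associator_inv h (overHb Y) (overHb B'))))))
  rw [coactOn_tensUnder]
  refine Cen.of_eq ?_ this
  rw [hb_over]
  monoidal

lemma cen_actOn_over {B B' : A} (e : B ⊗ B' ⟶ 𝟙_ A) :
    Cen (tens (overHb B) (tens (tensOver h Y) (overHb B'))) (tensOver h Y)
      (actOn (tensOver h Y) e) := by
  have := (Cen.whiskerLeft (overHb B) (Cen.associator h (overHb Y) (overHb B'))).comp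
    ((Cen.associator_inv (overHb B) h (tens (overHb Y) (overHb B'))).comp
    (((Cen.hb_over h B).whiskerRight (tens (overHb Y) (overHb B'))).comp
    ((Cen.associator h (overHb B) (tens (overHb Y) (overHb B'))).comp
    (Cen.whiskerLeft h (Cen.tens_ofOver (actOn (overHb Y) e))))))
  have h1 : actOn (tensOver h Y) e = actOn (tens h (overHb Y)) e := rfl
  rw [h1, actOn_tens]
  refine Cen.of_eq ?_ this
  monoidal

lemma cen_coactOn_under {B B' : A} (c : 𝟙_ A ⟶ B ⊗ B') :
    Cen (tensUnder X h') (tens (underHb B) (tens (tensUnder X h') (underHb B')))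
      (coactOn (tensUnder X h') c) := by
  have := ((Cen.ofUnder_tens (coactOn (underHb X) c)).whiskerRight h').comp
    ((Cen.associator (underHb B) (tens (underHb X) (underHb B')) h').comp
    ((Cen.whiskerLeft (underHb B) (Cen.associator (underHb X) (underHb B') h')).comp
    ((Cen.whiskerLeft (underHb B) (Cen.whiskerLeft (underHb X) (Cen.hb_under h' B'))).comp
    (Cen.whiskerLeft (underHb B) (Cen.associator_inv (underHb X) h' (underHb B'))))))
  have h1 : coactOn (tensUnder X h') c = coactOn (tens (underHb X) h') c := rfl
  rw [h1, coactOn_tens]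
  refine Cen.of_eq ?_ this
  monoidal

lemma cen_actOn_under {B B' : A} (e : B ⊗ B' ⟶ 𝟙_ A) :
    Cen (tens (underHb B) (tens (tensUnder X h') (underHb B'))) (tensUnder X h')
      (actOn (tensOver h Y) e) := by
  have := (Cen.whiskerLeft (underHb B) (Cen.associator (underHb X) h' (underHb B'))).comp
    ((Cen.whiskerLeft (underHb B) (Cen.whiskerLeft (underHb X) (Cen.under_hb h' B'))).comp
    ((Cen.whiskerLeft (underHb B) (Cen.associator_inv (underHb X) (underHb B') h')).comp
    ((Cen.associator_inv (underHb B) (tens (underHb X) (underHb B')) h').comp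
    ((Cen.tens_ofUnder (actOn h e)).whiskerRight h'))))
  rw [actOn_tensOver]
  refine Cen.of_eq ?_ this
  rw [hb_under]
  monoidal

lemma rproj_eq : rproj S h h' = (S.sqrtGlobalDim ^ 2)⁻¹ • ∑ i, dim k (S.obj i) •
    (coactOn (tensUnder X h') (η_ (S.obj i) (S.obj i)ᘁ) ≫
      actOn (tensOver h Y) (evR (S.obj i))) := by
  rw [rproj, avg_eq]; simp

/-- A strand that passes over the whole loop moves through both halves of it. Together with
`cen_rproj_under_over`, which is the centrality of averages, this gives control over `Q` from both
half-braidings. -/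
lemma cen_rproj_over_over : Cen (tensOver h Y) (tensOver h Y) (rproj S h h') := by
  rw [rproj_eq]
  exact (Cen.sum _ fun i _ => ((cen_coactOn_over h h' _).comp (cen_actOn_over h _)).smul _).smul _

lemma cen_rproj_under_under : Cen (tensUnder X h') (tensUnder X h') (rproj S h h') := by
  rw [rproj_eq]
  exact (Cen.sum _ fun i _ =>
    ((cen_coactOn_under h' _).comp (cen_actOn_under h h' _)).smul _).smul _

lemma cen_rproj_over_under : Cen (tensOver h Y) (tensUnder X h') (rproj S h h') := by
  intro B
  rw [cen_rproj_under_under, ← cen_rproj_under_over, cen_rproj_over_over]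

/-- Both sides are the same crossing preceded by `Q`, one by each of two centrality statements with
a common target. After projecting, the two half-braidings of `X ⊗ Y` cannot be told apart. -/
lemma hb_tensOver_rproj (B : A) : hb (tensOver h Y) B ≫ rproj S h h' ▷ B =
    hb (tensUnder X h') B ≫ rproj S h h' ▷ B := by
  rw [← cen_rproj_under_over, cen_rproj_over_over]

variable {S} {h h'}

/-- Centrality for `tensOver` moves `f` inside the average that defines `Q`; centrality for
`tensUnder` makes that average equal to `f`. Idempotency of `Q` is the case `f = Q`. -/
lemma rproj_comp {Z : A} {h'' : HalfBraiding Z} {f : X ⊗ Y ⟶ Z} [CharZero k]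
    (h1 : Cen (tensOver h Y) h'' f) (h2 : Cen (tensUnder X h') h'' f) : rproj S h h' ≫ f = f := by
  rw [rproj, avg_comp S _ h1, Category.id_comp, avg_of_cen S h2]

lemma rproj_rproj [CharZero k] : rproj S h h' ≫ rproj S h h' = rproj S h h' :=
  rproj_comp (cen_rproj_over_over S h h') (cen_rproj_under_over S h h')

lemma tensorHom_rproj {X' Y' : A} {g : HalfBraiding X'} {g' : HalfBraiding Y'} {f : X ⟶ X'}
    {f' : Y ⟶ Y'} (hf : Cen h g f) (hf' : Cen h' g' f') :
    (f ⊗ₘ f') ≫ rproj S g g' = rproj S h h' ≫ (f ⊗ₘ f') := by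
  have h1 : Cen (tensOver h Y) (tensOver g Y') (f ⊗ₘ f') := by
    rw [MonoidalCategory.tensorHom_def]
    exact (hf.whiskerRight _).comp (Cen.whiskerLeft _ (Cen.ofOver f'))
  have h2 : Cen (tensUnder X h') (tensUnder X' g') (f ⊗ₘ f') := by
    rw [MonoidalCategory.tensorHom_def]
    exact ((Cen.ofUnder f).whiskerRight _).comp (Cen.whiskerLeft _ hf')
  rw [rproj, rproj, comp_avg S h2, avg_comp S _ h1, Category.id_comp, Category.comp_id]

end ProjectionCentral

section ReducedTensorObj

variable {k : Type w} [Field k] [IsAlgClosed k]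
  {A : Type u} [Category.{v} A] [Abelian A] [Linear k A] [MonoidalCategory A]
  [MonoidalPreadditive A] [MonoidalLinear k A] [BraidedCategory A] [RigidCategory A]
  [PivotalCategory A] [PremodularCategory k A] {ι : Type u₁} [Fintype ι]
  (S : SimpleData k A ι)

variable {X Y : A} (h : HalfBraiding X) (h' : HalfBraiding Y)

/-- The object underlying the reduced tensor product. -/
def rtensObj : A := image (rproj S h h')

/-- The inclusion of the reduced tensor product. -/
def rincl : rtensObj S h h' ⟶ X ⊗ Y := image.ι (rproj S h h')

/-- The projection to the reduced tensor product. -/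
def rpr : X ⊗ Y ⟶ rtensObj S h h' := factorThruImage (rproj S h h')

lemma rpr_rincl : rpr S h h' ≫ rincl S h h' = rproj S h h' := image.fac _

instance : Mono (rincl S h h') := inferInstanceAs (Mono (image.ι (rproj S h h')))

instance : Epi (rpr S h h') := inferInstanceAs (Epi (factorThruImage (rproj S h h')))

variable [CharZero k]

lemma rincl_rpr : rincl S h h' ≫ rpr S h h' = 𝟙 _ := by
  rw [← cancel_epi (rpr S h h'), ← cancel_mono (rincl S h h'), Category.comp_id,
    Category.assoc, Category.assoc, rpr_rincl, ← Category.assoc, rpr_rincl, rproj_rproj]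

lemma rincl_rproj : rincl S h h' ≫ rproj S h h' = rincl S h h' := by
  rw [← rpr_rincl, ← Category.assoc, rincl_rpr, Category.id_comp]

lemma rproj_rpr : rproj S h h' ≫ rpr S h h' = rpr S h h' := by
  rw [← rpr_rincl, Category.assoc, rincl_rpr, Category.comp_id]

/-- The half-braiding of the reduced tensor product. -/
def rtens : HalfBraiding (rtensObj S h h') :=
  retractHb (rincl_rpr S h h') (by rw [rpr_rincl]; exact cen_rproj_over_over S h h')

lemma hb_rtens (B : A) : hb (rtens S h h') B =
    B ◁ rincl S h h' ≫ hb (tensOver h Y) B ≫ rpr S h h' ▷ B := rfl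

lemma cen_rincl_over : Cen (rtens S h h') (tensOver h Y) (rincl S h h') := cen_retract_incl _ _

lemma cen_over_rpr : Cen (tensOver h Y) (rtens S h h') (rpr S h h') := cen_retract_proj _ _

/-- The image carries the restriction of `tensOver`, but `Q` also intertwines the two
half-braidings, so the inclusion is central for either of them. -/
lemma cen_rincl_under : Cen (rtens S h h') (tensUnder X h') (rincl S h h') := by
  rw [← rincl_rproj]
  exact (cen_rincl_over S h h').comp (cen_rproj_over_under S h h')

lemma cen_under_rpr : Cen (tensUnder X h') (rtens S h h') (rpr S h h') := by
  rw [← rproj_rpr]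
  exact (cen_rproj_under_over S h h').comp (cen_over_rpr S h h')

end ReducedTensorObj

section Triple

variable {k : Type w} [Field k] [IsAlgClosed k]
  {A : Type u} [Category.{v} A] [Abelian A] [Linear k A] [MonoidalCategory A]
  [MonoidalPreadditive A] [MonoidalLinear k A] [BraidedCategory A] [RigidCategory A]
  [PivotalCategory A] [PremodularCategory k A] {ι : Type u₁} [Fintype ι]
  (S : SimpleData k A ι)

variable {X Y Z : A} (h : HalfBraiding X) (h' : HalfBraiding Y) (h'' : HalfBraiding Z) [CharZero k]

/-- The inclusion of the left-nested triple reduced tensor product. -/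
def rinclL : rtensObj S (rtens S h h') h'' ⟶ (X ⊗ Y) ⊗ Z :=
  rincl S (rtens S h h') h'' ≫ rincl S h h' ▷ Z

/-- The projection to the left-nested triple reduced tensor product. -/
def rprL : (X ⊗ Y) ⊗ Z ⟶ rtensObj S (rtens S h h') h'' :=
  rpr S h h' ▷ Z ≫ rpr S (rtens S h h') h''

/-- The inclusion of the right-nested triple reduced tensor product. -/
def rinclR : rtensObj S h (rtens S h' h'') ⟶ X ⊗ Y ⊗ Z :=
  rincl S h (rtens S h' h'') ≫ X ◁ rincl S h' h''

/-- The projection to the right-nested triple reduced tensor product. -/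
def rprR : X ⊗ Y ⊗ Z ⟶ rtensObj S h (rtens S h' h'') :=
  X ◁ rpr S h' h'' ≫ rpr S h (rtens S h' h'')

lemma rinclL_rprL : rinclL S h h' h'' ≫ rprL S h h' h'' = 𝟙 _ := by
  rw [rinclL, rprL, Category.assoc, ← comp_whiskerRight_assoc, rincl_rpr,
    MonoidalCategory.id_whiskerRight, Category.id_comp, rincl_rpr]

lemma rinclR_rprR : rinclR S h h' h'' ≫ rprR S h h' h'' = 𝟙 _ := by
  rw [rinclR, rprR, Category.assoc, ← MonoidalCategory.whiskerLeft_comp_assoc, rincl_rpr,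
    MonoidalCategory.whiskerLeft_id, Category.id_comp, rincl_rpr]

lemma cen_rinclL : Cen (rtens S (rtens S h h') h'') (tensOver (tensOver h Y) Z)
    (rinclL S h h' h'') :=
  (cen_rincl_over S _ _).comp ((cen_rincl_over S h h').whiskerRight _)

lemma cen_rprR : Cen (tensOver h (Y ⊗ Z)) (rtens S h (rtens S h' h''))
    (rprR S h h' h'') :=
  (Cen.whiskerLeft h (Cen.ofOver _)).comp (cen_over_rpr S _ _)

lemma cen_associator_over : Cen (tensOver (tensOver h Y) Z) (tensOver h (Y ⊗ Z))
    (α_ X Y Z).hom := by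
  rw [tensOver, tensOver, tensOver, ← tens_over_over]
  exact Cen.associator _ _ _

lemma cen_associator_under : Cen (tensUnder (X ⊗ Y) h'') (tensUnder X (tensUnder Y h''))
    (α_ X Y Z).hom := by
  rw [tensUnder, tensUnder, tensUnder, ← tens_under_under]
  exact Cen.associator _ _ _

/-- The outer projection is an average over loops around `X ⊗̄ Y` and `Z`; the central inclusion and
projection of `X ⊗̄ Y` are pulled into the average, where they compose to the inner projection. -/
lemma rprL_rinclL : rprL S h h' h'' ≫ rinclL S h h' h'' = avg S (tensUnder (X ⊗ Y) h'')
    (tensOver (tensOver h Y) Z) (rproj S h h' ▷ Z) := by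
  have h1 : Cen (tensUnder (X ⊗ Y) h'') (tensUnder (rtensObj S h h') h'') (rpr S h h' ▷ Z) :=
    (Cen.ofUnder _).whiskerRight _
  have h2 : Cen (tensOver (rtens S h h') Z) (tensOver (tensOver h Y) Z) (rincl S h h' ▷ Z) :=
    (cen_rincl_over S h h').whiskerRight _
  calc _ = rpr S h h' ▷ Z ≫ rproj S (rtens S h h') h'' ≫ rincl S h h' ▷ Z := by
        rw [rprL, rinclL, ← rpr_rincl]; simp only [Category.assoc]
    _ = _ := by
        rw [rproj, avg_comp S _ h2, comp_avg S h1, Category.id_comp, ← comp_whiskerRight,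
          rpr_rincl]

lemma rprR_rinclR : rprR S h h' h'' ≫ rinclR S h h' h'' = avg S (tensUnder X (tensUnder Y h''))
    (tensOver h (Y ⊗ Z)) (X ◁ rproj S h' h'') := by
  have h1 : Cen (tensUnder X (tensUnder Y h'')) (tensUnder X (rtens S h' h''))
      (X ◁ rpr S h' h'') := Cen.whiskerLeft _ (cen_under_rpr S h' h'')
  have h2 : Cen (tensOver h (rtensObj S h' h'')) (tensOver h (Y ⊗ Z)) (X ◁ rincl S h' h'') :=
    Cen.whiskerLeft _ (Cen.ofOver _)
  calc _ = X ◁ rpr S h' h'' ≫ rproj S h (rtens S h' h'') ≫ X ◁ rincl S h' h'' := by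
        rw [rprR, rinclR, ← rpr_rincl]; simp only [Category.assoc]
    _ = _ := by
        rw [rproj, avg_comp S _ h2, comp_avg S h1, Category.id_comp, ← whiskerLeft_comp,
          rpr_rincl]

/-- The idempotents defining the two triple reduced tensor products agree. -/
lemma rprL_rinclL_associator : rprL S h h' h'' ≫ rinclL S h h' h'' ≫ (α_ X Y Z).hom =
    (α_ X Y Z).hom ≫ rprR S h h' h'' ≫ rinclR S h h' h'' := by
  have ha : rproj S h h' ▷ Z = avg S (tensOver (tensUnder X h') Z) (tensOver (tensOver h Y) Z)
      (𝟙 (X ⊗ Y) ▷ Z) := (avg_whiskerRight S _ _ _ _).symm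
  have hb : X ◁ rproj S h' h'' = avg S (tensUnder X (tensUnder Y h'')) (tensUnder X (tensOver h' Z))
      (X ◁ 𝟙 (Y ⊗ Z)) := (avg_whiskerLeft S _ _ _ _).symm
  have ca : Cen (tensOver (tensUnder X h') Z) (tensOver (tensOver h Y) Z) (rproj S h h' ▷ Z) :=
    (cen_rproj_under_over S h h').whiskerRight _
  have cb : Cen (tensUnder X (tensUnder Y h'')) (tensUnder X (tensOver h' Z))
      (X ◁ rproj S h' h'') := Cen.whiskerLeft _ (cen_rproj_under_over S h' h'')
  have ci : Cen (tensUnder X (tensOver h' Z)) (tensOver (tensUnder X h') Z) (α_ X Y Z).inv :=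
    Cen.associator_inv _ _ _
  -- The product of the two adjacent projections is evaluated twice: writing the second factor as an
  -- average and absorbing the first gives the right-nested idempotent, while in `key'` the roles
  -- are exchanged and the left-nested one appears.
  have key : X ◁ rproj S h' h'' ≫ (α_ X Y Z).inv ≫ rproj S h h' ▷ Z ≫ (α_ X Y Z).hom =
      avg S (tensUnder X (tensUnder Y h'')) (tensOver h (Y ⊗ Z)) (X ◁ rproj S h' h'') := by
    rw [ha, avg_comp S _ (cen_associator_over h), comp_avg S ci, comp_avg S cb]
    simp
  have key' : X ◁ rproj S h' h'' ≫ (α_ X Y Z).inv ≫ rproj S h h' ▷ Z ≫ (α_ X Y Z).hom =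
      avg S (tensUnder X (tensUnder Y h'')) (tensOver h (Y ⊗ Z))
        ((α_ X Y Z).inv ≫ rproj S h h' ▷ Z ≫ (α_ X Y Z).hom) := by
    rw [hb, avg_comp S _ (ci.comp (ca.comp (cen_associator_over h)))]
    simp
  rw [← Category.assoc, rprL_rinclL, rprR_rinclR, avg_comp S _ (cen_associator_over h),
    key.symm.trans key', comp_avg S (cen_associator_under h'')]
  simp

end Triple

end

end ReducedTensor

namespace ReducedTensor

noncomputable section

/-! ### The isomorphisms `I(V) ⊗ W ≅ I(V ⊗ W) ≅ V ⊗ I(W)` and the unit constraints -/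

section InductionTensor

variable {k : Type w} [Field k] [IsAlgClosed k]
  {A : Type u} [Category.{v} A] [Abelian A] [Linear k A] [MonoidalCategory A]
  [MonoidalPreadditive A] [MonoidalLinear k A] [BraidedCategory A] [RigidCategory A]
  [PivotalCategory A] [PremodularCategory k A] {ι : Type u₁} [Fintype ι]
  (S : SimpleData k A ι)

lemma ins_add (V : A) {B B' : A} (f g : B ⊗ B' ⟶ 𝟙_ A) :
    ins S V (f + g) = ins S V f + ins S V g := by
  have := ins_sum S V (Finset.univ : Finset Bool) (fun b => if b then f else g)
  simpa using this

/-- The component of `inductionTensor` on `ins S V e`. -/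
def inductionTensorOn (V W : A) {B B' : A} (e : B ⊗ B' ⟶ 𝟙_ A) :
    (B ⊗ V ⊗ B') ⊗ W ⟶ indObj S (V ⊗ W) :=
  𝟙 _ ⊗≫ (B ⊗ V) ◁ (β_ W B').inv ⊗≫ ins S (V ⊗ W) e

lemma inductionTensorOn_isExtranatural (V W : A) :
    IsExtranatural k (tensorRight W) V (inductionTensorOn S V W) where
  left {B C C'} f g := by
    change (g ▷ (V ⊗ C')) ▷ W ≫ inductionTensorOn S V W f = _
    calc
      _ = 𝟙 _ ⊗≫ (g ▷ (V ⊗ (C' ⊗ W)) ≫ C ◁ (V ◁ (β_ W C').inv)) ⊗≫ ins S (V ⊗ W) f := by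
        rw [inductionTensorOn]; monoidal
      _ = 𝟙 _ ⊗≫ (B ⊗ V) ◁ (β_ W C').inv ⊗≫ (g ▷ ((V ⊗ W) ⊗ C') ≫ ins S (V ⊗ W) f) := by
        rw [← whisker_exchange]; monoidal
      _ = _ := by rw [ins_left, inductionTensorOn]
  right {B B' C'} f h := by
    change (B ◁ V ◁ h) ▷ W ≫ inductionTensorOn S V W f = _
    calc
      _ = 𝟙 _ ⊗≫ (B ⊗ V) ◁ (h ▷ W ≫ (β_ W C').inv) ⊗≫ ins S (V ⊗ W) f := by
        rw [inductionTensorOn]; monoidal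
      _ = 𝟙 _ ⊗≫ (B ⊗ V) ◁ (β_ W B').inv ⊗≫ (B ◁ (V ⊗ W) ◁ h ≫ ins S (V ⊗ W) f) := by
        rw [BraidedCategory.braiding_inv_naturality_left]; monoidal
      _ = _ := by rw [ins_right, inductionTensorOn]
  add f g := by simp [inductionTensorOn, monoidalComp, ins_add]
  smul c f := by simp [inductionTensorOn, monoidalComp, ins_smul]

/-- The isomorphism `I(V) ⊗ W ⟶ I(V ⊗ W)` passing strands over `W`. -/
def inductionTensor (V W : A) : indObj S V ⊗ W ⟶ indObj S (V ⊗ W) :=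
  desc S (tensorRight W) V (inductionTensorOn S V W)

lemma ins_inductionTensor (V W : A) {B B' : A} (e : B ⊗ B' ⟶ 𝟙_ A) :
    ins S V e ▷ W ≫ inductionTensor S V W =
      𝟙 _ ⊗≫ (B ⊗ V) ◁ (β_ W B').inv ⊗≫ ins S (V ⊗ W) e :=
  map_ins_desc S (tensorRight W) V (inductionTensorOn_isExtranatural S V W) e

/-- The inverse of `inductionTensor`. -/
def inductionTensorInv (V W : A) : indObj S (V ⊗ W) ⟶ indObj S V ⊗ W :=
  indMap S (ins₁ S V ▷ W) ≫ act S (tensOver (indHb S V) W)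

lemma ins₁_actOn (V : A) {B B' : A} (e : B ⊗ B' ⟶ 𝟙_ A) :
    B ◁ ins₁ S V ▷ B' ≫ actOn (indHb S V) e = ins S V e := by
  rw [← ins_act S, ← Category.assoc, ins_map, Category.assoc, indMap_ins₁_act, Category.comp_id]

lemma ins_inductionTensorInv (V W : A) {B B' : A} (e : B ⊗ B' ⟶ 𝟙_ A) :
    ins S (V ⊗ W) e ≫ inductionTensorInv S V W =
      𝟙 _ ⊗≫ (B ⊗ V) ◁ (β_ W B').hom ⊗≫ ins S V e ▷ W := by
  calc
    _ = B ◁ (ins₁ S V ▷ W) ▷ B' ≫ actOn (tensOver (indHb S V) W) e := by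
      rw [inductionTensorInv, ← Category.assoc, ← ins_map, Category.assoc, ins_act]
    _ = 𝟙 _ ⊗≫ B ◁ (ins₁ S V ▷ (W ⊗ B') ≫ indObj S V ◁ (β_ W B').hom) ⊗≫
        actOn (indHb S V) e ▷ W := by
      rw [actOn_tensOver]; monoidal
    _ = 𝟙 _ ⊗≫ (B ⊗ V) ◁ (β_ W B').hom ⊗≫ (B ◁ ins₁ S V ▷ B' ≫ actOn (indHb S V) e) ▷ W := by
      rw [← whisker_exchange]; monoidal
    _ = _ := by rw [ins₁_actOn]

lemma inductionTensor_inv (V W : A) :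
    inductionTensor S V W ≫ inductionTensorInv S V W = 𝟙 _ := by
  apply hom_ext_ins_right S
  intro i
  rw [← Category.assoc, ins_inductionTensor]
  calc
    _ = 𝟙 _ ⊗≫ (S.obj i ⊗ V) ◁ (β_ W (S.obj i)ᘁ).inv ⊗≫
        (ins S (V ⊗ W) (evR (S.obj i)) ≫ inductionTensorInv S V W) := by monoidal
    _ = 𝟙 _ ⊗≫ (S.obj i ⊗ V) ◁ ((β_ W (S.obj i)ᘁ).inv ≫ (β_ W (S.obj i)ᘁ).hom) ⊗≫
        ins S V (evR (S.obj i)) ▷ W := by rw [ins_inductionTensorInv]; monoidal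
    _ = _ := by rw [Iso.inv_hom_id]; monoidal

lemma inductionTensorInv_hom (V W : A) :
    inductionTensorInv S V W ≫ inductionTensor S V W = 𝟙 _ := by
  apply hom_ext_ins S
  intro i
  rw [← Category.assoc, ins_inductionTensorInv]
  calc
    _ = 𝟙 _ ⊗≫ (S.obj i ⊗ V) ◁ (β_ W (S.obj i)ᘁ).hom ⊗≫
        (ins S V (evR (S.obj i)) ▷ W ≫ inductionTensor S V W) := by monoidal
    _ = 𝟙 _ ⊗≫ (S.obj i ⊗ V) ◁ ((β_ W (S.obj i)ᘁ).hom ≫ (β_ W (S.obj i)ᘁ).inv) ⊗≫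
        ins S (V ⊗ W) (evR (S.obj i)) := by rw [ins_inductionTensor]; monoidal
    _ = _ := by rw [Iso.hom_inv_id]; monoidal

lemma cen_inductionTensorInv (V W : A) :
    Cen (indHb S (V ⊗ W)) (tensOver (indHb S V) W) (inductionTensorInv S V W) :=
  (cen_indMap S _).comp (cen_act S _)

/-- The inverse is central because it is composed of central maps, and inverses of central
isomorphisms are central. -/
lemma cen_inductionTensor (V W : A) :
    Cen (tensOver (indHb S V) W) (indHb S (V ⊗ W)) (inductionTensor S V W) :=
  Cen.of_iso (cen_inductionTensorInv S V W) (inductionTensorInv_hom S V W)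
    (inductionTensor_inv S V W)

lemma ins₁_inductionTensorInv (V W : A) :
    ins₁ S (V ⊗ W) ≫ inductionTensorInv S V W = ins₁ S V ▷ W := by
  rw [inductionTensorInv, ← Category.assoc, ins₁_indMap, Category.assoc, ins₁_act,
    Category.comp_id]

lemma ins₁_inductionTensor (V W : A) :
    ins₁ S V ▷ W ≫ inductionTensor S V W = ins₁ S (V ⊗ W) := by
  rw [← ins₁_inductionTensorInv, Category.assoc, inductionTensorInv_hom, Category.comp_id]

/-- With its half-braiding passing over `W`, the object `I(V) ⊗ W` is again induced, from `V ⊗ W`,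
so central morphisms out of it are determined there. -/
lemma hom_ext_ins₁_whiskerRight {V W Z : A} {h : HalfBraiding Z} {f g : indObj S V ⊗ W ⟶ Z}
    (hf : Cen (tensOver (indHb S V) W) h f) (hg : Cen (tensOver (indHb S V) W) h g)
    (H : ins₁ S V ▷ W ≫ f = ins₁ S V ▷ W ≫ g) : f = g := by
  have : inductionTensorInv S V W ≫ f = inductionTensorInv S V W ≫ g := by
    refine hom_ext_ins₁ S ((cen_inductionTensorInv S V W).comp hf)
      ((cen_inductionTensorInv S V W).comp hg) ?_
    rw [← Category.assoc, ins₁_inductionTensorInv, H, ← ins₁_inductionTensorInv, Category.assoc]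
  rw [← Category.id_comp f, ← inductionTensor_inv, Category.assoc, this, ← Category.assoc,
    inductionTensor_inv, Category.id_comp]

end InductionTensor

section TensorInduction

variable {k : Type w} [Field k] [IsAlgClosed k]
  {A : Type u} [Category.{v} A] [Abelian A] [Linear k A] [MonoidalCategory A]
  [MonoidalPreadditive A] [MonoidalLinear k A] [BraidedCategory A] [RigidCategory A]
  [PivotalCategory A] [PremodularCategory k A] {ι : Type u₁} [Fintype ι]
  (S : SimpleData k A ι)

/-- The component of `tensorInduction` on `ins S W e`. -/
def tensorInductionOn (V W : A) {B B' : A} (e : B ⊗ B' ⟶ 𝟙_ A) :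
    V ⊗ (B ⊗ W ⊗ B') ⟶ indObj S (V ⊗ W) :=
  𝟙 _ ⊗≫ (β_ B V).inv ▷ (W ⊗ B') ⊗≫ ins S (V ⊗ W) e

lemma tensorInductionOn_isExtranatural (V W : A) :
    IsExtranatural k (tensorLeft V) W (tensorInductionOn S V W) where
  left {B C C'} f g := by
    change V ◁ (g ▷ (W ⊗ C')) ≫ tensorInductionOn S V W f = _
    calc
      _ = 𝟙 _ ⊗≫ (V ◁ g ≫ (β_ C V).inv) ▷ (W ⊗ C') ⊗≫ ins S (V ⊗ W) f := by
        rw [tensorInductionOn]; monoidal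
      _ = 𝟙 _ ⊗≫ (β_ B V).inv ▷ (W ⊗ C') ⊗≫ (g ▷ ((V ⊗ W) ⊗ C') ≫ ins S (V ⊗ W) f) := by
        rw [BraidedCategory.braiding_inv_naturality_right]; monoidal
      _ = _ := by rw [ins_left, tensorInductionOn]
  right {B B' C'} f h := by
    change V ◁ (B ◁ W ◁ h) ≫ tensorInductionOn S V W f = _
    calc
      _ = 𝟙 _ ⊗≫ ((V ⊗ B) ◁ (W ◁ h) ≫ (β_ B V).inv ▷ (W ⊗ C')) ⊗≫ ins S (V ⊗ W) f := by
        rw [tensorInductionOn]; monoidal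
      _ = 𝟙 _ ⊗≫ (β_ B V).inv ▷ (W ⊗ B') ⊗≫ (B ◁ (V ⊗ W) ◁ h ≫ ins S (V ⊗ W) f) := by
        rw [whisker_exchange]; monoidal
      _ = _ := by rw [ins_right, tensorInductionOn]
  add f g := by simp [tensorInductionOn, monoidalComp, ins_add]
  smul c f := by simp [tensorInductionOn, monoidalComp, ins_smul]

/-- The isomorphism `V ⊗ I(W) ⟶ I(V ⊗ W)` passing strands under `V`. -/
def tensorInduction (V W : A) : V ⊗ indObj S W ⟶ indObj S (V ⊗ W) :=
  desc S (tensorLeft V) W (tensorInductionOn S V W)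

lemma ins_tensorInduction (V W : A) {B B' : A} (e : B ⊗ B' ⟶ 𝟙_ A) :
    V ◁ ins S W e ≫ tensorInduction S V W =
      𝟙 _ ⊗≫ (β_ B V).inv ▷ (W ⊗ B') ⊗≫ ins S (V ⊗ W) e :=
  map_ins_desc S (tensorLeft V) W (tensorInductionOn_isExtranatural S V W) e

/-- The inverse of `tensorInduction`. -/
def tensorInductionInv (V W : A) : indObj S (V ⊗ W) ⟶ V ⊗ indObj S W :=
  indMap S (V ◁ ins₁ S W) ≫ act S (tensUnder V (indHb S W))

lemma ins_tensorInductionInv (V W : A) {B B' : A} (e : B ⊗ B' ⟶ 𝟙_ A) :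
    ins S (V ⊗ W) e ≫ tensorInductionInv S V W =
      𝟙 _ ⊗≫ (β_ B V).hom ▷ (W ⊗ B') ⊗≫ V ◁ ins S W e := by
  calc
    _ = B ◁ (V ◁ ins₁ S W) ▷ B' ≫ actOn (tensUnder V (indHb S W)) e := by
      rw [tensorInductionInv, ← Category.assoc, ← ins_map, Category.assoc, ins_act]
    _ = 𝟙 _ ⊗≫ ((B ⊗ V) ◁ ins₁ S W ≫ (β_ B V).hom ▷ indObj S W) ▷ B' ⊗≫
        V ◁ actOn (indHb S W) e := by
      rw [actOn_tensUnder]; monoidal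
    _ = 𝟙 _ ⊗≫ (β_ B V).hom ▷ (W ⊗ B') ⊗≫ V ◁ (B ◁ ins₁ S W ▷ B' ≫ actOn (indHb S W) e) := by
      rw [whisker_exchange]; monoidal
    _ = _ := by rw [ins₁_actOn]

lemma tensorInduction_inv (V W : A) :
    tensorInduction S V W ≫ tensorInductionInv S V W = 𝟙 _ := by
  apply hom_ext_ins_left S
  intro i
  rw [← Category.assoc, ins_tensorInduction]
  calc
    _ = 𝟙 _ ⊗≫ (β_ (S.obj i) V).inv ▷ (W ⊗ (S.obj i)ᘁ) ⊗≫
        (ins S (V ⊗ W) (evR (S.obj i)) ≫ tensorInductionInv S V W) := by monoidal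
    _ = 𝟙 _ ⊗≫ ((β_ (S.obj i) V).inv ≫ (β_ (S.obj i) V).hom) ▷ (W ⊗ (S.obj i)ᘁ) ⊗≫
        V ◁ ins S W (evR (S.obj i)) := by rw [ins_tensorInductionInv]; monoidal
    _ = _ := by rw [Iso.inv_hom_id]; monoidal

lemma tensorInductionInv_hom (V W : A) :
    tensorInductionInv S V W ≫ tensorInduction S V W = 𝟙 _ := by
  apply hom_ext_ins S
  intro i
  rw [← Category.assoc, ins_tensorInductionInv]
  calc
    _ = 𝟙 _ ⊗≫ (β_ (S.obj i) V).hom ▷ (W ⊗ (S.obj i)ᘁ) ⊗≫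
        (V ◁ ins S W (evR (S.obj i)) ≫ tensorInduction S V W) := by monoidal
    _ = 𝟙 _ ⊗≫ ((β_ (S.obj i) V).hom ≫ (β_ (S.obj i) V).inv) ▷ (W ⊗ (S.obj i)ᘁ) ⊗≫
        ins S (V ⊗ W) (evR (S.obj i)) := by rw [ins_tensorInduction]; monoidal
    _ = _ := by rw [Iso.hom_inv_id]; monoidal

lemma cen_tensorInductionInv (V W : A) :
    Cen (indHb S (V ⊗ W)) (tensUnder V (indHb S W)) (tensorInductionInv S V W) :=
  (cen_indMap S _).comp (cen_act S _)

lemma cen_tensorInduction (V W : A) :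
    Cen (tensUnder V (indHb S W)) (indHb S (V ⊗ W)) (tensorInduction S V W) :=
  Cen.of_iso (cen_tensorInductionInv S V W) (tensorInductionInv_hom S V W)
    (tensorInduction_inv S V W)

lemma ins₁_tensorInductionInv (V W : A) :
    ins₁ S (V ⊗ W) ≫ tensorInductionInv S V W = V ◁ ins₁ S W := by
  rw [tensorInductionInv, ← Category.assoc, ins₁_indMap, Category.assoc, ins₁_act,
    Category.comp_id]

lemma ins₁_tensorInduction (V W : A) :
    V ◁ ins₁ S W ≫ tensorInduction S V W = ins₁ S (V ⊗ W) := by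
  rw [← ins₁_tensorInductionInv, Category.assoc, tensorInductionInv_hom, Category.comp_id]

lemma hom_ext_ins₁_whiskerLeft {V W Z : A} {h : HalfBraiding Z} {f g : V ⊗ indObj S W ⟶ Z}
    (hf : Cen (tensUnder V (indHb S W)) h f) (hg : Cen (tensUnder V (indHb S W)) h g)
    (H : V ◁ ins₁ S W ≫ f = V ◁ ins₁ S W ≫ g) : f = g := by
  have : tensorInductionInv S V W ≫ f = tensorInductionInv S V W ≫ g := by
    refine hom_ext_ins₁ S ((cen_tensorInductionInv S V W).comp hf)
      ((cen_tensorInductionInv S V W).comp hg) ?_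
    rw [← Category.assoc, ins₁_tensorInductionInv, H, ← ins₁_tensorInductionInv, Category.assoc]
  rw [← Category.id_comp f, ← tensorInduction_inv, Category.assoc, this, ← Category.assoc,
    tensorInduction_inv, Category.id_comp]

end TensorInduction

section ActOnUnderOver

variable {k : Type w} [Field k] [IsAlgClosed k]
  {A : Type u} [Category.{v} A] [Abelian A] [Linear k A] [MonoidalCategory A]
  [MonoidalPreadditive A] [MonoidalLinear k A] [BraidedCategory A] [RigidCategory A]
  [PivotalCategory A] [PremodularCategory k A] {ι : Type u₁} [Fintype ι]
  (S : SimpleData k A ι)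

lemma cen_actOn_underHb {X : A} (h : HalfBraiding X) {B B' : A} (e : B ⊗ B' ⟶ 𝟙_ A) :
    Cen (tens (underHb B) (tens h (underHb B'))) h (actOn h e) := by
  have := (Cen.associator_inv (underHb B) h (underHb B')).comp
    (((Cen.hb_under h B).whiskerRight (underHb B')).comp
    ((Cen.associator h (underHb B) (underHb B')).comp
    ((Cen.whiskerLeft h (show Cen _ unitHb e by
      rw [tens_under_under, ← under_unit]; exact Cen.ofUnder e)).comp (Cen.rightUnitor h))))
  refine Cen.of_eq ?_ this
  rw [actOn]; monoidal

lemma cen_actOn_overHb {X : A} (h : HalfBraiding X) {B B' : A} (e : B ⊗ B' ⟶ 𝟙_ A) :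
    Cen (tens (overHb B) (tens h (overHb B'))) h (actOn h e) := by
  have := (Cen.associator_inv (overHb B) h (overHb B')).comp
    (((Cen.hb_over h B).whiskerRight (overHb B')).comp
    ((Cen.associator h (overHb B) (overHb B')).comp
    ((Cen.whiskerLeft h (show Cen _ unitHb e by
      rw [tens_over_over, ← over_unit]; exact Cen.ofOver e)).comp (Cen.rightUnitor h))))
  refine Cen.of_eq ?_ this
  rw [actOn]; monoidal

end ActOnUnderOver

section UnitConstraints

variable {k : Type w} [Field k] [IsAlgClosed k]
  {A : Type u} [Category.{v} A] [Abelian A] [Linear k A] [MonoidalCategory A]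
  [MonoidalPreadditive A] [MonoidalLinear k A] [BraidedCategory A] [RigidCategory A]
  [PivotalCategory A] [PremodularCategory k A] {ι : Type u₁} [Fintype ι]
  (S : SimpleData k A ι)

/-- The left unit constraint `I(𝟙) ⊗ X ⟶ X`, up to a scalar. -/
def lunit {X : A} (h : HalfBraiding X) : indObj S (𝟙_ A) ⊗ X ⟶ X :=
  inductionTensor S (𝟙_ A) X ≫ indMap S (λ_ X).hom ≫ act S h

/-- The right unit constraint `X ⊗ I(𝟙) ⟶ X`, up to a scalar. -/
def runit {X : A} (h : HalfBraiding X) : X ⊗ indObj S (𝟙_ A) ⟶ X :=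
  tensorInduction S X (𝟙_ A) ≫ indMap S (ρ_ X).hom ≫ act S h

variable {X : A} (h : HalfBraiding X)

lemma ins_lunit {B B' : A} (e : B ⊗ B' ⟶ 𝟙_ A) : ins S (𝟙_ A) e ▷ X ≫ lunit S h =
    𝟙 _ ⊗≫ B ◁ (β_ X B').inv ⊗≫ actOn h e := by
  rw [lunit, ← Category.assoc, ins_inductionTensor]
  calc
    _ = 𝟙 _ ⊗≫ (B ⊗ 𝟙_ A) ◁ (β_ X B').inv ⊗≫
        (ins S (𝟙_ A ⊗ X) e ≫ indMap S (λ_ X).hom ≫ act S h) := by monoidal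
    _ = _ := by
      rw [← Category.assoc (ins S (𝟙_ A ⊗ X) e), ← ins_map, Category.assoc, ins_act]; monoidal

lemma ins_runit {B B' : A} (e : B ⊗ B' ⟶ 𝟙_ A) : X ◁ ins S (𝟙_ A) e ≫ runit S h =
    𝟙 _ ⊗≫ (β_ B X).inv ▷ B' ⊗≫ actOn h e := by
  rw [runit, ← Category.assoc, ins_tensorInduction]
  calc
    _ = 𝟙 _ ⊗≫ (β_ B X).inv ▷ (𝟙_ A ⊗ B') ⊗≫
        (ins S (X ⊗ 𝟙_ A) e ≫ indMap S (ρ_ X).hom ≫ act S h) := by monoidal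
    _ = _ := by
      rw [← Category.assoc (ins S (X ⊗ 𝟙_ A) e), ← ins_map, Category.assoc, ins_act]; monoidal

lemma redLeftUnitor_eq (X : ZCenter A) :
    redLeftUnitor S X = S.sqrtGlobalDim⁻¹ • lunit S X.halfBraiding := by
  rw [redLeftUnitor, ← Category.id_comp (lunit S X.halfBraiding),
    ← MonoidalCategory.id_whiskerRight, ← sum_indπ_indι, sum_whiskerRight, Preadditive.sum_comp,
    Finset.smul_sum]
  refine Finset.sum_congr rfl fun i _ => ?_
  rw [comp_whiskerRight, Category.assoc, indι_eq, MonoidalLinear.smul_whiskerRight,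
    Linear.smul_comp, ins_lunit, Linear.comp_smul, smul_smul, div_eq_mul_inv, mul_comm]
  congr 1
  change indπ S (𝟙_ A) i ▷ X.obj ⊗≫ S.obj i ◁ (β_ X.obj (S.obj i)ᘁ).inv ⊗≫
      hb X.halfBraiding (S.obj i) ▷ (S.obj i)ᘁ ⊗≫ X.obj ◁ evR (S.obj i) ⊗≫ 𝟙 _ = _
  rw [actOn]; monoidal

lemma redRightUnitor_eq (X : ZCenter A) :
    redRightUnitor S X = S.sqrtGlobalDim⁻¹ • runit S X.halfBraiding := by
  rw [redRightUnitor, ← Category.id_comp (runit S X.halfBraiding),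
    ← MonoidalCategory.whiskerLeft_id, ← sum_indπ_indι, whiskerLeft_sum, Preadditive.sum_comp,
    Finset.smul_sum]
  refine Finset.sum_congr rfl fun i _ => ?_
  rw [MonoidalCategory.whiskerLeft_comp, Category.assoc, indι_eq, MonoidalLinear.whiskerLeft_smul,
    Linear.smul_comp, ins_runit, Linear.comp_smul, smul_smul, div_eq_mul_inv, mul_comm]
  congr 1
  change X.obj ◁ indπ S (𝟙_ A) i ⊗≫ (β_ (S.obj i) X.obj).inv ▷ (S.obj i)ᘁ ⊗≫
      hb X.halfBraiding (S.obj i) ▷ (S.obj i)ᘁ ⊗≫ X.obj ◁ evR (S.obj i) ⊗≫ 𝟙 _ = _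
  rw [actOn]; monoidal

lemma cen_over_lunit : Cen (tensOver (indHb S (𝟙_ A)) X) h (lunit S h) :=
  (cen_inductionTensor S _ _).comp ((cen_indMap S _).comp (cen_act S h))

lemma cen_under_runit : Cen (tensUnder X (indHb S (𝟙_ A))) h (runit S h) :=
  (cen_tensorInduction S _ _).comp ((cen_indMap S _).comp (cen_act S h))

/-- Centrality for `tensOver` is built in; the other half-braiding has to be checked summand by
summand, where each crossing is central by Yang–Baxter. Centrality for both is what lets the
constraint absorb the projection. -/
lemma cen_under_lunit : Cen (tensUnder (indObj S (𝟙_ A)) h) h (lunit S h) := by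
  have key : ∀ i, Cen (tensUnder (S.obj i ⊗ (S.obj i)ᘁ) h) h
      (𝟙 _ ⊗≫ S.obj i ◁ (β_ X (S.obj i)ᘁ).inv ⊗≫ actOn h (evR (S.obj i))) := by
    intro i
    have hb1 : Cen (tens (underHb ((S.obj i)ᘁ : A)) h) (tens h (underHb ((S.obj i)ᘁ : A)))
        (β_ X (S.obj i)ᘁ).inv := by
      have := Cen.under_hb h ((S.obj i)ᘁ : A)
      rw [hb_under] at this
      exact Cen.of_iso this (Iso.hom_inv_id _) (Iso.inv_hom_id _)
    have := (Cen.associator (underHb (S.obj i)) (underHb ((S.obj i)ᘁ : A)) h).comp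
      ((Cen.whiskerLeft (underHb (S.obj i)) hb1).comp (cen_actOn_underHb h (evR (S.obj i))))
    rw [tens_under_under] at this
    refine Cen.of_eq ?_ this
    monoidal
  have e : lunit S h = ∑ i, S.sqrtDim i • ((indπ S (𝟙_ A) i ≫
      (S.obj i ◁ (λ_ (S.obj i)ᘁ).hom)) ▷ X ≫
      (𝟙 _ ⊗≫ S.obj i ◁ (β_ X (S.obj i)ᘁ).inv ⊗≫ actOn h (evR (S.obj i)))) := by
    rw [← Category.id_comp (lunit S h), ← MonoidalCategory.id_whiskerRight, ← sum_indπ_indι,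
      sum_whiskerRight, Preadditive.sum_comp]
    refine Finset.sum_congr rfl fun i _ => ?_
    rw [comp_whiskerRight, Category.assoc, indι_eq, MonoidalLinear.smul_whiskerRight,
      Linear.smul_comp, ins_lunit, Linear.comp_smul]
    congr 1
    monoidal
  rw [e]
  exact Cen.sum _ fun i _ => (((Cen.ofUnder _).whiskerRight h).comp (key i)).smul _

lemma cen_over_runit : Cen (tensOver h (indObj S (𝟙_ A))) h (runit S h) := by
  have key : ∀ i, Cen (tensOver h (S.obj i ⊗ (S.obj i)ᘁ)) h
      (𝟙 _ ⊗≫ (β_ (S.obj i) X).inv ▷ (S.obj i)ᘁ ⊗≫ actOn h (evR (S.obj i))) := by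
    intro i
    have hb1 : Cen (tens h (overHb (S.obj i))) (tens (overHb (S.obj i)) h)
        (β_ (S.obj i) X).inv := by
      have := Cen.over_hb h (S.obj i)
      rwa [hb_over] at this
    have := (Cen.associator_inv h (overHb (S.obj i)) (overHb ((S.obj i)ᘁ : A))).comp
      ((hb1.whiskerRight (overHb ((S.obj i)ᘁ : A))).comp
        ((Cen.associator _ _ _).comp (cen_actOn_overHb h (evR (S.obj i)))))
    rw [tens_over_over] at this
    refine Cen.of_eq ?_ this
    monoidal
  have e : runit S h = ∑ i, S.sqrtDim i • (X ◁ (indπ S (𝟙_ A) i ≫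
      (S.obj i ◁ (λ_ (S.obj i)ᘁ).hom)) ≫
      (𝟙 _ ⊗≫ (β_ (S.obj i) X).inv ▷ (S.obj i)ᘁ ⊗≫ actOn h (evR (S.obj i)))) := by
    rw [← Category.id_comp (runit S h), ← MonoidalCategory.whiskerLeft_id, ← sum_indπ_indι,
      whiskerLeft_sum, Preadditive.sum_comp]
    refine Finset.sum_congr rfl fun i _ => ?_
    rw [MonoidalCategory.whiskerLeft_comp, Category.assoc, indι_eq,
      MonoidalLinear.whiskerLeft_smul, Linear.smul_comp, ins_runit, Linear.comp_smul]
    congr 1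
    monoidal
  rw [e]
  exact Cen.sum _ fun i _ => ((Cen.whiskerLeft h (Cen.ofOver _)).comp (key i)).smul _

lemma ins₁_lunit : ins₁ S (𝟙_ A) ▷ X ≫ lunit S h = (λ_ X).hom := by
  rw [lunit, ← Category.assoc, ins₁_inductionTensor, ← Category.assoc, ins₁_indMap,
    Category.assoc, ins₁_act, Category.comp_id]

lemma ins₁_runit : X ◁ ins₁ S (𝟙_ A) ≫ runit S h = (ρ_ X).hom := by
  rw [runit, ← Category.assoc, ins₁_tensorInduction, ← Category.assoc, ins₁_indMap,
    Category.assoc, ins₁_act, Category.comp_id]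

lemma cen_ins₁_left : Cen h (tensUnder (indObj S (𝟙_ A)) h) ((λ_ X).inv ≫ ins₁ S (𝟙_ A) ▷ X) := by
  refine (Cen.leftUnitor_inv h).comp ?_
  rw [← under_unit]
  exact (Cen.ofUnder _).whiskerRight h

lemma cen_ins₁_right : Cen h (tensOver h (indObj S (𝟙_ A))) ((ρ_ X).inv ≫ X ◁ ins₁ S (𝟙_ A)) := by
  refine (Cen.rightUnitor_inv h).comp ?_
  rw [← over_unit]
  exact Cen.whiskerLeft h (Cen.ofOver _)

/-- The inclusion of `X` along the unit copy is a one-sided inverse of `lunit` (`ins₁_lunit`); on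
the image of the projection it is two-sided, because both sides are central and agree on that copy.
-/
lemma lunit_ins₁_rproj : lunit S h ≫ ((λ_ X).inv ≫ ins₁ S (𝟙_ A) ▷ X) ≫
    rproj S (indHb S (𝟙_ A)) h = rproj S (indHb S (𝟙_ A)) h := by
  refine hom_ext_ins₁_whiskerRight S
    ((cen_over_lunit S h).comp ((cen_ins₁_left S h).comp (cen_rproj_under_over S _ _)))
    (cen_rproj_over_over S _ _) ?_
  rw [← Category.assoc, ins₁_lunit]; simp

lemma runit_ins₁_rproj : runit S h ≫ ((ρ_ X).inv ≫ X ◁ ins₁ S (𝟙_ A)) ≫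
    rproj S h (indHb S (𝟙_ A)) = rproj S h (indHb S (𝟙_ A)) := by
  refine hom_ext_ins₁_whiskerLeft S
    ((cen_under_runit S h).comp ((cen_ins₁_right S h).comp (cen_rproj_over_over S _ _)))
    (cen_rproj_under_over S _ _) ?_
  rw [← Category.assoc, ins₁_runit]; simp

variable {h} in
lemma lunit_naturality {Y : A} {h' : HalfBraiding Y} {f : X ⟶ Y} (hf : Cen h h' f) :
    indObj S (𝟙_ A) ◁ f ≫ lunit S h' = lunit S h ≫ f := by
  refine hom_ext_ins₁_whiskerRight S
    ((Cen.whiskerLeft _ (Cen.ofOver f)).comp (cen_over_lunit S h')) ((cen_over_lunit S h).comp hf) ?_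
  rw [← whisker_exchange_assoc, ins₁_lunit, ← Category.assoc, ins₁_lunit]; simp

variable {h} in
lemma runit_naturality {Y : A} {h' : HalfBraiding Y} {f : X ⟶ Y} (hf : Cen h h' f) :
    f ▷ indObj S (𝟙_ A) ≫ runit S h' = runit S h ≫ f := by
  refine hom_ext_ins₁_whiskerLeft S
    (((Cen.ofUnder f).whiskerRight _).comp (cen_under_runit S h'))
    ((cen_under_runit S h).comp hf) ?_
  rw [whisker_exchange_assoc, ins₁_runit, ← Category.assoc, ins₁_runit]; simp

lemma actOn_tensOver_rproj {Y : A} (h' : HalfBraiding Y) {B B' : A} (e : B ⊗ B' ⟶ 𝟙_ A) :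
    actOn (tensOver h Y) e ≫ rproj S h h' = actOn (tensUnder X h') e ≫ rproj S h h' := by
  have key : ∀ g : HalfBraiding (X ⊗ Y), actOn g e ≫ rproj S h h' =
      𝟙 _ ⊗≫ (hb g B ≫ rproj S h h' ▷ B) ▷ B' ⊗≫ (X ⊗ Y) ◁ e ⊗≫ 𝟙 _ := by
    intro g
    calc
      _ = 𝟙 _ ⊗≫ hb g B ▷ B' ⊗≫ ((X ⊗ Y) ◁ e ≫ rproj S h h' ▷ 𝟙_ A) ⊗≫ 𝟙 _ := by
        rw [actOn]; monoidal
      _ = _ := by rw [whisker_exchange]; monoidal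
  rw [key, key, hb_tensOver_rproj]

/-- The content of the triangle axiom. A cap between `X` and `Y` may act on `X` from the left or on
`Y` from the right; these are the actions for the two half-braidings of `X ⊗ Y`, which agree after
the projection (`actOn_tensOver_rproj`). -/
lemma runit_lunit_rproj {Y : A} (h' : HalfBraiding Y) : runit S h ▷ Y ≫ rproj S h h' =
    (α_ _ _ _).hom ≫ X ◁ lunit S h' ≫ rproj S h h' := by
  rw [← Iso.inv_comp_eq]
  have key : ∀ f g : X ⊗ indObj S (𝟙_ A) ⊗ Y ⟶ X ⊗ Y,
      (∀ i, X ◁ ins S (𝟙_ A) (evR (S.obj i)) ▷ Y ≫ f =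
        X ◁ ins S (𝟙_ A) (evR (S.obj i)) ▷ Y ≫ g) → f = g := by
    intro f g H
    rw [← Category.id_comp f, ← Category.id_comp g, ← MonoidalCategory.whiskerLeft_id,
      ← MonoidalCategory.id_whiskerRight, ← sum_indπ_indι]
    simp only [sum_whiskerRight, whiskerLeft_sum, Preadditive.sum_comp, comp_whiskerRight,
      MonoidalCategory.whiskerLeft_comp, Category.assoc, indι_eq, MonoidalLinear.smul_whiskerRight,
      MonoidalLinear.whiskerLeft_smul, Linear.smul_comp, H]
  apply key
  intro i
  generalize evR (S.obj i) = e
  generalize ((S.obj i)ᘁ : A) = B' at e ⊢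
  generalize S.obj i = B at e ⊢
  have h1 := actOn_tensOver h Y e
  have h2 := actOn_tensUnder X h' e
  have h3 := actOn_tensOver_rproj S h h' e
  calc
    _ = 𝟙 _ ⊗≫ (X ◁ ins S (𝟙_ A) e ≫ runit S h) ▷ Y ⊗≫ rproj S h h' := by monoidal
    _ = 𝟙 _ ⊗≫ (β_ B X).inv ▷ (B' ⊗ Y) ⊗≫ (B ⊗ X) ◁ ((β_ Y B').inv ≫ (β_ Y B').hom) ⊗≫
        actOn h e ▷ Y ⊗≫ rproj S h h' := by
      rw [ins_runit, Iso.inv_hom_id]; monoidal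
    _ = 𝟙 _ ⊗≫ ((β_ B X).inv ▷ (B' ⊗ Y) ≫ (B ⊗ X) ◁ (β_ Y B').inv) ⊗≫
        (actOn (tensOver h Y) e ≫ rproj S h h') := by
      rw [h1]; monoidal
    _ = 𝟙 _ ⊗≫ X ◁ B ◁ (β_ Y B').inv ⊗≫ ((β_ B X).inv ≫ (β_ B X).hom) ▷ (Y ⊗ B') ⊗≫
        X ◁ actOn h' e ⊗≫ rproj S h h' := by
      rw [← whisker_exchange, h3, h2]; monoidal
    _ = X ◁ (ins S (𝟙_ A) e ▷ Y ≫ lunit S h') ≫ rproj S h h' := by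
      rw [ins_lunit, Iso.inv_hom_id]; monoidal
    _ = _ := by monoidal

end UnitConstraints

end

end ReducedTensor

namespace ReducedTensor

noncomputable section

/-! ### The monoidal category of the reduced tensor product -/

section MonoidalStructure

variable {k : Type w} [Field k] [IsAlgClosed k]
  {A : Type u} [Category.{v} A] [Abelian A] [Linear k A] [MonoidalCategory A]
  [MonoidalPreadditive A] [MonoidalLinear k A] [BraidedCategory A] [RigidCategory A]
  [PivotalCategory A] [PremodularCategory k A] {ι : Type u₁} [Fintype ι]
  (S : SimpleData k A ι)

variable [CharZero k]

/-- The Drinfeld center, as a type that remembers the choice of simple objects, so that it can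
carry the reduced tensor product as an instance. -/
@[nolint unusedArguments]
def RCenter (_ : SimpleData k A ι) : Type _ := ZCenter A

namespace RCenter

instance : Category (RCenter S) := inferInstanceAs (Category (ZCenter A))

variable {S}

/-- The object of `A` underlying an object of the center. -/
def obj (X : RCenter S) : A := ZCenter.obj X

/-- The half-braiding of an object of the center. -/
def halfBraiding (X : RCenter S) : HalfBraiding X.obj := ZCenter.halfBraiding X

/-- The morphism of `A` underlying a morphism in the center. -/
def hom {X Y : RCenter S} (f : X ⟶ Y) : X.obj ⟶ Y.obj := ZCenter.Hom.hom f

/-- A morphism in the center, from a morphism that is compatible with the half-braidings. -/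
def mk {X Y : RCenter S} (f : X.obj ⟶ Y.obj) (hf : Cen X.halfBraiding Y.halfBraiding f) : X ⟶ Y :=
  ⟨f, hf⟩

lemma cen {X Y : RCenter S} (f : X ⟶ Y) :
    Cen X.halfBraiding Y.halfBraiding (hom f) := ZCenter.Hom.comm f

@[ext]
lemma hom_ext {X Y : RCenter S} {f g : X ⟶ Y} (h : hom f = hom g) : f = g := ZCenter.hom_ext h

@[simp]
lemma id_hom (X : RCenter S) : hom (𝟙 X) = 𝟙 X.obj := rfl

@[simp]
lemma comp_hom {X Y Z : RCenter S} (f : X ⟶ Y) (g : Y ⟶ Z) : hom (f ≫ g) = hom f ≫ hom g := rfl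

/-- An isomorphism in the center. -/
def mkIso {X Y : RCenter S} (f : X.obj ⟶ Y.obj) (g : Y.obj ⟶ X.obj)
    (hf : Cen X.halfBraiding Y.halfBraiding f) (hfg : f ≫ g = 𝟙 _) (hgf : g ≫ f = 𝟙 _) : X ≅ Y where
  hom := mk f hf
  inv := mk g (hf.of_iso hfg hgf)
  hom_inv_id := hom_ext hfg
  inv_hom_id := hom_ext hgf

/-- The reduced tensor product of objects. -/
def tens (X Y : RCenter S) : RCenter S :=
  ZCenter.mk (rtensObj S X.halfBraiding Y.halfBraiding) (rtens S X.halfBraiding Y.halfBraiding)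

/-- The inclusion of the reduced tensor product in the tensor product. -/
def incl (X Y : RCenter S) : (tens X Y).obj ⟶ X.obj ⊗ Y.obj := rincl S X.halfBraiding Y.halfBraiding

/-- The projection of the tensor product to the reduced tensor product. -/
def proj (X Y : RCenter S) : X.obj ⊗ Y.obj ⟶ (tens X Y).obj := rpr S X.halfBraiding Y.halfBraiding

/-- The idempotent defining the reduced tensor product. -/
def idem (X Y : RCenter S) : X.obj ⊗ Y.obj ⟶ X.obj ⊗ Y.obj :=
  rproj S X.halfBraiding Y.halfBraiding

lemma proj_incl (X Y : RCenter S) : proj X Y ≫ incl X Y = idem X Y := rpr_rincl S _ _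

lemma incl_proj (X Y : RCenter S) : incl X Y ≫ proj X Y = 𝟙 _ := rincl_rpr S _ _

lemma incl_idem (X Y : RCenter S) : incl X Y ≫ idem X Y = incl X Y := rincl_rproj S _ _

lemma idem_proj (X Y : RCenter S) : idem X Y ≫ proj X Y = proj X Y := rproj_rpr S _ _

instance (X Y : RCenter S) : Mono (incl X Y) := mono_of_mono_fac (incl_proj X Y)

instance (X Y : RCenter S) : Epi (proj X Y) := epi_of_epi_fac (incl_proj X Y)

/-- The reduced tensor product of morphisms. -/
def tensHom {X X' Y Y' : RCenter S} (f : X ⟶ X') (g : Y ⟶ Y') : tens X Y ⟶ tens X' Y' :=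
  mk (incl X Y ≫ (hom f ⊗ₘ hom g) ≫ proj X' Y') (by
    rw [MonoidalCategory.tensorHom_def, Category.assoc]
    exact (cen_rincl_over S _ _).comp (((cen f).whiskerRight _).comp
      ((Cen.whiskerLeft _ (Cen.ofOver _)).comp (cen_over_rpr S _ _))))

lemma tensHom_hom {X X' Y Y' : RCenter S} (f : X ⟶ X') (g : Y ⟶ Y') :
    hom (tensHom f g) = incl X Y ≫ (hom f ⊗ₘ hom g) ≫ proj X' Y' := rfl

lemma tensorHom_idem {X X' Y Y' : RCenter S} (f : X ⟶ X') (g : Y ⟶ Y') :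
    (hom f ⊗ₘ hom g) ≫ idem X' Y' = idem X Y ≫ (hom f ⊗ₘ hom g) :=
  tensorHom_rproj (cen f) (cen g)

lemma tensHom_incl {X X' Y Y' : RCenter S} (f : X ⟶ X') (g : Y ⟶ Y') :
    hom (tensHom f g) ≫ incl X' Y' = incl X Y ≫ (hom f ⊗ₘ hom g) := by
  rw [tensHom_hom, Category.assoc, Category.assoc, proj_incl, tensorHom_idem,
    ← Category.assoc, incl_idem]

lemma proj_tensHom {X X' Y Y' : RCenter S} (f : X ⟶ X') (g : Y ⟶ Y') :
    proj X Y ≫ hom (tensHom f g) = (hom f ⊗ₘ hom g) ≫ proj X' Y' := by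
  rw [tensHom_hom, ← Category.assoc, proj_incl, ← Category.assoc, ← tensorHom_idem,
    Category.assoc, idem_proj]

/-- The inclusion of the left-nested triple reduced tensor product. -/
def inclL (X Y Z : RCenter S) : (tens (tens X Y) Z).obj ⟶ (X.obj ⊗ Y.obj) ⊗ Z.obj :=
  incl (tens X Y) Z ≫ incl X Y ▷ Z.obj

/-- The projection to the left-nested triple reduced tensor product. -/
def projL (X Y Z : RCenter S) : (X.obj ⊗ Y.obj) ⊗ Z.obj ⟶ (tens (tens X Y) Z).obj :=
  proj X Y ▷ Z.obj ≫ proj (tens X Y) Z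

/-- The inclusion of the right-nested triple reduced tensor product. -/
def inclR (X Y Z : RCenter S) : (tens X (tens Y Z)).obj ⟶ X.obj ⊗ Y.obj ⊗ Z.obj :=
  incl X (tens Y Z) ≫ X.obj ◁ incl Y Z

/-- The projection to the right-nested triple reduced tensor product. -/
def projR (X Y Z : RCenter S) : X.obj ⊗ Y.obj ⊗ Z.obj ⟶ (tens X (tens Y Z)).obj :=
  X.obj ◁ proj Y Z ≫ proj X (tens Y Z)

lemma inclL_projL (X Y Z : RCenter S) : inclL X Y Z ≫ projL X Y Z = 𝟙 _ := rinclL_rprL S _ _ _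

lemma inclR_projR (X Y Z : RCenter S) : inclR X Y Z ≫ projR X Y Z = 𝟙 _ := rinclR_rprR S _ _ _

lemma projL_inclL_associator (X Y Z : RCenter S) :
    projL X Y Z ≫ inclL X Y Z ≫ (α_ X.obj Y.obj Z.obj).hom =
      (α_ X.obj Y.obj Z.obj).hom ≫ projR X Y Z ≫ inclR X Y Z :=
  rprL_rinclL_associator S _ _ _

/-- The associativity constraint of the reduced tensor product. -/
def assoc (X Y Z : RCenter S) : tens (tens X Y) Z ≅ tens X (tens Y Z) :=
  mkIso (inclL X Y Z ≫ (α_ X.obj Y.obj Z.obj).hom ≫ projR X Y Z)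
    (inclR X Y Z ≫ (α_ X.obj Y.obj Z.obj).inv ≫ projL X Y Z)
    ((cen_rinclL S _ _ _).comp ((cen_associator_over _).comp (cen_rprR S _ _ _)))
    (by
      have := projL_inclL_associator X Y Z
      simp only [Category.assoc]
      rw [← reassoc_of% this]
      simp only [Iso.hom_inv_id_assoc, inclL_projL, Category.comp_id])
    (by
      have := projL_inclL_associator X Y Z
      simp only [Category.assoc]
      rw [reassoc_of% this]
      simp only [Iso.inv_hom_id_assoc, inclR_projR, Category.comp_id])

lemma assoc_hom (X Y Z : RCenter S) : hom (assoc X Y Z).hom =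
    incl (tens X Y) Z ≫ incl X Y ▷ Z.obj ≫ (α_ X.obj Y.obj Z.obj).hom ≫
      X.obj ◁ proj Y Z ≫ proj X (tens Y Z) := by
  change inclL X Y Z ≫ (α_ X.obj Y.obj Z.obj).hom ≫ projR X Y Z = _
  rw [inclL, projR]
  simp only [Category.assoc]

lemma assoc_incl (X Y Z : RCenter S) : hom (assoc X Y Z).hom ≫ incl X (tens Y Z) ≫
    X.obj ◁ incl Y Z = incl (tens X Y) Z ≫ incl X Y ▷ Z.obj ≫ (α_ X.obj Y.obj Z.obj).hom := by
  change (inclL X Y Z ≫ (α_ X.obj Y.obj Z.obj).hom ≫ projR X Y Z) ≫ inclR X Y Z = _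
  rw [Category.assoc, Category.assoc, ← projL_inclL_associator, ← Category.assoc, inclL_projL,
    Category.id_comp, inclL, Category.assoc]

lemma cancel_incl_incl {W X Y Z : RCenter S} {f g : W ⟶ tens X (tens Y Z)}
    (h : hom f ≫ incl X (tens Y Z) ≫ X.obj ◁ incl Y Z = hom g ≫ incl X (tens Y Z) ≫
      X.obj ◁ incl Y Z) : f = g := by
  apply hom_ext
  have := congrArg (fun t => t ≫ X.obj ◁ proj Y Z) h
  simp only [Category.assoc, ← MonoidalCategory.whiskerLeft_comp, incl_proj,
    MonoidalCategory.whiskerLeft_id, Category.comp_id] at this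
  exact (cancel_mono _).1 this

lemma cancel_incl {W X Y : RCenter S} {f g : W ⟶ tens X Y}
    (h : hom f ≫ incl X Y = hom g ≫ incl X Y) : f = g := by
  exact hom_ext ((cancel_mono _).1 h)

variable (S) in
/-- The unit object of the reduced tensor product. -/
def unit : RCenter S := ZCenter.mk (indObj S (𝟙_ A)) (indHb S (𝟙_ A))

/-- The inclusion of the unit object of `A` in that of the center. -/
def unitIns : 𝟙_ A ⟶ (unit S).obj := ins₁ S (𝟙_ A)

/-- The left unit constraint, before restriction. -/
def lunit (X : RCenter S) : (unit S).obj ⊗ X.obj ⟶ X.obj := ReducedTensor.lunit S X.halfBraiding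

/-- The right unit constraint, before restriction. -/
def runit (X : RCenter S) : X.obj ⊗ (unit S).obj ⟶ X.obj := ReducedTensor.runit S X.halfBraiding

lemma idem_lunit (X : RCenter S) : idem (unit S) X ≫ lunit X = lunit X :=
  rproj_comp (cen_over_lunit S _) (cen_under_lunit S _)

lemma idem_runit (X : RCenter S) : idem X (unit S) ≫ runit X = runit X :=
  rproj_comp (cen_over_runit S _) (cen_under_runit S _)

lemma proj_incl_lunit (X : RCenter S) : proj (unit S) X ≫ incl (unit S) X ≫ lunit X = lunit X := by
  rw [← Category.assoc, proj_incl, idem_lunit]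

lemma proj_incl_runit (X : RCenter S) : proj X (unit S) ≫ incl X (unit S) ≫ runit X = runit X := by
  rw [← Category.assoc, proj_incl, idem_runit]

lemma unitIns_lunit (X : RCenter S) : unitIns ▷ X.obj ≫ lunit X = (λ_ X.obj).hom := ins₁_lunit S _

lemma unitIns_runit (X : RCenter S) : X.obj ◁ unitIns ≫ runit X = (ρ_ X.obj).hom := ins₁_runit S _

lemma lunit_unitIns_idem (X : RCenter S) :
    lunit X ≫ (λ_ X.obj).inv ≫ unitIns ▷ X.obj ≫ idem (unit S) X = idem (unit S) X := by
  have := lunit_ins₁_rproj S X.halfBraiding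
  rw [Category.assoc] at this
  exact this

lemma runit_unitIns_idem (X : RCenter S) :
    runit X ≫ (ρ_ X.obj).inv ≫ X.obj ◁ unitIns ≫ idem X (unit S) = idem X (unit S) := by
  have := runit_ins₁_rproj S X.halfBraiding
  rw [Category.assoc] at this
  exact this

lemma runit_lunit_idem (X Y : RCenter S) : runit X ▷ Y.obj ≫ idem X Y =
    (α_ _ _ _).hom ≫ X.obj ◁ lunit Y ≫ idem X Y := runit_lunit_rproj S _ _

lemma whiskerLeft_lunit {X Y : RCenter S} (f : X ⟶ Y) :
    (unit S).obj ◁ hom f ≫ lunit Y = lunit X ≫ hom f := lunit_naturality S (cen f)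

lemma whiskerRight_runit {X Y : RCenter S} (f : X ⟶ Y) :
    hom f ▷ (unit S).obj ≫ runit Y = runit X ≫ hom f := runit_naturality S (cen f)

/-- The left unit constraint of the reduced tensor product. -/
def leftUnit (X : RCenter S) : tens (unit S) X ≅ X :=
  mkIso (S.sqrtGlobalDim⁻¹ • (incl (unit S) X ≫ lunit X))
    -- The constraint carries the factor `𝒟^{-1/2}`, so its inverse carries `𝒟^{1/2}`.
    (S.sqrtGlobalDim • ((λ_ X.obj).inv ≫ unitIns ▷ X.obj ≫ proj (unit S) X))
    (((cen_rincl_over S _ _).comp (cen_over_lunit S _)).smul _)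
    (by
      have h := congrArg (fun t => incl (unit S) X ≫ t) (lunit_unitIns_idem X)
      rw [incl_idem, ← proj_incl] at h
      rw [Linear.smul_comp, Linear.comp_smul, smul_smul,
        inv_mul_cancel₀ (sqrtGlobalDim_ne_zero S), one_smul, ← cancel_mono (incl (unit S) X)]
      simpa using h)
    (by
      rw [Linear.smul_comp, Linear.comp_smul, smul_smul,
        mul_inv_cancel₀ (sqrtGlobalDim_ne_zero S), one_smul, Category.assoc, Category.assoc,
        proj_incl_lunit, unitIns_lunit, Iso.inv_hom_id])

/-- The right unit constraint of the reduced tensor product. -/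
def rightUnit (X : RCenter S) : tens X (unit S) ≅ X :=
  mkIso (S.sqrtGlobalDim⁻¹ • (incl X (unit S) ≫ runit X))
    (S.sqrtGlobalDim • ((ρ_ X.obj).inv ≫ X.obj ◁ unitIns ≫ proj X (unit S)))
    (((cen_rincl_under S _ _).comp (cen_under_runit S _)).smul _)
    (by
      have h := congrArg (fun t => incl X (unit S) ≫ t) (runit_unitIns_idem X)
      rw [incl_idem, ← proj_incl] at h
      rw [Linear.smul_comp, Linear.comp_smul, smul_smul,
        inv_mul_cancel₀ (sqrtGlobalDim_ne_zero S), one_smul, ← cancel_mono (incl X (unit S))]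
      simpa using h)
    (by
      rw [Linear.smul_comp, Linear.comp_smul, smul_smul,
        mul_inv_cancel₀ (sqrtGlobalDim_ne_zero S), one_smul, Category.assoc, Category.assoc,
        proj_incl_runit, unitIns_runit, Iso.inv_hom_id])

lemma leftUnit_hom (X : RCenter S) :
    hom (leftUnit X).hom = S.sqrtGlobalDim⁻¹ • (incl (unit S) X ≫ lunit X) := rfl

lemma rightUnit_hom (X : RCenter S) :
    hom (rightUnit X).hom = S.sqrtGlobalDim⁻¹ • (incl X (unit S) ≫ runit X) := rfl

instance : MonoidalCategoryStruct (RCenter S) where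
  tensorObj := tens
  whiskerLeft X _ _ f := tensHom (𝟙 X) f
  whiskerRight f Y := tensHom f (𝟙 Y)
  tensorHom := tensHom
  tensorUnit := unit S
  associator := assoc
  leftUnitor := leftUnit
  rightUnitor := rightUnit

lemma tensHom_id (X Y : RCenter S) : tensHom (𝟙 X) (𝟙 Y) = 𝟙 (tens X Y) := by
  apply cancel_incl
  rw [tensHom_incl]; simp

lemma tensHom_comp {X Y Z X' Y' Z' : RCenter S} (f : X ⟶ Y) (f' : X' ⟶ Y') (g : Y ⟶ Z)
    (g' : Y' ⟶ Z') : tensHom f f' ≫ tensHom g g' = tensHom (f ≫ g) (f' ≫ g') := by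
  apply cancel_incl
  rw [comp_hom, Category.assoc, tensHom_incl, tensHom_incl, ← Category.assoc, tensHom_incl]
  simp

lemma assoc_naturality {X Y Z X' Y' Z' : RCenter S} (f : X ⟶ X') (g : Y ⟶ Y') (h : Z ⟶ Z') :
    tensHom (tensHom f g) h ≫ (assoc X' Y' Z').hom =
      (assoc X Y Z).hom ≫ tensHom f (tensHom g h) := by
  apply cancel_incl_incl
  rw [comp_hom, comp_hom, Category.assoc, Category.assoc, assoc_incl, ← Category.assoc,
    tensHom_incl, ← Category.assoc (hom (tensHom f (tensHom g h))), tensHom_incl, Category.assoc,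
    Category.assoc]
  have h1 : (hom (tensHom f g) ⊗ₘ hom h) ≫ incl X' Y' ▷ Z'.obj =
      incl X Y ▷ Z.obj ≫ ((hom f ⊗ₘ hom g) ⊗ₘ hom h) := by
    rw [tensorHom_comp_whiskerRight, tensHom_incl, whiskerRight_comp_tensorHom]
  have h2 : (hom f ⊗ₘ hom (tensHom g h)) ≫ X'.obj ◁ incl Y' Z' =
      X.obj ◁ incl Y Z ≫ (hom f ⊗ₘ hom g ⊗ₘ hom h) := by
    rw [tensorHom_comp_whiskerLeft, tensHom_incl, whiskerLeft_comp_tensorHom]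
  rw [reassoc_of% h1, h2, ← Category.assoc (incl X (tens Y Z)), ← Category.assoc (hom (assoc X Y Z).hom),
    assoc_incl]
  simp

lemma leftUnit_naturality {X Y : RCenter S} (f : X ⟶ Y) :
    tensHom (𝟙 (unit S)) f ≫ (leftUnit Y).hom = (leftUnit X).hom ≫ f := by
  apply hom_ext
  rw [comp_hom, comp_hom, leftUnit_hom, leftUnit_hom, Linear.comp_smul, Linear.smul_comp,
    ← Category.assoc, tensHom_incl, Category.assoc, Category.assoc]
  congr 2
  simpa using whiskerLeft_lunit f

lemma rightUnit_naturality {X Y : RCenter S} (f : X ⟶ Y) :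
    tensHom f (𝟙 (unit S)) ≫ (rightUnit Y).hom = (rightUnit X).hom ≫ f := by
  apply hom_ext
  rw [comp_hom, comp_hom, rightUnit_hom, rightUnit_hom, Linear.comp_smul, Linear.smul_comp,
    ← Category.assoc, tensHom_incl, Category.assoc, Category.assoc]
  congr 2
  simpa using whiskerRight_runit f

/-- Both sides are compared inside `X ⊗ Y`, followed by the projection, which acts trivially on the
image and makes `runit_lunit_idem` applicable. -/
lemma reduced_triangle (X Y : RCenter S) : (assoc X (unit S) Y).hom ≫ tensHom (𝟙 X) (leftUnit Y).hom =
    tensHom (rightUnit X).hom (𝟙 Y) := by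
  apply cancel_incl
  have h := runit_lunit_idem X Y
  have h1 : incl X (tens (unit S) Y) ≫ X.obj ◁ (incl (unit S) Y ≫ lunit Y) =
      (incl X (tens (unit S) Y) ≫ X.obj ◁ incl (unit S) Y) ≫ X.obj ◁ lunit Y := by simp
  have e1 : hom (tensHom (𝟙 X) (leftUnit Y).hom) ≫ incl X Y =
      S.sqrtGlobalDim⁻¹ • ((incl X (tens (unit S) Y) ≫ X.obj ◁ incl (unit S) Y) ≫
        X.obj ◁ lunit Y) := by
    rw [tensHom_incl, leftUnit_hom, id_hom, id_tensorHom, MonoidalLinear.whiskerLeft_smul,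
      Linear.comp_smul, h1]
  have e2 : hom (tensHom (rightUnit X).hom (𝟙 Y)) ≫ incl X Y =
      S.sqrtGlobalDim⁻¹ • ((incl (tens X (unit S)) Y ≫ incl X (unit S) ▷ Y.obj) ≫
        runit X ▷ Y.obj) := by
    rw [tensHom_incl, rightUnit_hom, id_hom, tensorHom_id, MonoidalLinear.smul_whiskerRight,
      Linear.comp_smul, comp_whiskerRight, Category.assoc]
  have e3 := congrArg (fun t => t ≫ idem X Y) e1
  have e4 := congrArg (fun t => t ≫ idem X Y) e2
  simp only [Category.assoc, incl_idem] at e3 e4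
  rw [comp_hom, Category.assoc, e3, e4]
  rw [Linear.smul_comp, Linear.smul_comp, Linear.comp_smul]
  congr 1
  have h2 := congrArg (fun t => (incl (tens X (unit S)) Y ≫ incl X (unit S) ▷ Y.obj) ≫ t) h
  have h3 := assoc_incl X (unit S) Y
  simp only [Category.assoc] at h2 ⊢
  rw [← Category.assoc (incl X (tens (unit S) Y)), ← Category.assoc (hom (assoc X (unit S) Y).hom),
    h3]
  simp only [Category.assoc]
  exact h2.symm

lemma reduced_pentagon (W X Y Z : RCenter S) :
    tensHom (assoc W X Y).hom (𝟙 Z) ≫ (assoc W (tens X Y) Z).hom ≫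
      tensHom (𝟙 W) (assoc X Y Z).hom =
      (assoc (tens W X) Y Z).hom ≫ (assoc W X (tens Y Z)).hom := by
  -- Morphisms are compared after inclusion in the fourfold tensor product of `A`, where every
  -- associator becomes that of `A` and the identity is its pentagon.
  have key : ∀ {V : RCenter S} {f g : V ⟶ tens W (tens X (tens Y Z))},
      hom f ≫ incl W (tens X (tens Y Z)) ≫ W.obj ◁ (incl X (tens Y Z) ≫ X.obj ◁ incl Y Z) =
        hom g ≫ incl W (tens X (tens Y Z)) ≫ W.obj ◁ (incl X (tens Y Z) ≫ X.obj ◁ incl Y Z) →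
      f = g := by
    intro V f g h
    apply cancel_incl_incl
    have := congrArg (fun t => t ≫ W.obj ◁ X.obj ◁ proj Y Z) h
    simpa only [Category.assoc, ← MonoidalCategory.whiskerLeft_comp, incl_proj,
      MonoidalCategory.whiskerLeft_id, Category.comp_id] using this
  apply key
  have hL : hom (tensHom (𝟙 W) (assoc X Y Z).hom) ≫ incl W (tens X (tens Y Z)) ≫
      W.obj ◁ (incl X (tens Y Z) ≫ X.obj ◁ incl Y Z) =
      incl W (tens (tens X Y) Z) ≫ W.obj ◁ (incl (tens X Y) Z ≫ incl X Y ▷ Z.obj ≫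
        (α_ X.obj Y.obj Z.obj).hom) := by
    rw [← assoc_incl, ← Category.assoc, tensHom_incl, id_hom, id_tensorHom, Category.assoc,
      ← MonoidalCategory.whiskerLeft_comp]
  have hM : hom (assoc W (tens X Y) Z).hom ≫ incl W (tens (tens X Y) Z) ≫
      W.obj ◁ incl (tens X Y) Z = _ := assoc_incl W (tens X Y) Z
  have hN : hom (tensHom (assoc W X Y).hom (𝟙 Z)) ≫ incl (tens W (tens X Y)) Z ≫
      (incl W (tens X Y) ≫ W.obj ◁ incl X Y) ▷ Z.obj = incl (tens (tens W X) Y) Z ≫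
      (incl (tens W X) Y ≫ incl W X ▷ Y.obj ≫ (α_ W.obj X.obj Y.obj).hom) ▷ Z.obj := by
    rw [← Category.assoc, tensHom_incl, id_hom, tensorHom_id, Category.assoc,
      ← comp_whiskerRight, assoc_incl]
  have hP := assoc_incl W X (tens Y Z)
  have hR := assoc_incl (tens W X) Y Z
  simp only [comp_hom, Category.assoc, MonoidalCategory.whiskerLeft_comp] at hL hM hN hP hR ⊢
  rw [hL, reassoc_of% hM, reassoc_of% hP, ← associator_naturality_right,
    ← whisker_exchange_assoc, reassoc_of% hR, ← associator_naturality_middle_assoc]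
  rw [comp_whiskerRight] at hN
  rw [reassoc_of% hN]
  simp only [comp_whiskerRight, Category.assoc]
  monoidal

instance : MonoidalCategory (RCenter S) :=
  .ofTensorHom
    (id_tensorHom_id := tensHom_id)
    (id_tensorHom := fun _ _ _ _ => rfl)
    (tensorHom_id := fun _ _ => rfl)
    (tensorHom_comp_tensorHom := tensHom_comp)
    (associator_naturality := assoc_naturality)
    (leftUnitor_naturality := leftUnit_naturality)
    (rightUnitor_naturality := rightUnit_naturality)
    (pentagon := reduced_pentagon)
    (triangle := reduced_triangle)

end RCenter

end MonoidalStructure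

end

end ReducedTensor

namespace ReducedTensor

noncomputable section

/-! ### The half-braiding of the dual -/

section Mate

variable {A : Type u} [Category.{v} A] [MonoidalCategory A]

/-- The mate `X^* ⊗ B ⟶ B ⊗ X^*` of a half-braiding `B ⊗ X ⟶ X ⊗ B`. -/
def mate {X : A} (X' : A) [ExactPairing X X'] (h : HalfBraiding X) (B : A) : X' ⊗ B ⟶ B ⊗ X' :=
  𝟙 _ ⊗≫ (X' ⊗ B) ◁ η_ X X' ⊗≫ X' ◁ hb h B ▷ X' ⊗≫ ε_ X X' ▷ (B ⊗ X') ⊗≫ 𝟙 _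

variable {X : A} (X' : A) [ExactPairing X X'] (h : HalfBraiding X)

lemma coevaluation_mate (B : A) : 𝟙 B ⊗≫ η_ X X' ▷ B ⊗≫ X ◁ mate X' h B ⊗≫ 𝟙 (X ⊗ B ⊗ X') =
    𝟙 _ ⊗≫ B ◁ η_ X X' ⊗≫ hb h B ▷ X' ⊗≫ 𝟙 _ := by
  calc
    _ = 𝟙 _ ⊗≫ (η_ X X' ▷ (B ⊗ 𝟙_ A) ≫ (X ⊗ X') ◁ (B ◁ η_ X X')) ⊗≫ X ◁ X' ◁ hb h B ▷ X' ⊗≫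
        X ◁ ε_ X X' ▷ (B ⊗ X') ⊗≫ 𝟙 _ := by rw [mate]; monoidal
    _ = 𝟙 _ ⊗≫ B ◁ η_ X X' ⊗≫ (η_ X X' ▷ (B ⊗ X) ≫ (X ⊗ X') ◁ hb h B) ▷ X' ⊗≫
        X ◁ ε_ X X' ▷ (B ⊗ X') ⊗≫ 𝟙 _ := by rw [← whisker_exchange]; monoidal
    _ = 𝟙 _ ⊗≫ B ◁ η_ X X' ⊗≫ hb h B ▷ X' ⊗≫ (η_ X X' ▷ X ⊗≫ X ◁ ε_ X X') ▷ (B ⊗ X') ⊗≫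
        𝟙 _ := by rw [← whisker_exchange]; monoidal
    _ = _ := by rw [ExactPairing.evaluation_coevaluation'']; monoidal

lemma mate_evaluation (B : A) : 𝟙 ((X' ⊗ B) ⊗ X) ⊗≫ mate X' h B ▷ X ⊗≫ B ◁ ε_ X X' ⊗≫ 𝟙 B =
    𝟙 _ ⊗≫ X' ◁ hb h B ⊗≫ ε_ X X' ▷ B ⊗≫ 𝟙 _ := by
  calc
    _ = 𝟙 _ ⊗≫ (X' ⊗ B) ◁ η_ X X' ▷ X ⊗≫ X' ◁ hb h B ▷ X' ▷ X ⊗≫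
        (ε_ X X' ▷ (B ⊗ (X' ⊗ X)) ≫ 𝟙_ A ◁ (B ◁ ε_ X X')) ⊗≫ 𝟙 _ := by rw [mate]; monoidal
    _ = 𝟙 _ ⊗≫ (X' ⊗ B) ◁ η_ X X' ▷ X ⊗≫ X' ◁ (hb h B ▷ (X' ⊗ X) ≫ (X ⊗ B) ◁ ε_ X X') ⊗≫
        ε_ X X' ▷ B ⊗≫ 𝟙 _ := by rw [← whisker_exchange]; monoidal
    _ = 𝟙 _ ⊗≫ (X' ⊗ B) ◁ (η_ X X' ▷ X ⊗≫ X ◁ ε_ X X') ⊗≫ X' ◁ hb h B ⊗≫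
        ε_ X X' ▷ B ⊗≫ 𝟙 _ := by rw [← whisker_exchange]; monoidal
    _ = _ := by rw [ExactPairing.evaluation_coevaluation'']; monoidal

lemma mate_naturality {B C : A} (f : B ⟶ C) :
    X' ◁ f ≫ mate X' h C = mate X' h B ≫ f ▷ X' := by
  calc
    _ = 𝟙 _ ⊗≫ X' ◁ (f ▷ 𝟙_ A ≫ C ◁ η_ X X') ⊗≫ X' ◁ hb h C ▷ X' ⊗≫
        ε_ X X' ▷ (C ⊗ X') ⊗≫ 𝟙 _ := by rw [mate]; monoidal
    _ = 𝟙 _ ⊗≫ (X' ⊗ B) ◁ η_ X X' ⊗≫ X' ◁ (f ▷ X ≫ hb h C) ▷ X' ⊗≫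
        ε_ X X' ▷ (C ⊗ X') ⊗≫ 𝟙 _ := by rw [← whisker_exchange]; monoidal
    _ = 𝟙 _ ⊗≫ (X' ⊗ B) ◁ η_ X X' ⊗≫ X' ◁ hb h B ▷ X' ⊗≫
        ((X' ⊗ X) ◁ (f ▷ X') ≫ ε_ X X' ▷ (C ⊗ X')) ⊗≫ 𝟙 _ := by
      rw [(hb_isLaxBraiding h).naturality]; monoidal
    _ = _ := by rw [whisker_exchange, mate]; monoidal

lemma mate_tensor (B C : A) :
    mate X' h (B ⊗ C) = 𝟙 _ ⊗≫ mate X' h B ▷ C ⊗≫ B ◁ mate X' h C ⊗≫ 𝟙 _ := by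
  symm
  calc
    _ = 𝟙 _ ⊗≫ (X' ⊗ B) ◁ η_ X X' ▷ C ⊗≫ X' ◁ hb h B ▷ (X' ⊗ C) ⊗≫
        (ε_ X X' ▷ (B ⊗ (X' ⊗ C)) ≫ 𝟙_ A ◁ (B ◁ mate X' h C)) ⊗≫ 𝟙 _ := by
      nth_rw 1 [mate]; monoidal
    _ = 𝟙 _ ⊗≫ (X' ⊗ B) ◁ η_ X X' ▷ C ⊗≫ X' ◁ (hb h B ▷ (X' ⊗ C) ≫ (X ⊗ B) ◁ mate X' h C) ⊗≫
        ε_ X X' ▷ (B ⊗ C ⊗ X') ⊗≫ 𝟙 _ := by rw [← whisker_exchange]; monoidal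
    _ = 𝟙 _ ⊗≫ (X' ⊗ B) ◁ (𝟙 C ⊗≫ η_ X X' ▷ C ⊗≫ X ◁ mate X' h C ⊗≫ 𝟙 (X ⊗ C ⊗ X')) ⊗≫
        X' ◁ hb h B ▷ (C ⊗ X') ⊗≫ ε_ X X' ▷ (B ⊗ C ⊗ X') ⊗≫ 𝟙 _ := by
      rw [← whisker_exchange]; monoidal
    _ = 𝟙 _ ⊗≫ (X' ⊗ B ⊗ C) ◁ η_ X X' ⊗≫ X' ◁ (𝟙 ((B ⊗ C) ⊗ X) ⊗≫ B ◁ hb h C ⊗≫ hb h B ▷ C ⊗≫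
        𝟙 (X ⊗ B ⊗ C)) ▷ X' ⊗≫ ε_ X X' ▷ (B ⊗ C ⊗ X') ⊗≫ 𝟙 _ := by
      rw [coevaluation_mate]; monoidal
    _ = _ := by rw [← (hb_isLaxBraiding h).tensor, mate]; monoidal

lemma mate_one : mate X' h (𝟙_ A) = 𝟙 _ ⊗≫ 𝟙 X' ⊗≫ 𝟙 _ := by
  calc
    _ = 𝟙 _ ⊗≫ (X' ◁ η_ X X' ⊗≫ ε_ X X' ▷ X') ⊗≫ 𝟙 _ := by rw [mate, (hb_isLaxBraiding h).unit]; monoidal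
    _ = _ := by rw [ExactPairing.coevaluation_evaluation'']; monoidal

variable [BraidedCategory A]

/-- The half-braiding of the dual object. -/
def dualBraiding (B : A) : B ⊗ X' ⟶ X' ⊗ B :=
  (β_ B X').hom ≫ mate X' h B ≫ (β_ X' B).inv

/-- The mate goes in the direction `X' ⊗ B ⟶ B ⊗ X'`, so it crosses the factors of `B ⊗ C` in the
order opposite to that of a half-braiding. Conjugating by the braiding repairs this. -/
lemma dualBraiding_isLaxBraiding : IsLaxBraiding (dualBraiding X' h) where
  naturality {B C} f := by
    rw [dualBraiding, dualBraiding, BraidedCategory.braiding_naturality_left_assoc,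
      reassoc_of% mate_naturality X' h f, BraidedCategory.braiding_inv_naturality_left]
    simp only [Category.assoc]
  tensor B C := by
    have h1 := (Cen.ofUnder (β_ X' C).inv) B
    have h2 := (Cen.ofUnder (mate X' h C)) B
    have h3 := (Cen.ofOver (mate X' h B)) C
    rw [← tens_under_under, ← tens_under_under, hb_tens, hb_tens] at h1 h2
    rw [← tens_over_over, ← tens_over_over, hb_tens, hb_tens] at h3
    simp only [hb_over, hb_under] at h1 h2 h3
    symm
    calc
      _ = 𝟙 _ ⊗≫ B ◁ (β_ C X').hom ⊗≫ B ◁ mate X' h C ⊗≫ (B ◁ (β_ X' C).inv ≫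
          (𝟙 (B ⊗ X' ⊗ C) ⊗≫ (β_ B X').hom ▷ C ⊗≫ X' ◁ (β_ B C).hom ⊗≫ 𝟙 ((X' ⊗ C) ⊗ B))) ⊗≫
          X' ◁ (β_ B C).inv ⊗≫ mate X' h B ▷ C ⊗≫ (β_ X' B).inv ▷ C ⊗≫ 𝟙 _ := by
        -- A crossing of `B` with `C` and its inverse are created between the two half-braidings.
        -- Naturality of the braidings then collects the two mates into the mate of `C ⊗ B`, and
        -- naturality of the mate cancels the pair.
        have : (β_ B C).hom ≫ (β_ B C).inv = 𝟙 _ := Iso.hom_inv_id _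
        symm
        calc
          _ = 𝟙 _ ⊗≫ B ◁ (β_ C X').hom ⊗≫ B ◁ mate X' h C ⊗≫ B ◁ (β_ X' C).inv ⊗≫
              (β_ B X').hom ▷ C ⊗≫ X' ◁ ((β_ B C).hom ≫ (β_ B C).inv) ⊗≫
              mate X' h B ▷ C ⊗≫ (β_ X' B).inv ▷ C ⊗≫ 𝟙 _ := by monoidal
          _ = _ := by rw [this, dualBraiding, dualBraiding]; monoidal
      _ = 𝟙 _ ⊗≫ B ◁ (β_ C X').hom ⊗≫ (B ◁ mate X' h C ≫
          (𝟙 (B ⊗ C ⊗ X') ⊗≫ (β_ B C).hom ▷ X' ⊗≫ C ◁ (β_ B X').hom ⊗≫ 𝟙 ((C ⊗ X') ⊗ B))) ⊗≫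
          (β_ X' C).inv ▷ B ⊗≫
          X' ◁ (β_ B C).inv ⊗≫ mate X' h B ▷ C ⊗≫ (β_ X' B).inv ▷ C ⊗≫ 𝟙 _ := by
        rw [h1]; monoidal
      _ = 𝟙 _ ⊗≫ B ◁ (β_ C X').hom ⊗≫ (β_ B X').hom ▷ C ⊗≫ X' ◁ (β_ B C).hom ⊗≫
          mate X' h C ▷ B ⊗≫ ((𝟙 (C ⊗ X' ⊗ B) ⊗≫ (β_ X' C).inv ▷ B ⊗≫
          X' ◁ (β_ B C).inv ⊗≫ 𝟙 ((X' ⊗ B) ⊗ C)) ≫ mate X' h B ▷ C) ⊗≫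
          (β_ X' B).inv ▷ C ⊗≫ 𝟙 _ := by
        rw [h2]; monoidal
      _ = 𝟙 _ ⊗≫ B ◁ (β_ C X').hom ⊗≫ (β_ B X').hom ▷ C ⊗≫ X' ◁ (β_ B C).hom ⊗≫
          (𝟙 (X' ⊗ C ⊗ B) ⊗≫ mate X' h C ▷ B ⊗≫ C ◁ mate X' h B ⊗≫ 𝟙 ((C ⊗ B) ⊗ X')) ⊗≫
          (β_ B C).inv ▷ X' ⊗≫ B ◁ (β_ X' C).inv ⊗≫ (β_ X' B).inv ▷ C ⊗≫ 𝟙 _ := by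
        rw [← h3]; monoidal
      _ = 𝟙 _ ⊗≫ B ◁ (β_ C X').hom ⊗≫ (β_ B X').hom ▷ C ⊗≫ (X' ◁ (β_ B C).hom ≫
          mate X' h (C ⊗ B)) ⊗≫
          (β_ B C).inv ▷ X' ⊗≫ B ◁ (β_ X' C).inv ⊗≫ (β_ X' B).inv ▷ C ⊗≫ 𝟙 _ := by
        rw [mate_tensor]; monoidal
      _ = 𝟙 _ ⊗≫ B ◁ (β_ C X').hom ⊗≫ (β_ B X').hom ▷ C ⊗≫ mate X' h (B ⊗ C) ⊗≫
          ((β_ B C).hom ≫ (β_ B C).inv) ▷ X' ⊗≫ B ◁ (β_ X' C).inv ⊗≫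
          (β_ X' B).inv ▷ C ⊗≫ 𝟙 _ := by
        rw [mate_naturality]; monoidal
      _ = 𝟙 _ ⊗≫ (𝟙 ((B ⊗ C) ⊗ X') ⊗≫ B ◁ hb (underHb X') C ⊗≫ hb (underHb X') B ▷ C ⊗≫
          𝟙 (X' ⊗ B ⊗ C)) ⊗≫ mate X' h (B ⊗ C) ⊗≫
          (𝟙 ((B ⊗ C) ⊗ X') ⊗≫ B ◁ hb (overHb X') C ⊗≫ hb (overHb X') B ▷ C ⊗≫
          𝟙 (X' ⊗ B ⊗ C)) ⊗≫ 𝟙 _ := by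
        rw [Iso.hom_inv_id]; simp only [hb_over, hb_under]; monoidal
      _ = _ := by
        rw [← (hb_isLaxBraiding (underHb X')).tensor, ← (hb_isLaxBraiding (overHb X')).tensor,
          hb_over, hb_under, dualBraiding]
        monoidal
  unit := by
    rw [dualBraiding, mate_one]
    simp [monoidalComp]

variable [RightRigidCategory A]

/-- The half-braiding on the dual of an object of the center. -/
def dualHb : HalfBraiding X' := (dualBraiding_isLaxBraiding X' h).halfBraiding

lemma hb_dualHb (B : A) : hb (dualHb X' h) B =
    (β_ B X').hom ≫ mate X' h B ≫ (β_ X' B).inv := rfl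

end Mate

section DualHalfBraiding

variable {k : Type w} [Field k] [IsAlgClosed k]
  {A : Type u} [Category.{v} A] [Abelian A] [Linear k A] [MonoidalCategory A]
  [MonoidalPreadditive A] [MonoidalLinear k A] [BraidedCategory A] [RigidCategory A]
  [PivotalCategory A] [PremodularCategory k A] {ι : Type u₁} [Fintype ι]
  (S : SimpleData k A ι)

variable {X : A} (X' : A) [ExactPairing X X'] (h : HalfBraiding X)

/-- The last crossing of `γ^∨` and the crossing over `X` form a strand that slides off the
evaluation. What remains is the mate, which is the half-braiding of `X` seen through the evaluation.
-/
lemma evaluation_dualHb (B : A) : hb (tensOver (dualHb X' h) X) B ≫ ε_ X X' ▷ B =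
    hb (tensUnder X' h) B ≫ ε_ X X' ▷ B := by
  have h1 := (Cen.ofOver (ε_ X X')) B
  rw [← tens_over_over, hb_tens, hb_over, hb_over, hb_over] at h1
  calc
    _ = 𝟙 _ ⊗≫ (β_ B X').hom ▷ X ⊗≫ mate X' h B ▷ X ⊗≫ (𝟙 (B ⊗ X' ⊗ X) ⊗≫
        (β_ X' B).inv ▷ X ⊗≫ X' ◁ (β_ X B).inv ⊗≫ 𝟙 ((X' ⊗ X) ⊗ B)) ≫ ε_ X X' ▷ B := by
      rw [hb_tensOver, hb_dualHb]; monoidal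
    _ = 𝟙 _ ⊗≫ (β_ B X').hom ▷ X ⊗≫ (𝟙 ((X' ⊗ B) ⊗ X) ⊗≫ mate X' h B ▷ X ⊗≫ B ◁ ε_ X X' ⊗≫
        𝟙 B) ⊗≫ 𝟙 _ := by
      rw [← h1]; simp only [braiding_inv_tensorUnit_left]; monoidal
    _ = _ := by rw [mate_evaluation, hb_tensUnder]; monoidal

lemma coevaluation_dualHb (B : A) : B ◁ η_ X X' ≫ hb (tensOver h X') B =
    B ◁ η_ X X' ≫ hb (tensUnder X (dualHb X' h)) B := by
  have h1 := (Cen.ofUnder (η_ X X')) B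
  rw [← tens_under_under, hb_tens, hb_under, hb_under, hb_under] at h1
  symm
  calc
    _ = (B ◁ η_ X X' ≫ (𝟙 (B ⊗ X ⊗ X') ⊗≫ (β_ B X).hom ▷ X' ⊗≫ X ◁ (β_ B X').hom ⊗≫
        𝟙 ((X ⊗ X') ⊗ B))) ⊗≫ X ◁ mate X' h B ⊗≫ X ◁ (β_ X' B).inv ⊗≫ 𝟙 _ := by
      rw [hb_tensUnder, hb_dualHb]; monoidal
    _ = 𝟙 _ ⊗≫ (𝟙 B ⊗≫ η_ X X' ▷ B ⊗≫ X ◁ mate X' h B ⊗≫ 𝟙 (X ⊗ B ⊗ X')) ⊗≫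
        X ◁ (β_ X' B).inv ⊗≫ 𝟙 _ := by
      rw [h1]; simp only [braiding_tensorUnit_right]; monoidal
    _ = _ := by rw [coevaluation_mate, hb_tensOver]; monoidal

/-- The defining formula of the half-braiding of the dual. -/
lemma coevaluation_tens_evaluation (B : A) :
    𝟙 _ ⊗≫ (B ⊗ X') ◁ η_ X X' ⊗≫ hb (tensOver (tensUnder X' h) X') B ⊗≫
      ε_ X X' ▷ (X' ⊗ B) ⊗≫ 𝟙 _ = hb (dualHb X' h) B := by
  calc
    _ = 𝟙 _ ⊗≫ ((B ⊗ X') ◁ η_ X X' ≫ (β_ B X').hom ▷ (X ⊗ X')) ⊗≫ X' ◁ hb h B ▷ X' ⊗≫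
        ((X' ⊗ X) ◁ (β_ X' B).inv ≫ ε_ X X' ▷ (X' ⊗ B)) ⊗≫ 𝟙 _ := by
      rw [hb_tensOver, hb_tensUnder]; monoidal
    _ = _ := by
      rw [whisker_exchange, whisker_exchange, hb_dualHb, mate]; monoidal

end DualHalfBraiding

end

end ReducedTensor

namespace ReducedTensor

noncomputable section

/-! ### Absorption of `Q`, evaluation and coevaluation in the center -/

section Absorption

variable {k : Type w} [Field k] [IsAlgClosed k]
  {A : Type u} [Category.{v} A] [Abelian A] [Linear k A] [MonoidalCategory A]
  [MonoidalPreadditive A] [MonoidalLinear k A] [BraidedCategory A] [RigidCategory A]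
  [PivotalCategory A] [PremodularCategory k A] {ι : Type u₁} [Fintype ι]
  (S : SimpleData k A ι)

variable {S} [CharZero k] {X Y : A} {h : HalfBraiding X} {h' : HalfBraiding Y}

/-- A version of `rproj_comp` that needs no half-braiding on `Z`: below the coaction, the action for
`tensOver` may be replaced by that for `tensUnder`, and the average of a central identity is the
identity. It applies to evaluations with values in the unit of `A`. -/
lemma rproj_comp_of_hb_comp {Z : A} {f : X ⊗ Y ⟶ Z}
    (H : ∀ B, hb (tensOver h Y) B ≫ f ▷ B = hb (tensUnder X h') B ≫ f ▷ B) :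
    rproj S h h' ≫ f = f := by
  have key : ∀ (g : HalfBraiding (X ⊗ Y)) {B B' : A} (e : B ⊗ B' ⟶ 𝟙_ A), actOn g e ≫ f =
      𝟙 _ ⊗≫ (hb g B ≫ f ▷ B) ▷ B' ⊗≫ Z ◁ e ⊗≫ 𝟙 _ := by
    intro g B B' e
    calc
      _ = 𝟙 _ ⊗≫ hb g B ▷ B' ⊗≫ ((X ⊗ Y) ◁ e ≫ f ▷ 𝟙_ A) ⊗≫ 𝟙 _ := by rw [actOn]; monoidal
      _ = _ := by rw [whisker_exchange]; monoidal
  have h1 : rproj S h h' ≫ f = avg S (tensUnder X h') (tensUnder X h') (𝟙 _) ≫ f := by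
    rw [rproj, avg_eq, avg_eq, Linear.smul_comp, Linear.smul_comp, Preadditive.sum_comp,
      Preadditive.sum_comp]
    congr 1
    refine Finset.sum_congr rfl fun i _ => ?_
    simp only [Linear.smul_comp, Category.assoc, key, H]
  rw [h1, avg_of_cen S (Cen.id _), Category.id_comp]

lemma comp_rproj_of_comp_hb {Z : A} {f : Z ⟶ X ⊗ Y}
    (H : ∀ B, B ◁ f ≫ hb (tensOver h Y) B = B ◁ f ≫ hb (tensUnder X h') B) :
    f ≫ rproj S h h' = f := by
  have key : ∀ (g : HalfBraiding (X ⊗ Y)) {B B' : A} (c : 𝟙_ A ⟶ B ⊗ B'), f ≫ coactOn g c =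
      𝟙 _ ⊗≫ c ▷ Z ⊗≫ B ◁ (B' ◁ f ≫ hb g B') := by
    intro g B B' c
    calc
      _ = 𝟙 _ ⊗≫ (𝟙_ A ◁ f ≫ c ▷ (X ⊗ Y)) ⊗≫ B ◁ hb g B' := by rw [coactOn]; monoidal
      _ = _ := by rw [whisker_exchange]; monoidal
  have h1 : f ≫ rproj S h h' = f ≫ avg S (tensOver h Y) (tensOver h Y) (𝟙 _) := by
    rw [rproj, avg_eq, avg_eq, Linear.comp_smul, Linear.comp_smul, Preadditive.comp_sum,
      Preadditive.comp_sum]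
    congr 1
    refine Finset.sum_congr rfl fun i _ => ?_
    simp only [Linear.comp_smul, ← Category.assoc, key, H]
  rw [h1, avg_of_cen S (Cen.id _), Category.comp_id]

variable (S) in
-- Neither `f` nor `f'` has to be central; it suffices that conjugating the crossing by the two
-- gives the half-braiding of `W`.
lemma comp_coact_indMap {W W' : A} {g : HalfBraiding W} {g' : HalfBraiding W'} {f : W ⟶ W'}
    {f' : W' ⟶ W} (H : ∀ B, B ◁ f ≫ hb g' B ≫ f' ▷ B = hb g B) :
    f ≫ coact S g' ≫ indMap S f' = coact S g := by
  rw [coact_eq, coact_eq, Preadditive.sum_comp, Preadditive.comp_sum]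
  refine Finset.sum_congr rfl fun i _ => ?_
  rw [Linear.smul_comp, Linear.comp_smul, Category.assoc, ← ins_map, ← Category.assoc,
    ← Category.assoc]
  congr 2
  generalize η_ (S.obj i) (S.obj i)ᘁ = c
  generalize ((S.obj i)ᘁ : A) = B' at c ⊢
  calc
    _ = 𝟙 _ ⊗≫ (𝟙_ A ◁ f ≫ c ▷ W') ⊗≫ S.obj i ◁ (hb g' B' ≫ f' ▷ B') := by
      rw [coactOn]; monoidal
    _ = 𝟙 _ ⊗≫ c ▷ W ⊗≫ S.obj i ◁ (B' ◁ f ≫ hb g' B' ≫ f' ▷ B') := by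
      rw [whisker_exchange]; monoidal
    _ = _ := by rw [H, coactOn]

end Absorption

section InductionTensorNaturality

variable {k : Type w} [Field k] [IsAlgClosed k]
  {A : Type u} [Category.{v} A] [Abelian A] [Linear k A] [MonoidalCategory A]
  [MonoidalPreadditive A] [MonoidalLinear k A] [BraidedCategory A] [RigidCategory A]
  [PivotalCategory A] [PremodularCategory k A] {ι : Type u₁} [Fintype ι]
  (S : SimpleData k A ι)

lemma tensorInduction_naturality_right (V : A) {W W' : A} (f : W ⟶ W') :
    V ◁ indMap S f ≫ tensorInduction S V W' = tensorInduction S V W ≫ indMap S (V ◁ f) := by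
  refine hom_ext_ins₁_whiskerLeft S ((Cen.whiskerLeft _ (cen_indMap S f)).comp
    (cen_tensorInduction S _ _)) ((cen_tensorInduction S _ _).comp (cen_indMap S _)) ?_
  rw [← MonoidalCategory.whiskerLeft_comp_assoc, ins₁_indMap, MonoidalCategory.whiskerLeft_comp,
    Category.assoc, ins₁_tensorInduction, ← Category.assoc, ins₁_tensorInduction, ins₁_indMap]

lemma inductionTensor_naturality_left {V V' : A} (f : V ⟶ V') (W : A) :
    indMap S f ▷ W ≫ inductionTensor S V' W = inductionTensor S V W ≫ indMap S (f ▷ W) := by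
  refine hom_ext_ins₁_whiskerRight S (((cen_indMap S f).whiskerRight _).comp
    (cen_inductionTensor S _ _)) ((cen_inductionTensor S _ _).comp (cen_indMap S _)) ?_
  rw [← comp_whiskerRight_assoc, ins₁_indMap, comp_whiskerRight,
    Category.assoc, ins₁_inductionTensor, ← Category.assoc, ins₁_inductionTensor, ins₁_indMap]

lemma inductionTensor_naturality_right (V : A) {W W' : A} (f : W ⟶ W') :
    indObj S V ◁ f ≫ inductionTensor S V W' = inductionTensor S V W ≫ indMap S (V ◁ f) := by
  refine hom_ext_ins₁_whiskerRight S ((Cen.whiskerLeft _ (Cen.ofOver f)).comp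
    (cen_inductionTensor S _ _)) ((cen_inductionTensor S _ _).comp (cen_indMap S _)) ?_
  rw [← whisker_exchange_assoc, ins₁_inductionTensor, ← Category.assoc, ins₁_inductionTensor,
    ins₁_indMap]

lemma coact_tensorInduction (V : A) {W : A} (h : HalfBraiding W) :
    V ◁ coact S h ≫ tensorInduction S V W = coact S (tensUnder V h) := by
  rw [coact_eq, coact_eq, whiskerLeft_sum, Preadditive.sum_comp]
  refine Finset.sum_congr rfl fun i _ => ?_
  rw [MonoidalLinear.whiskerLeft_smul, Linear.smul_comp, MonoidalCategory.whiskerLeft_comp,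
    Category.assoc, ins_tensorInduction, coactOn_tensUnder]
  congr 1
  monoidal

lemma coact_inductionTensor {W : A} (h : HalfBraiding W) (V : A) :
    coact S h ▷ V ≫ inductionTensor S W V = coact S (tensOver h V) := by
  rw [coact_eq, coact_eq, sum_whiskerRight, Preadditive.sum_comp]
  refine Finset.sum_congr rfl fun i _ => ?_
  rw [MonoidalLinear.smul_whiskerRight, Linear.smul_comp, comp_whiskerRight,
    Category.assoc, ins_inductionTensor, coactOn_tensOver]
  congr 1
  monoidal

end InductionTensorNaturality

section EvaluationCoevaluation

variable {k : Type w} [Field k] [IsAlgClosed k]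
  {A : Type u} [Category.{v} A] [Abelian A] [Linear k A] [MonoidalCategory A]
  [MonoidalPreadditive A] [MonoidalLinear k A] [BraidedCategory A] [RigidCategory A]
  [PivotalCategory A] [PremodularCategory k A] {ι : Type u₁} [Fintype ι]
  (S : SimpleData k A ι)

variable {X : A} (X' : A) [ExactPairing X X'] (h : HalfBraiding X)

/-- The evaluation `X^* ⊗ X ⟶ I(𝟙)`, before restriction. -/
def centralEv : X' ⊗ X ⟶ indObj S (𝟙_ A) :=
  S.sqrtGlobalDim⁻¹ • (coact S (tensUnder X' h) ≫ indMap S (ε_ X X'))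

/-- The coevaluation `I(𝟙) ⟶ X ⊗ X^*`, before restriction. -/
def centralCoev : indObj S (𝟙_ A) ⟶ X ⊗ X' :=
  S.sqrtGlobalDim⁻¹ • (indMap S (η_ X X') ≫ act S (tensOver h X'))

lemma redEv_eq (X : ZCenter A) : redEv S X = centralEv S (X.objᘁ : A) X.halfBraiding := by
  rw [redEv, centralEv, coact, Preadditive.sum_comp, Finset.smul_sum]
  refine Finset.sum_congr rfl fun i _ => ?_
  rw [Linear.smul_comp, smul_smul, div_eq_mul_inv, mul_comm, Category.assoc, indMap,
    biproduct.ι_map, coactOn_tensUnder, coactOn]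
  congr 1
  change 𝟙 _ ⊗≫ _ ⊗≫ _ ⊗≫ (S.obj i ⊗ X.objᘁ) ◁ hb X.halfBraiding (S.obj i)ᘁ ⊗≫ _ = _
  calc
    _ = 𝟙 _ ⊗≫ (X.objᘁ : A) ◁ η_ (S.obj i) (S.obj i)ᘁ ▷ X.obj ⊗≫
      ((β_ (S.obj i) (X.objᘁ : A)).inv ▷ ((S.obj i)ᘁ ⊗ X.obj) ≫
      (S.obj i ⊗ X.objᘁ) ◁ hb X.halfBraiding (S.obj i)ᘁ) ⊗≫
      S.obj i ◁ ε_ X.obj X.objᘁ ▷ (S.obj i)ᘁ ⊗≫ indι S (𝟙_ A) i := by monoidal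
    _ = _ := by rw [← whisker_exchange]; monoidal

lemma redCoev_eq (X : ZCenter A) : redCoev S X = centralCoev S (X.objᘁ : A) X.halfBraiding := by
  rw [redCoev, centralCoev, ← Category.id_comp (indMap S _ ≫ _), ← sum_indπ_indι,
    Preadditive.sum_comp, Finset.smul_sum]
  refine Finset.sum_congr rfl fun i _ => ?_
  have h1 : indι S (𝟙_ A) i ≫ indMap S (η_ X.obj X.objᘁ) =
      S.obj i ◁ η_ X.obj X.objᘁ ▷ (S.obj i)ᘁ ≫ indι S _ i := by rw [indMap, biproduct.ι_map]
  rw [Category.assoc, reassoc_of% h1, indι_act, Linear.comp_smul, Linear.comp_smul, smul_smul,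
    div_eq_mul_inv, mul_comm, actOn_tensOver, actOn]
  congr 1
  change indπ S (𝟙_ A) i ⊗≫ _ ⊗≫ hb X.halfBraiding (S.obj i) ▷ (X.objᘁ ⊗ (S.obj i)ᘁ) ⊗≫ _ = _
  calc
    _ = indπ S (𝟙_ A) i ⊗≫ S.obj i ◁ η_ X.obj X.objᘁ ▷ (S.obj i)ᘁ ⊗≫
      (hb X.halfBraiding (S.obj i) ▷ (X.objᘁ ⊗ (S.obj i)ᘁ) ≫
      (X.obj ⊗ S.obj i) ◁ (β_ (X.objᘁ : A) (S.obj i)ᘁ).hom) ⊗≫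
      X.obj ◁ evR (S.obj i) ▷ X.objᘁ ⊗≫ 𝟙 _ := by monoidal
    _ = _ := by rw [← whisker_exchange]; monoidal

lemma cen_under_centralEv : Cen (tensUnder X' h) (indHb S (𝟙_ A)) (centralEv S X' h) :=
  ((cen_coact S _).comp (cen_indMap S _)).smul _

lemma cen_over_centralCoev : Cen (indHb S (𝟙_ A)) (tensOver h X') (centralCoev S X' h) :=
  ((cen_indMap S _).comp (cen_act S _)).smul _

lemma ins₁_centralCoev :
    ins₁ S (𝟙_ A) ≫ centralCoev S X' h = S.sqrtGlobalDim⁻¹ • η_ X X' := by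
  rw [centralCoev, Linear.comp_smul, ← Category.assoc, ins₁_indMap, Category.assoc, ins₁_act,
    Category.comp_id]

variable [CharZero k]

/-- On the unit copy the coevaluation is a multiple of that of `A`, which does not distinguish the
two half-braidings; centrality extends the identity to all of `I(𝟙)`. -/
lemma centralCoev_rproj :
    centralCoev S X' h ≫ rproj S h (dualHb X' h) = centralCoev S X' h := by
  refine hom_ext_ins₁ S ((cen_over_centralCoev S X' h).comp (cen_rproj_over_over S _ _))
    (cen_over_centralCoev S X' h) ?_
  rw [← Category.assoc, ins₁_centralCoev, Linear.smul_comp,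
    comp_rproj_of_comp_hb (coevaluation_dualHb X' h)]

lemma inv_sq_smul_coact_act {W : A} (h : HalfBraiding W) :
    S.sqrtGlobalDim⁻¹ • S.sqrtGlobalDim⁻¹ • (coact S h ≫ act S h) = 𝟙 W := by
  have h0 := sqrtGlobalDim_ne_zero S
  rw [coact_act, ← S.sqrtGlobalDim_sq, smul_smul, smul_smul]
  convert one_smul k _ using 2
  field_simp

/-- On the unit copy the coevaluation of `A` commutes with the coaction, so the zigzag of `A` can be
applied inside `I`. What is left is `coact ≫ act`, whose value `𝒟` cancels the two normalising
factors. -/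
lemma centralCoev_centralEv : centralCoev S X' h ▷ X ≫ (α_ _ _ _).hom ≫ X ◁ centralEv S X' h ≫
    runit S h = lunit S h := by
  refine hom_ext_ins₁_whiskerRight S
    (((cen_over_centralCoev S X' h).whiskerRight _).comp ((cen_associator_over h).comp
    ((Cen.whiskerLeft h (Cen.ofOver _)).comp (cen_over_runit S h)))) (cen_over_lunit S h) ?_
  have hg : Cen (tensUnder (𝟙_ A) h) (tensUnder X (tensUnder X' h))
      (η_ X X' ▷ X ≫ (α_ _ _ _).hom) :=
    ((Cen.ofUnder _).whiskerRight h).comp (cen_associator_under h)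
  have hl : Cen (tensUnder (𝟙_ A) h) h (λ_ X).hom := by
    rw [tensUnder, under_unit]; exact Cen.leftUnitor h
  have hz : (η_ X X' ▷ X ≫ (α_ _ _ _).hom) ≫ X ◁ ε_ X X' ≫ (ρ_ X).hom = (λ_ X).hom := by
    simp
  calc
    _ = S.sqrtGlobalDim⁻¹ • S.sqrtGlobalDim⁻¹ • ((η_ X X' ▷ X ≫ (α_ _ _ _).hom) ≫
        (X ◁ coact S (tensUnder X' h) ≫ X ◁ indMap S (ε_ X X') ≫ tensorInduction S X (𝟙_ A)) ≫
        indMap S (ρ_ X).hom ≫ act S h) := by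
      rw [← comp_whiskerRight_assoc, ins₁_centralCoev, centralEv, runit]
      simp only [MonoidalLinear.smul_whiskerRight, MonoidalLinear.whiskerLeft_smul,
        Linear.smul_comp, Linear.comp_smul, MonoidalCategory.whiskerLeft_comp, Category.assoc]
    _ = S.sqrtGlobalDim⁻¹ • S.sqrtGlobalDim⁻¹ • (coact S (tensUnder (𝟙_ A) h) ≫
        indMap S ((η_ X X' ▷ X ≫ (α_ _ _ _).hom) ≫ X ◁ ε_ X X' ≫ (ρ_ X).hom) ≫ act S h) := by
      generalize η_ X X' ▷ X ≫ (α_ X X' X).hom = g at hg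
      rw [tensorInduction_naturality_right, ← Category.assoc (X ◁ coact S _),
        coact_tensorInduction, indMap_comp, indMap_comp]
      simp only [Category.assoc]
      rw [reassoc_of% coact_indMap S hg]
    _ = (λ_ X).hom ≫
        (S.sqrtGlobalDim⁻¹ • S.sqrtGlobalDim⁻¹ • (coact S h ≫ act S h)) := by
      rw [hz, ← Category.assoc, coact_indMap S hl]
      simp only [Linear.comp_smul, Category.assoc]
    _ = _ := by rw [inv_sq_smul_coact_act, Category.comp_id, ins₁_lunit]

/-- The other zigzag is not symmetric to the first, because the coaction is computed with strands
crossing `X` in the middle of `X' ⊗ X ⊗ X'`. It is here that the formula for `γ^∨` is forced. -/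
lemma centralEv_centralCoev : X' ◁ centralCoev S X' h ≫ (α_ _ _ _).inv ≫ centralEv S X' h ▷ X' ≫
    lunit S (dualHb X' h) = runit S (dualHb X' h) := by
  refine hom_ext_ins₁_whiskerLeft S
    ((Cen.whiskerLeft _ (cen_over_centralCoev S X' h)).comp ((Cen.associator_inv _ _ _).comp
    (((cen_under_centralEv S X' h).whiskerRight _).comp (cen_over_lunit S _))))
    (cen_under_runit S _) ?_
  -- Bending the coaction on `X' ⊗ X ⊗ X'` with coevaluation and evaluation gives the coaction for
  -- the dual half-braiding.
  have hf : ((ρ_ X').inv ≫ X' ◁ η_ X X' ≫ (α_ _ _ _).inv) ≫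
      coact S (tensOver (tensUnder X' h) X') ≫ indMap S (ε_ X X' ▷ X' ≫ (λ_ X').hom) =
      coact S (dualHb X' h) := by
    apply comp_coact_indMap
    intro B
    rw [← coevaluation_tens_evaluation]
    monoidal
  calc
    _ = S.sqrtGlobalDim⁻¹ • S.sqrtGlobalDim⁻¹ • ((X' ◁ η_ X X' ≫ (α_ _ _ _).inv) ≫
        (coact S (tensUnder X' h) ▷ X' ≫ indMap S (ε_ X X') ▷ X' ≫ inductionTensor S (𝟙_ A) X') ≫
        indMap S (λ_ X').hom ≫ act S (dualHb X' h)) := by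
      rw [← MonoidalCategory.whiskerLeft_comp_assoc, ins₁_centralCoev, centralEv, lunit]
      simp only [MonoidalLinear.smul_whiskerRight, MonoidalLinear.whiskerLeft_smul,
        Linear.smul_comp, Linear.comp_smul, comp_whiskerRight, Category.assoc]
    _ = (ρ_ X').hom ≫ (S.sqrtGlobalDim⁻¹ • S.sqrtGlobalDim⁻¹ • ((((ρ_ X').inv ≫ X' ◁ η_ X X' ≫
        (α_ _ _ _).inv) ≫ coact S (tensOver (tensUnder X' h) X') ≫
        indMap S (ε_ X X' ▷ X' ≫ (λ_ X').hom)) ≫ act S (dualHb X' h))) := by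
      rw [inductionTensor_naturality_left, ← Category.assoc (coact S _ ▷ X'),
        coact_inductionTensor, indMap_comp]
      simp only [Category.assoc, Linear.comp_smul, Iso.hom_inv_id_assoc]
    _ = _ := by rw [hf, inv_sq_smul_coact_act, Category.comp_id, ins₁_runit]

end EvaluationCoevaluation

end

end ReducedTensor

namespace ReducedTensor

noncomputable section

/-! ### Duals in the center and their comparison with duals in `A` -/

section Rigid

variable {k : Type w} [Field k] [IsAlgClosed k]
  {A : Type u} [Category.{v} A] [Abelian A] [Linear k A] [MonoidalCategory A]
  [MonoidalPreadditive A] [MonoidalLinear k A] [BraidedCategory A] [RigidCategory A]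
  [PivotalCategory A] [PremodularCategory k A] {ι : Type u₁} [Fintype ι]
  (S : SimpleData k A ι)

variable {S} [CharZero k]

namespace RCenter

lemma whiskerLeft_incl (X : RCenter S) {Y Z : RCenter S} (f : Y ⟶ Z) :
    hom (X ◁ f) ≫ incl X Z = incl X Y ≫ X.obj ◁ hom f := by
  have := tensHom_incl (𝟙 X) f
  rwa [id_hom, id_tensorHom] at this

lemma whiskerRight_incl {X Y : RCenter S} (f : X ⟶ Y) (Z : RCenter S) :
    hom (f ▷ Z) ≫ incl Y Z = incl X Z ≫ hom f ▷ Z.obj := by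
  have := tensHom_incl f (𝟙 Z)
  rwa [id_hom, tensorHom_id] at this

lemma tensorHom_incl {X Y X' Y' : RCenter S} (f : X ⟶ X') (g : Y ⟶ Y') :
    hom (f ⊗ₘ g) ≫ incl X' Y' = incl X Y ≫ (hom f ⊗ₘ hom g) := tensHom_incl f g

lemma associator_incl (X Y Z : RCenter S) : hom (α_ X Y Z).hom ≫ incl X (Y ⊗ Z) ≫
    X.obj ◁ incl Y Z = incl (X ⊗ Y) Z ≫ incl X Y ▷ Z.obj ≫ (α_ X.obj Y.obj Z.obj).hom :=
  assoc_incl X Y Z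

lemma associator_inv_incl (X Y Z : RCenter S) : hom (α_ X Y Z).inv ≫ incl (X ⊗ Y) Z ≫
    incl X Y ▷ Z.obj = incl X (Y ⊗ Z) ≫ X.obj ◁ incl Y Z ≫ (α_ X.obj Y.obj Z.obj).inv := by
  have h : hom (α_ X Y Z).inv ≫ hom (α_ X Y Z).hom = 𝟙 _ := by
    rw [← comp_hom, Iso.inv_hom_id, id_hom]
  have h1 := congrArg (fun t => hom (α_ X Y Z).inv ≫ t ≫ (α_ X.obj Y.obj Z.obj).inv)
    (associator_incl X Y Z)
  simp only [Category.assoc, Iso.hom_inv_id, Category.comp_id] at h1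
  rw [← h1, reassoc_of% h]

lemma leftUnitor_hom (X : RCenter S) :
    hom (λ_ X).hom = S.sqrtGlobalDim⁻¹ • (incl (𝟙_ _) X ≫ lunit X) := rfl

lemma rightUnitor_hom (X : RCenter S) :
    hom (ρ_ X).hom = S.sqrtGlobalDim⁻¹ • (incl X (𝟙_ _) ≫ runit X) := rfl

/-- The dual of an object of the center. -/
def dual (X : RCenter S) : RCenter S :=
  ZCenter.mk ((X.obj)ᘁ : A) (dualHb ((X.obj)ᘁ : A) X.halfBraiding)

/-- The evaluation of `X^* ⊗ X`, before restriction. -/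
def cev (X : RCenter S) : (dual X).obj ⊗ X.obj ⟶ (unit S).obj :=
  centralEv S ((X.obj)ᘁ : A) X.halfBraiding

/-- The coevaluation of `X ⊗ X^*`, before restriction. -/
def ccoev (X : RCenter S) : (unit S).obj ⟶ X.obj ⊗ (dual X).obj :=
  centralCoev S ((X.obj)ᘁ : A) X.halfBraiding

/-- The evaluation of the reduced tensor product. -/
def ev (X : RCenter S) : dual X ⊗ X ⟶ 𝟙_ (RCenter S) :=
  mk (incl (dual X) X ≫ cev X) ((cen_rincl_under S _ _).comp (cen_under_centralEv S ((X.obj)ᘁ : A) _))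

/-- The coevaluation of the reduced tensor product. -/
def coev (X : RCenter S) : 𝟙_ (RCenter S) ⟶ X ⊗ dual X :=
  mk (ccoev X ≫ proj X (dual X)) ((cen_over_centralCoev S ((X.obj)ᘁ : A) _).comp (cen_over_rpr S _ _))

lemma ev_hom (X : RCenter S) : hom (ev X) = incl (dual X) X ≫ cev X := rfl

lemma coev_hom (X : RCenter S) : hom (coev X) = ccoev X ≫ proj X (dual X) := rfl

lemma ccoev_idem (X : RCenter S) : ccoev X ≫ idem X (dual X) = ccoev X  := by
  have := centralCoev_rproj S ((X.obj)ᘁ : A) X.halfBraiding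
  exact this

lemma coev_incl (X : RCenter S) : hom (coev X) ≫ incl X (dual X) = ccoev X := by
  rw [coev_hom, Category.assoc, proj_incl, ccoev_idem]

lemma ccoev_cev (X : RCenter S) : ccoev X ▷ X.obj ≫ (α_ _ _ _).hom ≫ X.obj ◁ cev X ≫ runit X =
    lunit X := centralCoev_centralEv S ((X.obj)ᘁ : A) _

lemma cev_ccoev (X : RCenter S) : (dual X).obj ◁ ccoev X ≫ (α_ _ _ _).inv ≫
    cev X ▷ (dual X).obj ≫ lunit (dual X) = runit (dual X) := centralEv_centralCoev S ((X.obj)ᘁ : A) _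

lemma coev_ev (X : RCenter S) : dual X ◁ coev X ≫ (α_ _ _ _).inv ≫ ev X ▷ dual X =
    (ρ_ (dual X)).hom ≫ (λ_ (dual X)).inv := by
  rw [← Category.assoc, Iso.eq_comp_inv]
  apply hom_ext
  have h1 := whiskerRight_incl (ev X) (dual X)
  have h2 := associator_inv_incl (dual X) X (dual X)
  have h3 := whiskerLeft_incl (dual X) (coev X)
  simp only [comp_hom, leftUnitor_hom, rightUnitor_hom, Linear.comp_smul, Category.assoc]
  rw [reassoc_of% h1, ev_hom, comp_whiskerRight_assoc, reassoc_of% h2, reassoc_of% h3,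
    ← MonoidalCategory.whiskerLeft_comp_assoc, coev_incl, cev_ccoev]

lemma ev_coev (X : RCenter S) : coev X ▷ X ≫ (α_ _ _ _).hom ≫ X ◁ ev X =
    (λ_ X).hom ≫ (ρ_ X).inv := by
  rw [← Category.assoc, Iso.eq_comp_inv]
  apply hom_ext
  have h1 := whiskerLeft_incl X (ev X)
  have h2 := associator_incl X (dual X) X
  have h3 := whiskerRight_incl (coev X) X
  simp only [comp_hom, leftUnitor_hom, rightUnitor_hom, Linear.comp_smul, Category.assoc]
  rw [reassoc_of% h1, ev_hom, MonoidalCategory.whiskerLeft_comp_assoc, reassoc_of% h2,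
    reassoc_of% h3, ← comp_whiskerRight_assoc, coev_incl, ccoev_cev]

instance (X : RCenter S) : ExactPairing X (dual X) where
  coevaluation' := coev X
  evaluation' := ev X
  coevaluation_evaluation' := coev_ev X
  evaluation_coevaluation' := ev_coev X

instance : RightRigidCategory (RCenter S) where
  rightDual X := { rightDual := dual X }

/-- The evaluation in `A` of the underlying object. -/
def evA (X : RCenter S) : (dual X).obj ⊗ X.obj ⟶ 𝟙_ A := ε_ X.obj (X.obj)ᘁ

/-- The dual in `A` of a morphism in the center. -/
def dualHom {X Y : RCenter S} (f : X.obj ⟶ Y.obj) : (dual Y).obj ⟶ (dual X).obj :=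
  (fᘁ : ((Y.obj)ᘁ : A) ⟶ (X.obj)ᘁ)

lemma dualHom_evA {X Y : RCenter S} (f : X.obj ⟶ Y.obj) :
    dualHom f ▷ X.obj ≫ evA X = (dual Y).obj ◁ f ≫ evA Y :=
  rightAdjointMate_comp_evaluation f

lemma idem_evA (X : RCenter S) : idem (dual X) X ≫ evA X = evA X :=
  rproj_comp_of_hb_comp (evaluation_dualHb ((X.obj)ᘁ : A) X.halfBraiding)

/-- The projection of the unit object of the center to that of `A`. -/
def unitCounit : (unit S).obj ⟶ 𝟙_ A := counit S (𝟙_ A)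

lemma cev_unitCounit (X : RCenter S) :
    cev X ≫ unitCounit = S.sqrtGlobalDim⁻¹ • evA X := by
  have : centralEv S ((X.obj)ᘁ : A) X.halfBraiding ≫ counit S (𝟙_ A) =
      S.sqrtGlobalDim⁻¹ • ε_ X.obj (X.obj)ᘁ := by
    rw [centralEv, Linear.smul_comp, Category.assoc, indMap_counit, ← Category.assoc,
      coact_counit, Category.id_comp]
  exact this

/-- The pairing of `A` that underlies a pairing in the center. -/
def flat {P W : RCenter S} (χ : P ⊗ W ⟶ 𝟙_ (RCenter S)) : P.obj ⊗ W.obj ⟶ 𝟙_ A :=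
  S.sqrtGlobalDim • (proj P W ≫ hom χ ≫ unitCounit)

lemma flat_ev {X : RCenter S} {P W : RCenter S} (f : P ⊗ W ⟶ dual X ⊗ X) :
    flat (f ≫ ev X) = proj P W ≫ hom f ≫ incl (dual X) X ≫ evA X := by
  rw [flat, comp_hom, ev_hom, Category.assoc, Category.assoc, cev_unitCounit]
  simp only [Linear.comp_smul]
  rw [smul_smul, mul_inv_cancel₀ (sqrtGlobalDim_ne_zero S), one_smul]

/-- The factor `𝒟^{1/2}` of `flat` cancels the normalisation of the evaluation, and the evaluation
of `A` absorbs the projection. So `flat` recovers pairings in `A` exactly. -/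
lemma flat_tensorHom_ev {X P W : RCenter S} (f : P ⟶ dual X) (g : W ⟶ X) :
    flat ((f ⊗ₘ g) ≫ ev X) = (hom f ⊗ₘ hom g) ≫ evA X := by
  have h2 := tensorHom_incl f g
  have h1 := tensorHom_idem f g
  rw [flat_ev, reassoc_of% h2, ← Category.assoc, proj_incl, ← Category.assoc, ← h1,
    Category.assoc, idem_evA]

lemma eq_of_whiskerRight_evaluation {P X : A} {f g : P ⟶ Xᘁ}
    (h : f ▷ X ≫ ε_ X Xᘁ = g ▷ X ≫ ε_ X Xᘁ) : f = g := by
  have key : ∀ f : P ⟶ Xᘁ, f = 𝟙 _ ⊗≫ P ◁ η_ X Xᘁ ⊗≫ (f ▷ X ≫ ε_ X Xᘁ) ▷ Xᘁ ⊗≫ 𝟙 _ := by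
    intro f
    symm
    calc
      _ = 𝟙 _ ⊗≫ (P ◁ η_ X Xᘁ ≫ f ▷ (X ⊗ Xᘁ)) ⊗≫ ε_ X Xᘁ ▷ Xᘁ ⊗≫ 𝟙 _ := by monoidal
      _ = 𝟙 _ ⊗≫ f ⊗≫ (Xᘁ ◁ η_ X Xᘁ ⊗≫ ε_ X Xᘁ ▷ Xᘁ) ⊗≫ 𝟙 _ := by
        rw [whisker_exchange]; monoidal
      _ = _ := by rw [ExactPairing.coevaluation_evaluation'']; monoidal
  rw [key f, key g, h]

lemma eq_of_whiskerRight_evA {P : A} {X : RCenter S} {f g : P ⟶ (dual X).obj}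
    (h : f ▷ X.obj ≫ evA X = g ▷ X.obj ≫ evA X) : f = g :=
  eq_of_whiskerRight_evaluation h

/-- A morphism to a dual is determined by the pairing it induces in `A`, and `flat` carries the
defining relation of mates in the center to that in `A`. -/
lemma rightAdjointMate_hom {X Y : RCenter S} (f : X ⟶ Y) : hom (fᘁ) = dualHom (hom f) := by
  apply eq_of_whiskerRight_evA
  have h1 := flat_tensorHom_ev (X := X) (P := dual Y) (f := (fᘁ : Yᘁ ⟶ Xᘁ)) (𝟙 X)
  have h2 := flat_tensorHom_ev (𝟙 (dual Y)) f
  rw [id_hom, tensorHom_id, tensorHom_id] at h1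
  rw [id_hom, id_tensorHom, id_tensorHom] at h2
  rw [dualHom_evA, ← h1, ← h2]
  exact congrArg flat (rightAdjointMate_comp_evaluation f)

end RCenter

end Rigid

end

end ReducedTensor

namespace ReducedTensor

noncomputable section

/-! ### Centrality of the pivot -/

section PivotHalfBraiding

variable {k : Type w} [Field k] [IsAlgClosed k]
  {A : Type u} [Category.{v} A] [Abelian A] [Linear k A] [MonoidalCategory A]
  [MonoidalPreadditive A] [MonoidalLinear k A] [BraidedCategory A] [RigidCategory A]
  [PivotalCategory A] [PremodularCategory k A] {ι : Type u₁} [Fintype ι]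
  (S : SimpleData k A ι)

/-- The hypothesis says that `T` is the dual of `g`, tested with the ordinary evaluations;
naturality of `evR` transports the relation to the pivotal ones. -/
lemma evR_tensor_comp {X Y : A} (g : Y ⊗ X ⟶ X ⊗ Y) (T : (Yᘁ : A) ⊗ Xᘁ ⟶ (Xᘁ : A) ⊗ Yᘁ)
    (hT : 𝟙 (((Yᘁ : A) ⊗ Xᘁ) ⊗ (Y ⊗ X)) ⊗≫ T ▷ (Y ⊗ X) ⊗≫ (Xᘁ : A) ◁ ε_ Y Yᘁ ▷ X ⊗≫ ε_ X Xᘁ =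
      𝟙 _ ⊗≫ ((Yᘁ : A) ⊗ Xᘁ) ◁ g ⊗≫ (Yᘁ : A) ◁ ε_ X Xᘁ ▷ Y ⊗≫ ε_ Y Yᘁ) :
    𝟙 (((Y ⊗ X) ⊗ (Yᘁ : A)) ⊗ Xᘁ) ⊗≫ g ▷ ((Yᘁ : A) ⊗ Xᘁ) ⊗≫ X ◁ evR Y ▷ Xᘁ ⊗≫ evR X =
      𝟙 _ ⊗≫ (Y ⊗ X) ◁ T ⊗≫ Y ◁ evR X ▷ Yᘁ ⊗≫ evR Y := by
  have h1 : (rightDualTensorIso X Y).inv ≫ gᘁ = T ≫ (rightDualTensorIso Y X).inv := by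
    apply RCenter.eq_of_whiskerRight_evaluation
    rw [comp_whiskerRight, Category.assoc, rightAdjointMate_comp_evaluation, ← whisker_exchange_assoc,
      rightDualTensorIso_inv_evaluation, comp_whiskerRight, Category.assoc,
      rightDualTensorIso_inv_evaluation]
    calc
      _ = 𝟙 _ ⊗≫ ((Yᘁ : A) ⊗ Xᘁ) ◁ g ⊗≫ (Yᘁ : A) ◁ ε_ X Xᘁ ▷ Y ⊗≫ ε_ Y Yᘁ := by monoidal
      _ = _ := by rw [← hT]; monoidal
  calc
    _ = 𝟙 _ ⊗≫ g ▷ ((Yᘁ : A) ⊗ Xᘁ) ⊗≫ (𝟙 ((X ⊗ Y) ⊗ (Yᘁ : A) ⊗ Xᘁ) ⊗≫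
        X ◁ evR Y ▷ Xᘁ ⊗≫ evR X) := by monoidal
    _ = 𝟙 _ ⊗≫ (g ▷ ((Yᘁ : A) ⊗ Xᘁ) ≫ (X ⊗ Y) ◁ (rightDualTensorIso X Y).inv) ⊗≫
        evR (X ⊗ Y) := by rw [← evR_tensor]; monoidal
    _ = 𝟙 _ ⊗≫ (Y ⊗ X) ◁ (rightDualTensorIso X Y).inv ⊗≫ (g ▷ (X ⊗ Y)ᘁ ≫ evR (X ⊗ Y)) := by
      rw [← whisker_exchange]; monoidal
    _ = 𝟙 _ ⊗≫ (Y ⊗ X) ◁ ((rightDualTensorIso X Y).inv ≫ gᘁ) ⊗≫ evR (Y ⊗ X) := by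
      rw [evR_naturality]; monoidal
    _ = 𝟙 _ ⊗≫ (Y ⊗ X) ◁ T ⊗≫ ((Y ⊗ X) ◁ (rightDualTensorIso Y X).inv ≫ evR (Y ⊗ X)) := by
      rw [h1]; monoidal
    _ = _ := by rw [evR_tensor]; monoidal

/-- The inverse of the mate of a half-braiding with the dual of `D`. -/
def mateInv {X : A} (h : HalfBraiding X) (D : A) : (Dᘁ : A) ⊗ Xᘁ ⟶ (Xᘁ : A) ⊗ Dᘁ :=
  𝟙 _ ⊗≫ ((Dᘁ : A) ⊗ Xᘁ) ◁ η_ D Dᘁ ⊗≫ (Dᘁ : A) ◁ mate (Xᘁ : A) h D ▷ (Dᘁ : A) ⊗≫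
    ε_ D Dᘁ ▷ ((Xᘁ : A) ⊗ Dᘁ) ⊗≫ 𝟙 _

variable {X : A} (h : HalfBraiding X) (D : A)

/-- The mates for `Dᘁ` and `D` combine to the mate for `Dᘁ ⊗ D`, which slides off the evaluation of
`D` by naturality. -/
lemma mate_mateInv : mate (Xᘁ : A) h Dᘁ ≫ mateInv h D = 𝟙 _ := by
  calc
    _ = 𝟙 _ ⊗≫ (mate (Xᘁ : A) h Dᘁ ▷ 𝟙_ A ≫ ((Dᘁ : A) ⊗ Xᘁ) ◁ η_ D Dᘁ) ⊗≫
        (Dᘁ : A) ◁ mate (Xᘁ : A) h D ▷ (Dᘁ : A) ⊗≫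
        ε_ D Dᘁ ▷ ((Xᘁ : A) ⊗ Dᘁ) ⊗≫ 𝟙 _ := by rw [mateInv]; monoidal
    _ = 𝟙 _ ⊗≫ ((Xᘁ : A) ⊗ Dᘁ) ◁ η_ D Dᘁ ⊗≫
        (𝟙 ((Xᘁ : A) ⊗ (Dᘁ : A) ⊗ D) ⊗≫ mate (Xᘁ : A) h Dᘁ ▷ D ⊗≫
          (Dᘁ : A) ◁ mate (Xᘁ : A) h D ⊗≫ 𝟙 (((Dᘁ : A) ⊗ D) ⊗ Xᘁ)) ▷ (Dᘁ : A) ⊗≫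
        ε_ D Dᘁ ▷ ((Xᘁ : A) ⊗ Dᘁ) ⊗≫ 𝟙 _ := by rw [← whisker_exchange]; monoidal
    _ = 𝟙 _ ⊗≫ ((Xᘁ : A) ⊗ Dᘁ) ◁ η_ D Dᘁ ⊗≫
        (mate (Xᘁ : A) h ((Dᘁ : A) ⊗ D) ≫ ε_ D Dᘁ ▷ (Xᘁ : A)) ▷ (Dᘁ : A) ⊗≫ 𝟙 _ := by
      rw [mate_tensor]; monoidal
    _ = 𝟙 _ ⊗≫ (Xᘁ : A) ◁ ((Dᘁ : A) ◁ η_ D Dᘁ ⊗≫ ε_ D Dᘁ ▷ (Dᘁ : A)) ⊗≫ 𝟙 _ := by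
      rw [← mate_naturality, mate_one]; monoidal
    _ = _ := by rw [ExactPairing.coevaluation_evaluation'']; monoidal

lemma mateInv_evaluation :
    𝟙 (((Dᘁ : A) ⊗ Xᘁ) ⊗ (D ⊗ X)) ⊗≫ mateInv h D ▷ (D ⊗ X) ⊗≫ (Xᘁ : A) ◁ ε_ D Dᘁ ▷ X ⊗≫
      ε_ X Xᘁ = 𝟙 _ ⊗≫ ((Dᘁ : A) ⊗ Xᘁ) ◁ hb h D ⊗≫ (Dᘁ : A) ◁ ε_ X Xᘁ ▷ D ⊗≫ ε_ D Dᘁ := by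
  calc
    _ = 𝟙 _ ⊗≫ ((Dᘁ : A) ⊗ Xᘁ) ◁ η_ D Dᘁ ▷ (D ⊗ X) ⊗≫
        (((Dᘁ : A) ◁ mate (Xᘁ : A) h D ⊗≫ ε_ D Dᘁ ▷ (Xᘁ : A) ⊗≫ 𝟙 (Xᘁ : A)) ▷ ((Dᘁ : A) ⊗ D) ≫
        (Xᘁ : A) ◁ ε_ D Dᘁ) ▷ X ⊗≫ ε_ X Xᘁ := by rw [mateInv]; monoidal
    _ = 𝟙 _ ⊗≫ ((Dᘁ : A) ⊗ Xᘁ) ◁ (η_ D Dᘁ ▷ D ⊗≫ D ◁ ε_ D Dᘁ) ▷ X ⊗≫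
        (Dᘁ : A) ◁ mate (Xᘁ : A) h D ▷ X ⊗≫ (ε_ D Dᘁ ▷ ((Xᘁ : A) ⊗ X) ≫ 𝟙_ A ◁ ε_ X Xᘁ) ⊗≫
        𝟙 _ := by rw [← whisker_exchange]; monoidal
    _ = 𝟙 _ ⊗≫ (Dᘁ : A) ◁ (𝟙 (((Xᘁ : A) ⊗ D) ⊗ X) ⊗≫ mate (Xᘁ : A) h D ▷ X ⊗≫ D ◁ ε_ X Xᘁ ⊗≫
        𝟙 D) ⊗≫ ε_ D Dᘁ ⊗≫ 𝟙 _ := by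
      rw [← whisker_exchange, ExactPairing.evaluation_coevaluation'']; monoidal
    _ = _ := by rw [mate_evaluation]; monoidal

lemma mateInv_evR :
    𝟙 (((D ⊗ X) ⊗ (Dᘁ : A)) ⊗ Xᘁ) ⊗≫ hb h D ▷ ((Dᘁ : A) ⊗ Xᘁ) ⊗≫ X ◁ evR D ▷ Xᘁ ⊗≫ evR X =
      𝟙 _ ⊗≫ (D ⊗ X) ◁ mateInv h D ⊗≫ D ◁ evR X ▷ Dᘁ ⊗≫ evR D :=
  evR_tensor_comp (hb h D) (mateInv h D) (mateInv_evaluation h D)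

lemma hb_mateInv_evR :
    𝟙 ((Dᘁ : A) ⊗ X ⊗ Xᘁ) ⊗≫ hb h (Dᘁ : A) ▷ (Xᘁ : A) ⊗≫ X ◁ mateInv h D ⊗≫ evR X ▷ (Dᘁ : A) ⊗≫
      𝟙 (Dᘁ : A) = 𝟙 _ ⊗≫ (Dᘁ : A) ◁ evR X ⊗≫ 𝟙 _ := by
  have hp := (hb_isLaxBraiding h).pairing (evR D)
  symm
  calc
    _ = 𝟙 _ ⊗≫ (coevL D ▷ (Dᘁ : A) ⊗≫ (Dᘁ : A) ◁ evR D) ▷ (X ⊗ Xᘁ) ⊗≫ (Dᘁ : A) ◁ evR X ⊗≫ 𝟙 _ := by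
      rw [evR_coevL]; monoidal
    _ = 𝟙 _ ⊗≫ coevL D ▷ ((Dᘁ : A) ⊗ X ⊗ Xᘁ) ⊗≫
        (Dᘁ : A) ◁ (𝟙 (D ⊗ (Dᘁ : A) ⊗ X) ⊗≫ evR D ▷ X ⊗≫ 𝟙 (X ⊗ 𝟙_ A)) ▷ (Xᘁ : A) ⊗≫
        (Dᘁ : A) ◁ evR X ⊗≫ 𝟙 _ := by monoidal
    _ = 𝟙 _ ⊗≫ (coevL D ▷ (((Dᘁ : A) ⊗ X) ⊗ Xᘁ) ≫ ((Dᘁ : A) ⊗ D) ◁ hb h (Dᘁ : A) ▷ (Xᘁ : A)) ⊗≫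
        (Dᘁ : A) ◁ (𝟙 (((D ⊗ X) ⊗ (Dᘁ : A)) ⊗ Xᘁ) ⊗≫ hb h D ▷ ((Dᘁ : A) ⊗ Xᘁ) ⊗≫
          X ◁ evR D ▷ Xᘁ ⊗≫ evR X) ⊗≫ 𝟙 _ := by rw [← hp]; monoidal
    _ = 𝟙 _ ⊗≫ hb h (Dᘁ : A) ▷ (Xᘁ : A) ⊗≫
        (coevL D ▷ (X ⊗ ((Dᘁ : A) ⊗ Xᘁ)) ≫ ((Dᘁ : A) ⊗ D) ◁ X ◁ mateInv h D) ⊗≫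
          ((Dᘁ : A) ⊗ D) ◁ evR X ▷ Dᘁ ⊗≫ (Dᘁ : A) ◁ evR D ⊗≫ 𝟙 _ := by
      rw [mateInv_evR, ← whisker_exchange]; monoidal
    _ = 𝟙 _ ⊗≫ hb h (Dᘁ : A) ▷ (Xᘁ : A) ⊗≫ X ◁ mateInv h D ⊗≫
        (coevL D ▷ ((X ⊗ (Xᘁ : A)) ⊗ (Dᘁ : A)) ≫ ((Dᘁ : A) ⊗ D) ◁ evR X ▷ (Dᘁ : A)) ⊗≫
        (Dᘁ : A) ◁ evR D ⊗≫ 𝟙 _ := by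
      rw [← whisker_exchange]; monoidal
    _ = 𝟙 _ ⊗≫ hb h (Dᘁ : A) ▷ (Xᘁ : A) ⊗≫ X ◁ mateInv h D ⊗≫ evR X ▷ (Dᘁ : A) ⊗≫
        (coevL D ▷ (Dᘁ : A) ⊗≫ (Dᘁ : A) ◁ evR D) ⊗≫ 𝟙 _ := by
      rw [← whisker_exchange]; monoidal
    _ = _ := by rw [evR_coevL]; monoidal

/-- The inverse of the crossing with `Dᘁ`, rotated, is the crossing with `D`. The result depends on
the half-braiding only through `R`, so two half-braidings with the same `R` agree after `f`. -/
lemma hb_comp_whiskerRight_of_dual {W Z : A} (g : HalfBraiding W) (f : W ⟶ Z)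
    (R : W ⊗ (Dᘁ : A) ⟶ (Dᘁ : A) ⊗ Z) (hR : hb g (Dᘁ : A) ≫ R = (Dᘁ : A) ◁ f) :
    hb g D ≫ f ▷ D = 𝟙 _ ⊗≫ (D ⊗ W) ◁ coevL D ⊗≫ D ◁ R ▷ D ⊗≫ evR D ▷ (Z ⊗ D) ⊗≫ 𝟙 _ := by
  have hp := (hb_isLaxBraiding g).pairing (evR D)
  have hi : (g.β Dᘁ).hom ≫ hb g (Dᘁ : A) = 𝟙 _ := Iso.hom_inv_id _
  have hR' : R = (g.β Dᘁ).hom ≫ (Dᘁ : A) ◁ f := by rw [← hR, reassoc_of% hi]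
  symm
  calc
    _ = 𝟙 _ ⊗≫ (D ⊗ W) ◁ coevL D ⊗≫ D ◁ (g.β Dᘁ).hom ▷ D ⊗≫ ((D ⊗ (Dᘁ : A)) ◁ (f ▷ D) ≫
        evR D ▷ (Z ⊗ D)) ⊗≫ 𝟙 _ := by rw [hR']; monoidal
    _ = 𝟙 _ ⊗≫ (D ⊗ W) ◁ coevL D ⊗≫ D ◁ (g.β Dᘁ).hom ▷ D ⊗≫
        (𝟙 (D ⊗ (Dᘁ : A) ⊗ W) ⊗≫ evR D ▷ W ⊗≫ 𝟙 (W ⊗ 𝟙_ A)) ▷ D ⊗≫ f ▷ D ⊗≫ 𝟙 _ := by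
      rw [whisker_exchange]; monoidal
    _ = 𝟙 _ ⊗≫ (D ⊗ W) ◁ coevL D ⊗≫ D ◁ ((g.β Dᘁ).hom ≫ hb g (Dᘁ : A)) ▷ D ⊗≫
        hb g D ▷ ((Dᘁ : A) ⊗ D) ⊗≫ W ◁ evR D ▷ D ⊗≫ f ▷ D ⊗≫ 𝟙 _ := by
      rw [← hp]; monoidal
    _ = 𝟙 _ ⊗≫ ((D ⊗ W) ◁ coevL D ≫ hb g D ▷ ((Dᘁ : A) ⊗ D)) ⊗≫ W ◁ evR D ▷ D ⊗≫ f ▷ D ⊗≫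
        𝟙 _ := by rw [hi]; monoidal
    _ = 𝟙 _ ⊗≫ hb g D ⊗≫ W ◁ (D ◁ coevL D ⊗≫ evR D ▷ D) ⊗≫ f ▷ D ⊗≫ 𝟙 _ := by
      rw [whisker_exchange]; monoidal
    _ = _ := by rw [coevL_evR]; monoidal

/-- The pivotal counterpart of `evaluation_dualHb`, and the reason for the centrality of the pivot.
Working with the dual strand `Dᘁ` makes the inverse of the mate available. -/
lemma evR_dualHb : hb (tensOver h (Xᘁ : A)) D ≫ evR X ▷ D =
    hb (tensUnder X (dualHb (Xᘁ : A) h)) D ≫ evR X ▷ D := by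
  have h1 := (Cen.ofUnder (evR X)) (Dᘁ : A)
  rw [← tens_under_under, hb_tens, hb_under, hb_under, hb_under] at h1
  have hb1 : (β_ (Xᘁ : A) (Dᘁ : A)).inv ≫ (β_ (Xᘁ : A) (Dᘁ : A)).hom = 𝟙 _ := Iso.inv_hom_id _
  let R : (X ⊗ Xᘁ) ⊗ (Dᘁ : A) ⟶ (Dᘁ : A) ⊗ 𝟙_ A :=
    𝟙 _ ⊗≫ X ◁ (β_ (Xᘁ : A) (Dᘁ : A)).hom ⊗≫ X ◁ mateInv h D ⊗≫ evR X ▷ (Dᘁ : A) ⊗≫ 𝟙 _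
  rw [hb_comp_whiskerRight_of_dual D (tensOver h (Xᘁ : A)) (evR X) R,
    hb_comp_whiskerRight_of_dual D (tensUnder X (dualHb (Xᘁ : A) h)) (evR X) R]
  · calc
      _ = 𝟙 _ ⊗≫ (β_ (Dᘁ : A) X).hom ▷ (Xᘁ : A) ⊗≫ X ◁ (β_ (Dᘁ : A) (Xᘁ : A)).hom ⊗≫
          X ◁ mate (Xᘁ : A) h (Dᘁ : A) ⊗≫ X ◁ ((β_ (Xᘁ : A) (Dᘁ : A)).inv ≫
          (β_ (Xᘁ : A) (Dᘁ : A)).hom) ⊗≫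
          X ◁ mateInv h D ⊗≫ evR X ▷ (Dᘁ : A) ⊗≫ 𝟙 _ := by
        rw [hb_tensUnder, hb_dualHb]; simp only [R]; monoidal
      _ = 𝟙 _ ⊗≫ (β_ (Dᘁ : A) X).hom ▷ (Xᘁ : A) ⊗≫ X ◁ (β_ (Dᘁ : A) (Xᘁ : A)).hom ⊗≫
          X ◁ (mate (Xᘁ : A) h (Dᘁ : A) ≫ mateInv h D) ⊗≫ evR X ▷ (Dᘁ : A) ⊗≫ 𝟙 _ := by
        rw [hb1]; monoidal
      _ = 𝟙 _ ⊗≫ ((𝟙 ((Dᘁ : A) ⊗ X ⊗ Xᘁ) ⊗≫ (β_ (Dᘁ : A) X).hom ▷ (Xᘁ : A) ⊗≫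
          X ◁ (β_ (Dᘁ : A) (Xᘁ : A)).hom ⊗≫ 𝟙 ((X ⊗ (Xᘁ : A)) ⊗ (Dᘁ : A))) ≫
          evR X ▷ (Dᘁ : A)) ⊗≫ 𝟙 _ := by rw [mate_mateInv]; monoidal
      _ = _ := by rw [← h1]; simp only [braiding_tensorUnit_right]; monoidal
  · calc
      _ = 𝟙 _ ⊗≫ hb h (Dᘁ : A) ▷ (Xᘁ : A) ⊗≫ X ◁ ((β_ (Xᘁ : A) (Dᘁ : A)).inv ≫
          (β_ (Xᘁ : A) (Dᘁ : A)).hom) ⊗≫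
          X ◁ mateInv h D ⊗≫ evR X ▷ (Dᘁ : A) ⊗≫ 𝟙 _ := by
        rw [hb_tensOver]; simp only [R]; monoidal
      _ = 𝟙 _ ⊗≫ (𝟙 ((Dᘁ : A) ⊗ X ⊗ Xᘁ) ⊗≫ hb h (Dᘁ : A) ▷ (Xᘁ : A) ⊗≫ X ◁ mateInv h D ⊗≫
          evR X ▷ (Dᘁ : A) ⊗≫ 𝟙 (Dᘁ : A)) ⊗≫ 𝟙 _ := by rw [hb1]; monoidal
      _ = _ := by rw [hb_mateInv_evR]; monoidal

lemma eq_of_braiding_evaluation {P Y Y' B : A} [ExactPairing Y Y'] {φ ψ : P ⟶ Y' ⊗ B}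
    (H : 𝟙 (P ⊗ Y) ⊗≫ φ ▷ Y ⊗≫ Y' ◁ (β_ Y B).inv ⊗≫ ε_ Y Y' ▷ B ⊗≫ 𝟙 B =
      𝟙 (P ⊗ Y) ⊗≫ ψ ▷ Y ⊗≫ Y' ◁ (β_ Y B).inv ⊗≫ ε_ Y Y' ▷ B ⊗≫ 𝟙 B) : φ = ψ := by
  have h1 := (Cen.ofOver (η_ Y Y')) B
  rw [← tens_over_over, hb_tens, hb_over, hb_over, hb_over] at h1
  have key : ∀ φ : P ⟶ Y' ⊗ B, φ = 𝟙 _ ⊗≫ P ◁ η_ Y Y' ⊗≫ (𝟙 (P ⊗ Y) ⊗≫ φ ▷ Y ⊗≫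
      Y' ◁ (β_ Y B).inv ⊗≫ ε_ Y Y' ▷ B ⊗≫ 𝟙 B) ▷ Y' ⊗≫ (β_ Y' B).inv := by
    intro φ
    symm
    calc
      _ = 𝟙 _ ⊗≫ (P ◁ η_ Y Y' ≫ φ ▷ (Y ⊗ Y')) ⊗≫ Y' ◁ (β_ Y B).inv ▷ Y' ⊗≫
          (ε_ Y Y' ▷ (B ⊗ Y') ≫ 𝟙_ A ◁ (β_ Y' B).inv) ⊗≫ 𝟙 _ := by monoidal
      _ = 𝟙 _ ⊗≫ φ ⊗≫ (Y' ⊗ B) ◁ η_ Y Y' ⊗≫ Y' ◁ (β_ Y B).inv ▷ Y' ⊗≫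
          ((Y' ⊗ Y) ◁ (β_ Y' B).inv ≫ ε_ Y Y' ▷ (Y' ⊗ B)) ⊗≫ 𝟙 _ := by
        rw [whisker_exchange, whisker_exchange]; monoidal
      _ = φ ⊗≫ Y' ◁ (B ◁ η_ Y Y' ≫ (𝟙 (B ⊗ Y ⊗ Y') ⊗≫ (β_ Y B).inv ▷ Y' ⊗≫
          Y ◁ (β_ Y' B).inv ⊗≫ 𝟙 ((Y ⊗ Y') ⊗ B))) ⊗≫ ε_ Y Y' ▷ (Y' ⊗ B) ⊗≫ 𝟙 _ := by
        monoidal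
      _ = φ ⊗≫ (Y' ◁ η_ Y Y' ⊗≫ ε_ Y Y' ▷ Y') ▷ B ⊗≫ 𝟙 _ := by
        rw [h1]; simp only [braiding_inv_tensorUnit_left]; monoidal
      _ = _ := by rw [ExactPairing.coevaluation_evaluation'']; monoidal
  rw [key φ, key ψ, H]

/-- Tested against `Xᘁ`, the two sides differ by replacing a crossing with `X` or with its double
dual by one with `Xᘁ`. Both replacements are allowed, by `evaluation_dualHb` for the evaluation of
`Xᘁ` and by `evR_dualHb` for that evaluation preceded by the pivot. -/
lemma cen_pivot : Cen h (dualHb ((Xᘁ : A)ᘁ : A) (dualHb (Xᘁ : A) h)) (pivot X).hom := by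
  intro B
  apply eq_of_braiding_evaluation (Y := (Xᘁ : A)) (Y' := ((Xᘁ : A)ᘁ : A))
  have h1 := evaluation_dualHb ((Xᘁ : A)ᘁ : A) (dualHb (Xᘁ : A) h) B
  have h2 := evR_dualHb h B
  rw [hb_tensOver, hb_tensUnder] at h1 h2
  generalize hb (dualHb ((Xᘁ : A)ᘁ : A) (dualHb (Xᘁ : A) h)) B = u at h1 ⊢
  generalize hb (dualHb (Xᘁ : A) h) B = w at h1 h2
  generalize hb h B = t at h2 ⊢
  rw [evR] at h2
  have hn : B ◁ (pivot X).hom ≫ (β_ B ((Xᘁ : A)ᘁ : A)).hom = (β_ B X).hom ≫ (pivot X).hom ▷ B :=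
    BraidedCategory.braiding_naturality_right _ _
  calc
    _ = 𝟙 _ ⊗≫ B ◁ (pivot X).hom ▷ (Xᘁ : A) ⊗≫ ((𝟙 (B ⊗ ((Xᘁ : A)ᘁ : A) ⊗ (Xᘁ : A)) ⊗≫ u ▷ (Xᘁ : A) ⊗≫
        ((Xᘁ : A)ᘁ : A) ◁ (β_ (Xᘁ : A) B).inv ⊗≫ 𝟙 ((((Xᘁ : A)ᘁ : A) ⊗ (Xᘁ : A)) ⊗ B)) ≫ ε_ (Xᘁ : A) ((Xᘁ : A)ᘁ : A) ▷ B) ⊗≫ 𝟙 _ := by monoidal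
    _ = 𝟙 _ ⊗≫ (B ◁ (pivot X).hom ≫ (β_ B ((Xᘁ : A)ᘁ : A)).hom) ▷ (Xᘁ : A) ⊗≫ ((Xᘁ : A)ᘁ : A) ◁ w ⊗≫ ε_ (Xᘁ : A) ((Xᘁ : A)ᘁ : A) ▷ B ⊗≫
        𝟙 _ := by rw [h1]; monoidal
    _ = 𝟙 _ ⊗≫ (β_ B X).hom ▷ (Xᘁ : A) ⊗≫ ((pivot X).hom ▷ (B ⊗ (Xᘁ : A)) ≫ ((Xᘁ : A)ᘁ : A) ◁ w) ⊗≫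
        ε_ (Xᘁ : A) ((Xᘁ : A)ᘁ : A) ▷ B ⊗≫ 𝟙 _ := by rw [hn]; monoidal
    _ = 𝟙 _ ⊗≫ ((𝟙 (B ⊗ X ⊗ (Xᘁ : A)) ⊗≫ (β_ B X).hom ▷ (Xᘁ : A) ⊗≫ X ◁ w ⊗≫ 𝟙 ((X ⊗ (Xᘁ : A)) ⊗ B)) ≫
        ((pivot X).hom ▷ (Xᘁ : A) ≫ ε_ (Xᘁ : A) ((Xᘁ : A)ᘁ : A)) ▷ B) ⊗≫ 𝟙 _ := by
      rw [← whisker_exchange]; monoidal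
    _ = 𝟙 _ ⊗≫ t ▷ (Xᘁ : A) ⊗≫ (X ◁ (β_ (Xᘁ : A) B).inv ≫ (pivot X).hom ▷ ((Xᘁ : A) ⊗ B)) ⊗≫
        ε_ (Xᘁ : A) ((Xᘁ : A)ᘁ : A) ▷ B ⊗≫ 𝟙 _ := by rw [← h2]; monoidal
    _ = _ := by rw [whisker_exchange]; monoidal

end PivotHalfBraiding

end

end ReducedTensor

namespace ReducedTensor

noncomputable section

/-! ### Monoidality of the pivotal structure -/

section TensorIso

variable {C : Type u} [Category.{v} C] [MonoidalCategory C] [RightRigidCategory C]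

lemma tensorIso_inv_evaluation (X Y : C) :
    (rightDualTensorIso X Y).inv ▷ (X ⊗ Y) ≫ ε_ (X ⊗ Y) (X ⊗ Y)ᘁ = (α_ _ _ _).hom ≫
      (Yᘁ : C) ◁ ((α_ _ _ _).inv ≫ ε_ X Xᘁ ▷ Y ≫ (λ_ Y).hom) ≫ ε_ Y Yᘁ := by
  rw [rightDualTensorIso_inv_evaluation]
  monoidal

lemma whiskerRight_tensorIso_evaluation {X Y P W : C} (i : P ⟶ Yᘁ ⊗ Xᘁ) (j : W ⟶ X ⊗ Y) :
    (i ≫ (rightDualTensorIso X Y).inv ≫ jᘁ) ▷ W ≫ ε_ W Wᘁ = (i ⊗ₘ j) ≫ (α_ _ _ _).hom ≫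
      (Yᘁ : C) ◁ ((α_ _ _ _).inv ≫ ε_ X Xᘁ ▷ Y ≫ (λ_ Y).hom) ≫ ε_ Y Yᘁ := by
  rw [← tensorIso_inv_evaluation, comp_whiskerRight, comp_whiskerRight, Category.assoc,
    Category.assoc, rightAdjointMate_comp_evaluation, ← whisker_exchange_assoc,
    MonoidalCategory.tensorHom_def, Category.assoc]

end TensorIso

section NestedEvaluation

variable {k : Type w} [Field k] [IsAlgClosed k]
  {A : Type u} [Category.{v} A] [Abelian A] [Linear k A] [MonoidalCategory A]
  [MonoidalPreadditive A] [MonoidalLinear k A] [BraidedCategory A] [RigidCategory A]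
  [PivotalCategory A] [PremodularCategory k A] {ι : Type u₁} [Fintype ι]
  (S : SimpleData k A ι)

variable {X Y : A} (X' Y' : A) [ExactPairing X X'] [ExactPairing Y Y'] (h : HalfBraiding X)
  (h' : HalfBraiding Y)

/-- The evaluation of `Y^* ⊗ X^*` with `X ⊗ Y`. -/
def nestedEv : (Y' ⊗ X') ⊗ (X ⊗ Y) ⟶ 𝟙_ A :=
  (α_ _ _ _).hom ≫ Y' ◁ ((α_ _ _ _).inv ≫ ε_ X X' ▷ Y ≫ (λ_ Y).hom) ≫ ε_ Y Y'

/-- Up to the outer evaluation of `Y` the map `t` is central for both half-braidings, and that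
evaluation does not distinguish them. -/
lemma rproj_nestedEv [CharZero k] {P W : A} {hP : HalfBraiding P} {hW : HalfBraiding W}
    {i : P ⟶ Y' ⊗ X'} {j : W ⟶ X ⊗ Y} (hi : Cen hP (tensOver (dualHb Y' h') X') i)
    (hj : Cen hW (tensUnder X h') j) :
    rproj S hP hW ≫ (i ⊗ₘ j) ≫ nestedEv X' Y' = (i ⊗ₘ j) ≫ nestedEv X' Y' := by
  let t : P ⊗ W ⟶ Y' ⊗ Y := i ▷ W ≫ (Y' ⊗ X') ◁ j ≫ (α_ _ _ _).hom ≫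
    Y' ◁ ((α_ _ _ _).inv ≫ ε_ X X' ▷ Y ≫ (λ_ Y).hom)
  have ht : (i ⊗ₘ j) ≫ nestedEv X' Y' = t ≫ ε_ Y Y' := by
    simp only [t, nestedEv, MonoidalCategory.tensorHom_def, Category.assoc]
  have h1 : Cen (tensOver hP W) (tensOver (dualHb Y' h') Y) t := by
    have a1 := Cen.associator (dualHb Y' h') (overHb X') (overHb (X ⊗ Y))
    rw [tens_over_over] at a1
    exact (hi.whiskerRight _).comp ((Cen.whiskerLeft _ (Cen.ofOver j)).comp
      (a1.comp (Cen.whiskerLeft _ (Cen.ofOver _))))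
  have h2 : Cen (tensUnder P hW) (tensUnder Y' h') t := by
    have a1 := Cen.associator (underHb Y') (underHb X') (tensUnder X h')
    have a2 := Cen.associator_inv (underHb X') (underHb X) h'
    have a3 := (Cen.ofUnder (ε_ X X')).whiskerRight h'
    have a4 := Cen.leftUnitor h'
    rw [tens_under_under] at a1 a2
    rw [← under_unit] at a4
    exact ((Cen.ofUnder i).whiskerRight _).comp ((Cen.whiskerLeft _ hj).comp
      (a1.comp (Cen.whiskerLeft _ (a2.comp (a3.comp a4)))))
  rw [ht]
  apply rproj_comp_of_hb_comp
  intro B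
  rw [comp_whiskerRight, ← Category.assoc, ← Category.assoc, ← h1 B, ← h2 B, Category.assoc,
    Category.assoc, evaluation_dualHb]

lemma centralEv_lunit : S.sqrtGlobalDim⁻¹ • (centralEv S X' h ▷ Y ≫ lunit S h') =
    avg S (tensOver (tensUnder X' h) Y) h' (ε_ X X' ▷ Y ≫ (λ_ Y).hom) := by
  rw [centralEv, lunit, avg, MonoidalLinear.smul_whiskerRight, Linear.smul_comp, smul_smul,
    ← mul_inv, ← sq, comp_whiskerRight, Category.assoc,
    reassoc_of% inductionTensor_naturality_left S (ε_ X X') Y, indMap_comp,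
    ← Category.assoc, coact_inductionTensor, Category.assoc]

/-- Evaluation in the center followed by the unit constraint is the average of the evaluation in
`A`. After the projection of `X ⊗ Y` that evaluation is already central, so averaging changes
nothing. -/
lemma rproj_centralEv_lunit [CharZero k] : X' ◁ rproj S h h' ≫ (α_ X' X Y).inv ≫
    (S.sqrtGlobalDim⁻¹ • (centralEv S X' h ▷ Y ≫ lunit S h')) =
      X' ◁ rproj S h h' ≫ (α_ X' X Y).inv ≫ ε_ X X' ▷ Y ≫ (λ_ Y).hom := by
  have h1 : Cen (tensUnder X' (tensUnder X h')) (tensOver (tensUnder X' h) Y)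
      (X' ◁ rproj S h h' ≫ (α_ X' X Y).inv) :=
    (Cen.whiskerLeft _ (cen_rproj_under_over S h h')).comp
      (Cen.associator_inv (underHb X') h (overHb Y))
  have h2 : Cen (tensUnder X' (tensUnder X h')) h'
      (X' ◁ rproj S h h' ≫ (α_ X' X Y).inv ≫ ε_ X X' ▷ Y ≫ (λ_ Y).hom) := by
    have a2 := Cen.associator_inv (underHb X') (underHb X) h'
    have a3 := (Cen.ofUnder (ε_ X X')).whiskerRight h'
    have a4 := Cen.leftUnitor h'
    rw [tens_under_under] at a2
    rw [← under_unit] at a4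
    exact (Cen.whiskerLeft _ (cen_rproj_under_under S h h')).comp (a2.comp (a3.comp a4))
  rw [centralEv_lunit, ← Category.assoc, comp_avg S h1, Category.assoc, avg_of_cen S h2]

end NestedEvaluation

section PivotalStructure

variable {k : Type w} [Field k] [IsAlgClosed k]
  {A : Type u} [Category.{v} A] [Abelian A] [Linear k A] [MonoidalCategory A]
  [MonoidalPreadditive A] [MonoidalLinear k A] [BraidedCategory A] [RigidCategory A]
  [PivotalCategory A] [PremodularCategory k A] {ι : Type u₁} [Fintype ι]
  (S : SimpleData k A ι)

variable {S} [CharZero k]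

namespace RCenter

/-- The evaluation in `A` of `Y^* ⊗ X^*` with `X ⊗ Y`. -/
def nestA (X Y : RCenter S) : ((dual Y).obj ⊗ (dual X).obj) ⊗ (X.obj ⊗ Y.obj) ⟶ 𝟙_ A :=
  (α_ _ _ _).hom ≫ (dual Y).obj ◁ ((α_ _ _ _).inv ≫ evA X ▷ Y.obj ≫ (λ_ Y.obj).hom) ≫ evA Y

lemma idem_nestA (X Y : RCenter S) : idem (dual Y ⊗ dual X) (X ⊗ Y) ≫
    (incl (dual Y) (dual X) ⊗ₘ incl X Y) ≫ nestA X Y =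
      (incl (dual Y) (dual X) ⊗ₘ incl X Y) ≫ nestA X Y :=
  rproj_nestedEv S ((X.obj)ᘁ : A) ((Y.obj)ᘁ : A) Y.halfBraiding
    (cen_rincl_over S (dual Y).halfBraiding (dual X).halfBraiding)
    (cen_rincl_under S X.halfBraiding Y.halfBraiding)

lemma idem_cev_lunit (X Y : RCenter S) : (dual X).obj ◁ idem X Y ≫ (α_ _ _ _).inv ≫
    (S.sqrtGlobalDim⁻¹ • (cev X ▷ Y.obj ≫ lunit Y)) =
      (dual X).obj ◁ idem X Y ≫ (α_ _ _ _).inv ≫ evA X ▷ Y.obj ≫ (λ_ Y.obj).hom :=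
  rproj_centralEv_lunit S ((X.obj)ᘁ : A) X.halfBraiding Y.halfBraiding

lemma incl_cev_lunit (X Y : RCenter S) : (dual X).obj ◁ incl X Y ≫ (α_ _ _ _).inv ≫
    (S.sqrtGlobalDim⁻¹ • (cev X ▷ Y.obj ≫ lunit Y)) =
      (dual X).obj ◁ incl X Y ≫ (α_ _ _ _).inv ≫ evA X ▷ Y.obj ≫ (λ_ Y.obj).hom := by
  rw [← incl_idem, MonoidalCategory.whiskerLeft_comp, Category.assoc, idem_cev_lunit]
  simp only [Category.assoc]

lemma ev_whiskerRight_hom (X Y : RCenter S) :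
    hom ((α_ (dual X) X Y).inv ≫ ev X ▷ Y ≫ (λ_ Y).hom) = incl (dual X) (X ⊗ Y) ≫
      (dual X).obj ◁ incl X Y ≫ (α_ _ _ _).inv ≫ evA X ▷ Y.obj ≫ (λ_ Y.obj).hom := by
  rw [← incl_cev_lunit]
  have h1 := whiskerRight_incl (ev X) Y
  have h2 := associator_inv_incl (dual X) X Y
  rw [comp_hom, comp_hom, leftUnitor_hom]
  simp only [Linear.comp_smul]
  rw [reassoc_of% h1, ev_hom, comp_whiskerRight_assoc, reassoc_of% h2]

lemma nested_hom (X Y : RCenter S) :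
    flat ((α_ (dual Y) (dual X) (X ⊗ Y)).hom ≫
      dual Y ◁ ((α_ (dual X) X Y).inv ≫ ev X ▷ Y ≫ (λ_ Y).hom) ≫ ev Y) =
    (incl (dual Y) (dual X) ⊗ₘ incl X Y) ≫ nestA X Y := by
  have h1 := whiskerLeft_incl (dual Y) ((α_ (dual X) X Y).inv ≫ ev X ▷ Y ≫ (λ_ Y).hom)
  have h2 := associator_incl (dual Y) (dual X) (X ⊗ Y)
  rw [← Category.assoc, flat_ev, comp_hom, Category.assoc, reassoc_of% h1, ev_whiskerRight_hom,
    ← idem_nestA, ← proj_incl, MonoidalCategory.tensorHom_def, nestA]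
  simp only [MonoidalCategory.whiskerLeft_comp, Category.assoc]
  rw [reassoc_of% h2]
  simp only [Category.assoc, tensor_whiskerLeft, Iso.inv_hom_id_assoc]

/-- Both sides induce the same nested pairing in `A`, the left one by `nested_hom`. This reduces the
monoidality of the pivot in the center to that in `A`. -/
lemma tensorIso_inv_hom (X Y : RCenter S) : hom (rightDualTensorIso X Y).inv =
    incl (dual Y) (dual X) ≫ (rightDualTensorIso X.obj Y.obj).inv ≫
      ((incl X Y)ᘁ : ((X.obj ⊗ Y.obj)ᘁ : A) ⟶ _) := by
  apply eq_of_whiskerRight_evA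
  have h1 := flat_tensorHom_ev (X := X ⊗ Y) (P := dual Y ⊗ dual X)
    (rightDualTensorIso X Y).inv (𝟙 (X ⊗ Y))
  rw [id_hom, tensorHom_id, tensorHom_id] at h1
  rw [← h1]
  have h2 := congrArg flat (tensorIso_inv_evaluation X Y)
  exact h2.trans ((nested_hom X Y).trans (whiskerRight_tensorIso_evaluation _ _).symm)

/-- The pivotal structure of the center. -/
def pivotIso (X : RCenter S) : X ≅ dual (dual X) :=
  mkIso (pivot X.obj).hom (pivot X.obj).inv (cen_pivot X.halfBraiding) (Iso.hom_inv_id _)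
    (Iso.inv_hom_id _)

lemma pivotIso_naturality {X Y : RCenter S} (f : X ⟶ Y) :
    f ≫ (pivotIso Y).hom = (pivotIso X).hom ≫ ((fᘁ)ᘁ) := by
  apply hom_ext
  have h1 : hom ((fᘁ)ᘁ) = dualHom (X := dual Y) (Y := dual X) (dualHom (hom f)) :=
    (rightAdjointMate_hom (fᘁ)).trans (congrArg _ (rightAdjointMate_hom f))
  rw [comp_hom, comp_hom]
  exact (pivot_naturality (hom f)).trans (congrArg ((pivot X.obj).hom ≫ ·) h1.symm)

lemma pivot_comp_tensorIso (X Y : RCenter S) :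
    (pivotIso (X ⊗ Y)).hom ≫ ((rightDualTensorIso X Y).inv)ᘁ =
      ((pivotIso X).hom ⊗ₘ (pivotIso Y).hom) ≫ (rightDualTensorIso Yᘁ Xᘁ).inv := by
  apply hom_ext
  have h1 := rightAdjointMate_hom (rightDualTensorIso X Y).inv
  have h2 := tensorIso_inv_hom (dual Y) (dual X)
  have h3 := tensorHom_incl (pivotIso X).hom (pivotIso Y).hom
  have h4 : ∀ {P W : A} (i : W ⟶ X.obj ⊗ Y.obj) (j : P ⟶ ((Y.obj)ᘁ : A) ⊗ (X.obj)ᘁ),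
      (pivot W).hom ≫ ((j ≫ (rightDualTensorIso X.obj Y.obj).inv ≫ iᘁ)ᘁ) =
        i ≫ ((pivot X.obj).hom ⊗ₘ (pivot Y.obj).hom) ≫
          (rightDualTensorIso ((Y.obj)ᘁ : A) ((X.obj)ᘁ : A)).inv ≫ jᘁ := by
    intro P W i j
    rw [comp_rightAdjointMate, comp_rightAdjointMate, Category.assoc,
      ← reassoc_of% pivot_naturality i, reassoc_of% pivot_comp_rightDualTensorIso X.obj Y.obj]
  have h5 : hom (pivotIso (X ⊗ Y)).hom ≫ dualHom (X := dual Y ⊗ dual X) (Y := dual (X ⊗ Y))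
      (hom (rightDualTensorIso X Y).inv) = incl X Y ≫
      (hom (pivotIso X).hom ⊗ₘ hom (pivotIso Y).hom) ≫
        (rightDualTensorIso ((Y.obj)ᘁ : A) ((X.obj)ᘁ : A)).inv ≫
        ((incl (dual Y) (dual X))ᘁ : (((Y.obj)ᘁ ⊗ (X.obj)ᘁ : A)ᘁ : A) ⟶ _) := by
    rw [tensorIso_inv_hom]
    exact h4 _ _
  rw [comp_hom, comp_hom]
  refine Eq.trans (congrArg (hom (pivotIso (X ⊗ Y)).hom ≫ ·) h1) (h5.trans ?_)
  refine Eq.trans ?_ (congrArg (hom ((pivotIso X).hom ⊗ₘ (pivotIso Y).hom) ≫ ·) h2.symm)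
  exact ((reassoc_of% h3) _).symm

instance : PivotalCategory (RCenter S) where
  pivot := pivotIso
  pivot_naturality := pivotIso_naturality
  pivot_tensor X Y := by
    rw [← Category.assoc, pivot_comp_tensorIso, Category.assoc, Iso.inv_hom_id, Category.comp_id]

end RCenter

end PivotalStructure

end

end ReducedTensor

namespace ReducedTensor

noncomputable section

/-! ### The tensor structure `J` in terms of insertions -/

section TensorStructure

variable {k : Type w} [Field k] [IsAlgClosed k]
  {A : Type u} [Category.{v} A] [Abelian A] [Linear k A] [MonoidalCategory A]
  [MonoidalPreadditive A] [MonoidalLinear k A] [BraidedCategory A] [RigidCategory A]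
  [PivotalCategory A] [PremodularCategory k A] {ι : Type u₁} [Fintype ι]
  (S : SimpleData k A ι)

lemma actOn_actOn {W : A} (h : HalfBraiding W) {B B' C C' : A} (f : C ⊗ C' ⟶ 𝟙_ A)
    (e : B ⊗ B' ⟶ 𝟙_ A) :
    B ◁ actOn h f ▷ B' ≫ actOn h e = 𝟙 _ ⊗≫ actOn h (nest f e) := by
  symm
  calc
    _ = 𝟙 _ ⊗≫ B ◁ hb h C ▷ (C' ⊗ B') ⊗≫ (hb h B ▷ (C ⊗ C') ≫ (W ⊗ B) ◁ f) ▷ B' ⊗≫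
        W ◁ e ⊗≫ 𝟙 _ := by rw [actOn, hb_tensor, nest]; monoidal
    _ = _ := by rw [← whisker_exchange, actOn, actOn]; monoidal

lemma ins_actOn (V : A) {B B' C C' : A} (f : C ⊗ C' ⟶ 𝟙_ A) (e : B ⊗ B' ⟶ 𝟙_ A) :
    B ◁ ins S V f ▷ B' ≫ actOn (indHb S V) e = 𝟙 _ ⊗≫ ins S V (nest f e) := by
  calc
    _ = 𝟙 _ ⊗≫ (B ⊗ C) ◁ ins₁ S V ▷ (C' ⊗ B') ⊗≫
        (B ◁ actOn (indHb S V) f ▷ B' ≫ actOn (indHb S V) e) := by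
      rw [← ins₁_actOn S V f]; monoidal
    _ = 𝟙 _ ⊗≫ ((B ⊗ C) ◁ ins₁ S V ▷ (C' ⊗ B') ≫ actOn (indHb S V) (nest f e)) := by
      rw [actOn_actOn]; monoidal
    _ = _ := by rw [ins₁_actOn]

lemma transpose_evR {P Q : A} (ψ : P ⟶ Q) : transpose (evR Q) ψ = ψᘁ := by
  have := transpose_comp_right (evR Q) (𝟙 P) ψ
  rw [Category.id_comp, evR_naturality, transpose_comp_left, transpose_evR_id,
    Category.comp_id] at this
  exact this

lemma transpose_nest_evR {P X Y : A} (ψ : P ⟶ X ⊗ Y) :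
    transpose (nest (evR Y) (evR X)) ψ = (rightDualTensorIso X Y).inv ≫ ψᘁ := by
  have : nest (evR Y) (evR X) = (X ⊗ Y) ◁ (rightDualTensorIso X Y).inv ≫ evR (X ⊗ Y) := by
    rw [evR_tensor, nest]
  rw [this, transpose_comp_left, transpose_evR]

/-- The morphism `I(V) ⊗ I(W) ⟶ I(V ⊗ W)` that nests the strands around `W` in those around
`V`. -/
def indTensor (V W : A) : indObj S V ⊗ indObj S W ⟶ indObj S (V ⊗ W) :=
  inductionTensor S V (indObj S W) ≫ indMap S (tensorInduction S V W) ≫ act S (indHb S (V ⊗ W))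

/-- The strands of `V` move over everything around `W`, the left strand of `W` moves under `V`, and
the iterated action nests the two pairings. -/
lemma ins_ins_indTensor (V W : A) {B B' C C' : A} (f : C ⊗ C' ⟶ 𝟙_ A) (e : B ⊗ B' ⟶ 𝟙_ A) :
    (ins S V e ⊗ₘ ins S W f) ≫ indTensor S V W =
      𝟙 _ ⊗≫ (B ⊗ V) ◁ (β_ (C ⊗ W ⊗ C') B').inv ⊗≫
        B ◁ (β_ C V).inv ▷ ((W ⊗ C') ⊗ B') ⊗≫ ins S (V ⊗ W) (nest f e) := by
  rw [indTensor, MonoidalCategory.tensorHom_def', Category.assoc, ← Category.assoc (ins S V e ▷ _),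
    ins_inductionTensor]
  calc
    _ = 𝟙 _ ⊗≫ (B ⊗ V) ◁ (B' ◁ ins S W f ≫ (β_ (indObj S W) B').inv) ⊗≫
        (ins S (V ⊗ indObj S W) e ≫ indMap S (tensorInduction S V W)) ≫
          act S (indHb S (V ⊗ W)) := by
      monoidal
    _ = 𝟙 _ ⊗≫ (B ⊗ V) ◁ (β_ (C ⊗ W ⊗ C') B').inv ⊗≫
        B ◁ (V ◁ ins S W f ≫ tensorInduction S V W) ▷ B' ≫
          (ins S (indObj S (V ⊗ W)) e ≫ act S (indHb S (V ⊗ W))) := by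
      rw [BraidedCategory.braiding_inv_naturality_right, ← ins_map]; monoidal
    _ = 𝟙 _ ⊗≫ (B ⊗ V) ◁ (β_ (C ⊗ W ⊗ C') B').inv ⊗≫
        B ◁ (β_ C V).inv ▷ (W ⊗ C') ▷ B' ⊗≫
          (B ◁ ins S (V ⊗ W) f ▷ B' ≫ actOn (indHb S (V ⊗ W)) e) := by
      rw [ins_tensorInduction, ins_act]; monoidal
    _ = _ := by rw [ins_actOn]; monoidal

/-- Fusing `X_i, X_l` into `X_j` along dual bases is by definition the insertion of the nested
pairing of `X_i ⊗ X_l`; the dual node becomes the transpose by `transpose_nest_evR`. -/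
lemma tensorComponent_sum (V W : A) (i l : ι) :
    ∑ j, S.sqrtDim j • (tensorComponent S V W i l j ≫ indι S (V ⊗ W) j) =
      (ins S V (evR (S.obj i)) ⊗ₘ ins S W (evR (S.obj l))) ≫ indTensor S V W := by
  rw [ins_ins_indTensor, ins]
  simp only [monoidalComp, Preadditive.comp_sum, Linear.comp_smul, tensorComponent,
    Preadditive.sum_comp]
  refine Finset.sum_congr rfl fun j _ => ?_
  congr 1
  refine Finset.sum_congr rfl fun a _ => ?_
  rw [transpose_nest_evR]
  generalize (rightDualTensorIso (S.obj i) (S.obj l)).inv ≫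
    (dualNode k (S.obj i ⊗ S.obj l) (S.obj j) a)ᘁ = t
  generalize node k (S.obj i ⊗ S.obj l) (S.obj j) a = φ
  generalize indι S (V ⊗ W) j = u
  rw [BraidedCategory.braiding_tensor_left_inv, BraidedCategory.braiding_tensor_left_inv]
  calc
    _ = 𝟙 _ ⊗≫ (S.obj i ⊗ V) ◁ (β_ (S.obj l) (S.obj i)ᘁ).inv ▷ (W ⊗ (S.obj l)ᘁ) ⊗≫
        S.obj i ◁ ((β_ (S.obj l) V).inv ▷ ((S.obj i)ᘁ ⊗ W ⊗ (S.obj l)ᘁ) ≫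
        (S.obj l ⊗ V) ◁ (𝟙 ((S.obj i)ᘁ ⊗ W ⊗ (S.obj l)ᘁ : A) ⊗≫ (β_ W (S.obj i)ᘁ).inv ▷ (S.obj l)ᘁ ⊗≫
          W ◁ (β_ ((S.obj l)ᘁ : A) ((S.obj i)ᘁ : A)).inv ⊗≫
          𝟙 (W ⊗ ((S.obj l)ᘁ ⊗ (S.obj i)ᘁ : A)))) ⊗≫
        φ ▷ (V ⊗ W ⊗ (S.obj l)ᘁ ⊗ (S.obj i)ᘁ) ⊗≫ (S.obj j ⊗ V ⊗ W) ◁ t ⊗≫ u := by monoidal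
    _ = _ := by rw [← whisker_exchange]; monoidal

lemma tensorMap_eq (V W : A) : tensorMap S V W = indTensor S V W := by
  have h : indTensor S V W = ∑ i, ∑ l, ((indπ S V i ≫ indι S V i) ⊗ₘ (indπ S W l ≫ indι S W l)) ≫
      indTensor S V W := by
    simp only [← Preadditive.sum_comp, ← tensor_sum, ← sum_tensor]
    rw [sum_indπ_indι, sum_indπ_indι]
    simp
  rw [h, tensorMap]
  refine Finset.sum_congr rfl fun i _ => Finset.sum_congr rfl fun l _ => ?_
  rw [← MonoidalCategory.tensorHom_comp_tensorHom, Category.assoc, indι_eq, indι_eq]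
  have h2 : ((S.sqrtDim i • ins S V (evR (S.obj i))) ⊗ₘ (S.sqrtDim l • ins S W (evR (S.obj l)))) =
      (S.sqrtDim i * S.sqrtDim l) • (ins S V (evR (S.obj i)) ⊗ₘ ins S W (evR (S.obj l))) := by
    simp [MonoidalCategory.tensorHom_def, smul_smul, mul_comm]
  rw [h2, Linear.smul_comp, ← tensorComponent_sum, Finset.smul_sum, Preadditive.comp_sum]
  refine Finset.sum_congr rfl fun j _ => ?_
  rw [smul_smul, Linear.comp_smul]
  congr 1
  ring

end TensorStructure

end

end ReducedTensor

namespace ReducedTensor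

noncomputable section

section TensorStructureCentral

variable {k : Type w} [Field k] [IsAlgClosed k]
  {A : Type u} [Category.{v} A] [Abelian A] [Linear k A] [MonoidalCategory A]
  [MonoidalPreadditive A] [MonoidalLinear k A] [BraidedCategory A] [RigidCategory A]
  [PivotalCategory A] [PremodularCategory k A] {ι : Type u₁} [Fintype ι]
  (S : SimpleData k A ι)

lemma cen_over_indTensor (V W : A) :
    Cen (tensOver (indHb S V) (indObj S W)) (indHb S (V ⊗ W)) (indTensor S V W) :=
  (cen_inductionTensor S V _).comp ((cen_indMap S _).comp (cen_act S _))

lemma ins₁_whiskerRight_indTensor (V W : A) :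
    ins₁ S V ▷ indObj S W ≫ indTensor S V W = tensorInduction S V W := by
  rw [indTensor, ← Category.assoc, ins₁_inductionTensor, ← Category.assoc, ins₁_indMap,
    Category.assoc, ins₁_act, Category.comp_id]

lemma ins₁_ins₁_indTensor (V W : A) :
    (ins₁ S V ⊗ₘ ins₁ S W) ≫ indTensor S V W = ins₁ S (V ⊗ W) := by
  rw [MonoidalCategory.tensorHom_def', Category.assoc, ins₁_whiskerRight_indTensor,
    ins₁_tensorInduction]

variable [CharZero k]

/-- Centrality for `tensOver` allows restriction to `V ⊗ I(W)`, where the map becomes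
`tensorInduction`, which is central for `tensUnder`. So both half-braidings are covered and the
projection is absorbed. -/
lemma rproj_indTensor (V W : A) :
    rproj S (indHb S V) (indHb S W) ≫ indTensor S V W = indTensor S V W := by
  refine hom_ext_ins₁_whiskerRight S
    ((cen_rproj_over_over S _ _).comp (cen_over_indTensor S V W)) (cen_over_indTensor S V W) ?_
  have h1 : Cen (tensUnder V (indHb S W)) (tensUnder (indObj S V) (indHb S W))
      (ins₁ S V ▷ indObj S W) := (Cen.ofUnder _).whiskerRight _
  rw [rproj, avg_comp S _ (cen_over_indTensor S V W), Category.id_comp, comp_avg S h1,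
    ins₁_whiskerRight_indTensor, avg_of_cen S (cen_tensorInduction S V W)]

lemma hom_ext_ins₁_tensorHom {V W Z : A} {h : HalfBraiding Z}
    {f g : indObj S V ⊗ indObj S W ⟶ Z}
    (hf : Cen (tensOver (indHb S V) (indObj S W)) h f)
    (hf' : Cen (tensUnder (indObj S V) (indHb S W)) h f)
    (hg : Cen (tensOver (indHb S V) (indObj S W)) h g)
    (hg' : Cen (tensUnder (indObj S V) (indHb S W)) h g)
    (H : (ins₁ S V ⊗ₘ ins₁ S W) ≫ f = (ins₁ S V ⊗ₘ ins₁ S W) ≫ g) : f = g := by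
  have h1 : Cen (tensUnder V (indHb S W)) (tensUnder (indObj S V) (indHb S W))
      (ins₁ S V ▷ indObj S W) := (Cen.ofUnder _).whiskerRight _
  refine hom_ext_ins₁_whiskerRight S hf hg
    (hom_ext_ins₁_whiskerLeft S (h1.comp hf') (h1.comp hg') ?_)
  rwa [← Category.assoc, ← Category.assoc, ← MonoidalCategory.tensorHom_def']

end TensorStructureCentral

/-! ### Adjunctions and the monoidal structure of `I` -/

section InductionFunctor

variable {k : Type w} [Field k] [IsAlgClosed k]
  {A : Type u} [Category.{v} A] [Abelian A] [Linear k A] [MonoidalCategory A]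
  [MonoidalPreadditive A] [MonoidalLinear k A] [BraidedCategory A] [RigidCategory A]
  [PivotalCategory A] [PremodularCategory k A] {ι : Type u₁} [Fintype ι]
  (S : SimpleData k A ι)

variable [CharZero k]

namespace RCenter

/-- The induction functor. -/
def ind : A ⥤ RCenter S := (induction S).functor

/-- The forgetful functor. -/
def forg : RCenter S ⥤ A := forget A

/-- Induction is left adjoint to the forgetful functor. -/
def indAdjForg : ind S ⊣ forg S :=
  Adjunction.mkOfUnitCounit
    { unit := { app := fun V => ins₁ S V
                naturality := fun _ _ f => (ins₁_indMap S f).symm }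
      counit := { app := fun X => mk (X := (ind S).obj ((forg S).obj X)) (Y := X)
                    (act S X.halfBraiding) (cen_act S X.halfBraiding)
                  naturality := fun _ _ f => hom_ext (indMap_act S (cen f)) }
      left_triangle := by
        ext V
        change indMap S (ins₁ S V) ≫ 𝟙 _ ≫ act S (indHb S V) = 𝟙 _
        rw [Category.id_comp, indMap_ins₁_act]
      right_triangle := by
        ext X
        change ins₁ S X.obj ≫ 𝟙 _ ≫ act S X.halfBraiding = 𝟙 _
        rw [Category.id_comp, ins₁_act] }

/-- Induction is right adjoint to the forgetful functor. -/
def forgAdjInd : forg S ⊣ ind S :=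
  Adjunction.mkOfUnitCounit
    { unit := { app := fun X => mk (X := X) (Y := (ind S).obj ((forg S).obj X))
                  (coact S X.halfBraiding) (cen_coact S X.halfBraiding)
                naturality := fun _ _ f => hom_ext (coact_indMap S (cen f)).symm }
      counit := { app := fun V => counit S V
                  naturality := fun _ _ f => indMap_counit S f }
      left_triangle := by
        ext X
        change coact S X.halfBraiding ≫ 𝟙 _ ≫ counit S X.obj = 𝟙 _
        rw [Category.id_comp, coact_counit]
      right_triangle := by
        ext V
        change coact S (indHb S V) ≫ 𝟙 _ ≫ indMap S (counit S V) = 𝟙 _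
        rw [Category.id_comp, coact_indMap_counit] }

variable {S} in
lemma projL_assoc (X Y Z : RCenter S) : proj X Y ▷ Z.obj ≫ proj (X ⊗ Y) Z ≫
    hom (α_ X Y Z).hom = (α_ X.obj Y.obj Z.obj).hom ≫ X.obj ◁ proj Y Z ≫ proj X (Y ⊗ Z) := by
  have h := projL_inclL_associator X Y Z
  have h2 := congrArg (· ≫ projR X Y Z) h
  simp only [Category.assoc, inclR_projR, Category.comp_id] at h2
  refine Eq.trans ?_ h2
  change _ ≫ _ ≫ (inclL X Y Z ≫ (α_ X.obj Y.obj Z.obj).hom ≫ projR X Y Z) = _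
  rw [projL, Category.assoc]
  rfl

lemma proj_leftUnitor (X : RCenter S) : (S.sqrtGlobalDim • unitIns) ▷ X.obj ≫ proj (𝟙_ _) X ≫
    hom (λ_ X).hom = (λ_ X.obj).hom := by
  change (S.sqrtGlobalDim • unitIns) ▷ X.obj ≫ proj (unit S) X ≫
    (S.sqrtGlobalDim⁻¹ • (incl (unit S) X ≫ lunit X)) = _
  rw [Linear.comp_smul, proj_incl_lunit, MonoidalLinear.smul_whiskerRight, Linear.smul_comp,
    Linear.comp_smul, smul_smul, mul_inv_cancel₀ (sqrtGlobalDim_ne_zero S), one_smul,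
    unitIns_lunit]

lemma proj_rightUnitor (X : RCenter S) : X.obj ◁ (S.sqrtGlobalDim • unitIns) ≫ proj X (𝟙_ _) ≫
    hom (ρ_ X).hom = (ρ_ X.obj).hom := by
  change X.obj ◁ (S.sqrtGlobalDim • unitIns) ≫ proj X (unit S) ≫
    (S.sqrtGlobalDim⁻¹ • (incl X (unit S) ≫ runit X)) = _
  rw [Linear.comp_smul, proj_incl_runit, MonoidalLinear.whiskerLeft_smul, Linear.smul_comp,
    Linear.comp_smul, smul_smul, mul_inv_cancel₀ (sqrtGlobalDim_ne_zero S), one_smul,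
    unitIns_runit]

/-- The scalar `𝒟^{1/2}` on the unit map compensates the factor `𝒟^{-1/2}` of the unit constraints.
Through the adjunction this structure makes `I` oplax monoidal, which supplies all coherence axioms
of `J`. -/
instance : (forg S).LaxMonoidal where
  ε := S.sqrtGlobalDim • unitIns
  μ X Y := proj X Y
  μ_natural_left {X Y} f Z := by
    refine Eq.trans ?_ (proj_tensHom f (𝟙 Z)).symm
    rw [id_hom, tensorHom_id]
    rfl
  μ_natural_right {X Y} Z f := by
    refine Eq.trans ?_ (proj_tensHom (𝟙 Z) f).symm
    rw [id_hom, id_tensorHom]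
    rfl
  associativity X Y Z := projL_assoc X Y Z
  left_unitality X := (proj_leftUnitor S X).symm
  right_unitality X := (proj_rightUnitor S X).symm

/-- The unit `V ⟶ I(V)` of the adjunction. -/
def indIns (V : A) : V ⟶ ((ind S).obj V).obj := ins₁ S V

/-- The morphism `I(V) ⊗ I(W) ⟶ I(V ⊗ W)`, before restriction. -/
def indTens (V W : A) : ((ind S).obj V).obj ⊗ ((ind S).obj W).obj ⟶ ((ind S).obj (V ⊗ W)).obj :=
  indTensor S V W

lemma indIns_indTens (V W : A) : (indIns S V ⊗ₘ indIns S W) ≫ indTens S V W = indIns S (V ⊗ W) :=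
  ins₁_ins₁_indTensor S V W

lemma idem_indTens (V W : A) : idem ((ind S).obj V) ((ind S).obj W) ≫ indTens S V W =
    indTens S V W := rproj_indTensor S V W

lemma hom_ext_indIns {V : A} {Z : RCenter S} {f g : (ind S).obj V ⟶ Z}
    (H : indIns S V ≫ hom f = indIns S V ≫ hom g) : f = g :=
  hom_ext (hom_ext_ins₁ S (cen f) (cen g) H)

/-- The projection is central for both half-braidings, so restriction to `V ⊗ W` may be done in one
factor at a time. -/
lemma hom_ext_indIns_tensorHom {V W : A} {Z : RCenter S}
    {f g : tens ((ind S).obj V) ((ind S).obj W) ⟶ Z}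
    (H : (indIns S V ⊗ₘ indIns S W) ≫ proj _ _ ≫ hom f =
      (indIns S V ⊗ₘ indIns S W) ≫ proj _ _ ≫ hom g) : f = g := by
  apply hom_ext
  rw [← cancel_epi (proj ((ind S).obj V) ((ind S).obj W))]
  exact hom_ext_ins₁_tensorHom S ((cen_over_rpr S _ _).comp (cen f))
    ((cen_under_rpr S _ _).comp (cen f)) ((cen_over_rpr S _ _).comp (cen g))
    ((cen_under_rpr S _ _).comp (cen g)) H

/-- The tensor structure of the induction functor. -/
def indμ (V W : A) : tens ((ind S).obj V) ((ind S).obj W) ⟶ (ind S).obj (V ⊗ W) :=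
  mk (incl ((ind S).obj V) ((ind S).obj W) ≫ indTens S V W)
    ((cen_rincl_over S _ _).comp (cen_over_indTensor S V W))

/-- The inverse of the tensor structure of the induction functor. -/
def indδ (V W : A) : (ind S).obj (V ⊗ W) ⟶ tens ((ind S).obj V) ((ind S).obj W) :=
  letI := (indAdjForg S).leftAdjointOplaxMonoidal
  Functor.OplaxMonoidal.δ (ind S) V W

lemma indIns_hom_homEquiv_symm {V : A} {Z : RCenter S} (f : V ⟶ (forg S).obj Z) :
    indIns S V ≫ hom (((indAdjForg S).homEquiv V Z).symm f) = f :=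
  ((indAdjForg S).homEquiv V Z).apply_symm_apply f

lemma indIns_indδ (V W : A) : indIns S (V ⊗ W) ≫ hom (indδ S V W) =
    (indIns S V ⊗ₘ indIns S W) ≫ proj ((ind S).obj V) ((ind S).obj W) :=
  indIns_hom_homEquiv_symm S (Z := tens ((ind S).obj V) ((ind S).obj W)) _

lemma proj_indμ (V W : A) : proj ((ind S).obj V) ((ind S).obj W) ≫ hom (indμ S V W) =
    indTens S V W := by
  change proj ((ind S).obj V) ((ind S).obj W) ≫ incl ((ind S).obj V) ((ind S).obj W) ≫
    indTens S V W = _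
  rw [← Category.assoc, proj_incl, idem_indTens]

/-- The tensor structure of the induction functor, as an isomorphism. -/
def indμIso (V W : A) : tens ((ind S).obj V) ((ind S).obj W) ≅ (ind S).obj (V ⊗ W) where
  hom := indμ S V W
  inv := indδ S V W
  hom_inv_id := by
    apply hom_ext_indIns_tensorHom
    rw [comp_hom, ← Category.assoc (proj _ _), proj_indμ, ← Category.assoc, indIns_indTens,
      indIns_indδ, id_hom, Category.comp_id]
  inv_hom_id := by
    apply hom_ext_indIns
    rw [comp_hom, ← Category.assoc, indIns_indδ, Category.assoc, proj_indμ, indIns_indTens,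
      id_hom, Category.comp_id]

/-- The counit constraint of the induction functor. -/
def indη : (ind S).obj (𝟙_ A) ⟶ unit S :=
  letI := (indAdjForg S).leftAdjointOplaxMonoidal
  Functor.OplaxMonoidal.η (ind S)

/-- The oplax unit map corresponds under the adjunction to the lax unit map of the forgetful
functor, from which it inherits the scalar. -/
lemma indη_eq : indη S = mk (X := (ind S).obj (𝟙_ A)) (Y := unit S)
    (S.sqrtGlobalDim • 𝟙 (unit S).obj) ((Cen.id _).smul _) := by
  apply hom_ext_indIns
  refine (indIns_hom_homEquiv_symm S (Z := unit S) _).trans ?_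
  change S.sqrtGlobalDim • unitIns = unitIns ≫ (S.sqrtGlobalDim • 𝟙 (unit S).obj)
  rw [Linear.comp_smul, Category.comp_id]

/-- The isomorphism of unit objects of the induction functor. -/
def indεIso : unit S ≅ (ind S).obj (𝟙_ A) where
  hom := mk (X := unit S) (Y := unit S) (S.sqrtGlobalDim⁻¹ • 𝟙 _) ((Cen.id _).smul _)
  inv := indη S
  hom_inv_id := by
    rw [indη_eq]
    apply hom_ext
    change (S.sqrtGlobalDim⁻¹ • 𝟙 (unit S).obj) ≫ (S.sqrtGlobalDim • 𝟙 (unit S).obj) = 𝟙 _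
    rw [Linear.comp_smul, Category.comp_id, smul_smul, mul_inv_cancel₀ (sqrtGlobalDim_ne_zero S),
      one_smul]
  inv_hom_id := by
    rw [indη_eq]
    apply hom_ext
    change (S.sqrtGlobalDim • 𝟙 (unit S).obj) ≫ (S.sqrtGlobalDim⁻¹ • 𝟙 (unit S).obj) = 𝟙 _
    rw [Linear.comp_smul, Category.comp_id, smul_smul,
      inv_mul_cancel₀ (sqrtGlobalDim_ne_zero S), one_smul]

/-- The oplax maps are the inverses in `indεIso` and `indμIso`, so the axioms of a strong monoidal
functor are the oplax ones. -/
instance indMonoidal : (ind S).Monoidal :=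
  letI := (indAdjForg S).leftAdjointOplaxMonoidal
  Functor.CoreMonoidal.toMonoidal
    (Functor.CoreMonoidal.mk' (F := ind S) (indεIso S) (indμIso S)
      (fun f X => Functor.OplaxMonoidal.δ_natural_left (ind S) f X)
      (fun X f => Functor.OplaxMonoidal.δ_natural_right (ind S) X f)
      (fun X Y Z => Functor.OplaxMonoidal.oplax_associativity (ind S) X Y Z)
      (fun X => Functor.OplaxMonoidal.oplax_left_unitality (ind S) X)
      (fun X => Functor.OplaxMonoidal.oplax_right_unitality (ind S) X))

end RCenter

end InductionFunctor

end

end ReducedTensor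

namespace ReducedTensor

noncomputable section

/-! ### Pivotality of `I` -/

section InductionCounit

variable {k : Type w} [Field k] [IsAlgClosed k]
  {A : Type u} [Category.{v} A] [Abelian A] [Linear k A] [MonoidalCategory A]
  [MonoidalPreadditive A] [MonoidalLinear k A] [BraidedCategory A] [RigidCategory A]
  [PivotalCategory A] [PremodularCategory k A] {ι : Type u₁} [Fintype ι]
  (S : SimpleData k A ι)

/-- The counit passes through strands coloured by `𝟙`, and these cross `W` trivially. -/
lemma inductionTensor_counit (V W : A) :
    inductionTensor S V W ≫ counit S (V ⊗ W) = counit S V ▷ W := by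
  have hs : Simple (𝟙_ A) := PremodularCategory.simple_unit k
  apply hom_ext_ins_right S
  intro i
  rw [← Category.assoc, ins_inductionTensor, ← comp_whiskerRight, ins_counit]
  have key : ∀ {B B' : A} (e : B ⊗ B' ⟶ 𝟙_ A) (n : B ⟶ 𝟙_ A) (m : 𝟙_ A ⟶ B),
      𝟙 _ ⊗≫ (B ⊗ V) ◁ (β_ W B').inv ⊗≫ (n ▷ ((V ⊗ W) ⊗ B') ⊗≫
        (V ⊗ W) ◁ (m ▷ B' ≫ e) ⊗≫ 𝟙 (V ⊗ W)) =
      (n ▷ (V ⊗ B') ⊗≫ V ◁ (m ▷ B' ≫ e) ⊗≫ 𝟙 V) ▷ W := by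
    intro B B' e n m
    calc
      _ = 𝟙 _ ⊗≫ (B ◁ (V ◁ (β_ W B').inv) ≫ n ▷ (V ⊗ W ⊗ B')) ⊗≫
          (V ⊗ W) ◁ (m ▷ B' ≫ e) ⊗≫ 𝟙 (V ⊗ W) := by monoidal
      _ = 𝟙 _ ⊗≫ n ▷ (V ⊗ B' ⊗ W) ⊗≫
          V ◁ ((β_ W B').inv ≫ W ◁ ((λ_ B').inv ≫ m ▷ B' ≫ e)) ⊗≫ 𝟙 (V ⊗ W) := by
        rw [whisker_exchange]; monoidal
      _ = _ := by
        rw [← BraidedCategory.braiding_inv_naturality_left, braiding_inv_tensorUnit_right]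
        monoidal
  calc
    _ = 𝟙 _ ⊗≫ (S.obj i ⊗ V) ◁ (β_ W (S.obj i)ᘁ).inv ⊗≫
        (ins S (V ⊗ W) (evR (S.obj i)) ≫ counit S (V ⊗ W)) := by monoidal
    _ = _ := by
      rw [ins_counit, counitOn, counitOn]
      simp only [monoidalComp, Preadditive.comp_sum, sum_whiskerRight] at key ⊢
      refine Finset.sum_congr rfl fun a _ => Eq.trans ?_ ((key (evR (S.obj i))
        (node k (S.obj i) (𝟙_ A) a) (dualNode k (S.obj i) (𝟙_ A) a)).trans ?_)
      · monoidal
      · monoidal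

lemma tensorInduction_counit (V W : A) :
    tensorInduction S V W ≫ counit S (V ⊗ W) = V ◁ counit S W := by
  have hs : Simple (𝟙_ A) := PremodularCategory.simple_unit k
  apply hom_ext_ins_left S
  intro i
  rw [← Category.assoc, ins_tensorInduction, ← MonoidalCategory.whiskerLeft_comp, ins_counit]
  have key : ∀ {B B' : A} (e : B ⊗ B' ⟶ 𝟙_ A) (n : B ⟶ 𝟙_ A) (m : 𝟙_ A ⟶ B),
      𝟙 _ ⊗≫ (β_ B V).inv ▷ (W ⊗ B') ⊗≫ (n ▷ ((V ⊗ W) ⊗ B') ⊗≫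
        (V ⊗ W) ◁ (m ▷ B' ≫ e) ⊗≫ 𝟙 (V ⊗ W)) =
      V ◁ (n ▷ (W ⊗ B') ⊗≫ W ◁ (m ▷ B' ≫ e) ⊗≫ 𝟙 W) := by
    intro B B' e n m
    calc
      _ = 𝟙 _ ⊗≫ ((β_ B V).inv ≫ n ▷ V) ▷ (W ⊗ B') ⊗≫
          (V ⊗ W) ◁ (m ▷ B' ≫ e) ⊗≫ 𝟙 (V ⊗ W) := by monoidal
      _ = _ := by
        rw [← BraidedCategory.braiding_inv_naturality_right, braiding_inv_tensorUnit_left]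
        monoidal
  calc
    _ = 𝟙 _ ⊗≫ (β_ (S.obj i) V).inv ▷ (W ⊗ (S.obj i)ᘁ) ⊗≫
        (ins S (V ⊗ W) (evR (S.obj i)) ≫ counit S (V ⊗ W)) := by monoidal
    _ = _ := by
      rw [ins_counit, counitOn, counitOn]
      simp only [monoidalComp, Preadditive.comp_sum, whiskerLeft_sum] at key ⊢
      refine Finset.sum_congr rfl fun a _ => Eq.trans ?_ ((key (evR (S.obj i))
        (node k (S.obj i) (𝟙_ A) a) (dualNode k (S.obj i) (𝟙_ A) a)).trans ?_)
      · monoidal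
      · monoidal

lemma whiskerLeft_ins₁_indTensor (V W : A) :
    indObj S V ◁ ins₁ S W ≫ indTensor S V W = inductionTensor S V W := by
  rw [indTensor, ← Category.assoc, inductionTensor_naturality_right, Category.assoc,
    ← Category.assoc (indMap S (V ◁ ins₁ S W)), ← indMap_comp, ins₁_tensorInduction,
    indMap_ins₁_act, Category.comp_id]

end InductionCounit

section Comparison

variable {C : Type u} [Category.{v} C] [MonoidalCategory C] [RightRigidCategory C]
  {D : Type u₁} [Category.{v₁} D] [MonoidalCategory D] [RightRigidCategory D]

lemma dualComparison_evaluation (F : C ⥤ D) [F.Monoidal] (X : C) :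
    dualComparison F X ▷ F.obj X ≫ ε_ (F.obj X) (F.obj X)ᘁ =
      Functor.LaxMonoidal.μ F Xᘁ X ≫ F.map (ε_ X Xᘁ) ≫ Functor.OplaxMonoidal.η F := by
  rw [dualComparison]
  generalize Functor.LaxMonoidal.μ F Xᘁ X ≫ F.map (ε_ X Xᘁ) ≫ Functor.OplaxMonoidal.η F = p
  calc
    _ = 𝟙 _ ⊗≫ F.obj Xᘁ ◁ (η_ (F.obj X) (F.obj X)ᘁ ▷ F.obj X) ⊗≫
        (p ▷ ((F.obj X)ᘁ ⊗ F.obj X) ≫ 𝟙_ D ◁ ε_ (F.obj X) (F.obj X)ᘁ) ⊗≫ 𝟙 (𝟙_ D) := by monoidal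
    _ = 𝟙 _ ⊗≫ F.obj Xᘁ ◁ (η_ (F.obj X) (F.obj X)ᘁ ▷ F.obj X ⊗≫
          F.obj X ◁ ε_ (F.obj X) (F.obj X)ᘁ) ⊗≫ p := by
      rw [← whisker_exchange]; monoidal
    _ = _ := by rw [ExactPairing.evaluation_coevaluation'']; monoidal

end Comparison

section Pivotal

variable {k : Type w} [Field k] [IsAlgClosed k]
  {A : Type u} [Category.{v} A] [Abelian A] [Linear k A] [MonoidalCategory A]
  [MonoidalPreadditive A] [MonoidalLinear k A] [BraidedCategory A] [RigidCategory A]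
  [PivotalCategory A] [PremodularCategory k A] {ι : Type u₁} [Fintype ι]
  (S : SimpleData k A ι)

variable [CharZero k]

namespace RCenter

/-- The counit `I(V) ⟶ V` of the adjunction. -/
def indCounit (V : A) : ((ind S).obj V).obj ⟶ V := counit S V

lemma indIns_naturality {V W : A} (f : V ⟶ W) :
    indIns S V ≫ hom ((ind S).map f) = f ≫ indIns S W := ins₁_indMap S f

/-- The comparison `I(V^*) ⟶ I(V)^*`. -/
def indDual (V : A) : (ind S).obj (Vᘁ : A) ⟶ dual ((ind S).obj V) := dualComparison (ind S) V

/-- The dual of the unit of the adjunction. -/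
def dualIns (V : A) : (dual ((ind S).obj V)).obj ⟶ (Vᘁ : A) := (ins₁ S V)ᘁ

lemma dualIns_evaluation (V : A) : dualIns S V ▷ V ≫ ε_ V (Vᘁ : A) =
    (dual ((ind S).obj V)).obj ◁ indIns S V ≫ evA ((ind S).obj V) :=
  rightAdjointMate_comp_evaluation (ins₁ S V)

lemma unitCounit_ind {V : A} (f : V ⟶ 𝟙_ A) :
    hom ((ind S).map f) ≫ unitCounit = indCounit S V ≫ f := indMap_counit S f

/-- The comparison `I(V^*) ⟶ I(V)^*` is characterised by its pairing. One factor `𝒟^{1/2}` comes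
from `flat`, the other from the oplax unit map of `I`. -/
lemma indDual_evA (V : A) : hom (indDual S V) ▷ ((ind S).obj V).obj ≫ evA ((ind S).obj V) =
    S.sqrtGlobalDim ^ 2 • (indTens S (Vᘁ : A) V ≫ indCounit S ((Vᘁ : A) ⊗ V) ≫ ε_ V (Vᘁ : A)) := by
  have h1 := flat_tensorHom_ev (indDual S V) (𝟙 ((ind S).obj V))
  have h2 : indDual S V ▷ (ind S).obj V ≫ ev ((ind S).obj V) =
      (indμ S (Vᘁ : A) V ≫ (ind S).map (ε_ V (Vᘁ : A)) ≫ indη S) :=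
    dualComparison_evaluation (ind S) V
  rw [id_hom, tensorHom_id, tensorHom_id] at h1
  rw [← h1]
  refine (congrArg flat h2).trans ?_
  rw [flat, indη_eq]
  have h3 : proj _ _ ≫ hom (indμ S (Vᘁ : A) V) ≫ hom ((ind S).map (ε_ V (Vᘁ : A))) ≫ unitCounit =
      indTens S (Vᘁ : A) V ≫ indCounit S ((Vᘁ : A) ⊗ V) ≫ ε_ V (Vᘁ : A) := by
    rw [← Category.assoc, proj_indμ]
    exact congrArg (indTens S (Vᘁ : A) V ≫ ·) (unitCounit_ind S _)
  rw [← h3]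
  change S.sqrtGlobalDim • (proj _ _ ≫ (hom (indμ S (Vᘁ : A) V) ≫
    hom (Y := unit S) ((ind S).map (ε_ V (Vᘁ : A))) ≫ (S.sqrtGlobalDim • 𝟙 (unit S).obj)) ≫
      unitCounit) = _
  simp only [Linear.comp_smul, Linear.smul_comp, Category.comp_id, Category.assoc, smul_smul, sq]
  rfl

lemma indIns_whiskerRight_indTens (V W : A) : indIns S V ▷ ((ind S).obj W).obj ≫ indTens S V W ≫
    indCounit S (V ⊗ W) = V ◁ indCounit S W := by
  have := ins₁_whiskerRight_indTensor S V W
  refine (Category.assoc _ _ _).symm.trans ?_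
  exact (congrArg (· ≫ counit S (V ⊗ W)) this).trans (tensorInduction_counit S V W)

lemma whiskerLeft_indIns_indTens (V W : A) : ((ind S).obj V).obj ◁ indIns S W ≫ indTens S V W ≫
    indCounit S (V ⊗ W) = indCounit S V ▷ W := by
  have := whiskerLeft_ins₁_indTensor S V W
  refine (Category.assoc _ _ _).symm.trans ?_
  exact (congrArg (· ≫ counit S (V ⊗ W)) this).trans (inductionTensor_counit S V W)

lemma indDual_dualIns (V : A) :
    hom (indDual S V) ≫ dualIns S V = S.sqrtGlobalDim ^ 2 • indCounit S (Vᘁ : A) := by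
  apply eq_of_whiskerRight_evaluation
  rw [comp_whiskerRight, Category.assoc, dualIns_evaluation, ← whisker_exchange_assoc,
    indDual_evA, Linear.comp_smul, MonoidalLinear.smul_whiskerRight, Linear.smul_comp]
  have := whiskerLeft_indIns_indTens S (Vᘁ : A) V
  rw [reassoc_of% this]

/-- The pivotal structure of `A` at the object underlying an object of the center. -/
def pivA (X : RCenter S) : X.obj ⟶ (dual (dual X)).obj := (pivot X.obj).hom

/-- The double dual of the unit of the adjunction. -/
def dualDualIns (V : A) : ((Vᘁ : A)ᘁ : A) ⟶ (dual (dual ((ind S).obj V))).obj := (dualIns S V)ᘁ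

lemma dualDualIns_evaluation (V : A) : dualDualIns S V ▷ (dual ((ind S).obj V)).obj ≫
    evA (dual ((ind S).obj V)) =
      ((Vᘁ : A)ᘁ : A) ◁ dualIns S V ≫ ε_ (Vᘁ : A) ((Vᘁ : A)ᘁ : A) :=
  rightAdjointMate_comp_evaluation (dualIns S V)

lemma indIns_pivA (V : A) : indIns S V ≫ pivA S ((ind S).obj V) =
    (pivot V).hom ≫ dualDualIns S V := pivot_naturality (ins₁ S V)

/-- The dual in `A` of the comparison `I(V^*) ⟶ I(V)^*`. -/
def dualIndDual (V : A) : (dual (dual ((ind S).obj V))).obj ⟶ (dual ((ind S).obj (Vᘁ : A))).obj :=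
  dualHom (hom (indDual S V))

lemma dualIndDual_evA (V : A) :
    dualIndDual S V ▷ ((ind S).obj (Vᘁ : A)).obj ≫ evA ((ind S).obj (Vᘁ : A)) =
      (dual (dual ((ind S).obj V))).obj ◁ hom (indDual S V) ≫ evA (dual ((ind S).obj V)) :=
  dualHom_evA _

lemma indIns_pivA_dualIndDual (V : A) :
    (indIns S V ≫ pivA S ((ind S).obj V) ≫ dualIndDual S V) ▷ ((ind S).obj (Vᘁ : A)).obj ≫
      evA ((ind S).obj (Vᘁ : A)) =
    S.sqrtGlobalDim ^ 2 • ((pivot V).hom ▷ _ ≫ ((Vᘁ : A)ᘁ : A) ◁ indCounit S (Vᘁ : A) ≫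
      ε_ (Vᘁ : A) ((Vᘁ : A)ᘁ : A)) := by
  have h := indIns_pivA S V
  rw [reassoc_of% h, comp_whiskerRight, comp_whiskerRight, Category.assoc, Category.assoc,
    dualIndDual_evA, ← whisker_exchange_assoc, dualDualIns_evaluation,
    ← MonoidalCategory.whiskerLeft_comp_assoc,
    indDual_dualIns, MonoidalLinear.whiskerLeft_smul, Linear.smul_comp, Linear.comp_smul]

lemma indIns_map_indDual (V : A) :
    (indIns S V ≫ hom ((ind S).map (pivot V).hom) ≫ hom (indDual S (Vᘁ : A))) ▷
      ((ind S).obj (Vᘁ : A)).obj ≫ evA ((ind S).obj (Vᘁ : A)) =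
    S.sqrtGlobalDim ^ 2 • ((pivot V).hom ▷ _ ≫ ((Vᘁ : A)ᘁ : A) ◁ indCounit S (Vᘁ : A) ≫
      ε_ (Vᘁ : A) ((Vᘁ : A)ᘁ : A)) := by
  have h := indIns_naturality S (pivot V).hom
  have h2 := indIns_whiskerRight_indTens S ((Vᘁ : A)ᘁ : A) (Vᘁ : A)
  rw [reassoc_of% h, comp_whiskerRight, comp_whiskerRight, Category.assoc, Category.assoc,
    indDual_evA, Linear.comp_smul, Linear.comp_smul, reassoc_of% h2]

/-- It is enough to compare the two sides on the copy of `V`, paired with `I(V^*)` by the evaluation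
of `A`. Both then equal `𝒟` times the pairing of `V`, through its pivot, with the counit of
`I(V^*)`. -/
lemma ind_isPivotalFunctor : IsPivotalFunctor (ind S) := by
  intro V
  have key : (ind S).map (pivot V).hom ≫ indDual S (Vᘁ : A) =
      (pivotIso ((ind S).obj V)).hom ≫ (indDual S V)ᘁ := by
    refine hom_ext_indIns S (eq_of_whiskerRight_evA (X := (ind S).obj (Vᘁ : A)) ?_)
    refine (indIns_map_indDual S V).trans ((indIns_pivA_dualIndDual S V).symm.trans ?_)
    have h := rightAdjointMate_hom (indDual S V)
    exact congrArg (fun t => (indIns S V ≫ pivA S ((ind S).obj V) ≫ t) ▷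
      ((ind S).obj (Vᘁ : A)).obj ≫ evA ((ind S).obj (Vᘁ : A))) h.symm
  exact key

end RCenter

end Pivotal

end

end ReducedTensor

namespace ReducedTensor

noncomputable section

/-! ### Agreement with the prescribed formulas -/

section Structure

variable {k : Type w} [Field k] [IsAlgClosed k] [CharZero k]
  {A : Type u} [Category.{v} A] [Abelian A] [Linear k A] [MonoidalCategory A]
  [MonoidalPreadditive A] [MonoidalLinear k A] [BraidedCategory A] [RigidCategory A]
  [PivotalCategory A] [PremodularCategory k A] {ι : Type u₁} [Fintype ι]
  (S : SimpleData k A ι)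

lemma hb_dualHb_eq_redDualγ (X : ZCenter A) (B : A) :
    hb (dualHb ((X.obj)ᘁ : A) X.halfBraiding) B = redDualγ X B := by
  have h : mate ((X.obj)ᘁ : A) X.halfBraiding B = 𝟙 _ ⊗≫ ((X.obj)ᘁ ⊗ B : A) ◁ η_ X.obj X.objᘁ ⊗≫
      X.objᘁ ◁ X.γ B ▷ X.objᘁ ⊗≫ ε_ X.obj X.objᘁ ▷ (B ⊗ X.objᘁ) ⊗≫ 𝟙 _ := by
    rw [mate]
    change _ ⊗≫ _ ⊗≫ _ ◁ X.γ B ▷ _ ⊗≫ _ = _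
    monoidal
  rw [hb_dualHb, redDualγ, h]
  monoidal

/-- The extra projection contained in the prescribed formula is absorbed by the inclusion of the
image. -/
lemma hb_rtens_eq_redγ (X Y : ZCenter A) (B : A) : hb (rtens S X.halfBraiding Y.halfBraiding) B =
    B ◁ rincl S X.halfBraiding Y.halfBraiding ≫ redγ S X Y B ≫
      rpr S X.halfBraiding Y.halfBraiding ▷ B := by
  rw [redγ_eq, redProj_eq, Category.assoc, ← MonoidalCategory.whiskerLeft_comp_assoc]
  change _ = B ◁ (_ ≫ rproj S X.halfBraiding Y.halfBraiding) ≫ _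
  rw [rincl_rproj, hb_rtens]

/-- The pivotal monoidal category given by the reduced tensor product. -/
def reducedStructure : ReducedStructure (induction S) where
  monoidal := inferInstanceAs (MonoidalCategory (RCenter S))
  incl X Y := RCenter.incl (S := S) X Y
  proj X Y := RCenter.proj (S := S) X Y
  incl_proj X Y := RCenter.incl_proj (S := S) X Y
  proj_incl X Y := (RCenter.proj_incl (S := S) X Y).trans (redProj_eq S X Y).symm
  tensorObj_γ X Y B := hb_rtens_eq_redγ S X Y B
  tensorHom_hom f g := RCenter.tensHom_hom (S := S) f g
  associator_hom X Y Z := RCenter.assoc_hom (S := S) X Y Z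
  unitIso := Iso.refl _
  leftUnitor_hom X := by
    have h {P U : A} (f : P ⟶ U ⊗ X.obj) (g : U ⊗ X.obj ⟶ X.obj) (c : k) :
        c • (f ≫ g) = f ≫ 𝟙 U ▷ X.obj ≫ (c • g) := by simp
    rw [redLeftUnitor_eq]
    exact h _ _ _
  rightUnitor_hom X := by
    have h {P U : A} (f : P ⟶ X.obj ⊗ U) (g : X.obj ⊗ U ⟶ X.obj) (c : k) :
        c • (f ≫ g) = f ≫ X.obj ◁ 𝟙 U ≫ (c • g) := by simp
    rw [redRightUnitor_eq]
    exact h _ _ _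
  rigid := inferInstanceAs (RightRigidCategory (RCenter S))
  dualIso X := Iso.refl _
  dual_γ X B := by
    have h {P : A} (f : B ⊗ P ⟶ P ⊗ B) : f = B ◁ 𝟙 P ≫ f ≫ 𝟙 P ▷ B := by simp
    exact (hb_dualHb_eq_redDualγ X B).trans (h _)
  evaluation_hom X := by
    have h {P Q U : A} (f : P ⟶ Q ⊗ X.obj) (g : Q ⊗ X.obj ⟶ U) :
        f ≫ g = f ≫ 𝟙 Q ▷ X.obj ≫ g ≫ 𝟙 U := by simp
    rw [redEv_eq]
    exact h _ _
  coevaluation_hom X := by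
    have h {P Q U : A} (f : U ⟶ X.obj ⊗ Q) (g : X.obj ⊗ Q ⟶ P) :
        f ≫ g = 𝟙 U ≫ f ≫ X.obj ◁ 𝟙 Q ≫ g := by simp
    rw [redCoev_eq]
    exact h _ _
  pivotal := inferInstanceAs (PivotalCategory (RCenter S))
  pivot_hom X := by
    have h : (pivot X.obj).hom ≫ 𝟙 _ = (pivot X.obj).hom ≫ ((𝟙 (X.objᘁ : A))ᘁ) := by
      rw [rightAdjointMate_id]
    exact h

end Structure

end

end ReducedTensor

theorem propositionp {k : Type w} [Field k] [IsAlgClosed k] [CharZero k]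
    {A : Type u} [Category.{v} A] [Abelian A] [Linear k A] [MonoidalCategory A]
    [MonoidalPreadditive A] [MonoidalLinear k A] [BraidedCategory A] [RigidCategory A]
    [PivotalCategory A] [PremodularCategory k A] {ι : Type u₁} [Fintype ι]
    (S : ReducedTensor.SimpleData k A ι) :
    ∃ (I : ReducedTensor.Induction S) (R : ReducedTensor.ReducedStructure I),
      letI := R.monoidal
      letI := R.rigid
      letI := R.pivotal
      Nonempty (I.functor ⊣ ReducedTensor.forget A) ∧
      Nonempty (ReducedTensor.forget A ⊣ I.functor) ∧
      I.functor.Additive ∧ I.functor.Linear k ∧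
      ∃ (_ : I.functor.Monoidal),
        (∀ V W : A, (Functor.LaxMonoidal.μ I.functor V W).hom =
          R.incl (I.functor.obj V) (I.functor.obj W) ≫ ReducedTensor.tensorMap S V W) ∧
        IsPivotalFunctor I.functor := by
  refine ⟨ReducedTensor.induction S, ReducedTensor.reducedStructure S,
    ⟨ReducedTensor.RCenter.indAdjForg S⟩, ⟨ReducedTensor.RCenter.forgAdjInd S⟩,
    ⟨fun {V W f g} => ReducedTensor.ZCenter.hom_ext (ReducedTensor.indMap_add S f g)⟩,
    ⟨fun {V W} f c => ReducedTensor.ZCenter.hom_ext (ReducedTensor.indMap_smul S c f)⟩,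
    ReducedTensor.RCenter.indMonoidal S, fun V W => ?_,
    ReducedTensor.RCenter.ind_isPivotalFunctor S⟩
  -- Once the sum over nodes is rewritten as `indTensor`, the structure map of the monoidal functor
  -- is its restriction by definition.
  rw [ReducedTensor.tensorMap_eq]
  rfl
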